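/- Let $n\ge 2$ be even. For nonzero $p,q\in\mathbb{C}$ with $p^2\neq1$ put $a=p^{-1}q^{-2}$, $\epsilon=p-p^{-1}$, $\tau=1-(a-a^{-1})/\epsilon$. Let $\mathcal{B}_n$ be the Birman–Wenzl–Murakami algebra, i.e. the unital $\mathbb{C}$-algebra generated by invertible $t_i$ and by $e_i$ ($1\le i\le n-1$) with relations $t_it_jt_i=t_jt_it_j$, $e_ie_je_i=e_i$, $e_it_je_i=a^{-1}e_i$, $t_jt_ie_j=e_it_jt_i=e_ie_j$ for $|i-j|=1$; $t_it_j=t_jt_i$, $e_ie_j=e_je_i$ for $|i-j|\ge2$; $t_i-t_i^{-1}=\epsilon(1-e_i)$, $e_it_i=t_ie_i=ae_i$, $e_i^2=\tau e_i$. Say that $\psi\in\mathbb{C}[z_1,\dots,z_n]$ has property (P) if for all $i<j<k$ it vanishes whenever $(z_i,z_j,z_k)$ equals $(z,q^2z,q^4z)$, $(z,p^2z,q^2p^2z)$ or $(z,q^2z,q^2p^2z)$ for some $z$. Let $\mathcal{M}_n$ be the space consisting of $0$ and of the homogeneous polynomials with property (P) whose degree is the least degree of a nonzero homogeneous polynomial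 with property (P). Write $b_{i,i+1}=qz_i-q^{-1}z_{i+1}$ and let $k_{i,i+1}$ be the exchange of $z_i$ and $z_{i+1}$. Then for generic $(p,q)$ (i.e. outside the zero set of some nonzero polynomial in $p,q$ that depends only on $n$) one has $\tau\ne 0$ and: 1. For every $1\le i\le n-1$, every $\psi\in\mathcal{M}_n$ can be written in a unique way as $$\psi=S_0+b_{i,i+1}\bigl(S_1+(pz_i-p^{-1}z_{i+1})S_2\bigr)$$ with polynomials $S_0,S_1,S_2$ symmetric under the exchange of $z_i$ and $z_{i+1}$ and such that the three pieces $S_0$, $b_{i,i+1}S_1$ and $b_{i,i+1}(pz_i-p^{-1}z_{i+1})S_2$ belong to $\mathcal{M}_n$. 2. There is a right action of $\mathcal{B}_n$ on $\mathcal{M}_n$, with $e_i,t_i$ acting by operators $\bar e_i,\bar t_i$, such that for every $1\le i\le n-1$ and every $\psi\in\mathcal{M}_n$, with $S_0,S_1,S_2$ as in 1, $$\psi\bar e_i=\tau S_0,\qquad \psi\bar t_i=aS_0-p^{-1}b_{i,i+1}S_1+p\,b_{i,i+1}(pz_i-p^{-1}z_{i+1})S_2;$$ $\psi\bar e_i=\tau\psi$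 if and only if $\psi$ is symmetric under the exchange of $z_i$ and $z_{i+1}$; $\psi\bar e_i=0$ if and only if $b_{i,i+1}$ divides $\psi$; and if $\psi=b_{i,i+1}\phi$ then $$\psi(\bar t_i-p)=-b_{i,i+1}\,(1+k_{i,i+1})\!\left[\frac{pz_{i+1}-p^{-1}z_i}{z_{i+1}-z_i}\,\phi\right],\qquad \psi(\bar t_i+p^{-1})=b_{i,i+1}\,(pz_i-p^{-1}z_{i+1})\,\frac{\phi-k_{i,i+1}\phi}{z_i-z_{i+1}} .$$ -/

import Mathlib

open MvPolynomial

noncomputable section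

namespace BMWPoly

/-- The twist parameter `a = p⁻¹ q⁻²`. -/
def aPar (p q : ℂ) : ℂ := p⁻¹ * (q⁻¹) ^ 2

/-- The skein parameter `ε = p - p⁻¹`. -/
def epsPar (p : ℂ) : ℂ := p - p⁻¹

/-- The loop weight `τ = 1 - (a - a⁻¹) / ε`. -/
def tauPar (p q : ℂ) : ℂ := 1 - (aPar p q - (aPar p q)⁻¹) / epsPar p

/-! ### The Birman-Wenzl-Murakami algebra, by generators and relations -/

/-- Letters `t_i`, `t_i⁻¹`, `e_i` for `n - 1` values of the index `i`. -/
inductive BMWGen (n : ℕ) : Type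
  | t (i : Fin (n - 1)) : BMWGen n
  | tInv (i : Fin (n - 1)) : BMWGen n
  | e (i : Fin (n - 1)) : BMWGen n

/-- The letter `t_i` in the free algebra. -/
def freeT {n : ℕ} (i : Fin (n - 1)) : FreeAlgebra ℂ (BMWGen n) := FreeAlgebra.ι ℂ (BMWGen.t i)

/-- The letter `t_i⁻¹` in the free algebra. -/
def freeTInv {n : ℕ} (i : Fin (n - 1)) : FreeAlgebra ℂ (BMWGen n) :=
  FreeAlgebra.ι ℂ (BMWGen.tInv i)

/-- The letter `e_i` in the free algebra. -/
def freeE {n : ℕ} (i : Fin (n - 1)) : FreeAlgebra ℂ (BMWGen n) := FreeAlgebra.ι ℂ (BMWGen.e i)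

/-- `j = i ± 1`. -/
def Adjacent {m : ℕ} (i j : Fin m) : Prop := (i : ℕ) + 1 = j ∨ (j : ℕ) + 1 = i

/-- `|i - j| ≥ 2`. -/
def Distant {m : ℕ} (i j : Fin m) : Prop := (i : ℕ) + 2 ≤ j ∨ (j : ℕ) + 2 ≤ i

/-- The defining relations of the Birman-Wenzl-Murakami algebra. -/
inductive BMWRel (n : ℕ) (p q : ℂ) :
    FreeAlgebra ℂ (BMWGen n) → FreeAlgebra ℂ (BMWGen n) → Prop
  | t_tInv (i) : BMWRel n p q (freeT i * freeTInv i) 1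
  | tInv_t (i) : BMWRel n p q (freeTInv i * freeT i) 1
  | braid (i j) : Adjacent i j →
      BMWRel n p q (freeT i * freeT j * freeT i) (freeT j * freeT i * freeT j)
  | t_comm (i j) : Distant i j → BMWRel n p q (freeT i * freeT j) (freeT j * freeT i)
  | eee (i j) : Adjacent i j → BMWRel n p q (freeE i * freeE j * freeE i) (freeE i)
  | e_comm (i j) : Distant i j → BMWRel n p q (freeE i * freeE j) (freeE j * freeE i)
  | skein (i) : BMWRel n p q (freeT i - freeTInv i) (epsPar p • (1 - freeE i))
  | et (i) : BMWRel n p q (freeE i * freeT i) (aPar p q • freeE i)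
  | te (i) : BMWRel n p q (freeT i * freeE i) (aPar p q • freeE i)
  | ee (i) : BMWRel n p q (freeE i * freeE i) (tauPar p q • freeE i)
  | ete (i j) : Adjacent i j →
      BMWRel n p q (freeE i * freeT j * freeE i) ((aPar p q)⁻¹ • freeE i)
  | tte (i j) : Adjacent i j →
      BMWRel n p q (freeT j * freeT i * freeE j) (freeE i * freeE j)
  | ett (i j) : Adjacent i j →
      BMWRel n p q (freeE i * freeT j * freeT i) (freeE i * freeE j)

/-- The Birman-Wenzl-Murakami algebra on `n` strands. -/
abbrev BMW (n : ℕ) (p q : ℂ) : Type := RingQuot (BMWRel n p q)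

/-- The braid generator `t_i`. -/
def BMW.t {n : ℕ} (p q : ℂ) (i : Fin (n - 1)) : BMW n p q :=
  RingQuot.mkAlgHom ℂ (BMWRel n p q) (freeT i)

/-- The Temperley-Lieb generator `e_i`. -/
def BMW.e {n : ℕ} (p q : ℂ) (i : Fin (n - 1)) : BMW n p q :=
  RingQuot.mkAlgHom ℂ (BMWRel n p q) (freeE i)

/-! ### The polynomial space -/

/-- The vanishing property (P): the polynomial vanishes whenever, for some `i < j < k`,
`(z_i, z_j, z_k)` is `(z, q²z, q⁴z)`, `(z, p²z, q²p²z)` or `(z, q²z, q²p²z)`. Equivalently, with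
`z_{i+n} = a⁻² z_i`, it vanishes at `(z_i, z_j, z_k) = (z, q²z, q⁴z)` for all `i < j < k < i + n`. -/
def PropP {n : ℕ} (p q : ℂ) (ψ : MvPolynomial (Fin n) ℂ) : Prop :=
  ∀ i j k : Fin n, i < j → j < k → ∀ z : Fin n → ℂ,
    ((z j = q ^ 2 * z i ∧ z k = q ^ 4 * z i) ∨
      (z j = p ^ 2 * z i ∧ z k = q ^ 2 * p ^ 2 * z i) ∨
      (z j = q ^ 2 * z i ∧ z k = q ^ 2 * p ^ 2 * z i)) → eval z ψ = 0

/-- The least degree of a nonzero homogeneous polynomial with property (P). -/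
def minDeg (n : ℕ) (p q : ℂ) : ℕ :=
  sInf {d | ∃ ψ : MvPolynomial (Fin n) ℂ, ψ ≠ 0 ∧ ψ.IsHomogeneous d ∧ PropP p q ψ}

/-- `M_n`: the homogeneous polynomials of minimal degree with property (P), together with `0`. -/
def M (n : ℕ) (p q : ℂ) : Submodule ℂ (MvPolynomial (Fin n) ℂ) where
  carrier := {ψ | ψ.IsHomogeneous (minDeg n p q) ∧ PropP p q ψ}
  zero_mem' := ⟨isHomogeneous_zero _ _ _, fun _ _ _ _ _ z _ => map_zero (eval z)⟩
  add_mem' := fun {x y} hx hy => ⟨hx.1.add hy.1, fun i j k hij hjk z hz => by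
    rw [map_add, hx.2 i j k hij hjk z hz, hy.2 i j k hij hjk z hz, add_zero]⟩
  smul_mem' := fun c x hx =>
    ⟨(homogeneousSubmodule (Fin n) ℂ (minDeg n p q)).smul_mem c hx.1,
      fun i j k hij hjk z hz => by rw [smul_eval, hx.2 i j k hij hjk z hz, mul_zero]⟩

/-! ### Two neighbouring variables -/

/-- Position of `z_i`. -/
def lft {n : ℕ} (i : Fin (n - 1)) : Fin n := ⟨i, by omega⟩

/-- Position of `z_{i+1}`. -/
def rgt {n : ℕ} (i : Fin (n - 1)) : Fin n := ⟨i + 1, by omega⟩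

/-- `k_{i,i+1}`: exchange of the variables `z_i` and `z_{i+1}`. -/
def swapVars {n : ℕ} (i : Fin (n - 1)) (ψ : MvPolynomial (Fin n) ℂ) : MvPolynomial (Fin n) ℂ :=
  rename (Equiv.swap (lft i) (rgt i)) ψ

/-- Symmetry under the exchange of `z_i` and `z_{i+1}`. -/
def SymAt {n : ℕ} (i : Fin (n - 1)) (ψ : MvPolynomial (Fin n) ℂ) : Prop := swapVars i ψ = ψ

/-- `s z_i - s⁻¹ z_{i+1}`. -/
def lin {n : ℕ} (s : ℂ) (i : Fin (n - 1)) : MvPolynomial (Fin n) ℂ :=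
  C s * X (lft i) - C s⁻¹ * X (rgt i)

/-- `b_{i,i+1} = q z_i - q⁻¹ z_{i+1}`. -/
def b {n : ℕ} (q : ℂ) (i : Fin (n - 1)) : MvPolynomial (Fin n) ℂ := lin q i

/-- `ψ = S₀ + b_{i,i+1} (S₁ + (p z_i - p⁻¹ z_{i+1}) S₂)`, with each of the three pieces in `M_n`
and `S₀`, `S₁`, `S₂` symmetric under the exchange of `z_i` and `z_{i+1}`. -/
structure IsSplitting {n : ℕ} (p q : ℂ) (i : Fin (n - 1))
    (ψ S₀ S₁ S₂ : MvPolynomial (Fin n) ℂ) : Prop where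
  sym₀ : SymAt i S₀
  sym₁ : SymAt i S₁
  sym₂ : SymAt i S₂
  mem₀ : S₀ ∈ M n p q
  mem₁ : b q i * S₁ ∈ M n p q
  mem₂ : b q i * (lin p i * S₂) ∈ M n p q
  eq : ψ = S₀ + b q i * (S₁ + lin p i * S₂)

/-- The right action `ψ ↦ ψ x` of an element `x` of the Birman-Wenzl-Murakami algebra. A right
module structure on `M_n` is an algebra morphism to the opposite of the endomorphism algebra. -/
def act {n : ℕ} {p q : ℂ} (ρ : BMW n p q →ₐ[ℂ] (Module.End ℂ (M n p q))ᵐᵒᵖ)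
    (ψ : M n p q) (x : BMW n p q) : MvPolynomial (Fin n) ℂ :=
  ((ρ x).unop ψ : M n p q)

end BMWPoly

end

noncomputable section
namespace BMWPoly
set_option linter.unusedSectionVars false
set_option linter.unusedSimpArgs false
variable {ι : Type} [DecidableEq ι]

/-- The polynomials in the given variables. -/
local notation "Pol" => MvPolynomial ι ℂ

/-- The linear form `z_y - c z_x`. -/
def lf (x y : ι) (c : ℂ) : Pol := X y - C c * X x

/-- The substitution `z_y ↦ c z_x`. -/
def sb (x y : ι) (c : ℂ) : Pol →ₐ[ℂ] Pol :=
  aeval fun i => if i = y then C c * X x else X i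

/-- The exchange of two variables. -/
def sw (x y : ι) : Pol →ₐ[ℂ] Pol := rename (Equiv.swap x y)

@[simp] lemma sb_X_right (x y : ι) (c : ℂ) : sb x y c (X y) = C c * X x := by simp [sb]

lemma sb_X_of_ne {x y i : ι} (c : ℂ) (h : i ≠ y) : sb x y c (X i) = X i := by simp [sb, h]

lemma sb_X (x y : ι) (c : ℂ) (i : ι) : sb x y c (X i) = if i = y then C c * X x else X i := by
  simp [sb]

lemma hom_C (σ : Pol →ₐ[ℂ] Pol) (c : ℂ) : σ (C c) = C c :=
  algHom_C σ c

lemma hom_lf (σ : Pol →ₐ[ℂ] Pol) (x y : ι) (c : ℂ) :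
    σ (lf x y c) = σ (X y) - C c * σ (X x) := by simp [lf, hom_C]

/-- A homomorphism compatible with `z_y = c z_x` factors through the substitution. -/
lemma hom_sb {σ : Pol →ₐ[ℂ] Pol} {x y : ι} {c : ℂ}
    (h : σ (X y) = C c * σ (X x)) (ψ : Pol) : σ (sb x y c ψ) = σ ψ := by
  have : σ.comp (sb x y c) = σ := by
    apply MvPolynomial.algHom_ext
    intro i
    by_cases hi : i = y
    · subst hi; simp [hom_C, h]
    · simp [sb_X_of_ne c hi]
  exact DFunLike.congr_fun this ψ

lemma lf_dvd_sub_sb (x y : ι) (c : ℂ) (ψ : Pol) : lf x y c ∣ ψ - sb x y c ψ := by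
  rw [← Ideal.mem_span_singleton, ← Ideal.Quotient.eq]
  have : (Ideal.Quotient.mkₐ ℂ (Ideal.span {lf x y c})) =
      (Ideal.Quotient.mkₐ ℂ (Ideal.span {lf x y c})).comp (sb x y c) := by
    apply MvPolynomial.algHom_ext
    intro i
    by_cases hi : i = y
    · subst hi
      simp only [AlgHom.comp_apply, sb_X_right, Ideal.Quotient.mkₐ_eq_mk]
      rw [Ideal.Quotient.eq, Ideal.mem_span_singleton]
      exact dvd_rfl
    · simp [sb_X_of_ne c hi]
  exact DFunLike.congr_fun this ψ

lemma sb_lf {x y : ι} (h : x ≠ y) (c : ℂ) : sb x y c (lf x y c) = 0 := by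
  simp [hom_lf, sb_X_of_ne c h]

lemma lf_dvd_iff {x y : ι} (h : x ≠ y) {c : ℂ} {ψ : Pol} :
    lf x y c ∣ ψ ↔ sb x y c ψ = 0 := by
  constructor
  · rintro ⟨φ, rfl⟩; rw [map_mul, sb_lf h, zero_mul]
  · intro h0; simpa [h0] using lf_dvd_sub_sb x y c ψ

lemma hom_eq_zero_of_dvd {σ : Pol →ₐ[ℂ] Pol} {x y : ι} {c : ℂ}
    {ψ : Pol} (hd : lf x y c ∣ ψ) (h : σ (X y) = C c * σ (X x)) : σ ψ = 0 := by
  obtain ⟨φ, rfl⟩ := hd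
  rw [map_mul, hom_lf, h, sub_self, zero_mul]

lemma lf_ne_zero {x y : ι} (h : x ≠ y) (c : ℂ) : lf x y c ≠ 0 := by
  intro h0
  have := congrArg (eval (fun i => if i = y then (1 : ℂ) else 0)) h0
  simp [lf, h] at this

lemma not_isUnit_lf (x y : ι) (c : ℂ) : ¬ IsUnit (lf x y c) := by
  intro h
  have := h.map (eval (fun _ => (0 : ℂ)))
  simp [lf] at this

lemma prime_lf {x y : ι} (h : x ≠ y) (c : ℂ) : Prime (lf x y c) := by
  refine ⟨lf_ne_zero h c, not_isUnit_lf x y c, fun f g hfg => ?_⟩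
  rw [lf_dvd_iff h, map_mul, mul_eq_zero] at hfg
  rwa [lf_dvd_iff h, lf_dvd_iff h]

lemma list_prod_dvd {R : Type*} [CommRing R] [IsDomain R] {n : R} :
    ∀ L : List R, (∀ a ∈ L, Prime a) → L.Pairwise (fun a b => ¬ a ∣ b) → (∀ a ∈ L, a ∣ n) →
      L.prod ∣ n := by
  intro L
  induction L with
  | nil => simp
  | cons a L ih =>
    intro hp hpw hd
    obtain ⟨k, rfl⟩ := ih (fun b hb => hp b (by simp [hb])) (List.pairwise_cons.1 hpw).2
      (fun b hb => hd b (by simp [hb]))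
    have ha := hp a (by simp)
    rcases ha.dvd_or_dvd (hd a (by simp)) with h | h
    · obtain ⟨b, hb, hab⟩ := (Prime.dvd_prod_iff ha).1 h
      exact absurd hab ((List.pairwise_cons.1 hpw).1 b hb)
    · rw [List.prod_cons, mul_comm a]
      exact mul_dvd_mul_left _ h

/-! ### The exchange -/

@[simp] lemma sw_X (x y i : ι) : sw x y (X i) = X (Equiv.swap x y i) := by simp [sw]

@[simp] lemma sw_C (x y : ι) (c : ℂ) : sw x y (C c) = C c := hom_C _ _

@[simp] lemma sw_sw (x y : ι) (ψ : Pol) : sw x y (sw x y ψ) = ψ := by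
  simp only [sw, rename_rename]
  have : (⇑(Equiv.swap x y) ∘ ⇑(Equiv.swap x y)) = id := by ext; simp
  rw [this, rename_id_apply]

lemma sw_comm (x y : ι) : sw x y = sw y x := by simp [sw, Equiv.swap_comm]

lemma sw_lf (x y u v : ι) (c : ℂ) :
    sw x y (lf u v c) = lf (Equiv.swap x y u) (Equiv.swap x y v) c := by simp [lf]

lemma sw_injective (x y : ι) : Function.Injective (sw x y) :=
  fun f g h => by rw [← sw_sw x y f, h, sw_sw]

lemma X_sub_X_dvd (x y : ι) (ψ : Pol) : (X x - X y : Pol) ∣ ψ - sw x y ψ := by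
  rw [← Ideal.mem_span_singleton, ← Ideal.Quotient.eq]
  have hxy : (Ideal.Quotient.mk (Ideal.span {(X x - X y : Pol)})) (X x) =
      (Ideal.Quotient.mk (Ideal.span {(X x - X y : Pol)})) (X y) := by
    rw [Ideal.Quotient.eq, Ideal.mem_span_singleton]
  have : (Ideal.Quotient.mkₐ ℂ (Ideal.span {(X x - X y : Pol)})) =
      (Ideal.Quotient.mkₐ ℂ (Ideal.span {(X x - X y : Pol)})).comp (sw x y) := by
    apply MvPolynomial.algHom_ext
    intro i
    simp only [AlgHom.comp_apply, sw_X, Ideal.Quotient.mkₐ_eq_mk]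
    by_cases h1 : i = x
    · subst h1; simp [hxy]
    · by_cases h2 : i = y
      · subst h2; simp [hxy]
      · rw [Equiv.swap_apply_of_ne_of_ne h1 h2]
  exact DFunLike.congr_fun this ψ

lemma X_sub_X_ne_zero {x y : ι} (h : x ≠ y) : (X x - X y : Pol) ≠ 0 := by
  have := lf_ne_zero h.symm 1
  simpa [lf] using this

/-- The divided difference `(ψ - s ψ) / (z_x - z_y)`. -/
def dd (x y : ι) (ψ : Pol) : Pol := (X_sub_X_dvd x y ψ).choose

lemma mul_dd (x y : ι) (ψ : Pol) : (X x - X y) * dd x y ψ = ψ - sw x y ψ :=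
  (X_sub_X_dvd x y ψ).choose_spec.symm

lemma dd_unique {x y : ι} (h : x ≠ y) {ψ φ : Pol}
    (hφ : (X x - X y) * φ = ψ - sw x y ψ) : dd x y ψ = φ :=
  mul_left_cancel₀ (X_sub_X_ne_zero h) ((mul_dd x y ψ).trans hφ.symm)

lemma sw_dd {x y : ι} (h : x ≠ y) (ψ : Pol) : sw x y (dd x y ψ) = dd x y ψ := by
  apply mul_left_cancel₀ (X_sub_X_ne_zero h)
  have := congrArg (sw x y) (mul_dd x y ψ)
  simp only [map_mul, map_sub, sw_X, Equiv.swap_apply_left, Equiv.swap_apply_right, sw_sw] at this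
  rw [mul_dd]
  linear_combination -this

/-! ### The fraction field and the operators `T` -/

/-- Rational functions. -/
abbrev Fr (κ : Type) : Type := FractionRing (MvPolynomial κ ℂ)

/-- The inclusion of polynomials in rational functions. -/
def io : Pol →ₐ[ℂ] Fr ι := Algebra.ofId _ _ |>.restrictScalars ℂ

lemma io_injective : Function.Injective (io : Pol →ₐ[ℂ] Fr ι) :=
  IsFractionRing.injective (Pol) (Fr ι)

lemma io_ne_zero {f : Pol} (h : f ≠ 0) : io f ≠ 0 := by
  rw [← map_zero io]; exact fun h' => h (io_injective h')

/-- The exchange of two variables in rational functions. -/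
def sF (x y : ι) : Fr ι ≃ₐ[ℂ] Fr ι :=
  IsFractionRing.fieldEquivOfAlgEquiv ℂ (Fr ι) (Fr ι) (renameEquiv ℂ (Equiv.swap x y))

@[simp] lemma sF_io (x y : ι) (ψ : Pol) : sF x y (io ψ) = io (sw x y ψ) :=
  IsFractionRing.fieldEquivOfAlgEquiv_algebraMap ℂ (Fr ι) (Fr ι)
    (renameEquiv ℂ (Equiv.swap x y)) ψ

lemma hom_ext_Fr {f g : Fr ι →ₐ[ℂ] Fr ι} (h : ∀ i, f (io (X i)) = g (io (X i))) : f = g := by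
  have h1 : f.comp io = g.comp io := MvPolynomial.algHom_ext h
  apply AlgHom.ext
  intro z
  obtain ⟨a, b, hb, rfl⟩ := IsFractionRing.div_surjective (A := Pol) z
  rw [map_div₀, map_div₀]
  have := fun c => DFunLike.congr_fun h1 c
  simp only [AlgHom.comp_apply] at this
  exact congrArg₂ _ (this a) (this b)


/-- A variable as a rational function. -/
def xF (i : ι) : Fr ι := io (X i)

@[simp] lemma sF_xF (x y i : ι) : sF x y (xF i) = xF (Equiv.swap x y i) := by simp [xF]

lemma xF_sub_ne_zero {x y : ι} (h : x ≠ y) : (xF x - xF y : Fr ι) ≠ 0 := by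
  rw [xF, xF, ← map_sub]; exact io_ne_zero (X_sub_X_ne_zero h)

lemma sF_hom_ext {f g : Fr ι ≃ₐ[ℂ] Fr ι} (h : ∀ i, f (xF i) = g (xF i)) (z : Fr ι) : f z = g z :=
  DFunLike.congr_fun (hom_ext_Fr (f := f.toAlgHom) (g := g.toAlgHom) h) z

@[simp] lemma sF_sF (x y : ι) (z : Fr ι) : sF x y (sF x y z) = z :=
  sF_hom_ext (f := (sF x y).trans (sF x y)) (g := AlgEquiv.refl) (fun i => by simp) z

lemma sF_conj (a b x y : ι) (z : Fr ι) :
    sF a b (sF x y z) = sF (Equiv.swap a b x) (Equiv.swap a b y) (sF a b z) :=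
  sF_hom_ext (f := (sF x y).trans (sF a b))
    (g := (sF a b).trans (sF (Equiv.swap a b x) (Equiv.swap a b y))) (fun i => by
      simp only [AlgEquiv.trans_apply, sF_xF]
      rw [Equiv.swap_apply_apply]; simp) z

/-- The form `s z_x - s⁻¹ z_y`. -/
def lnf (s : ℂ) (x y : ι) : Pol := C s * X x - C s⁻¹ * X y

lemma lnf_eq {s : ℂ} (hs : s ≠ 0) (x y : ι) : lnf s x y = C (-s⁻¹) * lf x y (s ^ 2) := by
  have : (C s : Pol) = C (s⁻¹) * C (s ^ 2) := by
    rw [← C_mul]; congr 1; field_simp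
  rw [lnf, lf, this, C_neg]; ring

lemma lnf_ne_zero {s : ℂ} (hs : s ≠ 0) {x y : ι} (h : x ≠ y) : lnf s x y ≠ 0 := by
  rw [lnf_eq hs]
  exact mul_ne_zero (by simpa using hs) (lf_ne_zero h _)

lemma lnf_dvd {s : ℂ} (hs : s ≠ 0) {x y : ι} {ψ : Pol} :
    lnf s x y ∣ ψ ↔ lf x y (s ^ 2) ∣ ψ := by
  rw [lnf_eq hs]
  have hu : IsUnit (C (-s⁻¹) : Pol) := by
    apply IsUnit.map; exact isUnit_iff_ne_zero.2 (by simpa using hs)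
  exact hu.mul_left_dvd

lemma hom_lnf (σ : Pol →ₐ[ℂ] Pol) (s : ℂ) (x y : ι) :
    σ (lnf s x y) = C s * σ (X x) - C s⁻¹ * σ (X y) := by simp [lnf]

lemma sw_lnf (s : ℂ) (x y : ι) : sw x y (lnf s x y) = lnf s y x := by simp [lnf]

lemma io_C (c : ℂ) : (io (C c) : Fr ι) = algebraMap ℂ _ c := by
  rw [← MvPolynomial.algebraMap_eq]; exact AlgHom.commutes io c

/-- `lnf` as a rational function. -/
def lF (s : ℂ) (x y : ι) : Fr ι := algebraMap ℂ _ s * xF x - algebraMap ℂ _ s⁻¹ * xF y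

lemma io_lnf (s : ℂ) (x y : ι) : io (lnf s x y) = lF s x y := by
  simp [lnf, lF, io_C, xF]

lemma lF_ne_zero {s : ℂ} (hs : s ≠ 0) {x y : ι} (h : x ≠ y) : lF s x y ≠ 0 := by
  rw [← io_lnf]; exact io_ne_zero (lnf_ne_zero hs h)

lemma sF_lF (s : ℂ) (a b x y : ι) :
    sF a b (lF s x y) = lF s (Equiv.swap a b x) (Equiv.swap a b y) := by
  simp [lF]

/-- The coefficient of the identity in `T`. -/
def uF (p : ℂ) (x y : ι) : Fr ι := algebraMap ℂ _ (epsPar p) * xF x / (xF x - xF y)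

/-- The coefficient of the exchange in `T`. -/
def vF (p q : ℂ) (x y : ι) : Fr ι := -(lF p x y * lF q x y) / ((xF x - xF y) * lF q y x)

lemma sF_uF (p : ℂ) (a b x y : ι) :
    sF a b (uF p x y) = uF p (Equiv.swap a b x) (Equiv.swap a b y) := by
  simp [uF]

lemma sF_vF (p q : ℂ) (a b x y : ι) :
    sF a b (vF p q x y) = vF p q (Equiv.swap a b x) (Equiv.swap a b y) := by
  simp [vF, sF_lF]

lemma uF_symm (p : ℂ) {x y : ι} (h : x ≠ y) :
    uF p y x = algebraMap ℂ (Fr ι) (epsPar p) - uF p x y := by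
  have h1 := xF_sub_ne_zero h
  have h2 := xF_sub_ne_zero h.symm
  rw [uF, uF]; field_simp; ring

lemma vF_mul_symm {p q : ℂ} (hp : p ≠ 0) (hq : q ≠ 0) {x y : ι} (h : x ≠ y) :
    vF p q x y * vF p q y x = 1 + algebraMap ℂ (Fr ι) (epsPar p) * uF p x y - uF p x y ^ 2 := by
  have h1 := xF_sub_ne_zero h
  have h2 := xF_sub_ne_zero h.symm
  have h3 := lF_ne_zero hq h
  have h4 := lF_ne_zero hq h.symm
  have hp' : algebraMap ℂ (Fr ι) p ≠ 0 := by simpa using hp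
  have : vF p q x y * vF p q y x = -(lF p x y * lF p y x) / (xF x - xF y) ^ 2 := by
    rw [vF, vF]; field_simp; ring
  rw [this, uF, epsPar]
  simp only [lF, map_sub, map_inv₀]
  field_simp
  ring

/-- The total operator `T` on rational functions. -/
def TF (p q : ℂ) (x y : ι) : Module.End ℂ (Fr ι) :=
  LinearMap.mulLeft ℂ (uF p x y) + (LinearMap.mulLeft ℂ (vF p q x y)) ∘ₗ (sF x y).toLinearMap

lemma TF_apply (p q : ℂ) (x y : ι) (f : Fr ι) :
    TF p q x y f = uF p x y * f + vF p q x y * sF x y f := rfl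

lemma TF_sq {p q : ℂ} (hp : p ≠ 0) (hq : q ≠ 0) {x y : ι} (h : x ≠ y) (f : Fr ι) :
    TF p q x y (TF p q x y f) = f + epsPar p • TF p q x y f := by
  have h1 := vF_mul_symm hp hq h
  have h2 := uF_symm p h
  simp only [TF_apply, map_add, map_mul, sF_sF, sF_uF, sF_vF, Equiv.swap_apply_left,
    Equiv.swap_apply_right, Algebra.smul_def]
  rw [h2]
  linear_combination f * h1

lemma TF_braid {p q : ℂ} (hp : p ≠ 0) (hq : q ≠ 0) {x y z : ι} (h : x ≠ y) (h' : y ≠ z)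
    (h'' : x ≠ z) (f : Fr ι) :
    TF p q x y (TF p q y z (TF p q x y f)) = TF p q y z (TF p q x y (TF p q y z f)) := by
  have hs : sF x y (sF y z (sF x y f)) = sF y z (sF x y (sF y z f)) := by
    rw [sF_conj x y y z (sF x y f), sF_sF, sF_conj y z x y (sF y z f), sF_sF]
    simp [Equiv.swap_apply_of_ne_of_ne h''.symm h'.symm, Equiv.swap_apply_of_ne_of_ne h h'']
  have e1 : Equiv.swap x y z = z := Equiv.swap_apply_of_ne_of_ne h''.symm h'.symm
  have e2 : Equiv.swap y z x = x := Equiv.swap_apply_of_ne_of_ne h h''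
  have hu1 := uF_symm p h
  have hu2 := uF_symm p h'
  have hv1 := vF_mul_symm hp hq h
  have hv2 := vF_mul_symm hp hq h'
  have hc : uF p x y * uF p x z = uF p x y * uF p y z
      + uF p x z * (algebraMap ℂ (Fr ι) (epsPar p) - uF p y z) := by
    have d1 := xF_sub_ne_zero h
    have d2 := xF_sub_ne_zero h'
    have d3 := xF_sub_ne_zero h''
    simp only [uF]; field_simp; ring
  simp only [TF_apply, map_add, map_mul, sF_sF, sF_uF, sF_vF, Equiv.swap_apply_left,
    Equiv.swap_apply_right, e1, e2, hs, hu1, hu2]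
  generalize sF x y (sF y z f) = f12
  generalize sF y z (sF x y f) = f21
  generalize sF y z (sF x y (sF y z f)) = f121
  generalize sF x y f = f1
  generalize sF y z f = f2
  generalize algebraMap ℂ (Fr ι) (epsPar p) = e at *
  generalize uF p x y = a at *
  generalize uF p y z = b at *
  generalize uF p x z = c at *
  linear_combination f * c * hv1 - f * c * hv2 + (-(a-b) * f - vF p q x y * f1 + vF p q y z * f2) * hc

lemma TF_comm {p q : ℂ} {x y z w : ι} (h1 : x ≠ z) (h2 : x ≠ w) (h3 : y ≠ z) (h4 : y ≠ w)
    (f : Fr ι) : TF p q x y (TF p q z w f) = TF p q z w (TF p q x y f) := by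
  have e1 : Equiv.swap x y z = z := Equiv.swap_apply_of_ne_of_ne h1.symm h3.symm
  have e2 : Equiv.swap x y w = w := Equiv.swap_apply_of_ne_of_ne h2.symm h4.symm
  have e3 : Equiv.swap z w x = x := Equiv.swap_apply_of_ne_of_ne h1 h2
  have e4 : Equiv.swap z w y = y := Equiv.swap_apply_of_ne_of_ne h3 h4
  have hs : sF x y (sF z w f) = sF z w (sF x y f) := by rw [sF_conj, e1, e2]
  simp only [TF_apply, map_add, map_mul, sF_uF, sF_vF, e1, e2, e3, e4, hs]
  ring

lemma TF_sF (p q : ℂ) (a b x y : ι) (f : Fr ι) : sF a b (TF p q x y f) =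
    TF p q (Equiv.swap a b x) (Equiv.swap a b y) (sF a b f) := by
  simp only [TF_apply, map_add, map_mul, sF_uF, sF_vF]
  rw [sF_conj a b x y]

lemma TF_mul_of_sF {p q : ℂ} {x y : ι} {g : Fr ι} (hg : sF x y g = g) (f : Fr ι) :
    TF p q x y (g * f) = g * TF p q x y f := by
  simp only [TF_apply, map_mul, hg]; ring

/-- Moving a variable through `T` inverts it. -/
lemma TF_xF_mul {p q : ℂ} {x y : ι} (h : x ≠ y) (f : Fr ι) :
    TF p q x y (xF y * f) = xF x * (TF p q x y f - epsPar p • f) := by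
  have d1 := xF_sub_ne_zero h
  have : uF p x y * (xF y - xF x) = - (algebraMap ℂ (Fr ι) (epsPar p) * xF x) := by
    rw [uF]; field_simp; ring
  simp only [TF_apply, map_mul, sF_xF, Equiv.swap_apply_right, Algebra.smul_def]
  linear_combination f * this

/-! ### `T` on polynomials -/

/-- The Demazure-Lusztig operator: `T` on the cofactor of `b`. -/
def dl (p : ℂ) (x y : ι) (φ : Pol) : Pol :=
  lnf p x y * dd x y φ - C p⁻¹ * φ

open Classical in
/-- The operator `T` on polynomials divisible by `q z_x - q⁻¹ z_y`. -/
def T (p q : ℂ) (x y : ι) (ψ : Pol) : Pol :=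
  if h : lnf q x y ∣ ψ then lnf q x y * dl p x y h.choose else 0

lemma T_mul {p q : ℂ} (hq : q ≠ 0) {x y : ι} (h : x ≠ y) (φ : Pol) :
    T p q x y (lnf q x y * φ) = lnf q x y * dl p x y φ := by
  have hd : lnf q x y ∣ lnf q x y * φ := ⟨φ, rfl⟩
  rw [T, dif_pos hd]
  have := mul_left_cancel₀ (lnf_ne_zero hq h) hd.choose_spec
  rw [← this]

lemma mul_dl {p : ℂ} {x y : ι} (φ : Pol) :
    (X x - X y) * dl p x y φ = C (epsPar p) * X x * φ - lnf p x y * sw x y φ := by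
  have := mul_dd x y φ
  rw [dl, mul_sub, mul_left_comm, this, lnf, epsPar, C_sub]; ring

lemma io_T {p q : ℂ} (hq : q ≠ 0) {x y : ι} (h : x ≠ y) {ψ : Pol}
    (hd : lf x y (q ^ 2) ∣ ψ) : io (T p q x y ψ) = TF p q x y (io ψ) := by
  obtain ⟨φ, rfl⟩ := (lnf_dvd hq).2 hd
  have d1 := xF_sub_ne_zero h
  have d2 := lF_ne_zero hq h.symm
  have := congrArg io (mul_dl (p := p) (x := x) (y := y) φ)
  simp only [map_mul, map_sub, io_C, io_lnf] at this
  apply mul_left_cancel₀ d1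
  rw [T_mul hq h, TF_apply, sF_io, map_mul, map_mul, map_mul, sw_lnf, map_mul, io_lnf, io_lnf, mul_left_comm]
  simp only [xF] at *
  rw [this, uF, vF]
  simp only [xF] at *
  field_simp
  ring

lemma T_dvd {p q : ℂ} (hq : q ≠ 0) (x y : ι) (ψ : Pol) :
    lf x y (q ^ 2) ∣ T p q x y ψ := by
  rw [← lnf_dvd hq, T]
  split_ifs with h
  · exact dvd_mul_right _ _
  · exact dvd_zero _

lemma lf_dvd_lf {x y u v : ι} {c d : ℂ} (hxy : x ≠ y) (huv : u ≠ v) (hc : c ≠ 0)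
    (h : lf x y c ∣ lf u v d) : (u = x ∧ v = y ∧ c = d) ∨ (u = y ∧ v = x ∧ c * d = 1) := by
  rw [lf_dvd_iff hxy, hom_lf, sb_X, sb_X] at h
  by_cases hv : v = y
  · subst hv
    rw [if_pos rfl, if_neg huv] at h
    left
    by_cases hu : u = x
    · subst hu
      have := congrArg (eval (fun _ => (1 : ℂ))) h
      simp at this
      exact ⟨rfl, rfl, by linear_combination this⟩
    · have := congrArg (eval (fun i => if i = x then (1 : ℂ) else 0)) h
      simp [hu, hc] at this
  · rw [if_neg hv] at h
    by_cases hu : u = y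
    · subst hu
      rw [if_pos rfl] at h
      right
      by_cases hx : v = x
      · subst hx
        have := congrArg (eval (fun _ => (1 : ℂ))) h
        simp at this
        exact ⟨rfl, rfl, by linear_combination -this⟩
      · have := congrArg (eval (fun i => if i = v then (1 : ℂ) else 0)) h
        simp [Ne.symm hx] at this
    · rw [if_neg hu] at h
      have := congrArg (eval (fun i => if i = v then (1 : ℂ) else 0)) h
      simp [huv] at this

lemma totalDegree_lf {x y : ι} (h : x ≠ y) (c : ℂ) : (lf x y c).totalDegree = 1 := by
  apply le_antisymm
  · apply (totalDegree_sub _ _).trans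
    rw [totalDegree_X, max_le_iff]
    refine ⟨le_rfl, (totalDegree_mul _ _).trans ?_⟩
    rw [totalDegree_C, totalDegree_X]
  · by_contra h0
    have h1 : (lf x y c).totalDegree = 0 := by omega
    rw [totalDegree_eq_zero_iff_eq_C] at h1
    have h2 := congrArg (eval (fun i => if i = y then (1 : ℂ) else 0)) h1
    have h3 := congrArg (eval (fun _ => (0 : ℂ))) h1
    simp [lf, h] at h2 h3

lemma totalDegree_aeval_le {f : ι → Pol} (hf : ∀ i, (f i).totalDegree ≤ 1)
    (ψ : Pol) : (aeval f ψ).totalDegree ≤ ψ.totalDegree := by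
  rw [MvPolynomial.aeval_def, MvPolynomial.eval₂_eq]
  apply totalDegree_finsetSum_le
  intro d hd
  rw [MvPolynomial.algebraMap_eq]
  apply (totalDegree_mul _ _).trans
  rw [totalDegree_C, zero_add]
  apply (totalDegree_finsetProd _ _).trans
  refine le_trans (Finset.sum_le_sum (g := fun i => d i) fun i _ => ?_) (le_totalDegree hd)
  apply (totalDegree_pow _ _).trans
  calc _ ≤ d i * 1 := by gcongr; exact hf i
    _ = d i := mul_one _

lemma totalDegree_C_mul_X_le (c : ℂ) (x : ι) :
    (C c * X x : Pol).totalDegree ≤ 1 := by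
  refine (totalDegree_mul _ _).trans ?_
  rw [totalDegree_C, totalDegree_X]

lemma totalDegree_sb (x y : ι) (c : ℂ) (ψ : Pol) :
    (sb x y c ψ).totalDegree ≤ ψ.totalDegree := by
  apply totalDegree_aeval_le
  intro i
  split_ifs
  · exact totalDegree_C_mul_X_le c x
  · rw [totalDegree_X]

lemma totalDegree_mul_eq {f g : Pol} (hf : f ≠ 0) (hg : g ≠ 0) :
    (f * g).totalDegree = f.totalDegree + g.totalDegree := totalDegree_mul_of_isDomain hf hg

/-! ### Property (P) along a list of positions -/

/-- The three admissible pairs of ratios. -/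
def Val (p q c₁ c₂ : ℂ) : Prop :=
  (c₁ = q ^ 2 ∧ c₂ = q ^ 4) ∨ (c₁ = p ^ 2 ∧ c₂ = q ^ 2 * p ^ 2) ∨ (c₁ = q ^ 2 ∧ c₂ = q ^ 2 * p ^ 2)

/-- Property (P) for the variables in the order of a list. -/
def PP (p q : ℂ) (l : List ι) (ψ : Pol) : Prop :=
  ∀ i j k, [i, j, k].Sublist l → ∀ c₁ c₂, Val p q c₁ c₂ →
    sb i k c₂ (sb i j c₁ ψ) = 0

lemma nodup3 {l : List ι} (hl : l.Nodup) {i j k : ι} (h : [i, j, k].Sublist l) :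
    i ≠ j ∧ i ≠ k ∧ j ≠ k := by
  have := h.nodup hl
  simp at this
  tauto

lemma nodup2 {l : List ι} (hl : l.Nodup) {i j : ι} (h : [i, j].Sublist l) : i ≠ j := by
  have := h.nodup hl
  simpa using this

lemma PP.hom {p q : ℂ} {l : List ι} {ψ : Pol} (h : PP p q l ψ) {i j k : ι}
    (hs : [i, j, k].Sublist l) {c₁ c₂ : ℂ} (hv : Val p q c₁ c₂)
    {σ : Pol →ₐ[ℂ] Pol} (h1 : σ (X j) = C c₁ * σ (X i))
    (h2 : σ (X k) = C c₂ * σ (X i)) : σ ψ = 0 := by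
  rw [← hom_sb h1, ← hom_sb h2, h i j k hs c₁ c₂ hv, map_zero]

/-- The substitution attached to a triple. -/
def tr (i j k : ι) (c₁ c₂ : ℂ) : Pol →ₐ[ℂ] Pol :=
  (sb i k c₂).comp (sb i j c₁)

lemma tr_X {i j k : ι} (c₁ c₂ : ℂ) (h : i ≠ k) (t : ι) : tr i j k c₁ c₂ (X t) =
    if t = j then C c₁ * X i else if t = k then C c₂ * X i else X t := by
  rw [tr, AlgHom.comp_apply, sb_X]
  split_ifs with h1 h2
  · rw [map_mul, hom_C, sb_X_of_ne _ h]
  · rw [h2, sb_X_right]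
  · rw [sb_X_of_ne _ h2]

lemma pp_iff {p q : ℂ} {l : List ι} {ψ : Pol} : PP p q l ψ ↔
    ∀ i j k, [i, j, k].Sublist l → ∀ c₁ c₂, Val p q c₁ c₂ → tr i j k c₁ c₂ ψ = 0 := Iff.rfl

lemma PP.of_mul {p q : ℂ} {l : List ι} {f g : Pol} (h : PP p q l (f * g))
    (hf : ∀ i j k, [i, j, k].Sublist l → ∀ c₁ c₂, Val p q c₁ c₂ → tr i j k c₁ c₂ f ≠ 0) :
    PP p q l g := by
  intro i j k hs c₁ c₂ hv
  have := h i j k hs c₁ c₂ hv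
  rw [map_mul, map_mul, mul_eq_zero] at this
  exact this.resolve_left (hf i j k hs c₁ c₂ hv)

lemma PP.add {p q : ℂ} {l : List ι} {f g : Pol} (hf : PP p q l f)
    (hg : PP p q l g) : PP p q l (f + g) := by
  intro i j k hs c₁ c₂ hv
  rw [map_add, map_add, hf i j k hs c₁ c₂ hv, hg i j k hs c₁ c₂ hv, add_zero]

lemma PP.smul {p q : ℂ} {l : List ι} {f : Pol} (hf : PP p q l f) (c : ℂ) :
    PP p q l (c • f) := by
  intro i j k hs c₁ c₂ hv
  rw [map_smul, map_smul, hf i j k hs c₁ c₂ hv, smul_zero]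

/-- The genericity conditions on the parameters. -/
structure Gen (p q : ℂ) : Prop where
  p0 : p ≠ 0
  q0 : q ≠ 0
  mono : ∀ i j : ℤ, (i ≠ 0 ∨ j ≠ 0) → |i| ≤ 12 → |j| ≤ 12 → p ^ i * q ^ j ≠ 1

lemma Gen.ne {p q : ℂ} (h : Gen p q) (i j i' j' : ℤ) (h1 : i - i' ≠ 0 ∨ j - j' ≠ 0)
    (h2 : |i - i'| ≤ 12 := by norm_num) (h3 : |j - j'| ≤ 12 := by norm_num) :
    p ^ i * q ^ j ≠ p ^ i' * q ^ j' := by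
  intro he
  apply h.mono (i - i') (j - j') h1 h2 h3
  have hp := h.p0
  have hq := h.q0
  rw [zpow_sub₀ hp, zpow_sub₀ hq]
  have a1 := zpow_ne_zero i' hp
  have a2 := zpow_ne_zero j' hq
  field_simp
  linear_combination he

lemma Gen.symm {p q : ℂ} (h : Gen p q) : Gen p⁻¹ q⁻¹ where
  p0 := inv_ne_zero h.p0
  q0 := inv_ne_zero h.q0
  mono i j hij hi hj := by
    have := h.mono (-i) (-j) (by omega) (by simpa using hi) (by simpa using hj)
    simpa using this

/-! ### Products of linear forms -/

lemma triples_prod_dvd (x : ι) (ψ : Pol) (L : List (ι × ℂ × ℂ))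
    (hn : (L.map Prod.fst).Nodup) (hx : x ∉ L.map Prod.fst)
    (h0 : ∀ t ∈ L, t.2.1 ≠ 0 ∧ t.2.2 ≠ 0 ∧ t.2.1 ≠ t.2.2)
    (hd : ∀ t ∈ L, lf x t.1 t.2.1 ∣ ψ ∧ lf x t.1 t.2.2 ∣ ψ) :
    (L.map fun t => lf x t.1 t.2.1 * lf x t.1 t.2.2).prod ∣ ψ := by
  induction L with
  | nil => simp
  | cons t L ih =>
    simp only [List.map_cons, List.nodup_cons, List.mem_cons, not_or, List.prod_cons,
      forall_eq_or_imp] at *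
    obtain ⟨k, rfl⟩ := ih hn.2 hx.2 h0.2 hd.2
    have key : ∀ c : ℂ, c ≠ 0 →
        ¬ lf x t.1 c ∣ (L.map fun t => lf x t.1 t.2.1 * lf x t.1 t.2.2).prod := by
      intro c hc hcd
      obtain ⟨f, hf, hdf⟩ := (Prime.dvd_prod_iff (prime_lf hx.1 c)).1 hcd
      obtain ⟨t', ht', rfl⟩ := List.mem_map.1 hf
      have hmem : t'.1 ∈ L.map Prod.fst := List.mem_map_of_mem ht'
      have hx' : x ≠ t'.1 := fun h => hx.2 (h ▸ hmem)
      rcases (prime_lf hx.1 c).dvd_or_dvd hdf with h | h <;>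
      · rcases lf_dvd_lf hx.1 hx' hc h with h | h
        · exact hn.1 (h.2.1 ▸ hmem)
        · exact hx.1 h.1
    have d1 := ((prime_lf hx.1 t.2.1).dvd_or_dvd hd.1.1).resolve_left (key _ h0.1.1)
    have d2 := ((prime_lf hx.1 t.2.2).dvd_or_dvd hd.1.2).resolve_left (key _ h0.1.2.1)
    obtain ⟨k, rfl⟩ := d1
    have d3 : lf x t.1 t.2.2 ∣ k := by
      refine ((prime_lf hx.1 t.2.2).dvd_or_dvd d2).resolve_left fun h => ?_
      rcases lf_dvd_lf hx.1 hx.1 h0.1.2.1 h with h | h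
      · exact h0.1.2.2 h.2.2.symm
      · exact hx.1 h.1
    obtain ⟨k, rfl⟩ := d3
    exact ⟨k, by ring⟩

lemma totalDegree_triples (x : ι) (L : List (ι × ℂ × ℂ)) (hx : x ∉ L.map Prod.fst) :
    (L.map fun t => lf x t.1 t.2.1 * lf x t.1 t.2.2).prod.totalDegree = 2 * L.length ∧
    (L.map fun t => lf x t.1 t.2.1 * lf x t.1 t.2.2).prod ≠ 0 := by
  induction L with
  | nil => simp
  | cons t L ih =>
    simp only [List.map_cons, List.mem_cons, not_or, List.prod_cons, List.length_cons] at *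
    obtain ⟨h1, h2⟩ := ih hx.2
    have a := lf_ne_zero hx.1 t.2.1
    have b := lf_ne_zero hx.1 t.2.2
    refine ⟨?_, mul_ne_zero (mul_ne_zero a b) h2⟩
    rw [totalDegree_mul_eq (mul_ne_zero a b) h2, totalDegree_mul_eq a b, h1,
      totalDegree_lf hx.1, totalDegree_lf hx.1]
    ring

/-- The product of all `z_b - q² z_a` with `a` before `b`. -/
def Delta (q : ℂ) : List ι → Pol
  | [] => 1
  | a :: l => (l.map fun w => lf a w (q ^ 2)).prod * Delta q l

/-- Divisibility by all `z_b - q² z_a` with `a` before `b`. -/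
def Blk (q : ℂ) (l : List ι) (ψ : Pol) : Prop :=
  ∀ a b, [a, b].Sublist l → lf a b (q ^ 2) ∣ ψ

lemma blk_cons {q : ℂ} {a : ι} {l : List ι} {ψ : Pol} :
    Blk q (a :: l) ψ ↔ (∀ w ∈ l, lf a w (q ^ 2) ∣ ψ) ∧ Blk q l ψ := by
  constructor
  · intro h
    exact ⟨fun w hw => h a w ((List.singleton_sublist.2 hw).cons_cons a),
      fun u v huv => h u v (huv.cons a)⟩
  · rintro ⟨h1, h2⟩ u v huv
    rcases huv with _ | h | h
    · exact h2 u v (by assumption)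
    · exact h1 v (List.singleton_sublist.1 (by assumption))

lemma Blk.sublist {q : ℂ} {l l' : List ι} {ψ : Pol} (h : Blk q l ψ)
    (hl : l'.Sublist l) : Blk q l' ψ := fun a b hab => h a b (hab.trans hl)

lemma star_prod_dvd {q : ℂ} (hq : q ≠ 0) {a : ι} {l : List ι} (hl : (a :: l).Nodup)
    {ψ : Pol} (h : ∀ w ∈ l, lf a w (q ^ 2) ∣ ψ) :
    (l.map fun w => lf a w (q ^ 2)).prod ∣ ψ := by
  have hq2 : q ^ 2 ≠ 0 := pow_ne_zero _ hq
  rw [List.nodup_cons] at hl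
  have hne : ∀ w ∈ l, a ≠ w := fun w hw h => hl.1 (h ▸ hw)
  apply list_prod_dvd
  · intro f hf
    obtain ⟨w, hw, rfl⟩ := List.mem_map.1 hf
    exact prime_lf (hne w hw) _
  · rw [List.pairwise_map]
    refine List.Pairwise.imp_of_mem ?_ hl.2
    intro u v hu hv huv hd
    rcases lf_dvd_lf (hne u hu) (hne v hv) hq2 hd with h | h
    · exact huv h.2.1.symm
    · exact hne u hu h.1
  · intro f hf
    obtain ⟨w, hw, rfl⟩ := List.mem_map.1 hf
    exact h w hw

lemma not_dvd_Delta {q c : ℂ} (hc : c ≠ 0) {a w : ι} {l : List ι} (hl : l.Nodup)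
    (ha : a ∉ l) (haw : a ≠ w) : ¬ lf a w c ∣ Delta q l := by
  induction l with
  | nil =>
    intro h
    exact (prime_lf haw c).not_isUnit (isUnit_of_dvd_one h)
  | cons b l ih =>
    rw [List.mem_cons, not_or] at ha
    rw [List.nodup_cons] at hl
    intro h
    rcases (prime_lf haw c).dvd_or_dvd h with h | h
    · obtain ⟨f, hf, hdf⟩ := (Prime.dvd_prod_iff (prime_lf haw c)).1 h
      obtain ⟨v, hv, rfl⟩ := List.mem_map.1 hf
      have hbv : b ≠ v := fun h => hl.1 (h ▸ hv)
      rcases lf_dvd_lf haw hbv hc hdf with h | h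
      · exact ha.1 h.1.symm
      · exact ha.2 (h.2.1 ▸ hv)
    · exact ih hl.2 ha.2 h

lemma Delta_dvd {q : ℂ} (hq : q ≠ 0) {l : List ι} (hl : l.Nodup)
    {ψ : Pol} (h : Blk q l ψ) : Delta q l ∣ ψ := by
  induction l with
  | nil => simp [Delta]
  | cons a l ih =>
    have hl' := List.nodup_cons.1 hl
    rw [blk_cons] at h
    obtain ⟨k, rfl⟩ := ih hl'.2 h.2
    have hne : ∀ w ∈ l, a ≠ w := fun w hw h => hl'.1 (h ▸ hw)
    have : (l.map fun w => lf a w (q ^ 2)).prod ∣ k := by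
      apply star_prod_dvd hq hl
      intro w hw
      exact ((prime_lf (hne w hw) _).dvd_or_dvd (h.1 w hw)).resolve_left
        (not_dvd_Delta (pow_ne_zero _ hq) hl'.2 hl'.1 (hne w hw))
    rw [Delta, mul_comm]
    exact mul_dvd_mul_left _ this

lemma star_ne_zero {q : ℂ} {a : ι} {l : List ι} (hl : (a :: l).Nodup) :
    (l.map fun w => lf a w (q ^ 2)).prod ≠ 0 ∧
    (l.map fun w => lf a w (q ^ 2)).prod.totalDegree = l.length := by
  induction l with
  | nil => simp
  | cons b l ih =>
    have hl1 : (a :: l).Nodup := by simp at hl ⊢; tauto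
    have hab : a ≠ b := by simp at hl; tauto
    obtain ⟨h1, h2⟩ := ih hl1
    rw [List.map_cons, List.prod_cons, List.length_cons]
    refine ⟨mul_ne_zero (lf_ne_zero hab _) h1, ?_⟩
    rw [totalDegree_mul_eq (lf_ne_zero hab _) h1, h2, totalDegree_lf hab, add_comm]

lemma Delta_ne_zero {q : ℂ} {l : List ι} (hl : l.Nodup) : Delta q l ≠ 0 ∧
    2 * (Delta q l).totalDegree = l.length * (l.length - 1) := by
  induction l with
  | nil => simp [Delta]
  | cons a l ih =>
    obtain ⟨h1, h2⟩ := ih (List.nodup_cons.1 hl).2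
    obtain ⟨h3, h4⟩ := star_ne_zero (q := q) hl
    refine ⟨mul_ne_zero h3 h1, ?_⟩
    rw [Delta, totalDegree_mul_eq h3 h1, h4, mul_add, h2, List.length_cons]
    cases l.length with
    | zero => rfl
    | succ n => simp only [Nat.add_sub_cancel]; ring

/-! ### Reduction -/

/-- The product split off when `z_y = q² z_x` is substituted. -/
def redPi (p q : ℂ) (x : ι) (l1 l2 l3 : List ι) : Pol :=
  (l1.map fun w => lf x w ((q ^ 2)⁻¹) * lf x w ((p ^ 2)⁻¹)).prod *
  ((l2.map fun w => lf x w (q ^ 2) * lf x w 1).prod *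
  (l3.map fun w => lf x w (q ^ 4) * lf x w (q ^ 2 * p ^ 2)).prod)

/-- The same product as a list of triples. -/
def redL (p q : ℂ) (l1 l2 l3 : List ι) : List (ι × ℂ × ℂ) :=
  (l1.map fun w => (w, (q ^ 2)⁻¹, (p ^ 2)⁻¹)) ++ ((l2.map fun w => (w, q ^ 2, 1)) ++
    (l3.map fun w => (w, q ^ 4, q ^ 2 * p ^ 2)))

lemma redPi_eq (p q : ℂ) (x : ι) (l1 l2 l3 : List ι) : redPi p q x l1 l2 l3 =
    ((redL p q l1 l2 l3).map fun t => lf x t.1 t.2.1 * lf x t.1 t.2.2).prod := by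
  simp [redPi, redL, Function.comp_def]

lemma redL_fst (p q : ℂ) (l1 l2 l3 : List ι) :
    (redL p q l1 l2 l3).map Prod.fst = l1 ++ (l2 ++ l3) := by
  simp [redL, Function.comp_def]

lemma redPi_ne_zero (p q : ℂ) {x : ι} {l1 l2 l3 : List ι} (hx : x ∉ l1 ++ (l2 ++ l3)) :
    redPi p q x l1 l2 l3 ≠ 0 ∧
    (redPi p q x l1 l2 l3).totalDegree = 2 * (l1 ++ (l2 ++ l3)).length := by
  have := totalDegree_triples x (redL p q l1 l2 l3) (by rwa [redL_fst])
  rw [← redPi_eq] at this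
  refine ⟨this.2, this.1.trans ?_⟩
  rw [← redL_fst p q, List.length_map]

/-- `φ` is the reduction of `ψ` at the pair `x`, `y`. -/
def IsRed (p q : ℂ) (x y : ι) (l1 l2 l3 : List ι) (ψ φ : Pol) : Prop :=
  sb x y (q ^ 2) ψ = redPi p q x l1 l2 l3 * φ

/-- The pairs inside `x, l2, y` that contain an end but are not `x, y`. -/
def Btw (q : ℂ) (x y : ι) (l2 : List ι) (ψ : Pol) : Prop :=
  ∀ w ∈ l2, lf x w (q ^ 2) ∣ ψ ∧ lf w y (q ^ 2) ∣ ψ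

lemma tr_lf_ne_zero {x i j k : ι} (hik : i ≠ k) (hi : x ≠ i) (hj : x ≠ j) (hk : x ≠ k)
    (c₁ c₂ : ℂ) {w : ι} (hw : x ≠ w) {c : ℂ} (hc : c ≠ 0) : tr i j k c₁ c₂ (lf x w c) ≠ 0 := by
  intro h
  rw [hom_lf, tr_X _ _ hik, tr_X _ _ hik, if_neg hj, if_neg hk] at h
  have := congrArg (eval (fun i => if i = x then (1 : ℂ) else 0)) h
  split_ifs at this <;> simp [hi.symm, hw.symm, hc] at this

lemma redL_ne_zero {p q : ℂ} (hp : p ≠ 0) (hq : q ≠ 0) {l1 l2 l3 : List ι} :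
    ∀ t ∈ redL p q l1 l2 l3, t.2.1 ≠ 0 ∧ t.2.2 ≠ 0 := by
  intro t ht
  simp only [redL, List.mem_append, List.mem_map] at ht
  rcases ht with ⟨w, _, rfl⟩ | ⟨w, _, rfl⟩ | ⟨w, _, rfl⟩ <;> simp [hp, hq]

lemma tr_redPi_ne_zero {p q : ℂ} (hp : p ≠ 0) (hq : q ≠ 0) {x : ι} {l1 l2 l3 : List ι}
    (hx : x ∉ l1 ++ (l2 ++ l3)) {i j k : ι} (hik : i ≠ k) (hi : x ≠ i) (hj : x ≠ j) (hk : x ≠ k)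
    (c₁ c₂ : ℂ) : tr i j k c₁ c₂ (redPi p q x l1 l2 l3) ≠ 0 := by
  rw [redPi_eq, map_list_prod]
  apply List.prod_ne_zero
  simp only [List.mem_map, not_exists, not_and]
  rintro f ⟨t, ht, rfl⟩ h
  have hw : x ≠ t.1 := by
    rintro rfl
    apply hx
    rw [← redL_fst p q]
    exact List.mem_map_of_mem ht
  have h0 := redL_ne_zero hp hq t ht
  rw [map_mul, mul_eq_zero] at h
  rcases h with h | h
  · exact tr_lf_ne_zero hik hi hj hk c₁ c₂ hw h0.1 h
  · exact tr_lf_ne_zero hik hi hj hk c₁ c₂ hw h0.2 h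

lemma sub_left {l1 l2 l3 : List ι} {x y w : ι} (h : w ∈ l1) :
    [w, x, y].Sublist (l1 ++ x :: (l2 ++ y :: l3)) := by
  have h1 : [w].Sublist l1 := List.singleton_sublist.2 h
  have h2 : [y].Sublist (l2 ++ y :: l3) := by simp
  exact h1.append (h2.cons_cons x)

lemma sub_right {l1 l2 l3 : List ι} {x y w : ι} (h : w ∈ l3) :
    [x, y, w].Sublist (l1 ++ x :: (l2 ++ y :: l3)) := by
  have h1 : [w].Sublist l3 := List.singleton_sublist.2 h
  have h2 : [y, w].Sublist (l2 ++ y :: l3) := (h1.cons_cons y).trans (List.sublist_append_right _ _)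
  exact (h2.cons_cons x).trans (List.sublist_append_right _ _)

lemma sub_rest {l1 l2 l3 : List ι} {x y : ι} :
    (l1 ++ (l2 ++ l3)).Sublist (l1 ++ x :: (l2 ++ y :: l3)) :=
  (List.Sublist.refl l1).append
    (((List.Sublist.refl l2).append (List.sublist_cons_self y l3)).cons x)

lemma red_names {x y : ι} {l1 l2 l3 : List ι} (hl : (l1 ++ x :: (l2 ++ y :: l3)).Nodup) :
    x ≠ y ∧ (l1 ++ (l2 ++ l3)).Nodup ∧ x ∉ l1 ++ (l2 ++ l3) ∧ y ∉ l1 ++ (l2 ++ l3) := by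
  refine ⟨?_, sub_rest.nodup hl, ?_, ?_⟩
  · rintro rfl; simp [List.nodup_append] at hl
  · have := List.nodup_middle.1 hl
    simp at this ⊢; tauto
  · have := List.nodup_middle.1 (by simpa using hl : ((l1 ++ x :: l2) ++ y :: l3).Nodup)
    simp at this ⊢; tauto

lemma redPi_dvd {p q : ℂ} (g : Gen p q) {x y : ι} {l1 l2 l3 : List ι}
    (hl : (l1 ++ x :: (l2 ++ y :: l3)).Nodup) {ψ : Pol}
    (hP : PP p q (l1 ++ x :: (l2 ++ y :: l3)) ψ) (hb : Btw q x y l2 ψ) :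
    redPi p q x l1 l2 l3 ∣ sb x y (q ^ 2) ψ := by
  have hp := g.p0
  have hq := g.q0
  have hq2 : q ^ 2 ≠ 0 := pow_ne_zero _ hq
  have hp2 : p ^ 2 ≠ 0 := pow_ne_zero _ hp
  obtain ⟨hxy, hnd, hx, hy⟩ := red_names hl
  have n1 : q ^ 2 ≠ 1 := by simpa using g.ne 0 2 0 0 (by norm_num)
  have n2 : q ^ 2 ≠ p ^ 2 := by
    have := g.ne 0 2 2 0 (by norm_num); norm_cast at this; simpa using this
  have n3 : q ^ 4 ≠ q ^ 2 * p ^ 2 := by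
    intro h; apply n2; apply mul_left_cancel₀ hq2; linear_combination h
  rw [redPi_eq]
  apply triples_prod_dvd
  · rwa [redL_fst]
  · rwa [redL_fst]
  · intro t ht
    refine ⟨(redL_ne_zero hp hq t ht).1, (redL_ne_zero hp hq t ht).2, ?_⟩
    simp only [redL, List.mem_append, List.mem_map] at ht
    rcases ht with ⟨w, _, rfl⟩ | ⟨w, _, rfl⟩ | ⟨w, _, rfl⟩
    · simpa using n2
    · exact n1
    · exact n3
  · intro t ht
    simp only [redL, List.mem_append, List.mem_map] at ht
    have hne : ∀ w ∈ l1 ++ (l2 ++ l3), x ≠ w ∧ y ≠ w := fun w hw =>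
      ⟨fun h => hx (h ▸ hw), fun h => hy (h ▸ hw)⟩
    rcases ht with ⟨w, hw, rfl⟩ | ⟨w, hw, rfl⟩ | ⟨w, hw, rfl⟩
    · have hxw := (hne w (by simp [hw])).1
      have hyw := (hne w (by simp [hw])).2
      have key : ∀ c₁, c₁ ≠ 0 → Val p q c₁ (q ^ 2 * c₁) → lf x w c₁⁻¹ ∣ sb x y (q ^ 2) ψ := by
        intro c₁ hc hv
        rw [lf_dvd_iff hxw]
        rw [← AlgHom.comp_apply]
        refine hP.hom (σ := (sb x w c₁⁻¹).comp (sb x y (q ^ 2))) (sub_left hw) hv ?_ ?_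
        · simp only [AlgHom.comp_apply, sb_X_of_ne _ hxy, sb_X_of_ne _ hyw.symm,
            sb_X_right, sb_X_of_ne _ hxw]
          rw [← mul_assoc, ← C_mul, mul_inv_cancel₀ hc, C_1, one_mul]
        · simp only [AlgHom.comp_apply, sb_X_of_ne _ hxy, sb_X_of_ne _ hyw.symm,
            sb_X_right, sb_X_of_ne _ hxw, map_mul, hom_C]
          rw [← mul_assoc, ← C_mul, ← C_mul, mul_assoc, mul_inv_cancel₀ hc, mul_one]
      exact ⟨key _ hq2 (Or.inl ⟨rfl, by ring⟩), key _ hp2 (Or.inr (Or.inl ⟨rfl, by ring⟩))⟩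
    · have hxw := (hne w (by simp [hw])).1
      have hyw := (hne w (by simp [hw])).2
      rw [lf_dvd_iff hxw, lf_dvd_iff hxw]
      constructor
      · rw [← AlgHom.comp_apply]
        refine hom_eq_zero_of_dvd (σ := (sb x w (q ^ 2)).comp (sb x y (q ^ 2))) (hb w hw).1 ?_
        simp only [AlgHom.comp_apply, sb_X_of_ne _ hxy, sb_X_of_ne _ hyw.symm,
            sb_X_right, sb_X_of_ne _ hxw]
      · rw [← AlgHom.comp_apply]
        refine hom_eq_zero_of_dvd (σ := (sb x w 1).comp (sb x y (q ^ 2))) (hb w hw).2 ?_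
        simp only [AlgHom.comp_apply, sb_X_of_ne _ hxy, sb_X_of_ne _ hyw.symm,
            sb_X_right, sb_X_of_ne _ hxw, map_mul, hom_C, C_1, one_mul]
    · have hxw := (hne w (by simp [hw])).1
      have hyw := (hne w (by simp [hw])).2
      have key : ∀ c₂, Val p q (q ^ 2) c₂ → lf x w c₂ ∣ sb x y (q ^ 2) ψ := by
        intro c₂ hv
        rw [lf_dvd_iff hxw]
        rw [← AlgHom.comp_apply]
        refine hP.hom (σ := (sb x w c₂).comp (sb x y (q ^ 2))) (sub_right hw) hv ?_ ?_
        · simp only [AlgHom.comp_apply, sb_X_of_ne _ hxy, sb_X_of_ne _ hyw.symm,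
            sb_X_right, sb_X_of_ne _ hxw, map_mul, hom_C]
        · simp only [AlgHom.comp_apply, sb_X_of_ne _ hxy, sb_X_of_ne _ hyw.symm,
            sb_X_right, sb_X_of_ne _ hxw]
      exact ⟨key _ (Or.inl ⟨rfl, rfl⟩), key _ (Or.inr (Or.inr ⟨rfl, rfl⟩))⟩

lemma exists_red {p q : ℂ} (g : Gen p q) {x y : ι} {l1 l2 l3 : List ι}
    (hl : (l1 ++ x :: (l2 ++ y :: l3)).Nodup) {ψ : Pol}
    (hP : PP p q (l1 ++ x :: (l2 ++ y :: l3)) ψ) (hb : Btw q x y l2 ψ) :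
    ∃ φ, IsRed p q x y l1 l2 l3 ψ φ ∧ PP p q (l1 ++ (l2 ++ l3)) φ ∧
      (φ ≠ 0 → φ.totalDegree + 2 * (l1 ++ (l2 ++ l3)).length ≤ ψ.totalDegree) := by
  have hp := g.p0
  have hq := g.q0
  have hq2 : q ^ 2 ≠ 0 := pow_ne_zero _ hq
  have hp2 : p ^ 2 ≠ 0 := pow_ne_zero _ hp
  obtain ⟨hxy, hnd, hx, hy⟩ := red_names hl
  have hdiv := redPi_dvd g hl hP hb
  obtain ⟨φ, hφ⟩ := hdiv
  obtain ⟨hPi, hdeg⟩ := redPi_ne_zero p q hx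
  refine ⟨φ, hφ, ?_, fun h0 => ?_⟩
  · refine PP.of_mul (f := redPi p q x l1 l2 l3) ?_ ?_
    · rw [← hφ]
      intro i j k hs c₁ c₂ hv
      have hs' := hs.trans (sub_rest (x := x) (y := y))
      have hm : ∀ w ∈ [i, j, k], w ≠ y := fun w hw h => hy (h ▸ hs.subset hw)
      have hn := nodup3 hnd hs
      have key : ((tr i j k c₁ c₂).comp (sb x y (q ^ 2))) ψ = 0 := by
        refine hP.hom hs' hv ?_ ?_
        · simp only [AlgHom.comp_apply]
          rw [sb_X_of_ne _ (hm j (by simp)), sb_X_of_ne _ (hm i (by simp)), tr_X _ _ hn.2.1,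
            tr_X _ _ hn.2.1]
          simp [hn]
        · simp only [AlgHom.comp_apply]
          rw [sb_X_of_ne _ (hm k (by simp)), sb_X_of_ne _ (hm i (by simp)), tr_X _ _ hn.2.1,
            tr_X _ _ hn.2.1]
          simp [hn, hn.2.2.symm]
      rwa [AlgHom.comp_apply, tr, AlgHom.comp_apply] at key
    · intro i j k hs c₁ c₂ hv
      have hm : ∀ w ∈ [i, j, k], x ≠ w := fun w hw h => hx (h ▸ hs.subset hw)
      exact tr_redPi_ne_zero hp hq hx (nodup3 hnd hs).2.1 (hm i (by simp)) (hm j (by simp))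
        (hm k (by simp)) c₁ c₂
  · have := totalDegree_sb x y (q ^ 2) ψ
    rw [hφ, totalDegree_mul_eq hPi h0, hdeg] at this
    omega

lemma sublist_pair_iff {l : List ι} {a b : ι} :
    [a, b].Sublist l ↔ ∃ l1 l2 l3, l = l1 ++ a :: (l2 ++ b :: l3) := by
  constructor
  · intro h
    obtain ⟨r1, r2, rfl, h1, h2⟩ := List.cons_sublist_iff.1 h
    obtain ⟨s1, s2, rfl⟩ := List.append_of_mem h1
    obtain ⟨t1, t2, rfl⟩ := List.append_of_mem (List.singleton_sublist.1 h2)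
    exact ⟨s1, s2 ++ t1, t2, by simp⟩
  · rintro ⟨l1, l2, l3, rfl⟩
    have h2 : [b].Sublist (l2 ++ b :: l3) := by simp
    exact (h2.cons_cons a).trans (List.sublist_append_right _ _)

/-- A nonzero polynomial with property (P) in `2m` variables has degree at least `2m(m-1)`. -/
theorem min_degree {p q : ℂ} (g : Gen p q) (m : ℕ) : ∀ (l : List ι), l.Nodup → l.length = 2 * m →
    ∀ ψ, PP p q l ψ → ψ.totalDegree < 2 * m * (m - 1) → ψ = 0 := by
  induction m with
  | zero => intro l _ _ ψ _ h; simp at h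
  | succ m ih =>
    intro l hl hlen ψ hP hdeg
    by_contra h0
    have key : ∀ N, ∀ l1 x l2 y l3, l2.length = N → l = l1 ++ x :: (l2 ++ y :: l3) →
        lf x y (q ^ 2) ∣ ψ := by
      intro N
      induction N using Nat.strong_induction_on with
      | _ N ihN =>
        rintro l1 x l2 y l3 hN rfl
        have hxy : x ≠ y := by rintro rfl; simp [List.nodup_append] at hl
        have hb : Btw q x y l2 ψ := by
          intro w hw
          obtain ⟨s, t, rfl⟩ := List.append_of_mem hw
          simp only [List.length_append, List.length_cons] at hN
          exact ⟨ihN s.length (by omega) l1 x s w (t ++ y :: l3) rfl (by simp),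
            ihN t.length (by omega) (l1 ++ x :: s) w t y l3 rfl (by simp)⟩
        obtain ⟨φ, h1, h2, h3⟩ := exists_red g hl hP hb
        rw [lf_dvd_iff hxy, h1]
        have hlen' : (l1 ++ (l2 ++ l3)).length = 2 * m := by
          simp at hlen ⊢; omega
        rw [hlen'] at h3
        suffices φ = 0 by rw [this, mul_zero]
        by_contra hφ
        apply hφ
        apply ih _ (sub_rest.nodup hl) hlen' φ h2
        have := h3 hφ
        have e : 2 * (m + 1) * (m + 1 - 1) = 2 * m * (m - 1) + 2 * (2 * m) := by
          cases m with
          | zero => rfl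
          | succ k => simp only [Nat.add_sub_cancel]; ring
        omega
    have hB : Blk q l ψ := by
      intro a b hab
      obtain ⟨l1, l2, l3, h⟩ := sublist_pair_iff.1 hab
      exact key _ l1 a l2 b l3 rfl h
    obtain ⟨k, rfl⟩ := Delta_dvd g.q0 hl hB
    obtain ⟨d1, d2⟩ := Delta_ne_zero (q := q) hl
    rw [totalDegree_mul_eq d1 (right_ne_zero_of_mul h0)] at hdeg
    rw [hlen] at d2
    have : 2 * (m + 1) * (2 * (m + 1) - 1) = 2 * (2 * (m + 1) * (m + 1 - 1)) + 2 * (m + 1) := by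
      simp only [Nat.add_sub_cancel]
      have : 2 * (m + 1) - 1 = 2 * m + 1 := by omega
      rw [this]; ring
    omega

/-- The minimal degree for a number of variables. -/
def dg (n : ℕ) : ℕ := 2 * (n / 2) * (n / 2 - 1)

lemma dg_add_two {n : ℕ} (h : Even n) : dg (n + 2) = dg n + 2 * n := by
  obtain ⟨m, rfl⟩ := h
  have e1 : (m + m + 2) / 2 = m + 1 := by omega
  have e2 : (m + m) / 2 = m := by omega
  rw [dg, dg, e1, e2]
  cases m with
  | zero => rfl
  | succ k => simp only [Nat.add_sub_cancel]; ring

/-- The polynomials of minimal degree with property (P) along a list. -/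
def ML (p q : ℂ) (l : List ι) : Submodule ℂ (Pol) where
  carrier := {ψ | PP p q l ψ ∧ ψ.totalDegree ≤ dg l.length}
  zero_mem' := ⟨fun i j k _ _ _ _ => by simp, by simp⟩
  add_mem' := fun hx hy => ⟨hx.1.add hy.1, (totalDegree_add _ _).trans (max_le hx.2 hy.2)⟩
  smul_mem' := fun c _ hx => ⟨hx.1.smul c, (totalDegree_smul_le _ _).trans hx.2⟩

lemma eq_zero_of_low {p q : ℂ} (g : Gen p q) {l : List ι} (hl : l.Nodup) (he : Even l.length)
    {ψ : Pol} (hP : PP p q l ψ) (h : ψ.totalDegree < dg l.length) : ψ = 0 := by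
  obtain ⟨m, hm⟩ := he
  have e2 : (m + m) / 2 = m := by omega
  rw [hm, dg, e2] at h
  exact min_degree g m l hl (by omega) ψ hP h

/-- A minimal polynomial has no factor that is invisible to property (P). -/
lemma eq_zero_of_factor {p q : ℂ} (g : Gen p q) {l : List ι} (hl : l.Nodup)
    (he : Even l.length) {x y : ι} {c : ℂ} {ψ : Pol} (hψ : ψ ∈ ML p q l)
    (hxy : x ≠ y) (hd : lf x y c ∣ ψ) (hn : ∀ i j k, [i, j, k].Sublist l → ∀ c₁ c₂, Val p q c₁ c₂ →
      tr i j k c₁ c₂ (lf x y c) ≠ 0) : ψ = 0 := by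
  obtain ⟨φ, rfl⟩ := hd
  by_contra h0
  have hφ := right_ne_zero_of_mul h0
  have h1 := PP.of_mul hψ.1 hn
  have h2 := hψ.2
  rw [totalDegree_mul_eq (lf_ne_zero hxy c) hφ, totalDegree_lf hxy] at h2
  exact hφ (eq_zero_of_low g hl he h1 (by omega))

lemma tr_lf_ne_zero' {x i j k : ι} (hik : i ≠ k) (hi : x ≠ i) (hj : x ≠ j) (hk : x ≠ k)
    (c₁ c₂ : ℂ) {w : ι} (hw : x ≠ w) {c : ℂ} : tr i j k c₁ c₂ (lf w x c) ≠ 0 := by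
  intro h
  rw [hom_lf, tr_X _ _ hik, tr_X _ _ hik, if_neg hj, if_neg hk] at h
  have := congrArg (eval (fun i => if i = x then (1 : ℂ) else 0)) h
  split_ifs at this <;> simp [hi.symm, hw.symm] at this

lemma tr_lf_ne {u v i j k : ι} (hik : i ≠ k) (huv : u ≠ v) {c : ℂ} (hc : c ≠ 0)
    (h : u ∉ [i, j, k] ∨ v ∉ [i, j, k]) (c₁ c₂ : ℂ) : tr i j k c₁ c₂ (lf u v c) ≠ 0 := by
  simp only [List.mem_cons, List.not_mem_nil, or_false, not_or] at h
  rcases h with h | h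
  · exact tr_lf_ne_zero hik h.1 h.2.1 h.2.2 c₁ c₂ huv hc
  · exact tr_lf_ne_zero' hik h.1 h.2.1 h.2.2 c₁ c₂ huv.symm

/-! ### Adjacent positions -/

lemma idx_lt {l : List ι} (hl : l.Nodup) {a b : ι} (h : [a, b].Sublist l) :
    l.idxOf a < l.idxOf b := by
  obtain ⟨l1, l2, l3, rfl⟩ := sublist_pair_iff.1 h
  obtain ⟨hab, _, ha, hb⟩ := red_names hl
  simp at ha hb
  rw [List.idxOf_append_of_notMem ha.1, List.idxOf_append_of_notMem hb.1, List.idxOf_cons_self,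
    List.idxOf_cons_ne _ hab]
  omega

lemma idx_adj {l1 l3 : List ι} {x y : ι} (hl : (l1 ++ x :: y :: l3).Nodup) :
    (l1 ++ x :: y :: l3).idxOf y = (l1 ++ x :: y :: l3).idxOf x + 1 := by
  obtain ⟨hab, _, ha, hb⟩ := red_names (l2 := []) hl
  simp at ha hb
  rw [List.idxOf_append_of_notMem ha.1, List.idxOf_append_of_notMem hb.1, List.idxOf_cons_self,
    List.idxOf_cons_ne _ hab, List.idxOf_cons_self]

lemma sub12 {i j k : ι} : [i, j].Sublist [i, j, k] := by simp
lemma sub23 {i j k : ι} : [j, k].Sublist [i, j, k] := by simp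

lemma map_swap_adj {l1 l3 : List ι} {x y : ι} (hl : (l1 ++ x :: y :: l3).Nodup) :
    (l1 ++ x :: y :: l3).map (Equiv.swap x y) = l1 ++ y :: x :: l3 := by
  obtain ⟨hab, _, ha, hb⟩ := red_names (l2 := []) hl
  simp at ha hb
  have h : ∀ l : List ι, x ∉ l → y ∉ l → l.map (Equiv.swap x y) = l := by
    intro l h1 h2
    conv_rhs => rw [← List.map_id l]
    apply List.map_congr_left
    intro w hw
    exact Equiv.swap_apply_of_ne_of_ne (fun h => h1 (h ▸ hw)) (fun h => h2 (h ▸ hw))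
  simp [h l1 ha.1 hb.1, h l3 ha.2 hb.2]

lemma adj_cases {l1 l3 : List ι} {x y i j k : ι} (hl : (l1 ++ x :: y :: l3).Nodup)
    (hs : [i, j, k].Sublist (l1 ++ x :: y :: l3)) :
    (x = i ∧ y = j) ∨ (x = j ∧ y = k) ∨ ((x ∉ [i, j, k] ∨ y ∉ [i, j, k]) ∧
      [Equiv.swap x y i, Equiv.swap x y j, Equiv.swap x y k].Sublist (l1 ++ x :: y :: l3)) := by
  have a1 := idx_lt hl (sub12.trans hs)
  have a2 := idx_lt hl (sub23.trans hs)
  have a3 := idx_adj hl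
  by_cases hm : x ∈ [i, j, k] ∧ y ∈ [i, j, k]
  · simp only [List.mem_cons, List.not_mem_nil, or_false] at hm
    obtain ⟨rfl | rfl | rfl, rfl | rfl | rfl⟩ := hm <;> first | omega | tauto
  · right; right
    have hm' : x ∉ [i, j, k] ∨ y ∉ [i, j, k] := by tauto
    refine ⟨hm', ?_⟩
    have hs2 := hs.map (Equiv.swap x y)
    rw [map_swap_adj hl] at hs2
    have hn2 : (l1 ++ y :: x :: l3).Nodup := by
      rw [← map_swap_adj hl]; exact hl.map (Equiv.swap x y).injective
    have e : [i, j, k].map (Equiv.swap x y) =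
      [Equiv.swap x y i, Equiv.swap x y j, Equiv.swap x y k] := rfl
    rw [← e]
    obtain ⟨hab, _, ha, hb⟩ := red_names (l2 := []) hl
    simp only [List.nil_append, List.mem_append, not_or] at ha hb
    have key : ∀ w, w ∉ [i, j, k].map (Equiv.swap x y) →
        ([i, j, k].map (Equiv.swap x y)).Sublist ((l1 ++ y :: x :: l3).erase w) := by
      intro w hw
      have := hs2.erase w
      rwa [List.erase_of_not_mem hw] at this
    rcases hm' with h | h
    · have := key y (fun h' => h (by
        obtain ⟨t, ht, hty⟩ := List.mem_map.1 h'
        rw [Equiv.swap_apply_eq_iff, Equiv.swap_apply_right] at hty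
        exact hty ▸ ht))
      rw [List.erase_append_right _ hb.1, List.erase_cons_head] at this
      exact this.trans ((List.Sublist.refl l1).append ((List.sublist_cons_self y l3).cons_cons x))
    · have := key x (fun h' => h (by
        obtain ⟨t, ht, hty⟩ := List.mem_map.1 h'
        rw [Equiv.swap_apply_eq_iff, Equiv.swap_apply_left] at hty
        exact hty ▸ ht))
      rw [List.erase_append_right _ ha.1, List.erase_cons_tail (by simpa using hab.symm),
        List.erase_cons_head] at this
      exact this.trans ((List.Sublist.refl l1).append (List.sublist_cons_self x _))

lemma adj_ratio {p q : ℂ} {l1 l3 : List ι} {x y i j k : ι} (hl : (l1 ++ x :: y :: l3).Nodup)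
    (hs : [i, j, k].Sublist (l1 ++ x :: y :: l3)) {c₁ c₂ : ℂ} (hv : Val p q c₁ c₂) :
    (tr i j k c₁ c₂ (X x) ≠ 0 ∧
      ∃ r, (r = q ^ 2 ∨ r = p ^ 2) ∧ tr i j k c₁ c₂ (X y) = C r * tr i j k c₁ c₂ (X x)) ∨
    ((x ∉ [i, j, k] ∨ y ∉ [i, j, k]) ∧
      [Equiv.swap x y i, Equiv.swap x y j, Equiv.swap x y k].Sublist (l1 ++ x :: y :: l3)) ∨
    p = 0 ∨ q = 0 := by
  obtain ⟨hij, hik, hjk⟩ := nodup3 hl hs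
  rcases adj_cases hl hs with ⟨rfl, rfl⟩ | ⟨rfl, rfl⟩ | h
  · left
    simp only [tr_X _ _ hik, hij, hik, if_true, if_false]
    refine ⟨X_ne_zero _, c₁, ?_, rfl⟩
    rcases hv with h | h | h <;> simp [h.1]
  · by_cases hp : p = 0
    · exact Or.inr (Or.inr (Or.inl hp))
    by_cases hq : q = 0
    · exact Or.inr (Or.inr (Or.inr hq))
    left
    simp only [tr_X _ _ hik, hjk.symm, if_true, if_false]
    have hc : c₁ ≠ 0 := by rcases hv with h | h | h <;> simp [h.1, hp, hq]
    refine ⟨mul_ne_zero (by simpa using hc) (X_ne_zero _), c₂ / c₁, ?_, ?_⟩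
    · rcases hv with h | h | h <;> rw [h.1, h.2] <;> [left; left; right] <;> field_simp
    · rw [← mul_assoc, ← C_mul, div_mul_cancel₀ _ hc]
  · exact Or.inr (Or.inl h)

lemma adj_ratio' {p q : ℂ} (g : Gen p q) {l1 l3 : List ι} {x y i j k : ι}
    (hl : (l1 ++ x :: y :: l3).Nodup)
    (hs : [i, j, k].Sublist (l1 ++ x :: y :: l3)) {c₁ c₂ : ℂ} (hv : Val p q c₁ c₂) :
    (tr i j k c₁ c₂ (X x) ≠ 0 ∧
      ∃ r, (r = q ^ 2 ∨ r = p ^ 2) ∧ tr i j k c₁ c₂ (X y) = C r * tr i j k c₁ c₂ (X x)) ∨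
    ((x ∉ [i, j, k] ∨ y ∉ [i, j, k]) ∧
      [Equiv.swap x y i, Equiv.swap x y j, Equiv.swap x y k].Sublist (l1 ++ x :: y :: l3)) := by
  rcases adj_ratio hl hs hv with h | h | h | h
  · exact Or.inl h
  · exact Or.inr h
  · exact absurd h g.p0
  · exact absurd h g.q0

lemma lf_ratio {σ : Pol →ₐ[ℂ] Pol} {x y : ι} {r : ℂ}
    (h : σ (X y) = C r * σ (X x)) (c : ℂ) :
    σ (lf y x c) = C (1 - r * c) * σ (X x) ∧ σ (lf x y c) = C (r - c) * σ (X x) := by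
  rw [hom_lf, hom_lf, h]
  simp only [C_sub, C_1, C_mul]
  constructor <;> ring

lemma tr_sb_ne_zero {p q : ℂ} (g : Gen p q) {l1 l3 : List ι} {x y i j k : ι}
    (hl : (l1 ++ x :: y :: l3).Nodup)
    (hs : [i, j, k].Sublist (l1 ++ x :: y :: l3)) {c₁ c₂ : ℂ} (hv : Val p q c₁ c₂) :
    tr i j k c₁ c₂ (lf y x (q ^ 2)) ≠ 0 ∧ tr i j k c₁ c₂ (lf y x 1) ≠ 0 := by
  have hxy : x ≠ y := (red_names (l2 := []) hl).1
  have n1 : q ^ 2 ≠ 1 := by simpa using g.ne 0 2 0 0 (by norm_num)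
  have n2 : p ^ 2 ≠ 1 := by simpa using g.ne 2 0 0 0 (by norm_num)
  have n3 : q ^ 4 ≠ 1 := by
    have := g.ne 0 4 0 0 (by norm_num); norm_cast at this; simpa using this
  have n4 : p ^ 2 * q ^ 2 ≠ 1 := by simpa using g.ne 2 2 0 0 (by norm_num)
  rcases adj_ratio' g hl hs hv with ⟨h0, r, hr, h⟩ | ⟨h, _⟩
  · rw [(lf_ratio h _).1, (lf_ratio h _).1]
    constructor
    · refine mul_ne_zero ?_ h0
      rw [Ne, C_eq_zero, sub_eq_zero]
      rcases hr with rfl | rfl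
      · intro h; apply n3; linear_combination -h
      · exact fun h => n4 h.symm
    · refine mul_ne_zero ?_ h0
      rw [Ne, C_eq_zero, sub_eq_zero, mul_one]
      rcases hr with rfl | rfl
      · exact n1.symm
      · exact n2.symm
  · have hik := (nodup3 hl hs).2.1
    exact ⟨tr_lf_ne hik hxy.symm (pow_ne_zero _ g.q0) h.symm _ _,
      tr_lf_ne hik hxy.symm one_ne_zero h.symm _ _⟩

/-- A minimal polynomial is not divisible by the exchanged form of a neighbouring pair. -/
lemma eq_zero_of_sb {p q : ℂ} (g : Gen p q) {l1 l3 : List ι} {x y : ι}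
    (hl : (l1 ++ x :: y :: l3).Nodup) (he : Even (l1 ++ x :: y :: l3).length)
    {ψ : Pol} (hψ : ψ ∈ ML p q (l1 ++ x :: y :: l3))
    (hd : lf y x (q ^ 2) ∣ ψ) : ψ = 0 :=
  eq_zero_of_factor g hl he hψ (red_names (l2 := []) hl).1.symm hd
    fun _ _ _ hs _ _ hv => (tr_sb_ne_zero g hl hs hv).1

lemma sw_dvd {x y u v : ι} {c : ℂ} {ψ : Pol} (h : lf u v c ∣ ψ) :
    lf (Equiv.swap x y u) (Equiv.swap x y v) c ∣ sw x y ψ := by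
  obtain ⟨φ, rfl⟩ := h
  rw [map_mul, sw_lf]; exact dvd_mul_right _ _

lemma eq_zero_of_sym_dvd {p q : ℂ} (g : Gen p q) {l1 l3 : List ι} {x y : ι}
    (hl : (l1 ++ x :: y :: l3).Nodup) (he : Even (l1 ++ x :: y :: l3).length)
    {ψ : Pol} (hψ : ψ ∈ ML p q (l1 ++ x :: y :: l3))
    (hs : sw x y ψ = ψ) (hd : lf x y (q ^ 2) ∣ ψ) : ψ = 0 := by
  apply eq_zero_of_sb g hl he hψ
  have := sw_dvd (x := x) (y := y) hd
  rwa [hs, Equiv.swap_apply_left, Equiv.swap_apply_right] at this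

/-! ### The operators on minimal polynomials -/

lemma totalDegree_sw (x y : ι) (ψ : Pol) : (sw x y ψ).totalDegree ≤ ψ.totalDegree :=
  totalDegree_rename_le _ _

lemma totalDegree_dl {p : ℂ} (hp : p ≠ 0) {x y : ι} (h : x ≠ y) (φ : Pol) :
    (dl p x y φ).totalDegree ≤ φ.totalDegree := by
  have h1 : (C p⁻¹ * φ).totalDegree ≤ φ.totalDegree := by
    refine (totalDegree_mul _ _).trans ?_; rw [totalDegree_C, zero_add]
  refine (totalDegree_sub _ _).trans (max_le ?_ h1)
  by_cases h0 : dd x y φ = 0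
  · rw [h0, mul_zero, totalDegree_zero]; exact Nat.zero_le _
  have e := congrArg totalDegree (mul_dd x y φ)
  have e1 : (X x - X y : Pol) = lf y x 1 := by simp [lf]
  rw [e1, totalDegree_mul_eq (lf_ne_zero h.symm 1) h0, totalDegree_lf h.symm] at e
  have h2 := (totalDegree_sub φ (sw x y φ)).trans (max_le le_rfl (totalDegree_sw x y φ))
  rw [← e] at h2
  refine (totalDegree_mul _ _).trans (le_trans ?_ h2)
  gcongr
  rw [lnf_eq hp]
  refine (totalDegree_mul _ _).trans ?_
  rw [totalDegree_C, totalDegree_lf h]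

lemma totalDegree_T {p q : ℂ} (hp : p ≠ 0) (hq : q ≠ 0) {x y : ι} (h : x ≠ y)
    (ψ : Pol) : (T p q x y ψ).totalDegree ≤ ψ.totalDegree := by
  by_cases hd : lnf q x y ∣ ψ
  · obtain ⟨φ, rfl⟩ := hd
    by_cases h0 : φ = 0
    · subst h0; rw [T_mul hq h]; simp [dl, dd_unique (φ := 0) h]
    rw [T_mul hq h, totalDegree_mul_eq (lnf_ne_zero hq h) h0]
    refine (totalDegree_mul _ _).trans ?_
    gcongr
    exact totalDegree_dl hp h φ
  · rw [T, dif_neg hd, totalDegree_zero]; exact Nat.zero_le _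

lemma T_rel {p q : ℂ} (hq : q ≠ 0) {x y : ι} (h : x ≠ y) {ψ : Pol}
    (hd : lf x y (q ^ 2) ∣ ψ) : (X x - X y) * lnf q y x * T p q x y ψ =
      C (epsPar p) * X x * lnf q y x * ψ - lnf p x y * lnf q x y * sw x y ψ := by
  obtain ⟨φ, rfl⟩ := (lnf_dvd hq).2 hd
  have := mul_dl (p := p) (x := x) (y := y) φ
  rw [T_mul hq h, map_mul, sw_lnf]
  linear_combination (lnf q x y * lnf q y x) * this

lemma T_unique {p q : ℂ} (hq : q ≠ 0) {x y : ι} (h : x ≠ y) {ψ χ : Pol}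
    (hd : lf x y (q ^ 2) ∣ ψ) (hr : (X x - X y) * lnf q y x * χ =
      C (epsPar p) * X x * lnf q y x * ψ - lnf p x y * lnf q x y * sw x y ψ) :
    T p q x y ψ = χ := by
  apply mul_left_cancel₀ (mul_ne_zero (X_sub_X_ne_zero h) (lnf_ne_zero hq h.symm))
  rw [T_rel hq h hd, hr]

lemma T_mem {p q : ℂ} (g : Gen p q) {l1 l3 : List ι} {x y : ι}
    (hl : (l1 ++ x :: y :: l3).Nodup) {ψ : Pol}
    (hψ : ψ ∈ ML p q (l1 ++ x :: y :: l3)) (hd : lf x y (q ^ 2) ∣ ψ) :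
    T p q x y ψ ∈ ML p q (l1 ++ x :: y :: l3) := by
  have hxy : x ≠ y := (red_names (l2 := []) hl).1
  refine ⟨pp_iff.2 fun i j k hs c₁ c₂ hv => ?_, (totalDegree_T g.p0 g.q0 hxy ψ).trans hψ.2⟩
  obtain ⟨hij, hik, hjk⟩ := nodup3 hl hs
  have hr := congrArg (tr i j k c₁ c₂) (T_rel (p := p) g.q0 hxy hd)
  have hne := tr_sb_ne_zero g hl hs hv
  have e1 : (X x - X y : Pol) = lf y x 1 := by simp [lf]
  have hψ0 : tr i j k c₁ c₂ ψ = 0 := pp_iff.1 hψ.1 i j k hs c₁ c₂ hv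
  have hq' : (C (-q⁻¹) : Pol) ≠ 0 := by simpa using g.q0
  simp only [map_mul, map_sub _ (_ * _) _, hψ0, e1, lnf_eq g.q0, hom_C, mul_zero, zero_sub] at hr
  have hne' := mul_ne_zero hne.2 (mul_ne_zero hq' hne.1)
  rcases adj_ratio' g hl hs hv with ⟨h0, r, hr', h⟩ | ⟨h, hs'⟩
  · rcases hr' with rfl | rfl
    · exact hom_eq_zero_of_dvd (T_dvd g.q0 x y ψ) h
    · rw [lnf_eq g.p0, map_mul, (lf_ratio h _).2, sub_self, C_0] at hr
      simp only [zero_mul, mul_zero, neg_zero] at hr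
      exact (mul_eq_zero.1 hr).resolve_left hne'
  · have : tr i j k c₁ c₂ (sw x y ψ) = 0 := by
      rw [← AlgHom.comp_apply]
      refine hψ.1.hom (σ := (tr i j k c₁ c₂).comp (sw x y)) hs' hv ?_ ?_ <;>
      · simp only [AlgHom.comp_apply, sw_X, Equiv.swap_apply_self]
        simp [tr_X _ _ hik, hij, hik, hjk.symm]
    rw [this, mul_zero, neg_zero] at hr
    exact (mul_eq_zero.1 hr).resolve_left hne'

lemma hom_ext_apply {σ τ : Pol →ₐ[ℂ] Pol} (h : ∀ i, σ (X i) = τ (X i))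
    (ψ : Pol) : σ ψ = τ ψ := DFunLike.congr_fun (MvPolynomial.algHom_ext h) ψ

lemma sw_conj (a b x y : ι) (ψ : Pol) : sw a b (sw x y ψ) =
    sw (Equiv.swap a b x) (Equiv.swap a b y) (sw a b ψ) :=
  hom_ext_apply (σ := (sw a b).comp (sw x y))
    (τ := (sw (Equiv.swap a b x) (Equiv.swap a b y)).comp (sw a b)) (fun i => by
      simp only [AlgHom.comp_apply, sw_X]
      rw [Equiv.swap_apply_apply]; simp) ψ

/-- Four names, the first two different from the last two. -/
def Dj (x y u v : ι) : Prop := x ≠ u ∧ x ≠ v ∧ y ≠ u ∧ y ≠ v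

lemma Dj.symm {x y u v : ι} (h : Dj x y u v) : Dj u v x y :=
  ⟨h.1.symm, h.2.2.1.symm, h.2.1.symm, h.2.2.2.symm⟩

lemma sw_sb (a b x y : ι) (c : ℂ) (ψ : Pol) : sw a b (sb x y c ψ) =
    sb (Equiv.swap a b x) (Equiv.swap a b y) c (sw a b ψ) :=
  hom_ext_apply (σ := (sw a b).comp (sb x y c))
    (τ := (sb (Equiv.swap a b x) (Equiv.swap a b y) c).comp (sw a b)) (fun i => by
      simp only [AlgHom.comp_apply, sw_X, sb_X]
      by_cases h : i = y
      · simp [h]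
      · simp [h]) ψ

lemma sb_sb_comm {a b x y : ι} (h : Dj a b x y) (c d : ℂ) (ψ : Pol) :
    sb a b c (sb x y d ψ) = sb x y d (sb a b c ψ) :=
  hom_ext_apply (σ := (sb a b c).comp (sb x y d)) (τ := (sb x y d).comp (sb a b c)) (fun i => by
      simp only [AlgHom.comp_apply, sb_X]
      by_cases h1 : i = b
      · subst h1; simp [h.2.2.2, sb_X, h.2.1]
      · by_cases h2 : i = y
        · subst h2; simp [h1, sb_X, h.2.2.1.symm]
        · simp [h1, h2, sb_X]) ψ

lemma sw_sb_of_dj {a b x y : ι} (h : Dj a b x y) (c : ℂ) (ψ : Pol) :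
    sw a b (sb x y c ψ) = sb x y c (sw a b ψ) := by
  rw [sw_sb, Equiv.swap_apply_of_ne_of_ne h.1.symm h.2.2.1.symm,
    Equiv.swap_apply_of_ne_of_ne h.2.1.symm h.2.2.2.symm]

lemma C_ne_zero' {k : ℂ} (hk : k ≠ 0) : (C k : Pol) ≠ 0 := by simpa using hk

lemma dvd_C_mul {k : ℂ} (hk : k ≠ 0) {f g : Pol} : f ∣ C k * g ↔ f ∣ g := by
  have hu : IsUnit (C k : Pol) := IsUnit.map C (isUnit_iff_ne_zero.2 hk)
  exact hu.dvd_mul_left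

lemma C_mul_dvd {k : ℂ} (hk : k ≠ 0) {f g : Pol} : C k * f ∣ g ↔ f ∣ g := by
  have hu : IsUnit (C k : Pol) := IsUnit.map C (isUnit_iff_ne_zero.2 hk)
  exact hu.mul_left_dvd

lemma hom_lf_of_scale {σ : Pol →ₐ[ℂ] Pol} {x y x' y' : ι} {k : ℂ}
    (hx : σ (X x) = C k * X x') (hy : σ (X y) = C k * X y') (c : ℂ) :
    σ (lf x y c) = C k * lf x' y' c := by
  rw [hom_lf, hx, hy, lf]; ring

/-- `T` commutes with substitutions that scale both variables. -/
lemma hom_T {p q : ℂ} (hq : q ≠ 0) {σ : Pol →ₐ[ℂ] Pol} {x y x' y' : ι}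
    {k : ℂ} (hk : k ≠ 0) (hx : σ (X x) = C k * X x') (hy : σ (X y) = C k * X y')
    (hs : ∀ f, σ (sw x y f) = sw x' y' (σ f)) (h : x ≠ y) (h' : x' ≠ y') {ψ : Pol}
    (hd : lf x y (q ^ 2) ∣ ψ) : σ (T p q x y ψ) = T p q x' y' (σ ψ) := by
  have hk' := C_ne_zero' (ι := ι) hk
  symm
  apply T_unique hq h'
  · obtain ⟨φ, rfl⟩ := hd
    rw [map_mul, hom_lf_of_scale hx hy, mul_assoc]
    exact dvd_mul_of_dvd_right (dvd_mul_right _ _) _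
  · have := congrArg σ (T_rel (p := p) hq h hd)
    simp only [map_mul, map_sub, hom_lnf, hx, hy, hs, hom_C] at this
    apply mul_left_cancel₀ (mul_ne_zero hk' hk')
    simp only [lnf]
    linear_combination this

lemma sw_T {p q : ℂ} (hq : q ≠ 0) (a b : ι) {x y : ι} (h : x ≠ y) {ψ : Pol}
    (hd : lf x y (q ^ 2) ∣ ψ) :
    sw a b (T p q x y ψ) = T p q (Equiv.swap a b x) (Equiv.swap a b y) (sw a b ψ) :=
  hom_T hq one_ne_zero (by simp) (by simp) (fun f => sw_conj a b x y f) h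
    (fun h' => h ((Equiv.swap a b).injective h')) hd

lemma sw_T_of_dj {p q : ℂ} (hq : q ≠ 0) {a b x y : ι} (hj : Dj a b x y) (h : x ≠ y)
    {ψ : Pol} (hd : lf x y (q ^ 2) ∣ ψ) :
    sw a b (T p q x y ψ) = T p q x y (sw a b ψ) := by
  rw [sw_T hq a b h hd, Equiv.swap_apply_of_ne_of_ne hj.1.symm hj.2.2.1.symm,
    Equiv.swap_apply_of_ne_of_ne hj.2.1.symm hj.2.2.2.symm]

lemma sb_T_of_dj {p q : ℂ} (hq : q ≠ 0) {a b x y : ι} (hj : Dj a b x y) (h : x ≠ y) (c : ℂ)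
    {ψ : Pol} (hd : lf x y (q ^ 2) ∣ ψ) :
    sb a b c (T p q x y ψ) = T p q x y (sb a b c ψ) :=
  hom_T hq one_ne_zero (by simp [sb_X_of_ne _ hj.2.2.1.symm]) (by simp [sb_X_of_ne _ hj.2.2.2.symm])
    (fun f => (sw_sb_of_dj hj.symm c f).symm) h h hd

section Tlin
variable {p q : ℂ} {x y : ι}

lemma T_add (hq : q ≠ 0) (h : x ≠ y) {f g : Pol} (hf : lf x y (q ^ 2) ∣ f)
    (hg : lf x y (q ^ 2) ∣ g) : T p q x y (f + g) = T p q x y f + T p q x y g := by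
  apply io_injective
  rw [io_T hq h (dvd_add hf hg), map_add, map_add, map_add, io_T hq h hf, io_T hq h hg]

lemma T_smul (hq : q ≠ 0) (h : x ≠ y) {f : Pol} (hf : lf x y (q ^ 2) ∣ f) (c : ℂ) :
    T p q x y (c • f) = c • T p q x y f := by
  apply io_injective
  rw [io_T hq h (dvd_smul_of_dvd c hf), map_smul, map_smul, map_smul, io_T hq h hf]

lemma T_T (hp : p ≠ 0) (hq : q ≠ 0) (h : x ≠ y) {f : Pol} (hf : lf x y (q ^ 2) ∣ f) :
    T p q x y (T p q x y f) = f + epsPar p • T p q x y f := by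
  apply io_injective
  rw [io_T hq h (T_dvd hq x y f), map_add, map_smul, io_T hq h hf, TF_sq hp hq h]

lemma T_mul_sym (hq : q ≠ 0) (h : x ≠ y) {g : Pol} (hg : sw x y g = g)
    {f : Pol} (hf : lf x y (q ^ 2) ∣ f) :
    T p q x y (g * f) = g * T p q x y f := by
  apply io_injective
  rw [io_T hq h (dvd_mul_of_dvd_right hf g), map_mul io, map_mul io, TF_mul_of_sF (by rw [sF_io, hg]),
    io_T hq h hf]

end Tlin

/-! ### Reduction of minimal polynomials -/

lemma IsRed.unique {p q : ℂ} {x y : ι} {l1 l2 l3 : List ι} {ψ φ φ' : Pol}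
    (hx : x ∉ l1 ++ (l2 ++ l3)) (h : IsRed p q x y l1 l2 l3 ψ φ)
    (h' : IsRed p q x y l1 l2 l3 ψ φ') : φ = φ' :=
  mul_left_cancel₀ (redPi_ne_zero p q hx).1 (h.symm.trans h')

lemma IsRed.add {p q : ℂ} {x y : ι} {l1 l2 l3 : List ι} {ψ φ ψ' φ' : Pol}
    (h : IsRed p q x y l1 l2 l3 ψ φ) (h' : IsRed p q x y l1 l2 l3 ψ' φ') :
    IsRed p q x y l1 l2 l3 (ψ + ψ') (φ + φ') := by
  rw [IsRed, map_add, h, h', mul_add]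

lemma IsRed.smul {p q : ℂ} {x y : ι} {l1 l2 l3 : List ι} {ψ φ : Pol}
    (h : IsRed p q x y l1 l2 l3 ψ φ) (c : ℂ) : IsRed p q x y l1 l2 l3 (c • ψ) (c • φ) := by
  rw [IsRed, map_smul, h, mul_smul_comm]

lemma len_rest (x y : ι) (l1 l2 l3 : List ι) :
    (l1 ++ x :: (l2 ++ y :: l3)).length = (l1 ++ (l2 ++ l3)).length + 2 := by
  simp only [List.length_append, List.length_cons]; omega

lemma even_rest {x y : ι} {l1 l2 l3 : List ι} (h : Even (l1 ++ x :: (l2 ++ y :: l3)).length) :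
    Even (l1 ++ (l2 ++ l3)).length := by
  rw [len_rest] at h
  simpa [Nat.even_add] using h

lemma ML_red {p q : ℂ} (g : Gen p q) {x y : ι} {l1 l2 l3 : List ι}
    (hl : (l1 ++ x :: (l2 ++ y :: l3)).Nodup) (he : Even (l1 ++ x :: (l2 ++ y :: l3)).length)
    {ψ : Pol}
    (hψ : ψ ∈ ML p q (l1 ++ x :: (l2 ++ y :: l3))) (hb : Btw q x y l2 ψ) :
    ∃ φ ∈ ML p q (l1 ++ (l2 ++ l3)), IsRed p q x y l1 l2 l3 ψ φ := by
  obtain ⟨φ, h1, h2, h3⟩ := exists_red g hl hψ.1 hb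
  refine ⟨φ, ⟨h2, ?_⟩, h1⟩
  by_cases h0 : φ = 0
  · rw [h0, totalDegree_zero]; exact Nat.zero_le _
  · have := h3 h0
    have h4 := hψ.2
    rw [len_rest, dg_add_two (even_rest he)] at h4
    omega

lemma sw_redPi (p q : ℂ) (a b x : ι) (l1 l2 l3 : List ι) : sw a b (redPi p q x l1 l2 l3) =
    redPi p q (Equiv.swap a b x) (l1.map (Equiv.swap a b)) (l2.map (Equiv.swap a b))
      (l3.map (Equiv.swap a b)) := by
  simp only [redPi, map_mul, map_list_prod, List.map_map, Function.comp_def, sw_lf]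

lemma map_swap_perm {a b : ι} {s : List ι} (hs : s.Nodup) (h : a ∈ s ↔ b ∈ s) :
    (s.map (Equiv.swap a b)).Perm s := by
  rw [List.perm_ext_iff_of_nodup (hs.map (Equiv.swap a b).injective) hs]
  intro w
  rw [List.mem_map]
  have key : ∀ w ∈ s, Equiv.swap a b w ∈ s := by
    intro w hw
    rw [Equiv.swap_apply_def]
    split_ifs with h1 h2
    · rw [← h, ← h1]; exact hw
    · rw [h, ← h2]; exact hw
    · exact hw
  constructor
  · rintro ⟨t, ht, rfl⟩; exact key t ht
  · intro hw; exact ⟨_, key w hw, Equiv.swap_apply_self _ _ _⟩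

lemma redPi_perm {p q : ℂ} {x : ι} {l1 l2 l3 l1' l2' l3' : List ι} (h1 : l1.Perm l1')
    (h2 : l2.Perm l2') (h3 : l3.Perm l3') : redPi p q x l1 l2 l3 = redPi p q x l1' l2' l3' := by
  rw [redPi, redPi, (h1.map _).prod_eq, (h2.map _).prod_eq, (h3.map _).prod_eq]

lemma sw_redPi_self {p q : ℂ} {a b x : ι} {l1 l2 l3 : List ι} (hl : (l1 ++ (l2 ++ l3)).Nodup)
    (ha : x ≠ a) (hb : x ≠ b)
    (h : (a ∈ l1 ↔ b ∈ l1) ∧ (a ∈ l2 ↔ b ∈ l2) ∧ (a ∈ l3 ↔ b ∈ l3)) :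
    sw a b (redPi p q x l1 l2 l3) = redPi p q x l1 l2 l3 := by
  rw [sw_redPi, Equiv.swap_apply_of_ne_of_ne ha hb]
  rw [List.nodup_append, List.nodup_append] at hl
  exact redPi_perm (map_swap_perm hl.1 h.1) (map_swap_perm hl.2.1.1 h.2.1)
    (map_swap_perm hl.2.1.2.1 h.2.2)

lemma lnf_eq' {s : ℂ} (hs : s ≠ 0) (x y : ι) : lnf s x y = C s * lf y x ((s ^ 2)⁻¹) := by
  have : (C s⁻¹ : Pol) = C s * C ((s ^ 2)⁻¹) := by
    rw [← C_mul]; congr 1; field_simp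
  rw [lnf, lf, this]; ring

lemma X_sub_X_eq (x y : ι) : (X x - X y : Pol) = lf y x 1 := by simp [lf]

lemma map_swap_of_notMem {a b : ι} {l : List ι} (h1 : a ∉ l) (h2 : b ∉ l) :
    l.map (Equiv.swap a b) = l := by
  conv_rhs => rw [← List.map_id l]
  apply List.map_congr_left
  intro w hw
  exact Equiv.swap_apply_of_ne_of_ne (fun h => h1 (h ▸ hw)) (fun h => h2 (h ▸ hw))

/-- Moving the left end of a reduced pair. -/
lemma moveR_left {p q : ℂ} (hp : p ≠ 0) (hq : q ≠ 0) {x' x u : ι} {l1 l2 l3 : List ι}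
    (hl : (l1 ++ x' :: x :: (l2 ++ u :: l3)).Nodup) {ω ρ : Pol}
    (h1 : lf x' x (q ^ 2) ∣ ω) (h2 : lf x u (q ^ 2) ∣ ω)
    (hr : IsRed p q x' u l1 (x :: l2) l3 ω ρ) :
    IsRed p q x u (l1 ++ [x']) l2 l3 (T p q x' x ω) (C (p * q ^ 2) * sw x' x ρ) := by
  have hn : x' ≠ x ∧ x' ≠ u ∧ x ≠ u ∧ x' ∉ l1 ∧ x' ∉ l2 ∧ x' ∉ l3 ∧ x ∉ l1 ∧ x ∉ l2 ∧ x ∉ l3 := by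
    simp [List.nodup_append] at hl; grind
  obtain ⟨n1, n2, n3, a1, a2, a3, b1, b2, b3⟩ := hn
  have hrel := congrArg (sb x u (q ^ 2)) (T_rel (p := p) hq n1 h1)
  have e1 : sb x u (q ^ 2) (sw x' x ω) =
      redPi p q x l1 l2 l3 * (lf x x' (q ^ 2) * lf x x' 1) * sw x' x ρ := by
    have := congrArg (sw x' x) hr
    rw [sw_sb, Equiv.swap_apply_left, Equiv.swap_apply_of_ne_of_ne n2.symm n3.symm, map_mul,
      sw_redPi, Equiv.swap_apply_left, List.map_cons, Equiv.swap_apply_right,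
      map_swap_of_notMem a1 b1, map_swap_of_notMem a2 b2, map_swap_of_notMem a3 b3] at this
    rw [this, redPi, redPi, List.map_cons, List.prod_cons]
    ring
  rw [IsRed]
  have e2 : redPi p q x (l1 ++ [x']) l2 l3 =
      redPi p q x l1 l2 l3 * (lf x x' ((q ^ 2)⁻¹) * lf x x' ((p ^ 2)⁻¹)) := by
    rw [redPi, redPi, List.map_append, List.prod_append, List.map_singleton, List.prod_singleton]
    ring
  simp only [map_mul, map_sub (sb x u (q ^ 2)) (_ * _) _, (lf_dvd_iff n3).1 h2, e1, mul_zero, zero_sub, X_sub_X_eq, lnf_eq hq x x',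
    lnf_eq' hq x' x, lnf_eq' hp, hom_C] at hrel
  have s1 : ∀ c, sb x u (q ^ 2) (lf x x' c) = lf x x' c := fun c => by
    rw [hom_lf, sb_X_of_ne _ n2, sb_X_of_ne _ n3, lf]
  simp only [s1] at hrel
  rw [e2]
  have hc : (C (-q⁻¹) * C (p * q ^ 2) : Pol) = -(C p * C q) := by
    rw [← C_mul, ← C_mul, ← C_neg]; congr 1; field_simp
  apply mul_left_cancel₀ (mul_ne_zero (lf_ne_zero n1.symm 1) (mul_ne_zero
    (C_ne_zero' (by simpa using hq : -q⁻¹ ≠ 0)) (lf_ne_zero n1.symm (q ^ 2))))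
  rw [hrel]
  linear_combination (-(lf x x' 1 * lf x x' (q ^ 2) * redPi p q x l1 l2 l3 * (lf x x' ((q ^ 2)⁻¹) * lf x x' ((p ^ 2)⁻¹)) * sw x' x ρ)) * hc

/-- Moving the right end of a reduced pair. -/
lemma moveR_right {p q : ℂ} (hp : p ≠ 0) (hq : q ≠ 0) {v u w : ι} {l1 l2 l3 : List ι}
    (hl : (l1 ++ v :: (l2 ++ u :: w :: l3)).Nodup) {η ρ : Pol}
    (h1 : lf u w (q ^ 2) ∣ η) (h2 : lf v u (q ^ 2) ∣ η)
    (hr : IsRed p q v w l1 (l2 ++ [u]) l3 η ρ) :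
    IsRed p q v u l1 l2 (w :: l3) (T p q u w η) (C (aPar p q) * sw u w ρ) := by
  have hn : u ≠ w ∧ v ≠ u ∧ v ≠ w ∧ u ∉ l1 ∧ u ∉ l2 ∧ u ∉ l3 ∧ w ∉ l1 ∧ w ∉ l2 ∧ w ∉ l3 := by
    simp [List.nodup_append] at hl; grind
  obtain ⟨n1, n2, n3, a1, a2, a3, b1, b2, b3⟩ := hn
  have hrel := congrArg (sb v u (q ^ 2)) (T_rel (p := p) hq n1 h1)
  have e1 : sb v u (q ^ 2) (sw u w η) =
      redPi p q v l1 l2 l3 * (lf v w (q ^ 2) * lf v w 1) * sw u w ρ := by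
    have := congrArg (sw u w) hr
    rw [sw_sb, Equiv.swap_apply_right, Equiv.swap_apply_of_ne_of_ne n2 n3, map_mul,
      sw_redPi, Equiv.swap_apply_of_ne_of_ne n2 n3, List.map_append, List.map_singleton, Equiv.swap_apply_left,
      map_swap_of_notMem a1 b1, map_swap_of_notMem a2 b2, map_swap_of_notMem a3 b3] at this
    rw [this, redPi, redPi, List.map_append, List.prod_append, List.map_singleton, List.prod_singleton]
    ring
  rw [IsRed]
  have e2 : redPi p q v l1 l2 (w :: l3) =
      redPi p q v l1 l2 l3 * (lf v w (q ^ 4) * lf v w (q ^ 2 * p ^ 2)) := by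
    rw [redPi, redPi, List.map_cons, List.prod_cons]
    ring
  have s0 : sb v u (q ^ 2) (X w) = X w := sb_X_of_ne _ n1.symm
  have t0 : (X u - X w : Pol) = -lf u w 1 := by simp [lf]
  have t1 : sb v u (q ^ 2) (lf u w 1) = lf v w (q ^ 2) := by
    rw [hom_lf, s0, sb_X_right, lf, C_1, one_mul]
  have t2 : sb v u (q ^ 2) (lnf q w u) = C q * lf v w 1 := by
    rw [hom_lnf, s0, sb_X_right, lf, C_1, one_mul, ← mul_assoc, ← C_mul,
      show q⁻¹ * q ^ 2 = q by field_simp]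
    ring
  have t3 : sb v u (q ^ 2) (lnf p u w) = -(C p⁻¹ * lf v w (q ^ 2 * p ^ 2)) := by
    rw [hom_lnf, s0, sb_X_right, lf, mul_sub, ← mul_assoc, ← C_mul, ← mul_assoc, ← C_mul,
      show p⁻¹ * (q ^ 2 * p ^ 2) = p * q ^ 2 by field_simp]
    ring
  have t4 : sb v u (q ^ 2) (lnf q u w) = -(C q⁻¹ * lf v w (q ^ 4)) := by
    rw [hom_lnf, s0, sb_X_right, lf, mul_sub, ← mul_assoc, ← C_mul, ← mul_assoc, ← C_mul,
      show q⁻¹ * q ^ 4 = q * q ^ 2 by field_simp]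
    ring
  simp only [t0, map_neg, map_mul, map_sub (sb v u (q ^ 2)) (_ * _) _, (lf_dvd_iff n2).1 h2, e1,
    mul_zero, zero_sub, t1, t2, t3, t4] at hrel
  rw [e2]
  have hc : (C q * C (aPar p q) : Pol) = C p⁻¹ * C q⁻¹ := by
    rw [← C_mul, ← C_mul, aPar]; congr 1; field_simp
  apply mul_left_cancel₀ (mul_ne_zero (lf_ne_zero n3 (q ^ 2)) (mul_ne_zero
    (C_ne_zero' hq) (lf_ne_zero n3 1)))
  linear_combination -hrel - (lf v w (q ^ 2) * lf v w 1 * redPi p q v l1 l2 l3 *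
    (lf v w (q ^ 4) * lf v w (q ^ 2 * p ^ 2)) * sw u w ρ) * hc

/-! ### Naturality of symmetric lifts -/

lemma sb_redPi_ne_zero {p q : ℂ} (hq : q ≠ 0) {a b c : ι} {l1 l2 l3 : List ι}
    (hc : c ∉ l1 ++ (l2 ++ l3)) (hab : a ≠ b) (ha : c ≠ a) (hb : c ≠ b) :
    sb a b (q ^ 2) (redPi p q c l1 l2 l3) ≠ 0 := by
  rw [Ne, ← lf_dvd_iff hab, redPi_eq]
  intro h
  have hpr := prime_lf hab (q ^ 2)
  obtain ⟨f, hf, hdf⟩ := (Prime.dvd_prod_iff hpr).1 h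
  obtain ⟨t, ht, rfl⟩ := List.mem_map.1 hf
  have hw : c ≠ t.1 := by
    rintro rfl
    apply hc
    rw [← redL_fst p q]
    exact List.mem_map_of_mem ht
  have hq2 : q ^ 2 ≠ 0 := pow_ne_zero _ hq
  rcases hpr.dvd_or_dvd hdf with h | h <;>
  · rcases lf_dvd_lf hab hw hq2 h with h | h
    · exact ha h.1
    · exact hb h.1

lemma natL_dvd {p q : ℂ} (g : Gen p q) {a b c e : ι} {s1 s2 s3 t1 t2 : List ι}
    (hl : (s1 ++ c :: (s2 ++ e :: s3)).Nodup) (he : Even (s1 ++ c :: (s2 ++ e :: s3)).length)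
    (ht : s1 ++ (s2 ++ s3) = t1 ++ a :: b :: t2)
    (hseg : (a ∈ s1 ↔ b ∈ s1) ∧ (a ∈ s2 ↔ b ∈ s2) ∧ (a ∈ s3 ↔ b ∈ s3))
    {ζ χ P : Pol} (hζ : ζ ∈ ML p q (s1 ++ c :: (s2 ++ e :: s3)))
    (hsym : sw a b ζ = ζ) (hred : sb a b (q ^ 2) ζ = P * χ) (hb : Btw q c e s2 ζ)
    (hχ : lf c e (q ^ 2) ∣ χ) : lf c e (q ^ 2) ∣ ζ := by
  obtain ⟨hce, hnd, hc, he'⟩ := red_names hl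
  obtain ⟨θ, hθ, hr⟩ := ML_red g hl he hζ hb
  have ma : a ∈ s1 ++ (s2 ++ s3) := by rw [ht]; simp
  have mb : b ∈ s1 ++ (s2 ++ s3) := by rw [ht]; simp
  have hca : c ≠ a := fun h => hc (h ▸ ma)
  have hcb : c ≠ b := fun h => hc (h ▸ mb)
  have hea : e ≠ a := fun h => he' (h ▸ ma)
  have heb : e ≠ b := fun h => he' (h ▸ mb)
  have hj : Dj a b c e := ⟨hca.symm, hea.symm, hcb.symm, heb.symm⟩
  have hab : a ≠ b := by rw [ht] at hnd; exact (red_names (l2 := []) hnd).1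
  have hPi := (redPi_ne_zero p q hc).1
  have hθs : sw a b θ = θ := by
    apply mul_left_cancel₀ hPi
    have := congrArg (sw a b) hr
    rw [sw_sb_of_dj hj, hsym, map_mul, sw_redPi_self hnd hca hcb hseg, hr] at this
    exact this.symm
  have hθd : lf a b (q ^ 2) ∣ θ := by
    rw [lf_dvd_iff hab]
    have := congrArg (sb a b (q ^ 2)) hr
    rw [sb_sb_comm hj, hred, map_mul, (lf_dvd_iff hce).1 hχ, mul_zero, map_mul] at this
    exact (mul_eq_zero.1 this.symm).resolve_left (sb_redPi_ne_zero g.q0 hc hab hca hcb)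
  have : θ = 0 := by
    have he2 := even_rest he
    rw [ht] at hnd hθ he2
    exact eq_zero_of_sym_dvd g hnd he2 hθ hθs hθd
  rw [lf_dvd_iff hce, hr, this, mul_zero]

lemma natL_T {p q : ℂ} (hq : q ≠ 0) {a b c e : ι} {r1 r2 r3 : List ι}
    (hr : (r1 ++ (r2 ++ r3)).Nodup) (hj : Dj a b c e) (hce : c ≠ e)
    (hseg : (c ∈ r1 ↔ e ∈ r1) ∧ (c ∈ r2 ↔ e ∈ r2) ∧ (c ∈ r3 ↔ e ∈ r3))
    {ζ χ : Pol} (hred : IsRed p q a b r1 r2 r3 ζ χ)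
    (h1 : lf c e (q ^ 2) ∣ ζ) (h2 : lf c e (q ^ 2) ∣ χ) :
    IsRed p q a b r1 r2 r3 (T p q c e ζ) (T p q c e χ) := by
  rw [IsRed, sb_T_of_dj hq hj hce _ h1, hred, T_mul_sym hq hce
    (sw_redPi_self hr hj.1 hj.2.1 hseg) h2]

/-! ### Reflection -/

lemma Val.symm {p q c₁ c₂ : ℂ} (hp : p ≠ 0) (hq : q ≠ 0) (h : Val p⁻¹ q⁻¹ c₁ c₂) :
    c₁ ≠ 0 ∧ c₂ ≠ 0 ∧ Val p q (c₁ / c₂) (1 / c₂) := by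
  rcases h with ⟨rfl, rfl⟩ | ⟨rfl, rfl⟩ | ⟨rfl, rfl⟩ <;>
    refine ⟨by simp [hp, hq], by simp [hp, hq], ?_⟩
  · left; constructor <;> field_simp
  · right; right; constructor <;> field_simp
  · right; left; constructor <;> field_simp

lemma PP.reflect {p q : ℂ} (hp : p ≠ 0) (hq : q ≠ 0) {l : List ι} (hl : l.Nodup)
    {ψ : Pol} (h : PP p q l ψ) : PP p⁻¹ q⁻¹ l.reverse ψ := by
  rw [pp_iff]
  intro i j k hs c₁ c₂ hv
  obtain ⟨h1, h2, h3⟩ := hv.symm hp hq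
  have hs' : [k, j, i].Sublist l := by
    have := hs.reverse
    simpa using this
  obtain ⟨hij, hik, hjk⟩ := nodup3 hl hs'
  refine h.hom (σ := tr i j k c₁ c₂) hs' h3 ?_ ?_
  · simp only [tr_X _ _ hjk.symm.symm, tr_X _ _ hik.symm, hij, hjk, hik, if_true, if_false, hjk.symm, hik.symm, hij.symm]
    rw [← mul_assoc, ← C_mul, div_mul_cancel₀ _ h2]
  · simp only [tr_X _ _ hik.symm, hij, hjk, hik, if_true, if_false, hjk.symm, hik.symm, hij.symm]
    rw [← mul_assoc, ← C_mul, div_mul_cancel₀ _ h2, C_1, one_mul]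

lemma ML_reflect {p q : ℂ} (hp : p ≠ 0) (hq : q ≠ 0) {l : List ι} (hl : l.Nodup)
    {ψ : Pol} : ψ ∈ ML p⁻¹ q⁻¹ l.reverse ↔ ψ ∈ ML p q l := by
  constructor
  · rintro ⟨h1, h2⟩
    refine ⟨?_, by simpa using h2⟩
    simpa using h1.reflect (inv_ne_zero hp) (inv_ne_zero hq) (List.nodup_reverse.2 hl)
  · rintro ⟨h1, h2⟩
    exact ⟨h1.reflect hp hq hl, by simpa using h2⟩

lemma lf_reflect {c : ℂ} (hc : c ≠ 0) (x y : ι) : lf y x c⁻¹ = C (-c⁻¹) * lf x y c := by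
  have : (C c⁻¹ * C c : Pol) = 1 := by rw [← C_mul, inv_mul_cancel₀ hc, C_1]
  rw [lf, lf, C_neg]; linear_combination (-X x) * this

lemma lf_dvd_reflect {q : ℂ} (hq : q ≠ 0) {x y : ι} {ψ : Pol} :
    lf y x ((q⁻¹) ^ 2) ∣ ψ ↔ lf x y (q ^ 2) ∣ ψ := by
  have h2 : q ^ 2 ≠ 0 := pow_ne_zero _ hq
  rw [inv_pow, lf_reflect h2, C_mul_dvd (by simpa using hq)]

lemma T_reflect {p q : ℂ} (hq : q ≠ 0) {x y : ι} (h : x ≠ y) {ψ : Pol}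
    (hd : lf x y (q ^ 2) ∣ ψ) : T p⁻¹ q⁻¹ y x ψ = T p q x y ψ - epsPar p • ψ := by
  apply T_unique (inv_ne_zero hq) h.symm ((lf_dvd_reflect hq).2 hd)
  have hr := T_rel (p := p) hq h hd
  have e : ∀ (s : ℂ) (x y : ι), lnf s⁻¹ x y = -lnf s y x := by
    intro s x y; simp [lnf]
  rw [e, e, e, sw_comm y x, smul_eq_C_mul, show epsPar p⁻¹ = -epsPar p by simp [epsPar], C_neg]
  linear_combination hr

/-! ### Rotation -/

/-- Scaling of some variables. -/
def scal (S : List ι) (k : ℂ) : Pol →ₐ[ℂ] Pol :=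
  aeval fun i => if i ∈ S then C k * X i else X i

lemma scal_X (S : List ι) (k : ℂ) (i : ι) :
    scal S k (X i) = if i ∈ S then C k * X i else X i := by simp [scal]

lemma scal_mem {S : List ι} (k : ℂ) {i : ι} (h : i ∈ S) : scal S k (X i) = C k * X i := by
  simp [scal_X, h]

lemma scal_notMem {S : List ι} (k : ℂ) {i : ι} (h : i ∉ S) : scal S k (X i) = X i := by
  simp [scal_X, h]

lemma scal_inv (S : List ι) {k : ℂ} (hk : k ≠ 0) (ψ : Pol) :
    scal S k⁻¹ (scal S k ψ) = ψ :=
  hom_ext_apply (σ := (scal S k⁻¹).comp (scal S k)) (τ := AlgHom.id ℂ _) (fun i => by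
    simp only [AlgHom.comp_apply, scal_X, AlgHom.id_apply]
    split_ifs with h
    · rw [map_mul, hom_C, scal_mem _ h, ← mul_assoc, ← C_mul, mul_inv_cancel₀ hk, C_1, one_mul]
    · rw [scal_notMem _ h]) ψ

lemma scal_inv' (S : List ι) {k : ℂ} (hk : k ≠ 0) (ψ : Pol) :
    scal S k (scal S k⁻¹ ψ) = ψ := by
  simpa using scal_inv S (inv_ne_zero hk) ψ

lemma totalDegree_scal (S : List ι) (k : ℂ) (ψ : Pol) :
    (scal S k ψ).totalDegree ≤ ψ.totalDegree := by
  apply totalDegree_aeval_le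
  intro i
  split_ifs
  · exact totalDegree_C_mul_X_le k i
  · rw [totalDegree_X]

lemma PP.rotate {p q : ℂ} (hp : p ≠ 0) (hq : q ≠ 0) {l1 l2 : List ι} (hl : (l1 ++ l2).Nodup)
    {ψ : Pol} (h : PP p q (l1 ++ l2) ψ) :
    PP p q (l2 ++ l1) (scal l1 ((p ^ 2 * q ^ 4)⁻¹) ψ) := by
  have hl' : (l2 ++ l1).Nodup := List.nodup_append_comm.1 hl
  have hdis : ∀ w ∈ l2, w ∉ l1 := fun w hw hw' => (List.nodup_append.1 hl).2.2 w hw' w hw rfl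
  rw [pp_iff]
  intro i j k hs c₁ c₂ hv
  obtain ⟨hij, hik, hjk⟩ := nodup3 hl' hs
  set κ := (p ^ 2 * q ^ 4)⁻¹ with hκ
  have hκ0 : κ ≠ 0 := by rw [hκ]; simp [hp, hq]
  have hc1 : c₁ ≠ 0 := by rcases hv with h | h | h <;> simp [h.1, hp, hq]
  have hc2 : c₂ ≠ 0 := by rcases hv with h | h | h <;> simp [h.2, hp, hq]
  have X1 : tr i j k c₁ c₂ (X i) = X i := by simp [tr_X _ _ hik, hij, hik]
  have X2 : tr i j k c₁ c₂ (X j) = C c₁ * X i := by simp [tr_X _ _ hik]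
  have X3 : tr i j k c₁ c₂ (X k) = C c₂ * X i := by simp [tr_X _ _ hik, hjk.symm]
  rw [← AlgHom.comp_apply]
  have V : ∀ {a b c : ι}, [a, b, c].Sublist (l1 ++ l2) → ∀ {s t r : ℂ},
      ((tr i j k c₁ c₂).comp (scal l1 κ)) (X a) = C r * X i →
      ((tr i j k c₁ c₂).comp (scal l1 κ)) (X b) = C s * X i →
      ((tr i j k c₁ c₂).comp (scal l1 κ)) (X c) = C t * X i → r ≠ 0 → Val p q (s / r) (t / r) →
      ((tr i j k c₁ c₂).comp (scal l1 κ)) ψ = 0 := by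
    intro a b c hs s t r h1 h2 h3 hr hv
    refine h.hom hs hv ?_ ?_
    · rw [h1, h2, ← mul_assoc, ← C_mul, div_mul_cancel₀ _ hr]
    · rw [h1, h3, ← mul_assoc, ← C_mul, div_mul_cancel₀ _ hr]
  have Y : ∀ {a : ι} {r : ℂ}, tr i j k c₁ c₂ (X a) = C r * X i →
      (a ∈ l1 → ((tr i j k c₁ c₂).comp (scal l1 κ)) (X a) = C (κ * r) * X i) ∧
      (a ∈ l2 → ((tr i j k c₁ c₂).comp (scal l1 κ)) (X a) = C r * X i) := by
    intro a r hr
    refine ⟨fun ha => ?_, fun ha => ?_⟩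
    · rw [AlgHom.comp_apply, scal_mem _ ha, map_mul, hom_C, hr, ← mul_assoc, ← C_mul]
    · rw [AlgHom.comp_apply, scal_notMem _ (hdis a ha), hr]
  have Y1 := Y (a := i) (r := 1) (by rw [X1, C_1, one_mul])
  have Y2 := Y X2
  have Y3 := Y X3
  obtain ⟨u, v, huv, hu, hv'⟩ := List.sublist_append_iff.1 hs
  rcases u with _ | ⟨u1, _ | ⟨u2, _ | ⟨u3, _ | ⟨u4, u⟩⟩⟩⟩
  · simp only [List.nil_append] at huv
    subst huv
    have m : ∀ w ∈ [i, j, k], w ∈ l1 := fun w hw => hv'.subset hw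
    refine V (hv'.trans (List.sublist_append_left _ _)) (Y1.1 (m _ (by simp)))
      (Y2.1 (m _ (by simp))) (Y3.1 (m _ (by simp))) (by simpa using hκ0) ?_
    rw [mul_div_mul_left _ _ hκ0, mul_div_mul_left _ _ hκ0, div_one, div_one]; exact hv
  · simp only [List.cons_append, List.nil_append, List.cons.injEq] at huv
    obtain ⟨rfl, rfl⟩ := huv
    have m : ∀ w ∈ [j, k], w ∈ l1 := fun w hw => hv'.subset hw
    refine V (a := j) (b := k) (c := i) (hv'.append hu) (Y2.1 (m _ (by simp)))
      (Y3.1 (m _ (by simp))) (Y1.2 (hu.subset (by simp))) (mul_ne_zero hκ0 hc1) ?_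
    rw [mul_div_mul_left _ _ hκ0]
    rcases hv with ⟨rfl, rfl⟩ | ⟨rfl, rfl⟩ | ⟨rfl, rfl⟩
    · right; right; constructor <;> (try simp only [hκ]) <;> field_simp
    · left; constructor <;> (try simp only [hκ]) <;> field_simp
    · right; left; constructor <;> (try simp only [hκ]) <;> field_simp
  · simp only [List.cons_append, List.nil_append, List.cons.injEq] at huv
    obtain ⟨rfl, rfl, rfl⟩ := huv
    have m : ∀ w ∈ [i, j], w ∈ l2 := fun w hw => hu.subset hw
    refine V (a := k) (b := i) (c := j) (hv'.append hu) (Y3.1 (hv'.subset (by simp)))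
      (Y1.2 (m _ (by simp))) (Y2.2 (m _ (by simp))) (mul_ne_zero hκ0 hc2) ?_
    rcases hv with ⟨rfl, rfl⟩ | ⟨rfl, rfl⟩ | ⟨rfl, rfl⟩
    · right; left; constructor <;> (try simp only [hκ]) <;> field_simp
    · right; right; constructor <;> (try simp only [hκ]) <;> field_simp
    · left; constructor <;> (try simp only [hκ]) <;> field_simp
  · simp only [List.cons_append, List.nil_append, List.cons.injEq] at huv
    obtain ⟨rfl, rfl, rfl, rfl⟩ := huv
    have m : ∀ w ∈ [i, j, k], w ∈ l2 := fun w hw => hu.subset hw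
    refine V (hu.trans (List.sublist_append_right _ _)) (Y1.2 (m _ (by simp)))
      (Y2.2 (m _ (by simp))) (Y3.2 (m _ (by simp))) one_ne_zero ?_
    rw [div_one, div_one]; exact hv
  · simp at huv

/-- The scaling constant of the rotation. -/
def rk (p q : ℂ) : ℂ := (p ^ 2 * q ^ 4)⁻¹

lemma rk_ne_zero {p q : ℂ} (hp : p ≠ 0) (hq : q ≠ 0) : rk p q ≠ 0 := by simp [rk, hp, hq]

lemma ML_rotate {p q : ℂ} (hp : p ≠ 0) (hq : q ≠ 0) {l1 l2 : List ι} (hl : (l1 ++ l2).Nodup)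
    {ψ : Pol} (h : ψ ∈ ML p q (l1 ++ l2)) :
    scal l1 (rk p q) ψ ∈ ML p q (l2 ++ l1) := by
  refine ⟨h.1.rotate hp hq hl, (totalDegree_scal _ _ _).trans ?_⟩
  rw [List.length_append, add_comm, ← List.length_append]
  exact h.2

lemma scal_reverse (S : List ι) (k : ℂ) : scal S.reverse k = scal S k := by simp [scal]

lemma ML_rotate_inv {p q : ℂ} (hp : p ≠ 0) (hq : q ≠ 0) {l1 l2 : List ι} (hl : (l1 ++ l2).Nodup)
    {ψ : Pol} (h : ψ ∈ ML p q (l2 ++ l1)) :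
    scal l1 (rk p q)⁻¹ ψ ∈ ML p q (l1 ++ l2) := by
  have hl' : (l2 ++ l1).Nodup := List.nodup_append_comm.1 hl
  rw [← ML_reflect hp hq hl', List.reverse_append] at h
  have h2 := ML_rotate (inv_ne_zero hp) (inv_ne_zero hq)
    (by rw [← List.reverse_append]; exact List.nodup_reverse.2 hl') h
  rw [← List.reverse_append, scal_reverse] at h2
  have e : rk p⁻¹ q⁻¹ = (rk p q)⁻¹ := by simp [rk, mul_comm]
  rwa [e, ML_reflect hp hq hl] at h2

lemma ML_rotate_iff {p q : ℂ} (hp : p ≠ 0) (hq : q ≠ 0) {l1 l2 : List ι} (hl : (l1 ++ l2).Nodup)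
    {ψ : Pol} : scal l1 (rk p q) ψ ∈ ML p q (l2 ++ l1) ↔ ψ ∈ ML p q (l1 ++ l2) := by
  refine ⟨fun h => ?_, ML_rotate hp hq hl⟩
  have := ML_rotate_inv hp hq hl h
  rwa [scal_inv _ (rk_ne_zero hp hq)] at this

section scal
variable {S : List ι} {k : ℂ} {x y : ι}

/-- Two names on the same side of a cut. -/
lemma scal_same (h : x ∈ S ↔ y ∈ S) (hk : k ≠ 0) : ∃ c : ℂ, c ≠ 0 ∧
    scal S k (X x) = C c * X x ∧ scal S k (X y) = C c * X y := by
  by_cases hx : x ∈ S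
  · exact ⟨k, hk, scal_mem _ hx, scal_mem _ (h.1 hx)⟩
  · exact ⟨1, one_ne_zero, by rw [scal_notMem _ hx, C_1, one_mul],
      by rw [scal_notMem _ (fun h' => hx (h.2 h')), C_1, one_mul]⟩

lemma scal_sw (h : x ∈ S ↔ y ∈ S) (k : ℂ) (ψ : Pol) :
    scal S k (sw x y ψ) = sw x y (scal S k ψ) :=
  hom_ext_apply (σ := (scal S k).comp (sw x y)) (τ := (sw x y).comp (scal S k)) (fun i => by
    simp only [AlgHom.comp_apply, sw_X, scal_X]
    have : Equiv.swap x y i ∈ S ↔ i ∈ S := by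
      rw [Equiv.swap_apply_def]
      split_ifs with h1 h2
      · rw [← h, h1]
      · rw [h, h2]
      · rfl
    by_cases hi : i ∈ S
    · simp [hi, this.2 hi]
    · have h' : Equiv.swap x y i ∉ S := fun h' => hi (this.1 h')
      simp only [if_neg hi, if_neg h', sw_X]) ψ

lemma scal_lf_dvd (h : x ∈ S ↔ y ∈ S) (hk : k ≠ 0) {c : ℂ} {ψ : Pol} :
    lf x y c ∣ scal S k ψ ↔ lf x y c ∣ ψ := by
  have key : ∀ {k : ℂ}, k ≠ 0 → ∀ {ψ : Pol}, lf x y c ∣ ψ → lf x y c ∣ scal S k ψ := by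
    rintro k hk ψ ⟨φ, rfl⟩
    obtain ⟨d, hd, h1, h2⟩ := scal_same h hk
    rw [map_mul, hom_lf_of_scale h1 h2, mul_assoc]
    exact dvd_mul_of_dvd_right (dvd_mul_right _ _) _
  refine ⟨fun h' => ?_, key hk⟩
  have := key (inv_ne_zero hk) h'
  rwa [scal_inv _ hk] at this

lemma scal_T {p q : ℂ} (hq : q ≠ 0) (h : x ∈ S ↔ y ∈ S) (hk : k ≠ 0) (hxy : x ≠ y)
    {ψ : Pol} (hd : lf x y (q ^ 2) ∣ ψ) :
    scal S k (T p q x y ψ) = T p q x y (scal S k ψ) := by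
  obtain ⟨d, hd', h1, h2⟩ := scal_same h hk
  exact hom_T hq hd' h1 h2 (fun f => scal_sw h k f) hxy hxy hd

end scal

lemma T_zero {p q : ℂ} (hq : q ≠ 0) {x y : ι} (h : x ≠ y) : T p q x y 0 = 0 := by
  have := T_smul (p := p) hq h (dvd_zero (lf x y (q ^ 2))) 0
  simpa using this

lemma T_dvd_dj {p q : ℂ} (hq : q ≠ 0) {x y u v : ι} (hj : Dj u v x y) (h : x ≠ y) (h' : u ≠ v)
    {c : ℂ} {ψ : Pol} (hd : lf x y (q ^ 2) ∣ ψ) (hc : lf u v c ∣ ψ) :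
    lf u v c ∣ T p q x y ψ := by
  rw [lf_dvd_iff h'] at hc ⊢
  rw [sb_T_of_dj hq hj h c hd, hc, T_zero hq h]

lemma T_dvd_of_both {p q : ℂ} (hq : q ≠ 0) {x y : ι} (h : x ≠ y) {f ψ : Pol}
    (hf : Prime f) (hd : lf x y (q ^ 2) ∣ ψ) (h1 : f ∣ ψ) (h2 : f ∣ sw x y ψ)
    (n1 : ¬ f ∣ lf y x 1) (n2 : ¬ f ∣ lf y x (q ^ 2)) : f ∣ T p q x y ψ := by
  have hr := T_rel (p := p) hq h hd
  rw [X_sub_X_eq, lnf_eq hq y x] at hr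
  have hdv : f ∣ lf y x 1 * (C (-q⁻¹) * lf y x (q ^ 2)) * T p q x y ψ := by
    rw [hr]
    exact dvd_sub (dvd_mul_of_dvd_right h1 _) (dvd_mul_of_dvd_right h2 _)
  refine (hf.dvd_or_dvd hdv).resolve_left fun h3 => ?_
  rcases hf.dvd_or_dvd h3 with h4 | h4
  · exact n1 h4
  · rw [dvd_C_mul (by simpa using hq)] at h4
    exact n2 h4

/-- `T` preserves divisibility by a star with apex before the pair. -/
lemma T_dvd_star {p q : ℂ} (hq : q ≠ 0) {x y u : ι} (h : x ≠ y) (hx : u ≠ x) (hy : u ≠ y)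
    {c : ℂ} (hc : c ≠ 0) {ψ : Pol} (hd : lf x y (q ^ 2) ∣ ψ)
    (h1 : lf u x c ∣ ψ) (h2 : lf u y c ∣ ψ) :
    lf u x c ∣ T p q x y ψ ∧ lf u y c ∣ T p q x y ψ := by
  have s1 := sw_dvd (x := x) (y := y) h1
  have s2 := sw_dvd (x := x) (y := y) h2
  rw [Equiv.swap_apply_left, Equiv.swap_apply_of_ne_of_ne hx hy] at s1
  rw [Equiv.swap_apply_right, Equiv.swap_apply_of_ne_of_ne hx hy] at s2
  constructor
  · refine T_dvd_of_both hq h (prime_lf hx c) hd h1 s2 ?_ ?_ <;>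
    · intro h3
      rcases lf_dvd_lf hx h.symm hc h3 with h4 | h4
      · exact hy h4.1.symm
      · exact hx h4.2.1.symm
  · refine T_dvd_of_both hq h (prime_lf hy c) hd h2 s1 ?_ ?_ <;>
    · intro h3
      rcases lf_dvd_lf hy h.symm hc h3 with h4 | h4
      · exact hy h4.1.symm
      · exact hx h4.2.1.symm

lemma T_dvd_star' {p q : ℂ} (hq : q ≠ 0) {x y u : ι} (h : x ≠ y) (hx : u ≠ x) (hy : u ≠ y)
    {c : ℂ} (hc : c ≠ 0) {ψ : Pol} (hd : lf x y (q ^ 2) ∣ ψ)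
    (h1 : lf x u c ∣ ψ) (h2 : lf y u c ∣ ψ) :
    lf x u c ∣ T p q x y ψ ∧ lf y u c ∣ T p q x y ψ := by
  have key : ∀ {a : ι} {f : Pol}, lf a u c ∣ f ↔ lf u a c⁻¹ ∣ f := fun {a f} => by
    rw [lf_reflect hc, C_mul_dvd (by simpa using hc)]
  rw [key] at h1 h2 ⊢
  rw [key]
  exact T_dvd_star hq h hx hy (inv_ne_zero hc) hd h1 h2

lemma T_blk {p q : ℂ} (hq : q ≠ 0) {w1 w2 : List ι} {x y : ι} (hl : (w1 ++ x :: y :: w2).Nodup)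
    {ψ : Pol} (h : Blk q (w1 ++ x :: y :: w2) ψ) :
    Blk q (w1 ++ x :: y :: w2) (T p q x y ψ) := by
  intro u v huv
  have hq2 : q ^ 2 ≠ 0 := pow_ne_zero _ hq
  have hxy : x ≠ y := (red_names (l2 := []) hl).1
  have huv' := nodup2 hl huv
  have hd : lf x y (q ^ 2) ∣ ψ := h x y (by simp)
  have i1 := idx_lt hl huv
  have i2 := idx_adj hl
  have hs : ∀ {u v}, [u, v].Sublist (w1 ++ x :: y :: w2) → (u ≠ x ∨ v ≠ y) →
      lf (Equiv.swap x y u) (Equiv.swap x y v) (q ^ 2) ∣ ψ := by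
    intro u v huv hne
    apply h
    have hm := huv.map (Equiv.swap x y)
    rw [map_swap_adj hl] at hm
    have i1 := idx_lt hl huv
    obtain ⟨_, _, ha, hb⟩ := red_names (l2 := []) hl
    simp only [List.nil_append, List.mem_append, not_or] at ha hb
    by_cases hx : u = x
    · subst hx
      have hv : v ≠ y := by simpa using hne
      have hvu : v ≠ u := (nodup2 hl huv).symm
      rw [Equiv.swap_apply_left, Equiv.swap_apply_of_ne_of_ne hvu hv]
      rw [List.map_cons, List.map_cons, Equiv.swap_apply_left,
        Equiv.swap_apply_of_ne_of_ne hvu hv] at hm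
      have := hm.erase u
      rw [List.erase_of_not_mem (by simp [hxy, hvu.symm]), List.erase_append_right _ ha.1,
        List.erase_cons_tail (by simpa using hxy.symm), List.erase_cons_head] at this
      exact this.trans ((List.Sublist.refl w1).append (List.sublist_cons_self u _))
    · by_cases hy : u = y
      · subst hy
        have hvu : v ≠ u := (nodup2 hl huv).symm
        have hvx : v ≠ x := by rintro rfl; omega
        rw [Equiv.swap_apply_right, Equiv.swap_apply_of_ne_of_ne hvx hvu]
        have hmem : v ∈ w2 := by
          have hvm : v ∈ w1 ++ x :: u :: w2 := huv.subset (by simp)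
          by_contra hv2
          have hv1 : v ∈ w1 := by simp [hvx, hvu, hv2] at hvm; exact hvm
          rw [List.idxOf_append_of_mem hv1, List.idxOf_append_of_notMem hb.1] at i1
          have := List.idxOf_lt_length_iff.2 hv1
          omega
        exact (((List.singleton_sublist.2 hmem).cons u).cons_cons x).trans
          (List.sublist_append_right _ _)
      · rw [Equiv.swap_apply_of_ne_of_ne hx hy]
        by_cases hvx : v = x ∨ v = y
        · have hu1 : u ∈ w1 := by
            have hum : u ∈ w1 ++ x :: y :: w2 := huv.subset (by simp)
            by_contra hu1
            rw [List.idxOf_append_of_notMem hu1, List.idxOf_cons_ne _ (Ne.symm hx), List.idxOf_cons_ne _ (Ne.symm hy)] at i1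
            rcases hvx with rfl | rfl
            · rw [List.idxOf_append_of_notMem ha.1, List.idxOf_cons_self] at i1; omega
            · rw [List.idxOf_append_of_notMem hb.1, List.idxOf_cons_ne _ hxy,
                List.idxOf_cons_self] at i1; omega
          have hm2 : Equiv.swap x y v ∈ x :: y :: w2 := by
            rcases hvx with rfl | rfl <;> simp
          exact (List.singleton_sublist.2 hu1).append (List.singleton_sublist.2 hm2)
        · rw [not_or] at hvx
          rw [Equiv.swap_apply_of_ne_of_ne hvx.1 hvx.2]; exact huv
  by_cases hu : u = x
  · subst hu
    by_cases hv : v = y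
    · subst hv; exact T_dvd hq _ _ _
    · have := hs huv (Or.inr hv)
      rw [Equiv.swap_apply_left, Equiv.swap_apply_of_ne_of_ne huv'.symm hv] at this
      exact (T_dvd_star' hq hxy huv'.symm hv hq2 hd (h _ _ huv) this).1
  · by_cases hu2 : u = y
    · subst hu2
      have hvx : v ≠ x := by rintro rfl; omega
      have := hs huv (Or.inl hu)
      rw [Equiv.swap_apply_right, Equiv.swap_apply_of_ne_of_ne hvx huv'.symm] at this
      exact (T_dvd_star' hq hxy hvx huv'.symm hq2 hd this (h _ _ huv)).2
    · have h3 := hs huv (Or.inl hu)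
      rw [Equiv.swap_apply_of_ne_of_ne hu hu2] at h3
      by_cases hv : v = x
      · subst hv
        rw [Equiv.swap_apply_left] at h3
        exact (T_dvd_star hq hxy hu hu2 hq2 hd (h _ _ huv) h3).1
      · by_cases hv2 : v = y
        · subst hv2
          rw [Equiv.swap_apply_right] at h3
          exact (T_dvd_star hq hxy hu hu2 hq2 hd h3 (h _ _ huv)).2
        · exact T_dvd_dj hq ⟨hu, hu2, hv, hv2⟩ hxy huv' hd (h _ _ huv)

/-! ### The explicit minimal polynomial -/

/-- The factor attached to two pairs of names. -/
def Qf (p q : ℂ) (P R : ι × ι) : Pol :=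
  lf P.1 R.1 (q ^ 2) * lf P.2 R.2 (q ^ 2) * lf R.1 P.2 (q ^ 2) * lf P.1 R.2 (p ^ 2 * q ^ 2)

/-- The product of `Qf` over all ordered couples of pairs. -/
def Psi (p q : ℂ) : List (ι × ι) → Pol
  | [] => 1
  | P :: L => (L.map (Qf p q P)).prod * Psi p q L

/-- The order of the variables attached to a list of pairs. -/
def ord (L : List (ι × ι)) : List ι := L.map Prod.fst ++ L.map Prod.snd

lemma Qf_dvd_Psi {p q : ℂ} {P R : ι × ι} {L : List (ι × ι)} (h : [P, R].Sublist L) :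
    Qf p q P R ∣ Psi p q L := by
  induction L with
  | nil => simp at h
  | cons S L ih =>
    rcases h with _ | h | h
    · exact dvd_mul_of_dvd_right (ih (by assumption)) _
    · exact dvd_mul_of_dvd_left (List.dvd_prod
        (List.mem_map_of_mem (List.singleton_sublist.1 (by assumption)))) _

lemma Psi_facts {p q : ℂ} {P R : ι × ι} {L : List (ι × ι)} (h : [P, R].Sublist L) :
    lf P.1 R.1 (q ^ 2) ∣ Psi p q L ∧ lf P.2 R.2 (q ^ 2) ∣ Psi p q L ∧
    lf R.1 P.2 (q ^ 2) ∣ Psi p q L ∧ lf P.1 R.2 (p ^ 2 * q ^ 2) ∣ Psi p q L := by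
  have hd := Qf_dvd_Psi (p := p) (q := q) h
  refine ⟨dvd_trans ?_ hd, dvd_trans ?_ hd, dvd_trans ?_ hd, dvd_trans ?_ hd⟩ <;> rw [Qf]
  · exact ⟨lf P.2 R.2 (q ^ 2) * lf R.1 P.2 (q ^ 2) * lf P.1 R.2 (p ^ 2 * q ^ 2), by ring⟩
  · exact ⟨lf P.1 R.1 (q ^ 2) * lf R.1 P.2 (q ^ 2) * lf P.1 R.2 (p ^ 2 * q ^ 2), by ring⟩
  · exact ⟨lf P.1 R.1 (q ^ 2) * lf P.2 R.2 (q ^ 2) * lf P.1 R.2 (p ^ 2 * q ^ 2), by ring⟩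
  · exact ⟨lf P.1 R.1 (q ^ 2) * lf P.2 R.2 (q ^ 2) * lf R.1 P.2 (q ^ 2), by ring⟩

lemma sub_trichotomy {α : Type} {L : List α} {P R : α} (hP : P ∈ L) (hR : R ∈ L) :
    P = R ∨ [P, R].Sublist L ∨ [R, P].Sublist L := by
  obtain ⟨s, t, rfl⟩ := List.append_of_mem hR
  rw [List.mem_append, List.mem_cons] at hP
  rcases hP with h | h | h
  · exact Or.inr (Or.inl ((List.singleton_sublist.2 h).append (by simp : [R].Sublist (R :: t))))
  · exact Or.inl h
  · exact Or.inr (Or.inr (((List.singleton_sublist.2 h).cons_cons R).trans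
      (List.sublist_append_right _ _)))

lemma sub_of_idx_lt {L : List ι} (hL : L.Nodup) {P R : ι} (hP : P ∈ L) (hR : R ∈ L)
    (h : L.idxOf P < L.idxOf R) : [P, R].Sublist L := by
  rcases sub_trichotomy hP hR with h1 | h1 | h1
  · rw [h1] at h; omega
  · exact h1
  · have := idx_lt hL h1; omega

lemma sub_trans_pair {L : List ι} (hL : L.Nodup) {P R S : ι} (h1 : [P, R].Sublist L)
    (h2 : [R, S].Sublist L) : [P, S].Sublist L :=
  sub_of_idx_lt hL (h1.subset (by simp)) (h2.subset (by simp))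
    ((idx_lt hL h1).trans (idx_lt hL h2))

lemma lift_pair {α β : Type} {f : α → β} {L : List α} {i j : β} (h : [i, j].Sublist (L.map f)) :
    ∃ P R, [P, R].Sublist L ∧ f P = i ∧ f R = j := by
  obtain ⟨l', h1, h2⟩ := List.sublist_map_iff.1 h
  match l', h2 with
  | [P, R], h2 =>
    simp only [List.map_cons, List.map_nil, List.cons.injEq, and_true] at h2
    exact ⟨P, R, h1, h2.1.symm, h2.2.symm⟩

lemma ord_nodup {L : List (ι × ι)} (h : (ord L).Nodup) : L.Nodup :=
  (List.nodup_append.1 h).1.of_map _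

lemma Psi_PP {p q : ℂ} {L : List (ι × ι)} (hL : (ord L).Nodup) :
    PP p q (ord L) (Psi p q L) := by
  rw [pp_iff]
  intro i j k hs c₁ c₂ hv
  have hLn := ord_nodup hL
  obtain ⟨hij, hik, hjk⟩ := nodup3 hL hs
  have X1 : tr i j k c₁ c₂ (X i) = X i := by simp [tr_X _ _ hik, hij, hik]
  have X2 : tr i j k c₁ c₂ (X j) = C c₁ * X i := by simp [tr_X _ _ hik]
  have X3 : tr i j k c₁ c₂ (X k) = C c₂ * X i := by simp [tr_X _ _ hik, hjk.symm]
  have D12 : ∀ c, lf i j c ∣ Psi p q L → c₁ = c → tr i j k c₁ c₂ (Psi p q L) = 0 := by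
    rintro c h rfl
    exact hom_eq_zero_of_dvd h (by rw [X1, X2])
  have D13 : ∀ c, lf i k c ∣ Psi p q L → c₂ = c → tr i j k c₁ c₂ (Psi p q L) = 0 := by
    rintro c h rfl
    exact hom_eq_zero_of_dvd h (by rw [X1, X3])
  have D23 : ∀ c, lf j k c ∣ Psi p q L → c₂ = c * c₁ → tr i j k c₁ c₂ (Psi p q L) = 0 := by
    rintro c h rfl
    exact hom_eq_zero_of_dvd h (by rw [X2, X3, ← mul_assoc, ← C_mul])
  obtain ⟨u, v, huv, hu, hv'⟩ := List.sublist_append_iff.1 hs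
  rcases u with _ | ⟨u1, _ | ⟨u2, _ | ⟨u3, _ | ⟨u4, u⟩⟩⟩⟩
  · simp only [List.nil_append] at huv
    subst huv
    obtain ⟨P, R, h1, rfl, rfl⟩ := lift_pair (sub12.trans hv')
    obtain ⟨P', R', h1', e1, rfl⟩ := lift_pair (sub23.trans hv')
    rcases hv with h | h | h
    · exact D12 _ (Psi_facts h1).2.1 h.1
    · refine D23 (q ^ 2) ?_ (by rw [h.1, h.2])
      rw [← e1]; exact (Psi_facts h1').2.1
    · exact D12 _ (Psi_facts h1).2.1 h.1
  · simp only [List.cons_append, List.nil_append, List.cons.injEq] at huv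
    obtain ⟨rfl, rfl⟩ := huv
    obtain ⟨P, R, h1, rfl, rfl⟩ := lift_pair hv'
    obtain ⟨S, hS, rfl⟩ := List.mem_map.1 (List.singleton_sublist.1 hu)
    rcases hv with h | h | h
    · exact D23 (q ^ 2) (Psi_facts h1).2.1 (by rw [h.1, h.2]; ring)
    · exact D23 (q ^ 2) (Psi_facts h1).2.1 (by rw [h.1, h.2])
    · have hP : P ∈ L := h1.subset (by simp)
      rcases sub_trichotomy hP hS with e | e | e
      · subst e
        exact D13 _ (Psi_facts h1).2.2.2 (by rw [h.2]; ring)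
      · exact D12 _ (Psi_facts e).2.2.1 h.1
      · exact D13 _ (Psi_facts (sub_trans_pair hLn e h1)).2.2.2 (by rw [h.2]; ring)
  · simp only [List.cons_append, List.nil_append, List.cons.injEq] at huv
    obtain ⟨rfl, rfl, rfl⟩ := huv
    obtain ⟨P, R, h1, rfl, rfl⟩ := lift_pair hu
    obtain ⟨S, hS, rfl⟩ := List.mem_map.1 (List.singleton_sublist.1 hv')
    rcases hv with h | h | h
    · exact D12 _ (Psi_facts h1).1 h.1
    · have hR : R ∈ L := h1.subset (by simp)
      rcases sub_trichotomy hR hS with e | e | e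
      · subst e
        exact D13 _ (Psi_facts h1).2.2.2 (by rw [h.2]; ring)
      · exact D13 _ (Psi_facts (sub_trans_pair hLn h1 e)).2.2.2 (by rw [h.2]; ring)
      · exact D23 _ (Psi_facts e).2.2.1 (by rw [h.1, h.2])
    · exact D12 _ (Psi_facts h1).1 h.1
  · simp only [List.cons_append, List.nil_append, List.cons.injEq] at huv
    obtain ⟨rfl, rfl, rfl, rfl⟩ := huv
    obtain ⟨P, R, h1, rfl, rfl⟩ := lift_pair (sub12.trans hu)
    obtain ⟨P', R', h1', e1, rfl⟩ := lift_pair (sub23.trans hu)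
    rcases hv with h | h | h
    · exact D12 _ (Psi_facts h1).1 h.1
    · refine D23 (q ^ 2) ?_ (by rw [h.1, h.2])
      rw [← e1]; exact (Psi_facts h1').1
    · exact D12 _ (Psi_facts h1).1 h.1
  · simp at huv

lemma ord_cons_ne {P : ι × ι} {L : List (ι × ι)} (h : (ord (P :: L)).Nodup) {R : ι × ι}
    (hR : R ∈ L) : P.1 ≠ R.1 ∧ P.1 ≠ R.2 ∧ P.2 ≠ R.1 ∧ P.2 ≠ R.2 := by
  have h1 : R.1 ∈ L.map Prod.fst := List.mem_map_of_mem hR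
  have h2 : R.2 ∈ L.map Prod.snd := List.mem_map_of_mem hR
  rw [ord, List.map_cons, List.map_cons, List.nodup_append] at h
  obtain ⟨a1, a2, a3⟩ := h
  rw [List.nodup_cons] at a1 a2
  refine ⟨fun e => a1.1 (e ▸ h1), a3 _ (by simp) _ (by simp [h2]), fun e => ?_,
    fun e => a2.1 (e ▸ h2)⟩
  exact a3 R.1 (by simp [h1]) P.2 (by simp) e.symm

lemma ord_self_ne {P : ι × ι} {L : List (ι × ι)} (h : (ord L).Nodup) (hP : P ∈ L) : P.1 ≠ P.2 :=
  (List.nodup_append.1 h).2.2 _ (List.mem_map_of_mem hP) _ (List.mem_map_of_mem hP)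

lemma ord_tail {P : ι × ι} {L : List (ι × ι)} (h : (ord (P :: L)).Nodup) : (ord L).Nodup := by
  refine List.Nodup.sublist ?_ h
  exact (List.sublist_cons_self _ _).append (List.sublist_cons_self _ _)

lemma Qf_ne {p q : ℂ} {P R : ι × ι} (h : P.1 ≠ R.1 ∧ P.1 ≠ R.2 ∧ P.2 ≠ R.1 ∧ P.2 ≠ R.2) :
    Qf p q P R ≠ 0 ∧ (Qf p q P R).totalDegree = 4 := by
  have h1 := lf_ne_zero h.1 (q ^ 2)
  have h2 := lf_ne_zero h.2.2.2 (q ^ 2)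
  have h3 := lf_ne_zero h.2.2.1.symm (q ^ 2)
  have h4 := lf_ne_zero h.2.1 (p ^ 2 * q ^ 2)
  refine ⟨mul_ne_zero (mul_ne_zero (mul_ne_zero h1 h2) h3) h4, ?_⟩
  rw [Qf, totalDegree_mul_eq (mul_ne_zero (mul_ne_zero h1 h2) h3) h4,
    totalDegree_mul_eq (mul_ne_zero h1 h2) h3, totalDegree_mul_eq h1 h2, totalDegree_lf h.1,
    totalDegree_lf h.2.2.2, totalDegree_lf h.2.2.1.symm, totalDegree_lf h.2.1]

lemma length_ord (L : List (ι × ι)) : (ord L).length = L.length + L.length := by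
  simp [ord]

lemma even_ord (L : List (ι × ι)) : Even (ord L).length := ⟨L.length, length_ord L⟩

lemma Qprod_ne {p q : ℂ} {P : ι × ι} {L : List (ι × ι)}
    (h : ∀ R ∈ L, P.1 ≠ R.1 ∧ P.1 ≠ R.2 ∧ P.2 ≠ R.1 ∧ P.2 ≠ R.2) :
    (L.map (Qf p q P)).prod ≠ 0 ∧ (L.map (Qf p q P)).prod.totalDegree = 4 * L.length := by
  induction L with
  | nil => simp
  | cons R L ih =>
    obtain ⟨h1, h2⟩ := ih (fun R' hR' => h R' (by simp [hR']))
    obtain ⟨h3, h4⟩ := Qf_ne (p := p) (q := q) (h R (by simp))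
    rw [List.map_cons, List.prod_cons]
    refine ⟨mul_ne_zero h3 h1, ?_⟩
    rw [totalDegree_mul_eq h3 h1, h2, h4, List.length_cons]; ring

lemma Psi_ne_zero {p q : ℂ} {L : List (ι × ι)} (hL : (ord L).Nodup) :
    Psi p q L ≠ 0 ∧ (Psi p q L).totalDegree = dg (ord L).length := by
  induction L with
  | nil => simp [Psi, dg, ord]
  | cons P L ih =>
    obtain ⟨h1, h2⟩ := ih (ord_tail hL)
    obtain ⟨h3, h4⟩ := Qprod_ne (p := p) (q := q) (P := P) (L := L)
      (fun R hR => ord_cons_ne hL hR)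
    refine ⟨mul_ne_zero h3 h1, ?_⟩
    have e : (ord (P :: L)).length = (ord L).length + 2 := by
      rw [length_ord, length_ord, List.length_cons]; omega
    rw [Psi, totalDegree_mul_eq h3 h1, h4, h2, e, dg_add_two (even_ord L), length_ord]
    ring

lemma Psi_mem {p q : ℂ} {L : List (ι × ι)} (hL : (ord L).Nodup) :
    Psi p q L ∈ ML p q (ord L) := ⟨Psi_PP hL, (Psi_ne_zero hL).2.le⟩

lemma Psi_append (p q : ℂ) (L1 L2 : List (ι × ι)) : Psi p q (L1 ++ L2) =
    Psi p q L1 * (L1.map fun P => (L2.map (Qf p q P)).prod).prod * Psi p q L2 := by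
  induction L1 with
  | nil => simp [Psi]
  | cons P L1 ih =>
    rw [List.cons_append, Psi, ih, Psi, List.map_append, List.prod_append, List.map_cons,
      List.prod_cons]
    ring

lemma hom_Qf {p q : ℂ} {σ : Pol →ₐ[ℂ] Pol} {f : ι → ι}
    {P R : ι × ι} (h : ∀ i ∈ [P.1, P.2, R.1, R.2], σ (X i) = X (f i)) :
    σ (Qf p q P R) = Qf p q (f P.1, f P.2) (f R.1, f R.2) := by
  simp only [List.mem_cons, List.not_mem_nil, or_false, forall_eq_or_imp, forall_eq] at h
  rw [Qf, Qf, map_mul, map_mul, map_mul, hom_lf, hom_lf, hom_lf, hom_lf, h.1, h.2.1, h.2.2.1,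
    h.2.2.2]
  rfl

lemma sw_Qf (p q : ℂ) (x y : ι) (P R : ι × ι) : sw x y (Qf p q P R) =
    Qf p q (Equiv.swap x y P.1, Equiv.swap x y P.2) (Equiv.swap x y R.1, Equiv.swap x y R.2) :=
  hom_Qf fun i _ => by simp

/-- Windows of length `m` are blocks of the explicit polynomial. -/
lemma Psi_blk {p q : ℂ} {L1 L2 : List (ι × ι)} :
    Blk q (L2.map Prod.fst ++ L1.map Prod.snd) (Psi p q (L1 ++ L2)) := by
  intro a b hab
  obtain ⟨u, v, huv, hu, hv⟩ := List.sublist_append_iff.1 hab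
  rcases u with _ | ⟨u1, _ | ⟨u2, _ | ⟨u3, u⟩⟩⟩
  · simp only [List.nil_append] at huv
    subst huv
    obtain ⟨P, R, h1, rfl, rfl⟩ := lift_pair hv
    exact (Psi_facts (h1.trans (List.sublist_append_left _ _))).2.1
  · simp only [List.cons_append, List.nil_append, List.cons.injEq] at huv
    obtain ⟨rfl, rfl⟩ := huv
    obtain ⟨P, hP, rfl⟩ := List.mem_map.1 (List.singleton_sublist.1 hu)
    obtain ⟨R, hR, rfl⟩ := List.mem_map.1 (List.singleton_sublist.1 hv)
    exact (Psi_facts ((List.singleton_sublist.2 hR).append (List.singleton_sublist.2 hP))).2.2.1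
  · simp only [List.cons_append, List.nil_append, List.cons.injEq] at huv
    obtain ⟨rfl, rfl, rfl⟩ := huv
    obtain ⟨P, R, h1, rfl, rfl⟩ := lift_pair hu
    exact (Psi_facts (h1.trans (List.sublist_append_right _ _))).1
  · simp at huv

lemma T_Qf {p q : ℂ} (hp : p ≠ 0) (hq : q ≠ 0) {a b c d : ι} (hac : a ≠ c) (hbd : b ≠ d)
    (hj : Dj a c b d) : T p q a c (Qf p q (a, b) (c, d)) = T p q b d (Qf p q (a, b) (c, d)) := by
  have d1 : lf a c (q ^ 2) ∣ Qf p q (a, b) (c, d) :=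
    ⟨lf b d (q ^ 2) * lf c b (q ^ 2) * lf a d (p ^ 2 * q ^ 2), by rw [Qf]; ring⟩
  have d2 : lf b d (q ^ 2) ∣ Qf p q (a, b) (c, d) :=
    ⟨lf a c (q ^ 2) * lf c b (q ^ 2) * lf a d (p ^ 2 * q ^ 2), by rw [Qf]; ring⟩
  apply T_unique hq hac d1
  have hr := T_rel (p := p) hq hbd d2
  apply mul_left_cancel₀ (mul_ne_zero (X_sub_X_ne_zero hbd) (lnf_ne_zero hq hbd.symm))
  have e : (X b - X d) * lnf q d b * ((X a - X c) * lnf q c a * T p q b d (Qf p q (a, b) (c, d))) =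
      (X a - X c) * lnf q c a *
      ((X b - X d) * lnf q d b * T p q b d (Qf p q (a, b) (c, d))) := by ring
  rw [e, hr, sw_Qf, sw_Qf]
  simp only [Equiv.swap_apply_left, Equiv.swap_apply_right,
    Equiv.swap_apply_of_ne_of_ne hj.1.symm hj.2.2.1.symm,
    Equiv.swap_apply_of_ne_of_ne hj.2.1.symm hj.2.2.2.symm,
    Equiv.swap_apply_of_ne_of_ne hj.1 hj.2.1,
    Equiv.swap_apply_of_ne_of_ne hj.2.2.1 hj.2.2.2]
  have eε : (C (epsPar p) : Pol) = C p⁻¹ * (C p ^ 2 - 1) := by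
    rw [← C_1, ← C_pow, ← C_sub, ← C_mul]; congr 1; rw [epsPar]; field_simp
  simp only [lnf_eq hp, lnf_eq hq, Qf, eε, C_mul, C_pow, lf, C_neg]
  ring

/-! ### Chains of operators -/

lemma blk_add {q : ℂ} {W : List ι} {f g : Pol} (hf : Blk q W f) (hg : Blk q W g) :
    Blk q W (f + g) := fun a b h => dvd_add (hf a b h) (hg a b h)

lemma blk_sub {q : ℂ} {W : List ι} {f g : Pol} (hf : Blk q W f) (hg : Blk q W g) :
    Blk q W (f - g) := fun a b h => dvd_sub (hf a b h) (hg a b h)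

lemma blk_smul {q : ℂ} {W : List ι} {f : Pol} (hf : Blk q W f) (c : ℂ) :
    Blk q W (c • f) := fun a b h => dvd_smul_of_dvd c (hf a b h)

lemma infix_pair {x y : ι} {W : List ι} (h : [x, y] <:+: W) : ∃ l1 l3, W = l1 ++ x :: y :: l3 := by
  obtain ⟨s, t, rfl⟩ := h
  exact ⟨s, t, by simp⟩

lemma T_blk_infix {p q : ℂ} (hq : q ≠ 0) {W : List ι} (hW : W.Nodup) {x y : ι}
    (h : [x, y] <:+: W) {ψ : Pol} (hψ : Blk q W ψ) : Blk q W (T p q x y ψ) := by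
  obtain ⟨l1, l3, rfl⟩ := infix_pair h
  exact T_blk hq hW hψ

lemma T_mem_infix {p q : ℂ} (g : Gen p q) {W : List ι} (hW : W.Nodup) {x y : ι}
    (h : [x, y] <:+: W) {ψ : Pol} (hψ : ψ ∈ ML p q W) (hd : lf x y (q ^ 2) ∣ ψ) :
    T p q x y ψ ∈ ML p q W := by
  obtain ⟨l1, l3, rfl⟩ := infix_pair h
  exact T_mem g hW hψ hd

lemma infix_ne {W : List ι} (hW : W.Nodup) {x y : ι} (h : [x, y] <:+: W) : x ≠ y := by
  have := h.sublist.nodup hW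
  simpa using this

/-- `T` with a constant subtracted. -/
def TFc (p q c : ℂ) (x y : ι) : Module.End ℂ (Fr ι) := TF p q x y - c • 1

lemma TFc_apply (p q c : ℂ) (x y : ι) (f : Fr ι) : TFc p q c x y f = TF p q x y f - c • f := rfl

/-- Chain of operators, the last pair acting first. -/
def cR (p q c : ℂ) : List ι → Module.End ℂ (Fr ι)
  | a :: b :: l => TFc p q c a b * cR p q c (b :: l)
  | _ => 1

/-- Chain of operators, the first pair acting first. -/
def cL (p q c : ℂ) : List ι → Module.End ℂ (Fr ι)
  | a :: b :: l => cL p q c (b :: l) * TFc p q c a b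
  | _ => 1

/-- Chain of operators on polynomials, the last pair acting first. -/
def pR (p q c : ℂ) : List ι → Pol → Pol
  | a :: b :: l, ψ => T p q a b (pR p q c (b :: l) ψ) - c • pR p q c (b :: l) ψ
  | _, ψ => ψ

/-- Chain of operators on polynomials, the first pair acting first. -/
def pL (p q c : ℂ) : List ι → Pol → Pol
  | a :: b :: l, ψ => pL p q c (b :: l) (T p q a b ψ - c • ψ)
  | _, ψ => ψ

lemma infix_tail {a : ι} {l W : List ι} (h : a :: l <:+: W) : l <:+: W :=
  (List.suffix_cons a l).isInfix.trans h

lemma infix_head {a b : ι} {l W : List ι} (h : a :: b :: l <:+: W) : [a, b] <:+: W :=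
  (List.prefix_append [a, b] l).isInfix.trans h

lemma pR_blk {p q : ℂ} (hq : q ≠ 0) (c : ℂ) {W : List ι} (hW : W.Nodup) {ψ : Pol}
    (hψ : Blk q W ψ) : ∀ {B : List ι}, B <:+: W → Blk q W (pR p q c B ψ)
  | [], _ => hψ
  | [_], _ => hψ
  | a :: b :: l, h => by
    have ih := pR_blk (p := p) hq c hW hψ (infix_tail h)
    exact blk_sub (T_blk_infix hq hW (infix_head h) ih) (blk_smul ih c)

lemma pL_blk {p q : ℂ} (hq : q ≠ 0) (c : ℂ) {W : List ι} (hW : W.Nodup) :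
    ∀ {B : List ι} {ψ : Pol}, Blk q W ψ → B <:+: W → Blk q W (pL p q c B ψ)
  | [], _, hψ, _ => hψ
  | [_], _, hψ, _ => hψ
  | _ :: b :: l, _, hψ, h =>
    pL_blk (p := p) hq c hW (B := b :: l)
      (blk_sub (T_blk_infix hq hW (infix_head h) hψ) (blk_smul hψ c)) (infix_tail h)

lemma blk_dvd {q : ℂ} {W : List ι} {ψ : Pol} (hψ : Blk q W ψ) {a b : ι}
    (h : [a, b] <:+: W) : lf a b (q ^ 2) ∣ ψ := hψ a b h.sublist

lemma pR_mem {p q : ℂ} (g : Gen p q) (c : ℂ) {W : List ι} (hW : W.Nodup) {l : List ι}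
    (hl : l.Nodup) (hWl : W <:+: l) {ψ : Pol} (hψ : Blk q W ψ) (hm : ψ ∈ ML p q l) :
    ∀ {B : List ι}, B <:+: W → pR p q c B ψ ∈ ML p q l
  | [], _ => hm
  | [_], _ => hm
  | a :: b :: s, h => by
    have ih := pR_mem g c hW hl hWl hψ hm (infix_tail h)
    have hb := pR_blk (p := p) g.q0 c hW hψ (infix_tail h)
    exact Submodule.sub_mem _ (T_mem_infix g hl ((infix_head h).trans hWl) ih
      (blk_dvd hb (infix_head h))) (Submodule.smul_mem _ _ ih)

lemma io_T_shift {p q : ℂ} (hq : q ≠ 0) {x y : ι} (h : x ≠ y) {ψ : Pol}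
    (hd : lf x y (q ^ 2) ∣ ψ) (c : ℂ) : io (T p q x y ψ - c • ψ) = TFc p q c x y (io ψ) := by
  rw [map_sub, map_smul, io_T hq h hd, TFc_apply]

lemma io_pR {p q : ℂ} (hq : q ≠ 0) (c : ℂ) {W : List ι} (hW : W.Nodup) {ψ : Pol}
    (hψ : Blk q W ψ) : ∀ {B : List ι}, B <:+: W → io (pR p q c B ψ) = cR p q c B (io ψ)
  | [], _ => rfl
  | [_], _ => rfl
  | a :: b :: s, h => by
    have hb := pR_blk (p := p) hq c hW hψ (infix_tail h)
    rw [pR, io_T_shift hq (infix_ne hW (infix_head h)) (blk_dvd hb (infix_head h)),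
      io_pR hq c hW hψ (infix_tail h)]
    rfl

lemma io_pL {p q : ℂ} (hq : q ≠ 0) (c : ℂ) {W : List ι} (hW : W.Nodup) :
    ∀ {B : List ι} {ψ : Pol}, Blk q W ψ → B <:+: W →
      io (pL p q c B ψ) = cL p q c B (io ψ)
  | [], _, _, _ => rfl
  | [_], _, _, _ => rfl
  | a :: b :: s, ψ, hψ, h => by
    rw [pL, io_pL hq c hW (B := b :: s)
      (blk_sub (T_blk_infix hq hW (infix_head h) hψ) (blk_smul hψ c)) (infix_tail h),
      io_T_shift hq (infix_ne hW (infix_head h)) (blk_dvd hψ (infix_head h))]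
    rfl

lemma TFc_comm {p q : ℂ} (c : ℂ) {x y z w : ι} (h : Dj x y z w) (f : Fr ι) :
    TFc p q c x y (TFc p q c z w f) = TFc p q c z w (TFc p q c x y f) := by
  simp only [TFc_apply, map_sub, map_smul, TF_comm h.1 h.2.1 h.2.2.1 h.2.2.2, smul_sub]
  abel

lemma cL_comm {p q : ℂ} (c : ℂ) {x y : ι} : ∀ {A : List ι}, x ∉ A → y ∉ A → ∀ f : Fr ι,
    cL p q c A (TFc p q c x y f) = TFc p q c x y (cL p q c A f)
  | [], _, _, _ => rfl
  | [_], _, _, _ => rfl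
  | a :: b :: s, hx, hy, f => by
    simp only [List.mem_cons, not_or] at hx hy
    have hj : Dj a b x y := ⟨fun h => hx.1 h.symm, fun h => hy.1 h.symm, fun h => hx.2.1 h.symm,
      fun h => hy.2.1 h.symm⟩
    have ih := cL_comm (p := p) (q := q) c (x := x) (y := y) (A := b :: s) (by simp [hx])
      (by simp [hy]) (TFc p q c a b f)
    rw [cL, Module.End.mul_apply, Module.End.mul_apply, TFc_comm c hj, ih]

/-- Operators on both halves agree, so do the chains. -/
lemma cR_eq_cL {p q : ℂ} (c : ℂ) (f : Fr ι) : ∀ {L : List (ι × ι)}, (ord L).Nodup →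
    (∀ P R, [P, R] <:+: L → TFc p q c P.2 R.2 f = TFc p q c P.1 R.1 f) →
    cR p q c (L.map Prod.snd) f = cL p q c (L.map Prod.fst) f
  | [], _, _ => rfl
  | [_], _, _ => rfl
  | P :: R :: L, hL, h => by
    have ih := cR_eq_cL c f (ord_tail hL) fun P' R' h' => h P' R' (h'.trans (List.suffix_cons _ _).isInfix)
    have hx : P.2 ∉ (R :: L).map Prod.fst := by
      intro hm
      obtain ⟨S, hS, e⟩ := List.mem_map.1 hm
      exact (ord_cons_ne hL hS).2.2.1 e.symm
    have hy : R.2 ∉ (R :: L).map Prod.fst := by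
      intro hm
      exact (List.nodup_append.1 (ord_tail hL)).2.2 _ hm _ (by simp) rfl
    have := cL_comm (p := p) (q := q) c hx hy f
    simp only [List.map_cons] at ih this ⊢
    rw [cR, cL, Module.End.mul_apply, Module.End.mul_apply, ih, ← this, h P R ⟨[], L, rfl⟩]

lemma TFc_eps {p q : ℂ} {x y : ι} (h : x ≠ y) (f : Fr ι) :
    TFc p q 0 x y (xF y * f) = xF x * TFc p q (epsPar p) x y f := by
  rw [TFc_apply, TFc_apply, zero_smul, sub_zero, TF_xF_mul h]

lemma cR_bernstein {p q : ℂ} {z : ι} (f : Fr ι) : ∀ {y : ι} {B : List ι}, (y :: B).Nodup →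
    (y :: B).getLast? = some z →
    cR p q 0 (y :: B) (xF z * f) = xF y * cR p q (epsPar p) (y :: B) f
  | y, [], _, hz => by
    simp at hz; subst hz; rfl
  | y, b :: B, hn, hz => by
    rw [List.getLast?_cons_cons] at hz
    have ih := cR_bernstein (p := p) (q := q) f (List.nodup_cons.1 hn).2 hz
    rw [cR, cR, Module.End.mul_apply, Module.End.mul_apply, ih, TFc_eps]
    simp at hn; tauto

lemma TFc_eps' {p q : ℂ} (hp : p ≠ 0) (hq : q ≠ 0) {x y : ι} (h : x ≠ y) (f : Fr ι) :
    TFc p q (epsPar p) x y (xF x * f) = xF y * TFc p q 0 x y f := by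
  have h1 := TFc_eps (p := p) (q := q) h (TFc p q 0 x y f)
  have h2 : TFc p q (epsPar p) x y (TFc p q 0 x y f) = f := by
    simp only [TFc_apply, zero_smul, sub_zero, TF_sq hp hq h]
    abel
  have h3 : ∀ g : Fr ι, TFc p q (epsPar p) x y (TFc p q 0 x y g) = g := by
    intro g
    simp only [TFc_apply, zero_smul, sub_zero, TF_sq hp hq h]
    abel
  rw [h2] at h1
  rw [← h1, h3]

lemma cL_bernstein {p q : ℂ} (hp : p ≠ 0) (hq : q ≠ 0) {z : ι} : ∀ {y : ι} {A : List ι} (f : Fr ι),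
    (y :: A).Nodup → (y :: A).getLast? = some z →
    cL p q (epsPar p) (y :: A) (xF y * f) = xF z * cL p q 0 (y :: A) f
  | y, [], f, _, hz => by
    simp at hz; subst hz; rfl
  | y, b :: A, f, hn, hz => by
    rw [List.getLast?_cons_cons] at hz
    have ih := cL_bernstein hp hq (TFc p q 0 y b f) (List.nodup_cons.1 hn).2 hz
    rw [cL, cL, Module.End.mul_apply, Module.End.mul_apply, ← ih, TFc_eps' hp hq]
    simp at hn; tauto

lemma TFc_mul_of_sF {p q c : ℂ} {x y : ι} {g : Fr ι} (hg : sF x y g = g) (f : Fr ι) :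
    TFc p q c x y (g * f) = g * TFc p q c x y f := by
  rw [TFc_apply, TFc_apply, TF_mul_of_sF hg, mul_sub, mul_smul_comm]

lemma cR_mul {p q c : ℂ} {z : ι} (f : Fr ι) : ∀ {B : List ι}, z ∉ B →
    cR p q c B (xF z * f) = xF z * cR p q c B f
  | [], _ => rfl
  | [_], _ => rfl
  | a :: b :: s, h => by
    simp only [List.mem_cons, not_or] at h
    rw [cR, Module.End.mul_apply, Module.End.mul_apply, cR_mul f (by simp [h]), TFc_mul_of_sF]
    rw [sF_xF, Equiv.swap_apply_of_ne_of_ne h.1 h.2.1]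

lemma cL_mul {p q c : ℂ} {z : ι} : ∀ {B : List ι} (f : Fr ι), z ∉ B →
    cL p q c B (xF z * f) = xF z * cL p q c B f
  | [], _, _ => rfl
  | [_], _, _ => rfl
  | a :: b :: s, f, h => by
    simp only [List.mem_cons, not_or] at h
    rw [cL, Module.End.mul_apply, Module.End.mul_apply, TFc_mul_of_sF, cL_mul _ (by simp [h])]
    rw [sF_xF, Equiv.swap_apply_of_ne_of_ne h.1 h.2.1]

/-! ### Both halves act alike on the explicit polynomial -/

lemma sw_Psi_of_notMem {p q : ℂ} {x y : ι} {L : List (ι × ι)} (hx : x ∉ ord L) (hy : y ∉ ord L) :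
    sw x y (Psi p q L) = Psi p q L := by
  have key : ∀ P R, P ∈ L → R ∈ L → sw x y (Qf p q P R) = Qf p q P R := by
    intro P R hP hR
    have : ∀ i ∈ ord L, Equiv.swap x y i = i := fun i hi =>
      Equiv.swap_apply_of_ne_of_ne (fun h => hx (h ▸ hi)) (fun h => hy (h ▸ hi))
    have m1 : ∀ P ∈ L, P.1 ∈ ord L ∧ P.2 ∈ ord L := fun P hP =>
      ⟨List.mem_append_left _ (List.mem_map_of_mem hP),
        List.mem_append_right _ (List.mem_map_of_mem hP)⟩
    rw [sw_Qf, this _ (m1 P hP).1, this _ (m1 P hP).2, this _ (m1 R hR).1, this _ (m1 R hR).2]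
  clear hx hy
  induction L with
  | nil => simp [Psi]
  | cons P L ih =>
    rw [Psi, map_mul, ih (fun P R hP hR => key P R (by simp [hP]) (by simp [hR])), map_list_prod,
      List.map_map]
    congr 2
    apply List.map_congr_left
    intro R hR
    exact key P R (by simp) (by simp [hR])

lemma sw_ne {x y i : ι} (h1 : i ≠ x) (h2 : i ≠ y) : Equiv.swap x y i = i :=
  Equiv.swap_apply_of_ne_of_ne h1 h2

/-- A couple of pairs seen from a pair before it. -/
lemma sw_Qf_before {p q : ℂ} {P : ι × ι} {a b c d : ι} (h1 : P.1 ≠ a) (h2 : P.1 ≠ b)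
    (h3 : P.1 ≠ c) (h4 : P.1 ≠ d) (h5 : P.2 ≠ a) (h6 : P.2 ≠ b) (h7 : P.2 ≠ c) (h8 : P.2 ≠ d)
    (hj : Dj a c b d) :
    sw a c (Qf p q P (a, b) * Qf p q P (c, d)) = Qf p q P (a, b) * Qf p q P (c, d) ∧
    sw b d (Qf p q P (a, b) * Qf p q P (c, d)) = Qf p q P (a, b) * Qf p q P (c, d) := by
  obtain ⟨j1, j2, j3, j4⟩ := hj
  rw [map_mul, map_mul, sw_Qf, sw_Qf, sw_Qf, sw_Qf]
  simp only [Equiv.swap_apply_left, Equiv.swap_apply_right, sw_ne h1 h3, sw_ne h5 h7, sw_ne h2 h4,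
    sw_ne h6 h8, sw_ne j1 j2, sw_ne j3 j4, sw_ne j1.symm j3.symm, sw_ne j2.symm j4.symm]
  constructor <;> simp only [Qf] <;> ring

/-- A couple of pairs seen from a pair after it. -/
lemma sw_Qf_after {p q : ℂ} {P : ι × ι} {a b c d : ι} (h1 : P.1 ≠ a) (h2 : P.1 ≠ b)
    (h3 : P.1 ≠ c) (h4 : P.1 ≠ d) (h5 : P.2 ≠ a) (h6 : P.2 ≠ b) (h7 : P.2 ≠ c) (h8 : P.2 ≠ d)
    (hj : Dj a c b d) :
    sw a c (Qf p q (a, b) P * Qf p q (c, d) P) = Qf p q (a, b) P * Qf p q (c, d) P ∧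
    sw b d (Qf p q (a, b) P * Qf p q (c, d) P) = Qf p q (a, b) P * Qf p q (c, d) P := by
  obtain ⟨j1, j2, j3, j4⟩ := hj
  rw [map_mul, map_mul, sw_Qf, sw_Qf, sw_Qf, sw_Qf]
  simp only [Equiv.swap_apply_left, Equiv.swap_apply_right, sw_ne h1 h3, sw_ne h5 h7, sw_ne h2 h4,
    sw_ne h6 h8, sw_ne j1 j2, sw_ne j3 j4, sw_ne j1.symm j3.symm, sw_ne j2.symm j4.symm]
  constructor <;> simp only [Qf] <;> ring

lemma sw_prod_map {x y : ι} {α : Type} {L : List α} {f : α → Pol}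
    (h : ∀ P ∈ L, sw x y (f P) = f P) : sw x y (L.map f).prod = (L.map f).prod := by
  rw [map_list_prod, List.map_map]
  congr 1
  apply List.map_congr_left
  intro P hP
  exact h P hP

lemma ord_append_perm (L1 L2 : List (ι × ι)) : (ord (L1 ++ L2)).Perm (ord L1 ++ ord L2) := by
  simp only [ord, List.map_append]
  rw [← Multiset.coe_eq_coe]
  simp only [← Multiset.coe_add]
  abel

lemma ord_cons_perm (P : ι × ι) (L : List (ι × ι)) :
    (ord (P :: L)).Perm (P.1 :: P.2 :: ord L) := by
  exact ord_append_perm [P] L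

/-- The explicit polynomial as a symmetric factor times one `Qf`. -/
lemma Psi_factor (p q : ℂ) {L1 L2 : List (ι × ι)} {P R : ι × ι}
    (hL : (ord (L1 ++ P :: R :: L2)).Nodup) : ∃ G, Psi p q (L1 ++ P :: R :: L2) = G * Qf p q P R ∧
      sw P.1 R.1 G = G ∧ sw P.2 R.2 G = G ∧ Dj P.1 R.1 P.2 R.2 ∧ P.1 ≠ R.1 ∧ P.2 ≠ R.2 := by
  obtain ⟨a, b⟩ := P
  obtain ⟨c, d⟩ := R
  have hperm : (ord (L1 ++ (a, b) :: (c, d) :: L2)).Perm (ord L1 ++ (a :: b :: c :: d :: ord L2)) :=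
    (ord_append_perm _ _).trans ((List.Perm.refl _).append ((ord_cons_perm _ _).trans
      (((ord_cons_perm _ _).cons _).cons _)))
  have hn := hperm.nodup_iff.1 hL
  have hL1 : (ord L1).Nodup := (List.nodup_append.1 hn).1
  have m1 : ∀ P ∈ L1, P.1 ∈ ord L1 ∧ P.2 ∈ ord L1 := fun P hP =>
      ⟨List.mem_append_left _ (List.mem_map_of_mem hP),
        List.mem_append_right _ (List.mem_map_of_mem hP)⟩
  have m2 : ∀ P ∈ L2, P.1 ∈ ord L2 ∧ P.2 ∈ ord L2 := fun P hP =>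
      ⟨List.mem_append_left _ (List.mem_map_of_mem hP),
        List.mem_append_right _ (List.mem_map_of_mem hP)⟩
  simp only [List.nodup_append, List.nodup_cons, List.mem_cons, not_or, forall_eq_or_imp] at hn
  obtain ⟨-, ⟨⟨ab, ac, ad, a2⟩, ⟨bc, bd, b2⟩, ⟨cd, c2⟩, d2, -⟩, hd⟩ := hn
  have hj : Dj a c b d := ⟨ab, ad, Ne.symm bc, cd⟩
  have o1 : ∀ i ∈ ord L1, i ≠ a ∧ i ≠ b ∧ i ≠ c ∧ i ≠ d := fun i hi =>
    ⟨(hd i hi).1, (hd i hi).2.1, (hd i hi).2.2.1, (hd i hi).2.2.2.1⟩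
  have o2 : ∀ i ∈ ord L2, i ≠ a ∧ i ≠ b ∧ i ≠ c ∧ i ≠ d := fun i hi =>
    ⟨fun h => a2 (h ▸ hi), fun h => b2 (h ▸ hi), fun h => c2 (h ▸ hi), fun h => d2 (h ▸ hi)⟩
  have f1 : ∀ P ∈ L1, ∀ R ∈ L2, (∀ x y, (x = a ∧ y = c) ∨ (x = b ∧ y = d) →
      sw x y (Qf p q P R) = Qf p q P R) := by
    rintro P hP R hR x y (⟨rfl, rfl⟩ | ⟨rfl, rfl⟩)
    · rw [sw_Qf, sw_ne (o1 _ (m1 P hP).1).1 (o1 _ (m1 P hP).1).2.2.1,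
        sw_ne (o1 _ (m1 P hP).2).1 (o1 _ (m1 P hP).2).2.2.1,
        sw_ne (o2 _ (m2 R hR).1).1 (o2 _ (m2 R hR).1).2.2.1,
        sw_ne (o2 _ (m2 R hR).2).1 (o2 _ (m2 R hR).2).2.2.1]
    · rw [sw_Qf, sw_ne (o1 _ (m1 P hP).1).2.1 (o1 _ (m1 P hP).1).2.2.2,
        sw_ne (o1 _ (m1 P hP).2).2.1 (o1 _ (m1 P hP).2).2.2.2,
        sw_ne (o2 _ (m2 R hR).1).2.1 (o2 _ (m2 R hR).1).2.2.2,
        sw_ne (o2 _ (m2 R hR).2).2.1 (o2 _ (m2 R hR).2).2.2.2]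
  have s1 : ∀ x y, (x = a ∧ y = c) ∨ (x = b ∧ y = d) → sw x y (Psi p q L1) = Psi p q L1 ∧
      sw x y (Psi p q L2) = Psi p q L2 := by
    rintro x y (⟨rfl, rfl⟩ | ⟨rfl, rfl⟩)
    · exact ⟨sw_Psi_of_notMem (fun h => (o1 _ h).1 rfl) (fun h => (o1 _ h).2.2.1 rfl),
        sw_Psi_of_notMem a2 c2⟩
    · exact ⟨sw_Psi_of_notMem (fun h => (o1 _ h).2.1 rfl) (fun h => (o1 _ h).2.2.2 rfl),
        sw_Psi_of_notMem b2 d2⟩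
  have k1 : ∀ P ∈ L1, ∀ x y, (x = a ∧ y = c) ∨ (x = b ∧ y = d) →
      sw x y (Qf p q P (a, b) * Qf p q P (c, d)) = Qf p q P (a, b) * Qf p q P (c, d) := by
    intro P hP x y hxy
    obtain ⟨e1, e2, e3, e4⟩ := o1 _ (m1 P hP).1
    obtain ⟨e5, e6, e7, e8⟩ := o1 _ (m1 P hP).2
    have := sw_Qf_before (p := p) (q := q) e1 e2 e3 e4 e5 e6 e7 e8 hj
    rcases hxy with ⟨rfl, rfl⟩ | ⟨rfl, rfl⟩
    · exact this.1
    · exact this.2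
  have k2 : ∀ P ∈ L2, ∀ x y, (x = a ∧ y = c) ∨ (x = b ∧ y = d) →
      sw x y (Qf p q (a, b) P * Qf p q (c, d) P) = Qf p q (a, b) P * Qf p q (c, d) P := by
    intro P hP x y hxy
    obtain ⟨e1, e2, e3, e4⟩ := o2 _ (m2 P hP).1
    obtain ⟨e5, e6, e7, e8⟩ := o2 _ (m2 P hP).2
    have := sw_Qf_after (p := p) (q := q) e1 e2 e3 e4 e5 e6 e7 e8 hj
    rcases hxy with ⟨rfl, rfl⟩ | ⟨rfl, rfl⟩
    · exact this.1
    · exact this.2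
  let G := Psi p q L1 * (L1.map fun P => (Qf p q P (a, b) * Qf p q P (c, d)) *
      (L2.map (Qf p q P)).prod).prod * ((L2.map fun P => Qf p q (a, b) P * Qf p q (c, d) P).prod *
      Psi p q L2)
  have hG : ∀ x y, (x = a ∧ y = c) ∨ (x = b ∧ y = d) → sw x y G = G := by
    intro x y hxy
    simp only [G, map_mul]
    rw [(s1 x y hxy).1, (s1 x y hxy).2, sw_prod_map fun P hP => k2 P hP x y hxy,
      sw_prod_map fun P hP => ?_]
    rw [map_mul, k1 P hP x y hxy, sw_prod_map fun R hR => f1 P hP R hR x y hxy]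
  refine ⟨G, ?_, hG a c (Or.inl ⟨rfl, rfl⟩), hG b d (Or.inr ⟨rfl, rfl⟩), hj, ac, bd⟩
  rw [Psi_append, Psi, Psi]
  simp only [G, List.map_cons, List.prod_cons, List.prod_map_mul]
  ring

lemma T_Psi {p q : ℂ} (hp : p ≠ 0) (hq : q ≠ 0) {L1 L2 : List (ι × ι)} {P R : ι × ι}
    (hL : (ord (L1 ++ P :: R :: L2)).Nodup) :
    T p q P.1 R.1 (Psi p q (L1 ++ P :: R :: L2)) = T p q P.2 R.2 (Psi p q (L1 ++ P :: R :: L2)) := by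
  obtain ⟨G, e, s1, s2, hj, n1, n2⟩ := Psi_factor p q hL
  obtain ⟨a, b⟩ := P
  obtain ⟨c, d⟩ := R
  have d1 : lf a c (q ^ 2) ∣ Qf p q (a, b) (c, d) :=
    ⟨lf b d (q ^ 2) * lf c b (q ^ 2) * lf a d (p ^ 2 * q ^ 2), by rw [Qf]; ring⟩
  have d2 : lf b d (q ^ 2) ∣ Qf p q (a, b) (c, d) :=
    ⟨lf a c (q ^ 2) * lf c b (q ^ 2) * lf a d (p ^ 2 * q ^ 2), by rw [Qf]; ring⟩
  rw [e, T_mul_sym hq n1 s1 d1, T_mul_sym hq n2 s2 d2, T_Qf hp hq n1 n2 hj]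

lemma TFc_Psi {p q : ℂ} (hp : p ≠ 0) (hq : q ≠ 0) (c : ℂ) {L : List (ι × ι)}
    (hL : (ord L).Nodup) (P R : ι × ι) (h : [P, R] <:+: L) :
    TFc p q c P.2 R.2 (io (Psi p q L)) = TFc p q c P.1 R.1 (io (Psi p q L)) := by
  obtain ⟨L1, L2, rfl⟩ := h
  have e : L1 ++ [P, R] ++ L2 = L1 ++ P :: R :: L2 := by simp
  rw [e] at hL ⊢
  obtain ⟨-, -, -, -, -, n1, n2⟩ := Psi_factor p q hL
  have hs : [P, R].Sublist (L1 ++ P :: R :: L2) := by simp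
  have hf := Psi_facts (p := p) (q := q) hs
  rw [TFc_apply, TFc_apply, ← io_T hq n1 hf.1, ← io_T hq n2 hf.2.1, T_Psi hp hq hL]

/-- The half-turn exchanges the two halves of the explicit polynomial. -/
lemma scal_Psi {p q : ℂ} (hp : p ≠ 0) (hq : q ≠ 0) : ∀ {L : List (ι × ι)}, (ord L).Nodup →
    ∀ {S : List ι}, (∀ P ∈ L, P.1 ∈ S) → (∀ P ∈ L, P.2 ∉ S) →
    ∃ c : ℂ, c ≠ 0 ∧ scal S (rk p q) (Psi p q L) = C c * Psi p q (L.map Prod.swap)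
  | [], _, _, _, _ => ⟨1, one_ne_zero, by simp [Psi]⟩
  | P :: L, hL, S, h1, h2 => by
    obtain ⟨c, hc, e⟩ := scal_Psi hp hq (ord_tail hL) (S := S) (fun R hR => h1 R (by simp [hR]))
      (fun R hR => h2 R (by simp [hR]))
    have key : ∃ d : ℂ, d ≠ 0 ∧ ∀ R ∈ L, scal S (rk p q) (Qf p q P R) =
        C d * Qf p q P.swap R.swap := by
      have hk := rk_ne_zero hp hq
      refine ⟨rk p q * ((rk p q * q ^ 2) * ((rk p q) * (p ^ 2 * q ^ 2))), by simp [hp, hq, hk], fun R hR => ?_⟩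
      have a1 := scal_mem (rk p q) (h1 P (by simp))
      have a2 := scal_notMem (rk p q) (h2 P (by simp))
      have b1 := scal_mem (rk p q) (h1 R (by simp [hR]))
      have b2 := scal_notMem (rk p q) (h2 R (by simp [hR]))
      rw [Qf, Qf, map_mul, map_mul, map_mul, hom_lf, hom_lf, hom_lf, hom_lf, a1, a2, b1, b2]
      simp only [Prod.fst_swap, Prod.snd_swap, lf]
      have r1 : (C (rk p q * q ^ 2) * C (p ^ 2 * q ^ 2) : Pol) = 1 := by
        rw [← C_mul, ← C_1]; congr 1; rw [rk]; field_simp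
      simp only [C_mul, C_pow] at r1 ⊢
      generalize (C (rk p q) : Pol) = K at *
      have e1 : (X P.2 - C q ^ 2 * (K * X R.1) : Pol) =
          -(K * C q ^ 2) * (X R.1 - C p ^ 2 * C q ^ 2 * X P.2) := by linear_combination -X P.2 * r1
      have e2 : (X R.2 - C p ^ 2 * C q ^ 2 * (K * X P.1) : Pol) =
          -(K * (C p ^ 2 * C q ^ 2)) * (X P.1 - C q ^ 2 * X R.2) := by
        linear_combination -X R.2 * r1
      rw [e1, e2]
      ring
    obtain ⟨d, hd, hQ⟩ := key
    refine ⟨d ^ L.length * c, mul_ne_zero (pow_ne_zero _ hd) hc, ?_⟩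
    have : (List.map (scal S (rk p q)) (L.map (Qf p q P))).prod =
        C (d ^ L.length) * ((L.map Prod.swap).map (Qf p q P.swap)).prod := by
      clear e hL h1 h2
      induction L with
      | nil => simp
      | cons R L ih =>
        simp only [List.map_cons, List.prod_cons, List.length_cons]
        rw [ih (fun R' hR' => hQ R' (by simp [hR'])), hQ R (by simp), pow_succ, C_mul]
        ring
    rw [Psi, map_mul, map_list_prod, this, e, List.map_cons, Psi, C_mul]
    ring

/-! ### The symmetric lift of the explicit polynomial -/

lemma aPar_ne_zero {p q : ℂ} (hp : p ≠ 0) (hq : q ≠ 0) : aPar p q ≠ 0 := by simp [aPar, hp, hq]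

lemma eps_mul_tau {p q : ℂ} (h : epsPar p ≠ 0) :
    epsPar p * tauPar p q = epsPar p - aPar p q + (aPar p q)⁻¹ := by
  rw [tauPar, mul_sub, mul_div_cancel₀ _ h]; ring

/-- The side condition of the lift. -/
lemma seed_side {p q : ℂ} (g : Gen p q) (hτ : epsPar p ≠ 0) {x y w : ι} (hxy : x ≠ y)
    (hxw : x ≠ w) (hyw : y ≠ w) {A A' G : Pol} (hA : lf y w (q ^ 2) ∣ A)
    (hA' : lf y w (q ^ 2) ∣ A') (hD : lf x w (q ^ 2) ∣ X y * A' - C (q ^ 2) * X x * A)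
    (hG : lf x y (q ^ 2) ∣ G) (hε : epsPar p • G = A - A') :
    lf x w (q ^ 2) ∣ (tauPar p q • A + T p q x y G + (aPar p q - epsPar p) • G) -
      sw x y (tauPar p q • A + T p q x y G + (aPar p q - epsPar p) • G) := by
  have hp := g.p0
  have hq := g.q0
  rw [lf_dvd_iff hxw]
  set σ := sb x w (q ^ 2) with hσ
  have hGw : lf y w (q ^ 2) ∣ G := by
    have : lf y w (q ^ 2) ∣ epsPar p • G := hε ▸ dvd_sub hA hA'
    rwa [smul_eq_C_mul, dvd_C_mul hτ] at this
  have hs : ∀ f, lf y w (q ^ 2) ∣ f → σ (sw x y f) = 0 := by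
    intro f hf
    have := sw_dvd (x := x) (y := y) hf
    rw [Equiv.swap_apply_right, sw_ne hxw.symm hyw.symm] at this
    exact (lf_dvd_iff hxw).1 this
  have hX : σ (X x) = X x := sb_X_of_ne _ hxw
  have hY : σ (X y) = X y := sb_X_of_ne _ hyw
  have r1 := T_rel (p := p) hq hxy hG
  have r2 := congrArg σ (congrArg (sw x y) r1)
  have r1 := congrArg σ r1
  have r3 := (lf_dvd_iff hxw).1 hD
  rw [← hσ] at r3
  have r4 := congrArg σ hε
  simp only [map_mul, map_sub, map_smul, hX, hY, hom_lnf, sw_X, sw_C, Equiv.swap_apply_left,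
    Equiv.swap_apply_right, sw_lnf, sw_sw, hs G hGw, hom_C, mul_zero, zero_sub, sub_zero] at r1 r2 r3 r4
  have r2' : (X y - X x) * (C q * X x - C q⁻¹ * X y) * σ (sw x y (T p q x y G)) =
      -((C p * X y - C p⁻¹ * X x) * (C q * X y - C q⁻¹ * X x) * σ G) := by
    rw [r2]
  have hne : ((X x - X y) * lnf q y x * lnf q x y * (X y : Pol)) ≠ 0 :=
    mul_ne_zero (mul_ne_zero (mul_ne_zero (X_sub_X_ne_zero hxy) (lnf_ne_zero hq hxy.symm))
      (lnf_ne_zero hq hxy)) (X_ne_zero y)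
  apply mul_left_cancel₀ hne
  simp only [map_sub, map_add, map_smul, hs A hA, hs G hGw, smul_zero, add_zero, zero_add] at r4 ⊢
  simp only [smul_eq_C_mul] at r4 ⊢
  generalize σ A = α at *
  generalize σ A' = α' at *
  generalize σ G = γ at *
  generalize σ (T p q x y G) = t1 at *
  generalize σ (sw x y (T p q x y G)) = t2 at *
  have c1 := congrArg (C : ℂ → Pol)
    (show q * aPar p q - p⁻¹ * q⁻¹ = 0 by rw [aPar]; field_simp; ring)
  have hετ := eps_mul_tau (q := q) hτ
  have c3 := congrArg (C : ℂ → Pol)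
    (show q⁻¹ * (epsPar p * tauPar p q) + q⁻¹ * (aPar p q - epsPar p) - p * q = 0 by
      rw [hετ, aPar]; field_simp; ring)
  have c2 := congrArg (C : ℂ → Pol)
    (show -q⁻¹ * (epsPar p * tauPar p q) - epsPar p * q⁻¹ - (q + q⁻¹) * (aPar p q - epsPar p)
        + p * q⁻¹ + p⁻¹ * q = 0 by
      rw [hετ, aPar, epsPar]; field_simp; ring)
  have hQ : (C q⁻¹ * C (q ^ 2) : Pol) = C q := by
    rw [← C_mul]; congr 1; field_simp
  simp only [C_add, C_sub, C_mul, C_neg, C_0] at c1 c2 c3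
  have hα : (C q * X x - C q⁻¹ * X y) * α = -(C q⁻¹ * C (epsPar p) * X y * γ) := by
    linear_combination C q⁻¹ * X y * r4 - C q⁻¹ * r3 - X x * α * hQ
  simp only [lnf, C_sub]
  linear_combination (X x - X y) * (C q * X y - C q⁻¹ * X x) * X y * C (tauPar p q) * hα +
    (C q * X x - C q⁻¹ * X y) * X y * r1 + (C q * X y - C q⁻¹ * X x) * X y * r2' +
    γ * X y * (C q * X y - C q⁻¹ * X x) * (X x ^ 2 * c1 + X x * X y * c2 + X y ^ 2 * c3)

/-- An element of a minimal space is symmetric once it is so on the side hyperplanes. -/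
lemma sym_of_sides {p q : ℂ} (g : Gen p q) {A0 B0 : List ι} {x y : ι}
    (hl : (A0 ++ x :: y :: B0).Nodup) (he : Even (A0 ++ x :: y :: B0).length)
    {F : Pol} (hF : F ∈ ML p q (A0 ++ x :: y :: B0))
    (hR : ∀ w ∈ B0, lf x w (q ^ 2) ∣ F - sw x y F)
    (hL : ∀ w ∈ A0, lf w y (q ^ 2) ∣ F - sw x y F) : sw x y F = F := by
  obtain ⟨hxy, hnd, hx, hy⟩ := red_names (l2 := []) hl
  rw [List.nil_append] at hnd hx hy
  have hq2 : q ^ 2 ≠ 0 := pow_ne_zero _ g.q0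
  set Z := F - sw x y F with hZ
  have hsZ : sw x y Z = -Z := by rw [hZ, map_sub, sw_sw]; ring
  set c : ι → ℂ := fun w => if w ∈ B0 then q ^ 2 else (q ^ 2)⁻¹ with hc
  have hc0 : ∀ w, c w ≠ 0 := by intro w; simp only [hc]; split_ifs <;> simp [g.q0]
  have hne : ∀ w ∈ A0 ++ B0, x ≠ w ∧ y ≠ w := fun w hw =>
    ⟨fun h => hx (h ▸ hw), fun h => hy (h ▸ hw)⟩
  have hflip : ∀ {u v : ι} {f : Pol}, lf v u ((q ^ 2)⁻¹) ∣ f ↔ lf u v (q ^ 2) ∣ f := by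
    intro u v f
    rw [lf_reflect hq2, C_mul_dvd (by simpa using g.q0)]
  have hZs : ∀ u v w d, (u = x ∧ v = y ∨ u = y ∧ v = x) → w ∈ A0 ++ B0 → lf u w d ∣ Z →
      lf v w d ∣ Z := by
    intro u v w d huv hw hd
    have hd' := sw_dvd (x := x) (y := y) hd
    rw [hsZ, dvd_neg, sw_ne (hne w hw).1.symm (hne w hw).2.symm] at hd'
    rcases huv with ⟨rfl, rfl⟩ | ⟨rfl, rfl⟩
    · rwa [Equiv.swap_apply_left] at hd'
    · rwa [Equiv.swap_apply_right] at hd'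
  have hZd : ∀ w ∈ A0 ++ B0, lf x w (c w) ∣ Z ∧ lf y w (c w) ∣ Z := by
    intro w hw
    by_cases hB : w ∈ B0
    · simp only [hc, if_pos hB]
      exact ⟨hR w hB, hZs x y w _ (Or.inl ⟨rfl, rfl⟩) hw (hR w hB)⟩
    · have hA : w ∈ A0 := by simpa [hB] using hw
      simp only [hc, if_neg hB]
      have := hflip.2 (hL w hA)
      exact ⟨hZs y x w _ (Or.inr ⟨rfl, rfl⟩) hw this, this⟩
  set L : List (Pol) := (A0 ++ B0).map (fun w => lf x w (c w)) ++
    (A0 ++ B0).map (fun w => lf y w (c w)) with hLdef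
  have hmem : ∀ f ∈ L, ∃ u w, (u = x ∨ u = y) ∧ w ∈ A0 ++ B0 ∧ f = lf u w (c w) := by
    intro f hf
    rw [hLdef, List.mem_append, List.mem_map, List.mem_map] at hf
    rcases hf with ⟨w, hw, rfl⟩ | ⟨w, hw, rfl⟩
    · exact ⟨x, w, Or.inl rfl, hw, rfl⟩
    · exact ⟨y, w, Or.inr rfl, hw, rfl⟩
  have hune : ∀ u w, (u = x ∨ u = y) → w ∈ A0 ++ B0 → u ≠ w := by
    rintro u w (rfl | rfl) hw
    · exact (hne w hw).1
    · exact (hne w hw).2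
  have hprime : ∀ f ∈ L, Prime f := by
    intro f hf
    obtain ⟨u, w, hu, hw, rfl⟩ := hmem f hf
    exact prime_lf (hune u w hu hw) _
  have hdvd : L.prod ∣ dd x y F := by
    apply list_prod_dvd L hprime
    · rw [hLdef, List.pairwise_append, List.pairwise_map, List.pairwise_map]
      refine ⟨hnd.imp_of_mem fun hu hv huv hd => ?_, hnd.imp_of_mem fun hu hv huv hd => ?_, ?_⟩
      · rcases lf_dvd_lf (hne _ hu).1 (hne _ hv).1 (hc0 _) hd with h | h
        · exact huv h.2.1.symm
        · exact (hne _ hu).1 h.1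
      · rcases lf_dvd_lf (hne _ hu).2 (hne _ hv).2 (hc0 _) hd with h | h
        · exact huv h.2.1.symm
        · exact (hne _ hu).2 h.1
      · intro f hf f' hf' hd
        obtain ⟨w, hw, rfl⟩ := List.mem_map.1 hf
        obtain ⟨w', hw', rfl⟩ := List.mem_map.1 hf'
        rcases lf_dvd_lf (hne _ hw).1 (hne _ hw').2 (hc0 _) hd with h | h
        · exact hxy h.1.symm
        · exact (hne _ hw).2 h.1
    · intro f hf
      have hp := hprime f hf
      obtain ⟨u, w, hu, hw, rfl⟩ := hmem f hf
      have hdZ : lf u w (c w) ∣ (X x - X y) * dd x y F := by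
        rw [mul_dd, ← hZ]
        rcases hu with rfl | rfl
        · exact (hZd w hw).1
        · exact (hZd w hw).2
      refine (hp.dvd_or_dvd hdZ).resolve_left fun hd => ?_
      rw [X_sub_X_eq] at hd
      rcases lf_dvd_lf (hune u w hu hw) hxy.symm (hc0 w) hd with h | h
      · exact (hne w hw).1 h.2.1
      · exact (hne w hw).2 h.1
  obtain ⟨h, hh⟩ := hdvd
  have hPi0 : L.prod ≠ 0 := List.prod_ne_zero fun h0 => (hprime 0 h0).ne_zero rfl
  have hdegL : L.prod.totalDegree = 2 * (A0 ++ B0).length := by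
    have key : ∀ u, (u = x ∨ u = y) → ∀ M : List ι, (∀ w ∈ M, w ∈ A0 ++ B0) →
        ((M.map fun w => lf u w (c w)).prod.totalDegree = M.length ∧
          (M.map fun w => lf u w (c w)).prod ≠ 0) := by
      intro u hu M hM
      induction M with
      | nil => simp
      | cons w M ih =>
        obtain ⟨h1, h2⟩ := ih fun w' hw' => hM w' (by simp [hw'])
        have hw := hune u w hu (hM w (by simp))
        rw [List.map_cons, List.prod_cons]
        refine ⟨?_, mul_ne_zero (lf_ne_zero hw _) h2⟩
        rw [totalDegree_mul_eq (lf_ne_zero hw _) h2, h1, totalDegree_lf hw, List.length_cons,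
          add_comm]
    obtain ⟨k1, k2⟩ := key x (Or.inl rfl) (A0 ++ B0) fun w hw => hw
    obtain ⟨k3, k4⟩ := key y (Or.inr rfl) (A0 ++ B0) fun w hw => hw
    rw [hLdef, List.prod_append, totalDegree_mul_eq k2 k4, k1, k3]; ring
  have hZe : Z = (X x - X y) * L.prod * h := by rw [hZ, ← mul_dd, hh, mul_assoc]
  have hsub : (A0 ++ B0).Sublist (A0 ++ x :: y :: B0) := sub_rest (l2 := [])
  have hPZ : PP p q (A0 ++ B0) Z := by
    rw [pp_iff]
    intro i j k hs c₁ c₂ hv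
    obtain ⟨hij, hik, hjk⟩ := nodup3 hnd hs
    have h1 := pp_iff.1 hF.1 i j k (hs.trans hsub) c₁ c₂ hv
    have h2 : ((tr i j k c₁ c₂).comp (sw x y)) F = 0 := by
      have m : ∀ t ∈ [i, j, k], Equiv.swap x y t = t := fun t ht =>
        sw_ne (hne t (hs.subset ht)).1.symm (hne t (hs.subset ht)).2.symm
      refine hF.1.hom (hs.trans hsub) hv ?_ ?_ <;>
      · simp only [AlgHom.comp_apply, sw_X]
        rw [m i (by simp), m _ (by simp), tr_X _ _ hik, tr_X _ _ hik]
        simp [hij, hik, hjk.symm]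
    rw [hZ, map_sub, h1, ← AlgHom.comp_apply, h2, sub_zero]
  have hPh : PP p q (A0 ++ B0) h := by
    refine PP.of_mul (f := (X x - X y) * L.prod) (by rwa [← hZe]) ?_
    intro i j k hs c₁ c₂ hv
    obtain ⟨hij, hik, hjk⟩ := nodup3 hnd hs
    have hx' : x ∉ [i, j, k] := fun h => hx (hs.subset h)
    have hy' : y ∉ [i, j, k] := fun h => hy (hs.subset h)
    rw [map_mul, X_sub_X_eq]
    refine mul_ne_zero (tr_lf_ne hik hxy.symm one_ne_zero (Or.inl hy') _ _) ?_
    rw [map_list_prod]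
    apply List.prod_ne_zero
    intro h0
    obtain ⟨f, hf, hf0⟩ := List.mem_map.1 h0
    obtain ⟨u, w, hu, hw, rfl⟩ := hmem f hf
    refine tr_lf_ne hik (hune u w hu hw) (hc0 w) (Or.inl ?_) _ _ hf0
    rcases hu with rfl | rfl <;> assumption
  have hh0 : h = 0 := by
    by_contra hne0
    have hZdeg : Z.totalDegree ≤ dg (A0 ++ x :: y :: B0).length :=
      (totalDegree_sub _ _).trans (max_le hF.2 ((totalDegree_sw _ _ _).trans hF.2))
    have e := len_rest x y A0 [] B0
    rw [List.nil_append, List.nil_append] at e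
    have he' := even_rest (l2 := []) he
    rw [List.nil_append] at he'
    have hX := X_sub_X_ne_zero hxy
    rw [e, dg_add_two he', hZe, totalDegree_mul_eq (mul_ne_zero hX hPi0) hne0,
      totalDegree_mul_eq hX hPi0, hdegL, X_sub_X_eq, totalDegree_lf hxy.symm] at hZdeg
    exact hne0 (eq_zero_of_low g hnd he' hPh (by omega))
  have : Z = 0 := by rw [hZe, hh0, mul_zero]
  rw [hZ, sub_eq_zero] at this
  exact this.symm

/-- The cyclic shift of a list of names. -/
def shf : List ι → Equiv.Perm ι
  | a :: b :: l => Equiv.swap a b * shf (b :: l)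
  | _ => 1

lemma shf_of_notMem : ∀ {l : List ι} {i : ι}, i ∉ l → shf l i = i
  | [], _, _ => rfl
  | [_], _, _ => rfl
  | a :: b :: l, i, h => by
    have h' : i ∉ b :: l := fun h' => h (by simp at h' ⊢; tauto)
    simp only [List.mem_cons, not_or] at h
    rw [shf, Equiv.Perm.mul_apply, shf_of_notMem h', sw_ne h.1 h.2.1]

lemma map_shf : ∀ {b : ι} {B : List ι}, (b :: B).Nodup → ((b :: B).dropLast).map (shf (b :: B)) = B
  | b, [], _ => rfl
  | b, b' :: B, h => by
    have h1 := List.nodup_cons.1 h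
    have ih := map_shf h1.2
    rw [List.dropLast_cons_cons, List.map_cons, shf, Equiv.Perm.mul_apply, shf_of_notMem h1.1,
      Equiv.swap_apply_left]
    congr 1
    have h2 := List.nodup_cons.1 h1.2
    rw [Equiv.Perm.coe_mul, ← List.map_map, ih, map_swap_of_notMem (fun h => h1.1 (by simp [h])) h2.1]

lemma T_chain_dvd {p q : ℂ} (hq : q ≠ 0) {x b b' w : ι} {A0 B1 B2 : List ι} {f : Pol}
    (hn : (A0 ++ x :: (B1 ++ b :: b' :: B2)).Nodup) (hw : w ∈ B1) (hbb : lf b b' (q ^ 2) ∣ f)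
    (hf : lf x w (q ^ 2) ∣ f) : lf x w (q ^ 2) ∣ T p q b b' f := by
  have h1 := (List.nodup_append.1 hn).2.1
  rw [List.nodup_cons, List.nodup_append] at h1
  obtain ⟨hx, -, h2, h3⟩ := h1
  simp only [List.mem_append, List.mem_cons, not_or] at hx
  have hbb' : b ≠ b' := by
    rintro rfl
    simp at h2
  exact T_dvd_dj hq ⟨hx.2.1, hx.2.2.1, h3 w hw b (by simp), h3 w hw b' (by simp)⟩ hbb'
    (fun h => hx.1 (h ▸ hw)) hbb hf

lemma red_chain {p q : ℂ} (hp : p ≠ 0) (hq : q ≠ 0) {x z : ι} {A0 : List ι}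
    {ψ ρ : Pol} (B2 : List ι) : ∀ (B1 : List ι) (b : ι),
    (A0 ++ x :: (B1 ++ b :: B2)).Nodup → (b :: B2).getLast? = some z → Blk q (b :: B2) ψ →
    (∀ w ∈ B1 ++ (b :: B2).dropLast, lf x w (q ^ 2) ∣ ψ) →
    IsRed p q x z A0 (B1 ++ (b :: B2).dropLast) [] ψ ρ →
    IsRed p q x b A0 B1 B2 (pR p q 0 (b :: B2) ψ)
      (C (aPar p q ^ B2.length) * rename (shf (b :: B2)) ρ) ∧
    ∀ w ∈ B1, lf x w (q ^ 2) ∣ pR p q 0 (b :: B2) ψ := by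
  induction B2 with
  | nil =>
    intro B1 b hn hz hB hd hr
    simp only [List.getLast?_singleton, Option.some.injEq] at hz
    simp only [List.dropLast_singleton, List.append_nil] at hd hr
    subst hz
    refine ⟨?_, hd⟩
    have h1 : ⇑(shf [b]) = id := by ext; simp [shf]
    rw [h1, rename_id_apply, List.length_nil, pow_zero, C_1, one_mul]
    exact hr
  | cons b' B2 ih =>
    intro B1 b hn hz hB hd hr
    have hn' : (A0 ++ x :: ((B1 ++ [b]) ++ b' :: B2)).Nodup := by
      rw [List.append_assoc]; exact hn
    have hbW : (b :: b' :: B2).Nodup := by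
      refine List.Nodup.sublist ?_ hn
      exact ((List.sublist_append_right B1 _).cons x).trans (List.sublist_append_right _ _)
    rw [List.getLast?_cons_cons] at hz
    rw [List.dropLast_cons_cons] at hd hr
    have e : B1 ++ b :: (b' :: B2).dropLast = (B1 ++ [b]) ++ (b' :: B2).dropLast := by
      rw [List.append_assoc]; rfl
    rw [e] at hd hr
    obtain ⟨ih1, ih2⟩ := ih (B1 ++ [b]) b' hn' hz
      (hB.sublist (List.sublist_cons_self _ _)) hd hr
    have hblk := pR_blk (p := p) hq 0 hbW hB (infix_tail (List.infix_refl (b :: b' :: B2)))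
    have hbb : lf b b' (q ^ 2) ∣ pR p q 0 (b' :: B2) ψ := hblk b b' (by simp)
    have hm := moveR_right hp hq (v := x) (u := b) (w := b') (l1 := A0) (l2 := B1) (l3 := B2)
      hn hbb (ih2 b (by simp)) ih1
    have hpR : pR p q 0 (b :: b' :: B2) ψ = T p q b b' (pR p q 0 (b' :: B2) ψ) := by
      rw [pR, zero_smul, sub_zero]
    rw [hpR]
    constructor
    · have e2 : (C (aPar p q ^ (b' :: B2).length) * rename (shf (b :: b' :: B2)) ρ :
          Pol) = C (aPar p q) * sw b b' (C (aPar p q ^ B2.length) *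
            rename (shf (b' :: B2)) ρ) := by
        rw [map_mul, sw_C, ← mul_assoc, ← C_mul, List.length_cons, pow_succ', sw, rename_rename]
        rfl
      rw [e2]
      exact hm
    · intro w hw
      exact T_chain_dvd hq hn hw hbb (ih2 w (by simp [hw]))

lemma rename_Psi (p q : ℂ) (f : ι → ι) (L : List (ι × ι)) :
    rename f (Psi p q L) = Psi p q (L.map fun P => (f P.1, f P.2)) := by
  induction L with
  | nil => simp [Psi]
  | cons P L ih =>
    have : L.map (⇑(rename (R := ℂ) f) ∘ Qf p q P) =
        L.map (Qf p q (f P.1, f P.2) ∘ fun R => (f R.1, f R.2)) := by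
      apply List.map_congr_left
      intro R _
      exact hom_Qf fun i _ => by simp
    rw [Psi, map_mul, ih, List.map_cons, Psi, map_list_prod, List.map_map, List.map_map, this]

/-- The reduction of the explicit polynomial at the last pair. -/
lemma red_Psi {p q : ℂ} (hp : p ≠ 0) (hq : q ≠ 0) {x z : ι} : ∀ {L : List (ι × ι)},
    (ord (L ++ [(x, z)])).Nodup → ∃ c : ℂ, c ≠ 0 ∧
    IsRed p q x z (L.map Prod.fst) (L.map Prod.snd) [] (Psi p q (L ++ [(x, z)]))
      (C c * Psi p q L) := by
  intro L hL
  have hn : ∀ P ∈ L, P.1 ≠ x ∧ P.1 ≠ z ∧ P.2 ≠ x ∧ P.2 ≠ z := by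
    intro P hP
    obtain ⟨s, t, rfl⟩ := List.append_of_mem hP
    have hs : (ord (P :: (t ++ [(x, z)]))).Nodup := by
      refine List.Nodup.sublist ?_ hL
      simp only [ord, List.append_assoc, List.cons_append]
      exact ((List.sublist_append_right s _).map _).append ((List.sublist_append_right s _).map _)
    exact ord_cons_ne hs (R := (x, z)) (by simp)
  have hxz : x ≠ z := ord_self_ne hL (P := (x, z)) (by simp)
  have key : ∀ P, P ∈ L → sb x z (q ^ 2) (Qf p q P (x, z)) =
      C (-(p ^ 2 * q ^ 6)) * ((lf x P.1 ((q ^ 2)⁻¹) * lf x P.1 ((p ^ 2)⁻¹)) *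
        (lf x P.2 (q ^ 2) * lf x P.2 1)) := by
    intro P hP
    obtain ⟨h1, h2, h3, h4⟩ := hn P hP
    rw [Qf, map_mul, map_mul, map_mul, hom_lf, hom_lf, hom_lf, hom_lf, sb_X_right,
      sb_X_of_ne _ hxz, sb_X_of_ne _ h2, sb_X_of_ne _ h4]
    have e1 : (C (q ^ 2) * C ((q ^ 2)⁻¹) : Pol) = 1 := by
      rw [← C_mul, mul_inv_cancel₀ (pow_ne_zero _ hq), C_1]
    have e2 : (C (p ^ 2) * C ((p ^ 2)⁻¹) : Pol) = 1 := by
      rw [← C_mul, mul_inv_cancel₀ (pow_ne_zero _ hp), C_1]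
    have f1 : (X x - C (q ^ 2) * X P.1 : Pol) =
        -C (q ^ 2) * lf x P.1 ((q ^ 2)⁻¹) := by rw [lf]; linear_combination -X x * e1
    have f2 : (C (q ^ 2) * X x - C (p ^ 2 * q ^ 2) * X P.1 : Pol) =
        -(C (p ^ 2) * C (q ^ 2)) * lf x P.1 ((p ^ 2)⁻¹) := by
      rw [lf, C_mul]; linear_combination -X x * C (q ^ 2) * e2
    rw [f1, f2]
    have e3 : (C (-(p ^ 2 * q ^ 6)) : Pol) = -(C (p ^ 2) * C (q ^ 2) ^ 3) := by
      rw [← C_pow, ← C_mul, ← C_neg]; congr 1; ring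
    rw [e3]
    simp only [lf, C_1]
    ring
  generalize hdc : -(p ^ 2 * q ^ 6) = d at key
  refine ⟨d ^ L.length, by simp [← hdc, hp, hq], ?_⟩
  have hsL : sb x z (q ^ 2) (Psi p q L) = Psi p q L := by
    have : ∀ M : List (ι × ι), (∀ P ∈ M, P ∈ L) → sb x z (q ^ 2) (Psi p q M) = Psi p q M := by
      intro M hM
      induction M with
      | nil => simp [Psi]
      | cons P M ih =>
        rw [Psi, map_mul, ih (fun R hR => hM R (by simp [hR])), map_list_prod, List.map_map]
        congr 2
        apply List.map_congr_left
        intro R hR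
        obtain ⟨-, h1, -, h2⟩ := hn P (hM P (by simp))
        obtain ⟨-, h3, -, h4⟩ := hn R (hM R (by simp [hR]))
        refine (hom_Qf (f := id) fun i hi => ?_)
        simp at hi
        rcases hi with rfl | rfl | rfl | rfl <;> exact sb_X_of_ne _ (by assumption)
    exact this L fun P hP => hP
  rw [IsRed, Psi_append, map_mul, map_mul, hsL, Psi, Psi, map_list_prod, List.map_map]
  simp only [List.map_nil, List.prod_nil, map_one, mul_one, List.map_cons, List.prod_cons]
  have : (L.map (⇑(sb x z (q ^ 2)) ∘ fun P => Qf p q P (x, z))).prod =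
      C (d ^ L.length) * redPi p q x (L.map Prod.fst) (L.map Prod.snd) [] := by
    clear hsL hL hn
    induction L with
    | nil => simp [redPi]
    | cons P L ih =>
      rw [List.map_cons, List.prod_cons, ih (fun R hR => key R (by simp [hR])), Function.comp_apply,
        key P (by simp), List.length_cons, pow_succ d, C_mul, redPi, redPi]
      simp only [List.map_cons, List.prod_cons, List.map_nil, List.prod_nil]
      ring
  rw [this]; ring

lemma Gen.eps {p q : ℂ} (g : Gen p q) : epsPar p ≠ 0 := by
  have h := g.ne 1 0 (-1) 0 (by norm_num)
  rw [epsPar, sub_ne_zero]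
  simpa using h

lemma Gen.tau_eq {p q : ℂ} (g : Gen p q) : tauPar p q * (q ^ 2 * (p ^ 2 - 1)) =
    (1 + q ^ 2) * (p ^ 2 * q ^ 2 - 1) := by
  have he := g.eps
  have hp := g.p0
  have hq := g.q0
  have h := eps_mul_tau (q := q) he
  have h2 : epsPar p * p = p ^ 2 - 1 := by rw [epsPar]; field_simp
  have h3 : aPar p q * (p * q ^ 2) = 1 := by rw [aPar]; field_simp
  have h4 : (aPar p q)⁻¹ = p * q ^ 2 := by rw [aPar]; field_simp
  rw [h4] at h
  linear_combination (-tauPar p q * q ^ 2) * h2 + p * q ^ 2 * h - h3 + q ^ 2 * h2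

lemma Gen.tau {p q : ℂ} (g : Gen p q) : tauPar p q ≠ 0 := by
  intro h
  have e := g.tau_eq
  rw [h, zero_mul] at e
  rcases mul_eq_zero.1 e.symm with h1 | h1
  · apply g.mono 0 4 (by norm_num) (by norm_num) (by norm_num)
    norm_cast
    linear_combination (q ^ 2 - 1) * h1
  · apply g.mono 2 2 (by norm_num) (by norm_num) (by norm_num)
    norm_cast
    linear_combination h1

lemma Gen.lnf_symm_par {p q : ℂ} : aPar p⁻¹ q⁻¹ = (aPar p q)⁻¹ := by
  simp only [aPar, inv_inv, mul_inv, inv_pow]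

lemma epsPar_inv (p : ℂ) : epsPar p⁻¹ = - epsPar p := by
  simp only [epsPar, inv_inv]; ring

lemma tauPar_inv (p q : ℂ) : tauPar p⁻¹ q⁻¹ = tauPar p q := by
  rw [tauPar, tauPar, Gen.lnf_symm_par, epsPar_inv, inv_inv, div_neg, ← neg_div]
  ring

lemma sw_swap (x y : ι) : sw x y = (sw y x : Pol →ₐ[ℂ] Pol) := by
  rw [sw, sw, Equiv.swap_comm]

/-- The two chains along the halves of the explicit polynomial. -/
structure Chains (p q : ℂ) (A0 B0 : List ι) (x y : ι) (A A' : Pol) : Prop where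
  mem : A ∈ ML p q (A0 ++ x :: y :: B0)
  mem' : A' ∈ ML p q (A0 ++ x :: y :: B0)
  blkR : Blk q (y :: B0) A
  blkR' : Blk q (y :: B0) A'
  blkL : Blk q (A0 ++ [x]) A
  blkL' : Blk q (A0 ++ [x]) A'
  dR : Blk q (x :: y :: B0) (X y * A' - C (q ^ 2) * X x * A)
  dL : Blk q (A0 ++ [x, y]) (X y * A' - C (q ^ 2) * X x * A)
  red : ∃ c : ℂ, c ≠ 0 ∧ IsRed p q x y A0 [] B0 A (C c * Psi p q (A0.zip B0))

theorem exists_chains {p q : ℂ} (g : Gen p q) {A0 B0 : List ι} {x y : ι}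
    (hl : (A0 ++ x :: y :: B0).Nodup) (hlen : A0.length = B0.length) :
    Chains p q A0 B0 x y (pR p q 0 (y :: B0) (Psi p q ((A0 ++ [x]).zip (y :: B0))))
      (pR p q (epsPar p) (y :: B0) (Psi p q ((A0 ++ [x]).zip (y :: B0)))) := by
  have hp := g.p0
  have hq := g.q0
  obtain ⟨D, z, hB⟩ : ∃ D z, y :: B0 = D ++ [z] :=
    ⟨(y :: B0).dropLast, (y :: B0).getLast (by simp), (List.dropLast_append_getLast _).symm⟩
  have hDl : A0.length = D.length := by
    have := congrArg List.length hB
    simp at this; omega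
  set L0 := A0.zip D with hL0
  set L := L0 ++ [(x, z)] with hLdef
  have hfst0 : L0.map Prod.fst = A0 := List.map_fst_zip hDl.le
  have hsnd0 : L0.map Prod.snd = D := List.map_snd_zip hDl.ge
  have hfst : L.map Prod.fst = A0 ++ [x] := by rw [hLdef, List.map_append, hfst0]; rfl
  have hsnd : L.map Prod.snd = y :: B0 := by rw [hLdef, List.map_append, hsnd0, hB]; rfl
  have hord : ord L = A0 ++ x :: y :: B0 := by rw [ord, hfst, hsnd]; simp
  have hL : (ord L).Nodup := hord ▸ hl
  have hz : (y :: B0).getLast? = some z := by rw [hB]; simp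
  have hdl : (y :: B0).dropLast = D := by rw [hB]; simp
  obtain ⟨a1, A1, hA⟩ : ∃ a1 A1, A0 ++ [x] = a1 :: A1 :=
    List.exists_cons_of_ne_nil (by simp)
  have hxl : (a1 :: A1).getLast? = some x := by rw [← hA]; simp
  have hnB : (y :: B0).Nodup := by
    refine List.Nodup.sublist ?_ hl
    exact (List.sublist_cons_self _ _).trans (List.sublist_append_right _ _)
  have hnxB : (x :: y :: B0).Nodup := hl.sublist (List.sublist_append_right _ _)
  have hnA : (A0 ++ [x]).Nodup := by
    refine List.Nodup.sublist ?_ hl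
    exact (List.Sublist.refl _).append (by simp)
  have hnAy : (A0 ++ [x, y]).Nodup := by
    refine List.Nodup.sublist ?_ hl
    exact (List.Sublist.refl _).append (by simp)
  have hzip : (A0 ++ [x]).zip (y :: B0) = L := by rw [hB, List.zip_append hDl]; rfl
  rw [hzip]
  set Ψ := Psi p q L with hΨ
  have bB : Blk q (y :: B0) Ψ := by
    have := Psi_blk (p := p) (q := q) (L1 := L) (L2 := [])
    rwa [List.append_nil, List.map_nil, List.nil_append, hsnd] at this
  have bA : Blk q (A0 ++ [x]) Ψ := by
    have := Psi_blk (p := p) (q := q) (L1 := []) (L2 := L)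
    rwa [List.nil_append, List.map_nil, List.append_nil, hfst] at this
  have bxD : Blk q (x :: D) Ψ := by
    have := Psi_blk (p := p) (q := q) (L1 := L0) (L2 := [(x, z)])
    rwa [hsnd0] at this
  have bAy : Blk q (A1 ++ [y]) Ψ := by
    obtain ⟨P, L', hP⟩ : ∃ P L', L = P :: L' := List.exists_cons_of_ne_nil (by simp [hLdef])
    have := Psi_blk (p := p) (q := q) (L1 := [P]) (L2 := L')
    have e1 : P.2 = y := by rw [hP] at hsnd; exact (List.cons.inj hsnd).1
    have e2 : L'.map Prod.fst = A1 := by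
      rw [hP, hA] at hfst; exact (List.cons.inj hfst).2
    rw [hΨ, hP]
    rw [e2] at this
    simpa [e1] using this
  have memΨ : Ψ ∈ ML p q (A0 ++ x :: y :: B0) := hord ▸ Psi_mem hL
  have inB : (y :: B0) <:+: (A0 ++ x :: y :: B0) := ⟨A0 ++ [x], [], by simp⟩
  have inA : (A0 ++ [x]) <:+: (A0 ++ x :: y :: B0) := ⟨[], y :: B0, by simp⟩
  have chain : ∀ c : ℂ, pR p q c (y :: B0) Ψ = pL p q c (A0 ++ [x]) Ψ := by
    intro c
    apply io_injective
    rw [io_pR hq c hnB bB (List.infix_refl _), io_pL hq c hnA bA (List.infix_refl _), ← hfst,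
      ← hsnd]
    exact cR_eq_cL c _ hL fun P R h => TFc_Psi hp hq c hL P R h
  have hyA : y ∉ A0 ++ [x] := by
    intro h
    have : (A0 ++ [x] ++ y :: B0).Nodup := by simpa using hl
    exact (List.nodup_append.1 this).2.2 _ h _ (by simp) rfl
  have hxB : x ∉ y :: B0 := (List.nodup_cons.1 hnxB).1
  set A := pR p q 0 (y :: B0) Ψ with hAdef
  set A' := pR p q (epsPar p) (y :: B0) Ψ with hA'def
  have i1 : io A = cR p q 0 (y :: B0) (io Ψ) := io_pR hq 0 hnB bB (List.infix_refl _)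
  have i2 : io A' = cR p q (epsPar p) (y :: B0) (io Ψ) := io_pR hq _ hnB bB (List.infix_refl _)
  have i3 : io A = cL p q 0 (A0 ++ [x]) (io Ψ) := by
    rw [hAdef, chain]; exact io_pL hq 0 hnA bA (List.infix_refl _)
  have i4 : io A' = cL p q (epsPar p) (A0 ++ [x]) (io Ψ) := by
    rw [hA'def, chain]; exact io_pL hq _ hnA bA (List.infix_refl _)
  have iX : ∀ i, io (X i : Pol) = xF i := fun i => rfl
  have bxB : Blk q (x :: y :: B0) (lf x z (q ^ 2) * Ψ) := by
    rw [blk_cons]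
    refine ⟨fun w hw => ?_, fun a b h => (bB a b h).mul_left _⟩
    rw [hB, List.mem_append, List.mem_singleton] at hw
    rcases hw with hw | rfl
    · exact ((blk_cons.1 bxD).1 w hw).mul_left _
    · exact Dvd.intro _ rfl
  have bAyy : Blk q (A0 ++ [x, y]) (lf a1 y (q ^ 2) * Ψ) := by
    have e : A0 ++ [x, y] = a1 :: (A1 ++ [y]) := by
      rw [← List.cons_append, ← hA]; simp
    rw [e, blk_cons]
    refine ⟨fun w hw => ?_, fun a b h => (bAy a b h).mul_left _⟩
    rw [List.mem_append, List.mem_singleton] at hw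
    rcases hw with hw | rfl
    · have := (blk_cons.1 (hA ▸ bA)).1 w hw
      exact this.mul_left _
    · exact Dvd.intro _ rfl
  have ioD : io (X y * A' - C (q ^ 2) * X x * A) = xF y * io A' - q ^ 2 • (xF x * io A) := by
    rw [map_sub, mul_assoc, ← smul_eq_C_mul, map_smul io (q ^ 2), map_mul, map_mul, iX, iX]
  have r1 : X y * A' - C (q ^ 2) * X x * A = pR p q 0 (y :: B0) (lf x z (q ^ 2) * Ψ) := by
    apply io_injective
    rw [io_pR hq 0 hnxB bxB (List.suffix_cons _ _).isInfix]
    have : io (lf x z (q ^ 2) * Ψ) = xF z * io Ψ - (q ^ 2) • (xF x * io Ψ) := by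
      rw [lf, ← smul_eq_C_mul, map_mul, map_sub, map_smul, iX, iX, sub_mul, smul_mul_assoc]
    rw [this, ioD, map_sub, map_smul, cR_bernstein _ hnB hz, cR_mul _ hxB, ← i1, ← i2]
  have r2 : X y * A' - C (q ^ 2) * X x * A =
      pL p q (epsPar p) (A0 ++ [x]) (lf a1 y (q ^ 2) * Ψ) := by
    apply io_injective
    have inA' : (A0 ++ [x]) <:+: (A0 ++ [x, y]) := ⟨[], [y], by simp⟩
    rw [io_pL hq _ hnAy bAyy inA']
    have : io (lf a1 y (q ^ 2) * Ψ) = xF y * io Ψ - (q ^ 2) • (xF a1 * io Ψ) := by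
      rw [lf, ← smul_eq_C_mul, map_mul, map_sub, map_smul, iX, iX, sub_mul, smul_mul_assoc]
    have e : cL p q (epsPar p) (A0 ++ [x]) (xF a1 * io Ψ) = xF x * io A := by
      rw [i3, hA]
      exact cL_bernstein hp hq _ (hA ▸ hnA) hxl
    rw [this, ioD, map_sub, map_smul, e, cL_mul _ hyA, ← i4]
  refine ⟨pR_mem g 0 hnB hl inB bB memΨ (List.infix_refl _),
    pR_mem g _ hnB hl inB bB memΨ (List.infix_refl _), pR_blk hq 0 hnB bB (List.infix_refl _),
    pR_blk hq _ hnB bB (List.infix_refl _), ?_, ?_, ?_, ?_, ?_⟩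
  · rw [hAdef, chain]; exact pL_blk hq 0 hnA bA (List.infix_refl _)
  · rw [hA'def, chain]; exact pL_blk hq _ hnA bA (List.infix_refl _)
  · rw [r1]; exact pR_blk hq 0 hnxB bxB (List.suffix_cons _ _).isInfix
  · rw [r2]; exact pL_blk hq _ hnAy bAyy ⟨[], [y], by simp⟩
  · obtain ⟨c, hc, hr⟩ := red_Psi hp hq hL
    rw [hfst0, hsnd0] at hr
    have := red_chain (A0 := A0) hp hq B0 [] y (by simpa using hl) hz bB
      (by rw [hdl, List.nil_append]; exact (blk_cons.1 bxD).1)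
      (by rw [hdl, List.nil_append]; exact hr)
    refine ⟨aPar p q ^ B0.length * c, mul_ne_zero (pow_ne_zero _ (aPar_ne_zero hp hq)) hc, ?_⟩
    have e := this.1
    rw [map_mul, rename_C, ← mul_assoc, ← C_mul, rename_Psi] at e
    have ez : (L0.map fun P => (shf (y :: B0) P.1, shf (y :: B0) P.2)) = A0.zip B0 := by
      apply List.zip_of_prod
      · rw [List.map_map]
        conv_rhs => rw [← hfst0]
        apply List.map_congr_left
        intro P hP
        apply shf_of_notMem
        intro h
        have hm : P.1 ∈ A0 := hfst0 ▸ List.mem_map_of_mem hP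
        exact (List.nodup_append.1 hl).2.2 _ hm _ (List.mem_cons_of_mem _ h) rfl
      · have := map_shf hnB
        rw [hdl, ← hsnd0, List.map_map] at this
        rw [List.map_map]
        exact this
    rwa [ez] at e

/-- The symmetric polynomial `F` built from `A`, `A'`, with `G = (A - A') / ε`. -/
structure Seed (p q : ℂ) (l1 : List ι) (x y : ι) (l2 : List ι) (A A' G F χ : Pol) :
    Prop where
  mem : F ∈ ML p q (l1 ++ x :: y :: l2)
  sym : sw x y F = F
  red : IsRed p q x y l1 [] l2 F χ
  dvd : lf x y (q ^ 2) ∣ G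
  diff : epsPar p • G = A - A'
  eq : F = tauPar p q • A + T p q x y G + (aPar p q - epsPar p) • G

/-- A symmetric lift of the explicit polynomial. -/
theorem seed_center {p q : ℂ} (g : Gen p q) {A0 B0 : List ι} {x y : ι}
    (hl : (A0 ++ x :: y :: B0).Nodup) (hlen : A0.length = B0.length) :
    ∃ G F, ∃ c : ℂ, c ≠ 0 ∧ Seed p q A0 x y B0
      (pR p q 0 (y :: B0) (Psi p q ((A0 ++ [x]).zip (y :: B0))))
      (pR p q (epsPar p) (y :: B0) (Psi p q ((A0 ++ [x]).zip (y :: B0)))) G F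
      (C c * Psi p q (A0.zip B0)) := by
  have hp := g.p0
  have hq := g.q0
  have hε := g.eps
  have h := exists_chains g hl hlen
  set A := pR p q 0 (y :: B0) (Psi p q ((A0 ++ [x]).zip (y :: B0)))
  set A' := pR p q (epsPar p) (y :: B0) (Psi p q ((A0 ++ [x]).zip (y :: B0)))
  obtain ⟨hxy, hnd, hx, hy⟩ := red_names (l2 := []) hl
  rw [List.nil_append] at hnd hx hy
  set G := (epsPar p)⁻¹ • (A - A') with hG
  have hGA : epsPar p • G = A - A' := by rw [hG, smul_smul, mul_inv_cancel₀ hε, one_smul]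
  have hGm : G ∈ ML p q (A0 ++ x :: y :: B0) :=
    Submodule.smul_mem _ _ (Submodule.sub_mem _ h.mem h.mem')
  have hGd : lf x y (q ^ 2) ∣ G := by
    have h1 : lf x y (q ^ 2) ∣ X y * (A' - A) := by
      have h2 := h.dR x y (by simp)
      have e : X y * (A' - A) = (X y * A' - C (q ^ 2) * X x * A) - lf x y (q ^ 2) * A := by
        rw [lf]; ring
      rw [e]
      exact dvd_sub h2 (Dvd.intro _ rfl)
    rw [lf_dvd_iff hxy, map_mul, sb_X_right] at h1
    have hne : (C (q ^ 2) * X x : Pol) ≠ 0 :=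
      mul_ne_zero (C_ne_zero' (pow_ne_zero _ hq)) (X_ne_zero x)
    have h3 := (mul_eq_zero.1 h1).resolve_left hne
    rw [lf_dvd_iff hxy, hG, map_smul, ← neg_sub, map_neg, h3, neg_zero, smul_zero]
  set F := tauPar p q • A + T p q x y G + (aPar p q - epsPar p) • G with hF
  have hFm : F ∈ ML p q (A0 ++ x :: y :: B0) :=
    Submodule.add_mem _ (Submodule.add_mem _ (Submodule.smul_mem _ _ h.mem)
      (T_mem g hl hGm hGd)) (Submodule.smul_mem _ _ hGm)
  have he : Even (A0 ++ x :: y :: B0).length := ⟨A0.length + 1, by simp; omega⟩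
  have hF' : F = tauPar p⁻¹ q⁻¹ • A' + T p⁻¹ q⁻¹ y x G + (aPar p⁻¹ q⁻¹ - epsPar p⁻¹) • G := by
    have e1 := eps_mul_tau (q := q) hε
    rw [tauPar_inv, Gen.lnf_symm_par, epsPar_inv, T_reflect hq hxy hGd, hF]
    have e2 : tauPar p q • A = tauPar p q • A' + (epsPar p * tauPar p q) • G := by
      rw [mul_comm, mul_smul, hGA, smul_sub]; abel
    rw [e2, e1]
    module
  have hsym : sw x y F = F := by
    apply sym_of_sides g hl he hFm
    · intro w hw
      have n1 : x ≠ w := fun e => hx (e ▸ List.mem_append_right _ hw)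
      have n2 : y ≠ w := fun e => hy (e ▸ List.mem_append_right _ hw)
      exact seed_side g hε hxy n1 n2 (h.blkR y w (by simp [hw])) (h.blkR' y w (by simp [hw]))
        (h.dR x w (by simp [hw])) hGd hGA
    · intro w hw
      have n1 : x ≠ w := fun e => hx (e ▸ List.mem_append_left _ hw)
      have n2 : y ≠ w := fun e => hy (e ▸ List.mem_append_left _ hw)
      have s1 : [w, x].Sublist (A0 ++ [x]) := (List.singleton_sublist.2 hw).append (List.Sublist.refl [x])
      have s2 : [w, y].Sublist (A0 ++ [x, y]) :=
        (List.singleton_sublist.2 hw).append (by simp : [y].Sublist [x, y])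
      have key := seed_side (A := A') (A' := A) g.symm g.symm.eps hxy.symm n2 n1
        ((lf_dvd_reflect hq).2 (h.blkL' w x s1)) ((lf_dvd_reflect hq).2 (h.blkL w x s1))
        (by
          rw [lf_dvd_reflect hq]
          have e : X x * A - C (q⁻¹ ^ 2) * X y * A' =
              C (-(q ^ 2)⁻¹) * (X y * A' - C (q ^ 2) * X x * A) := by
            have e1 : (C ((q ^ 2)⁻¹) * C (q ^ 2) : Pol) = 1 := by
              rw [← C_mul, inv_mul_cancel₀ (pow_ne_zero _ hq), C_1]
            rw [inv_pow, C_neg]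
            linear_combination -X x * A * e1
          rw [e]
          exact (h.dL w y s2).mul_left _)
        ((lf_dvd_reflect hq).2 hGd) (by rw [epsPar_inv, neg_smul, hGA, neg_sub])
      rw [← hF', sw_swap y x] at key
      exact (lf_dvd_reflect hq).1 key
  obtain ⟨c, hc, hr⟩ := h.red
  refine ⟨G, F, tauPar p q * c, mul_ne_zero g.tau hc, hFm, hsym, ?_, hGd, hGA, hF⟩
  have z1 := (lf_dvd_iff hxy).1 hGd
  have z2 := (lf_dvd_iff hxy).1 (T_dvd (p := p) hq x y G)
  rw [IsRed] at hr ⊢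
  rw [hF, map_add, map_add, map_smul, map_smul, z1, z2, hr, C_mul, smul_eq_C_mul]
  simp only [smul_zero, add_zero]
  ring

theorem exists_seed {p q : ℂ} (g : Gen p q) {A0 B0 : List ι} {x y : ι}
    (hl : (A0 ++ x :: y :: B0).Nodup) (hlen : A0.length = B0.length) :
    ∃ F ∈ ML p q (A0 ++ x :: y :: B0), sw x y F = F ∧
      ∃ c : ℂ, c ≠ 0 ∧ IsRed p q x y A0 [] B0 F (C c * Psi p q (A0.zip B0)) := by
  obtain ⟨G, F, c, hc, h⟩ := seed_center g hl hlen
  exact ⟨F, h.mem, h.sym, c, hc, h.red⟩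

lemma map_swap_map (a b : ι) (l : List ι) : (l.map (Equiv.swap a b)).map (Equiv.swap a b) = l := by
  rw [List.map_map]
  convert List.map_id l
  ext i
  simp

/-! ### Renaming, reduction and divisibility -/

lemma PP.sw {p q : ℂ} {l : List ι} {ψ : Pol} (h : PP p q l ψ) (hl : l.Nodup) (a b : ι) :
    PP p q (l.map (Equiv.swap a b)) (sw a b ψ) := by
  rw [pp_iff]
  intro i j k hs c₁ c₂ hv
  have hs' : [Equiv.swap a b i, Equiv.swap a b j, Equiv.swap a b k].Sublist l := by
    have := hs.map (Equiv.swap a b)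
    rwa [map_swap_map] at this
  obtain ⟨hij, hik, hjk⟩ := nodup3 (hl.map (Equiv.swap a b).injective) hs
  refine h.hom (σ := (tr i j k c₁ c₂).comp (BMWPoly.sw a b)) hs' hv ?_ ?_ <;>
  · simp only [AlgHom.comp_apply, sw_X, Equiv.swap_apply_self]
    rw [tr_X _ _ hik, tr_X _ _ hik]
    simp [hij, hik, hjk.symm]

lemma ML_sw {p q : ℂ} {l : List ι} (hl : l.Nodup) {ψ : Pol} (h : ψ ∈ ML p q l)
    (a b : ι) : sw a b ψ ∈ ML p q (l.map (Equiv.swap a b)) :=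
  ⟨h.1.sw hl a b, (totalDegree_sw _ _ _).trans (by rw [List.length_map]; exact h.2)⟩

lemma Blk.sw {q : ℂ} {l : List ι} {ψ : Pol} (h : Blk q l ψ) (a b : ι) :
    Blk q (l.map (Equiv.swap a b)) (sw a b ψ) := by
  intro i j hs
  have hs' : [Equiv.swap a b i, Equiv.swap a b j].Sublist l := by
    have := hs.map (Equiv.swap a b)
    rwa [map_swap_map] at this
  have := sw_dvd (x := a) (y := b) (h _ _ hs')
  rwa [Equiv.swap_apply_self, Equiv.swap_apply_self] at this

lemma IsRed.dvd {p q : ℂ} (hq : q ≠ 0) {x y a b : ι} {l1 l2 l3 : List ι} {ψ φ : Pol}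
    (h : IsRed p q x y l1 l2 l3 ψ φ) (hx : x ∉ l1 ++ (l2 ++ l3)) (hab : a ≠ b) (hj : Dj x y a b)
    (hd : lf a b (q ^ 2) ∣ ψ) : lf a b (q ^ 2) ∣ φ := by
  rw [lf_dvd_iff hab] at hd ⊢
  have := congrArg (sb a b (q ^ 2)) h
  rw [← sb_sb_comm hj, hd, map_zero, map_mul] at this
  exact (mul_eq_zero.1 this.symm).resolve_left (sb_redPi_ne_zero hq hx hab hj.1 hj.2.1)

/-- Divisibility of the reduction detects divisibility of the reduction at another pair. -/
lemma IsRed.dvd_other {p q : ℂ} (hq : q ≠ 0) {x y a b : ι} {l1 l2 l3 s1 s2 s3 : List ι}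
    {ψ φ χ : Pol} (h : IsRed p q x y l1 l2 l3 ψ φ)
    (h' : IsRed p q a b s1 s2 s3 ψ χ) (ha : a ∉ s1 ++ (s2 ++ s3)) (hxy : x ≠ y) (hab : a ≠ b)
    (hj : Dj x y a b) (hd : lf a b (q ^ 2) ∣ φ) : lf x y (q ^ 2) ∣ χ := by
  rw [lf_dvd_iff hab] at hd
  rw [lf_dvd_iff hxy]
  have e := congrArg (sb a b (q ^ 2)) h
  rw [map_mul, hd, mul_zero, ← sb_sb_comm hj, h', map_mul] at e
  exact (mul_eq_zero.1 e).resolve_left (sb_redPi_ne_zero hq ha hxy hj.symm.1 hj.symm.2.1)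

lemma IsRed.dvd_of_zero {p q : ℂ} {x y : ι} {l1 l2 l3 : List ι} {ψ : Pol}
    (hxy : x ≠ y) (h : IsRed p q x y l1 l2 l3 ψ 0) : lf x y (q ^ 2) ∣ ψ := by
  rw [lf_dvd_iff hxy, h, mul_zero]

lemma IsRed.sub {p q : ℂ} {x y : ι} {l1 l2 l3 : List ι} {ψ φ ψ' φ' : Pol}
    (h : IsRed p q x y l1 l2 l3 ψ φ) (h' : IsRed p q x y l1 l2 l3 ψ' φ') :
    IsRed p q x y l1 l2 l3 (ψ - ψ') (φ - φ') := by
  rw [IsRed] at *; rw [map_sub, h, h', mul_sub]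

lemma isRed_zero_of_dvd {p q : ℂ} {x y : ι} {l1 l2 l3 : List ι} {ψ : Pol}
    (hxy : x ≠ y) (h : lf x y (q ^ 2) ∣ ψ) : IsRed p q x y l1 l2 l3 ψ 0 := by
  rw [IsRed, (lf_dvd_iff hxy).1 h, mul_zero]

lemma blk_concat {q : ℂ} {u : ι} {I : List ι} {ψ : Pol} :
    Blk q (I ++ [u]) ψ ↔ Blk q I ψ ∧ ∀ w ∈ I, lf w u (q ^ 2) ∣ ψ := by
  constructor
  · intro h
    exact ⟨h.sublist (List.sublist_append_left _ _), fun w hw =>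
      h w u ((List.singleton_sublist.2 hw).append (List.Sublist.refl [u]))⟩
  · rintro ⟨h1, h2⟩ a b h
    obtain ⟨s, t, e, hs, ht⟩ := List.sublist_append_iff.1 h
    rcases t with _ | ⟨t0, t⟩
    · rw [List.append_nil] at e; subst e; exact h1 a b hs
    · have : t0 = u ∧ t = [] := by
        have := ht.length_le
        simp at this
        subst this
        simpa using ht
      obtain ⟨rfl, rfl⟩ := this
      rcases s with _ | ⟨s0, s⟩
      · simp at e
      · rcases s with _ | ⟨s1, s⟩
        · simp at e; obtain ⟨rfl, rfl⟩ := e; exact h2 _ (by simpa using hs)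
        · have := congrArg List.length e
          simp at this

lemma T_T_comm {p q : ℂ} (hq : q ≠ 0) {x y a b : ι} (hj : Dj x y a b) (hxy : x ≠ y) (hab : a ≠ b)
    {ψ : Pol} (h1 : lf x y (q ^ 2) ∣ ψ) (h2 : lf a b (q ^ 2) ∣ ψ) :
    T p q x y (T p q a b ψ) = T p q a b (T p q x y ψ) := by
  apply io_injective
  rw [io_T hq hxy (T_dvd_dj hq hj hab hxy h2 h1), io_T hq hab h2,
    io_T hq hab (T_dvd_dj hq hj.symm hxy hab h1 h2), io_T hq hxy h1,
    TF_comm hj.1 hj.2.1 hj.2.2.1 hj.2.2.2]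

/-! ### Reachability -/

/-- What can be reached by linear combinations and moves at neighbouring names of `W`. -/
inductive Reach (p q : ℂ) (W : List ι) (S : Pol → Prop) : Pol → Prop
  | base {ψ} : S ψ → Reach p q W S ψ
  | zero : Reach p q W S 0
  | add {ψ φ} : Reach p q W S ψ → Reach p q W S φ → Reach p q W S (ψ + φ)
  | smul {ψ} (c : ℂ) : Reach p q W S ψ → Reach p q W S (c • ψ)
  | move {ψ} (x y : ι) : [x, y] <:+: W → Reach p q W S ψ → lf x y (q ^ 2) ∣ ψ →
      Reach p q W S (T p q x y ψ)

lemma Reach.sub {p q : ℂ} {W : List ι} {S : Pol → Prop} {ψ φ : Pol}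
    (h : Reach p q W S ψ) (h' : Reach p q W S φ) : Reach p q W S (ψ - φ) := by
  have : ψ - φ = ψ + (-1 : ℂ) • φ := by rw [neg_smul, one_smul, sub_eq_add_neg]
  rw [this]
  exact h.add (h'.smul _)

lemma Reach.trans {p q : ℂ} {W W' : List ι} {S S' : Pol → Prop} (hW : W <:+: W')
    (h : ∀ ψ, S ψ → Reach p q W' S' ψ) {ψ : Pol} (hψ : Reach p q W S ψ) :
    Reach p q W' S' ψ := by
  induction hψ with
  | base hs => exact h _ hs
  | zero => exact .zero
  | add _ _ h1 h2 => exact h1.add h2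
  | smul c _ h1 => exact h1.smul c
  | move x y hxy _ hd h1 => exact .move x y (hxy.trans hW) h1 hd

/-- Minimal polynomials divisible by all pairs of an initial segment. -/
def MB (p q : ℂ) (I J : List ι) (ψ : Pol) : Prop := ψ ∈ ML p q (I ++ J) ∧ Blk q I ψ

lemma MB.zero {p q : ℂ} {I J : List ι} : MB p q I J 0 :=
  ⟨Submodule.zero_mem _, fun _ _ _ => dvd_zero _⟩

lemma MB.add {p q : ℂ} {I J : List ι} {ψ φ : Pol} (h : MB p q I J ψ)
    (h' : MB p q I J φ) : MB p q I J (ψ + φ) := ⟨Submodule.add_mem _ h.1 h'.1, blk_add h.2 h'.2⟩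

lemma MB.sub {p q : ℂ} {I J : List ι} {ψ φ : Pol} (h : MB p q I J ψ)
    (h' : MB p q I J φ) : MB p q I J (ψ - φ) := ⟨Submodule.sub_mem _ h.1 h'.1, blk_sub h.2 h'.2⟩

lemma MB.smul {p q : ℂ} {I J : List ι} {ψ : Pol} (h : MB p q I J ψ) (c : ℂ) :
    MB p q I J (c • ψ) := ⟨Submodule.smul_mem _ _ h.1, blk_smul h.2 c⟩

lemma dj_of_append {I J : List ι} (hn : (I ++ J).Nodup) {x y a b : ι} (hx : x ∈ I) (hy : y ∈ I)
    (ha : a ∈ J) (hb : b ∈ J) : Dj x y a b := by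
  have := (List.nodup_append.1 hn).2.2
  exact ⟨this x hx a ha, this x hx b hb, this y hy a ha, this y hy b hb⟩

lemma T_blk_dj {p q : ℂ} (hq : q ≠ 0) {I J : List ι} (hn : (I ++ J).Nodup) {x y : ι}
    (hxy : [x, y] <:+: J) {ψ : Pol} (hd : lf x y (q ^ 2) ∣ ψ) (h : Blk q I ψ) :
    Blk q I (T p q x y ψ) := by
  intro a b hab
  have ha : a ∈ I := hab.subset (by simp)
  have hb : b ∈ I := hab.subset (by simp)
  have hx : x ∈ J := hxy.subset (by simp)
  have hy : y ∈ J := hxy.subset (by simp)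
  exact T_dvd_dj hq (dj_of_append hn ha hb hx hy) (infix_ne (List.nodup_append.1 hn).2.1 hxy)
    (nodup2 (List.nodup_append.1 hn).1 hab) hd (h a b hab)

lemma MB.T_right {p q : ℂ} (g : Gen p q) {I J : List ι} (hn : (I ++ J).Nodup) {x y : ι}
    (hxy : [x, y] <:+: J) {ψ : Pol} (hd : lf x y (q ^ 2) ∣ ψ) (h : MB p q I J ψ) :
    MB p q I J (T p q x y ψ) :=
  ⟨T_mem_infix g hn (hxy.trans (List.suffix_append _ _).isInfix) h.1 hd,
    T_blk_dj g.q0 hn hxy hd h.2⟩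

lemma MB.T_left {p q : ℂ} (g : Gen p q) {I J : List ι} (hn : (I ++ J).Nodup) {x y : ι}
    (hxy : [x, y] <:+: I) {ψ : Pol} (h : MB p q I J ψ) :
    MB p q I J (T p q x y ψ) :=
  ⟨T_mem_infix g hn (hxy.trans (List.prefix_append _ _).isInfix) h.1 (blk_dvd h.2 hxy),
    T_blk_infix g.q0 (List.nodup_append.1 hn).1 hxy h.2⟩

lemma Reach.mb {p q : ℂ} (g : Gen p q) {I J : List ι} (hn : (I ++ J).Nodup)
    {S : Pol → Prop} (hS : ∀ ψ, S ψ → MB p q I J ψ) {ψ : Pol}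
    (h : Reach p q J S ψ) : MB p q I J ψ := by
  induction h with
  | base hs => exact hS _ hs
  | zero => exact .zero
  | add _ _ h1 h2 => exact h1.add h2
  | smul c _ h1 => exact h1.smul c
  | move x y hxy _ hd h1 => exact h1.T_right g hn hxy hd

/-- Moves on the left preserve what is reachable by moves on the right. -/
lemma Reach.move_left {p q : ℂ} (g : Gen p q) {I J : List ι} (hn : (I ++ J).Nodup)
    {S : Pol → Prop} (hS : ∀ ψ, S ψ → MB p q I J ψ) {x y : ι} (hxy : [x, y] <:+: I)
    (hT : ∀ ψ, S ψ → Reach p q J S (T p q x y ψ)) {ψ : Pol} (h : Reach p q J S ψ) :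
    Reach p q J S (T p q x y ψ) := by
  have hne := infix_ne (List.nodup_append.1 hn).1 hxy
  have hd : ∀ {φ}, Reach p q J S φ → lf x y (q ^ 2) ∣ φ := fun h => blk_dvd (h.mb g hn hS).2 hxy
  induction h with
  | base hs => exact hT _ hs
  | zero => rw [T_zero g.q0 hne]; exact .zero
  | add a1 a2 h1 h2 => rw [T_add g.q0 hne (hd a1) (hd a2)]; exact h1.add h2
  | smul c a1 h1 => rw [T_smul g.q0 hne (hd a1)]; exact h1.smul c
  | move a b hab a1 ha h1 =>
    have hj := dj_of_append hn (hxy.subset (by simp : x ∈ [x, y]))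
      (hxy.subset (by simp : y ∈ [x, y])) (hab.subset (by simp : a ∈ [a, b]))
      (hab.subset (by simp : b ∈ [a, b]))
    have hab' := infix_ne (List.nodup_append.1 hn).2.1 hab
    rw [T_T_comm g.q0 hj hne hab' (hd a1) ha]
    exact .move a b hab h1 (T_dvd_dj g.q0 hj.symm hne hab' (hd a1) ha)

/-! ### Elimination of one name -/

/-- If the reductions at all pairs `v`, `u` lift to a subspace, then modulo that subspace everything
is divisible by the pairs `v`, `u`. -/
lemma eliminate {p q : ℂ} (g : Gen p q) {I J : List ι} {u : ι} (hn : (I ++ u :: J).Nodup)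
    (he : Even (I ++ u :: J).length) {N : Pol → Prop} (h0 : N 0)
    (hadd : ∀ ψ φ, N ψ → N φ → N (ψ + φ))
    (H : ∀ I1 v I2, I = I1 ++ v :: I2 → ∀ ρ, MB p q (I1 ++ I2) J ρ →
      ∃ η, N η ∧ MB p q I (u :: J) η ∧ (∀ w ∈ I2, lf w u (q ^ 2) ∣ η) ∧ IsRed p q v u I1 I2 J η ρ)
    {ψ : Pol} (hψ : MB p q I (u :: J) ψ) :
    ∃ η, N η ∧ MB p q (I ++ [u]) J (ψ - η) := by
  have key : ∀ (I2 I1 : List ι), I = I1 ++ I2 → ∃ η, N η ∧ MB p q I (u :: J) η ∧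
      ∀ w ∈ I2, lf w u (q ^ 2) ∣ ψ - η := by
    intro I2
    induction I2 with
    | nil => exact fun I1 _ => ⟨0, h0, .zero, by simp⟩
    | cons v I2 ih =>
      intro I1 hI
      obtain ⟨η, h1, h2, h3⟩ := ih (I1 ++ [v]) (by simp [hI])
      have hn' : (I1 ++ v :: (I2 ++ u :: J)).Nodup := by simpa [hI] using hn
      have he' : Even (I1 ++ v :: (I2 ++ u :: J)).length := by simpa [hI] using he
      obtain ⟨hvu, hnr, hv, hu⟩ := red_names hn'
      have hm := hψ.sub h2
      have hm1 : ψ - η ∈ ML p q (I1 ++ v :: (I2 ++ u :: J)) := by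
        have := hm.1; rw [hI] at this; simpa using this
      obtain ⟨ρ, hρ, hr⟩ := ML_red g hn' he' hm1 fun w hw =>
        ⟨hm.2 v w (by
          rw [hI]
          exact (((List.singleton_sublist.2 hw).cons_cons v)).trans (List.sublist_append_right _ _)),
          h3 w hw⟩
      have hρ' : MB p q (I1 ++ I2) J ρ := by
        refine ⟨by rw [List.append_assoc]; exact hρ, fun a b hab => ?_⟩
        have ha : a ∈ I1 ++ (I2 ++ J) := by
          rw [← List.append_assoc]; exact List.mem_append_left _ (hab.subset (by simp))
        have hb : b ∈ I1 ++ (I2 ++ J) := by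
          rw [← List.append_assoc]; exact List.mem_append_left _ (hab.subset (by simp))
        have hne : a ≠ b := by
          rw [← List.append_assoc] at hnr
          exact nodup2 (List.nodup_append.1 hnr).1 hab
        refine hr.dvd g.q0 hv hne ⟨fun h => hv (h ▸ ha), fun h => hv (h ▸ hb),
          fun h => hu (h ▸ ha), fun h => hu (h ▸ hb)⟩ (hm.2 a b ?_)
        rw [hI]
        exact hab.trans ((List.Sublist.refl _).append (List.sublist_cons_self _ _))
      obtain ⟨η', k1, k2, k3, k4⟩ := H I1 v I2 hI ρ hρ'
      refine ⟨η + η', hadd _ _ h1 k1, h2.add k2, fun w hw => ?_⟩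
      rw [← sub_sub]
      rcases List.mem_cons.1 hw with rfl | hw
      · apply IsRed.dvd_of_zero hvu (p := p) (l1 := I1) (l2 := I2) (l3 := J)
        have := hr.sub k4
        rwa [sub_self] at this
      · exact dvd_sub (h3 w hw) (k3 w hw)
  obtain ⟨η, h1, h2, h3⟩ := key I [] rfl
  refine ⟨η, h1, ?_, blk_concat.2 ⟨(hψ.sub h2).2, h3⟩⟩
  have := (hψ.sub h2).1
  simpa using this

/-- No minimal polynomial is divisible by all pairs of a segment longer than half. -/
lemma MB.eq_zero {p q : ℂ} (g : Gen p q) (m : ℕ) : ∀ {J I : List ι}, (I ++ J).Nodup →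
    I.length + J.length = 2 * m → m + 1 ≤ I.length → ∀ {ψ}, MB p q I J ψ → ψ = 0 := by
  induction m with
  | zero => intro J I _ h1 h2; omega
  | succ m ihm =>
    intro J
    induction J with
    | nil =>
      intro I hn h1 h2 ψ hψ
      rw [List.append_nil] at hn
      rw [List.length_nil, add_zero] at h1
      by_contra h0
      obtain ⟨f, rfl⟩ := Delta_dvd g.q0 hn hψ.2
      obtain ⟨d1, d2⟩ := Delta_ne_zero (q := q) hn
      have hdeg := hψ.1.2
      rw [List.append_nil, h1, totalDegree_mul_eq d1 (right_ne_zero_of_mul h0), dg] at hdeg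
      rw [h1] at d2
      have e1 : 2 * (m + 1) / 2 = m + 1 := by omega
      have e2 : 2 * (m + 1) - 1 = 2 * m + 1 := by omega
      have e3 : m + 1 - 1 = m := by omega
      rw [e1, e3] at hdeg
      rw [e2] at d2
      nlinarith
    | cons u J ih =>
      intro I hn h1 h2 ψ hψ
      have he : Even (I ++ u :: J).length := ⟨m + 1, by simp at h1 ⊢; omega⟩
      obtain ⟨η, hη, hm⟩ := eliminate g hn he (N := fun ψ => ψ = 0) rfl
        (by rintro _ _ rfl rfl; simp) (by
          intro I1 v I2 hI ρ hρ
          have hsub : (I1 ++ I2 ++ J).Sublist (I ++ u :: J) := by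
            rw [hI]
            exact ((List.Sublist.refl _).append (List.sublist_cons_self _ _)).append
              (List.sublist_cons_self _ _)
          have := ihm (hn.sublist hsub) (by simp [hI] at h1 ⊢; omega) (by simp [hI] at h2 ⊢; omega) hρ
          subst this
          exact ⟨0, rfl, .zero, by simp, by rw [IsRed]; simp⟩) hψ
      subst hη
      rw [sub_zero] at hm
      exact ih (by simpa using hn) (by simp at h1 ⊢; omega) (by simp at h2 ⊢; omega) hm

/-! ### Rotation of lifts -/

lemma scal_redPi {p q : ℂ} (hp : p ≠ 0) (hq : q ≠ 0) {x : ι} {l1 l1' l2 l3 : List ι}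
    (hx : x ∉ l1) (hn : ((l1 ++ l1') ++ (l2 ++ l3)).Nodup) :
    scal l1 (rk p q) (redPi p q x (l1 ++ l1') l2 l3) =
      C ((rk p q ^ 2) ^ l1.length) * redPi p q x l1' l2 (l3 ++ l1) := by
  have hk := rk_ne_zero hp hq
  rw [List.append_assoc] at hn
  have hout : ∀ w ∈ l1' ++ (l2 ++ l3), w ∉ l1 := fun w hw h => (List.nodup_append.1 hn).2.2 w h w hw rfl
  have h1 : ∀ w, w ∉ l1 → ∀ c, scal l1 (rk p q) (lf x w c) = lf x w c := by
    intro w hw c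
    rw [hom_lf, scal_notMem _ hw, scal_notMem _ hx, lf]
  have h2 : ∀ w ∈ l1, ∀ c, scal l1 (rk p q) (lf x w c) = C (rk p q) * lf x w (c * (rk p q)⁻¹) := by
    intro w hw c
    have e : (C (rk p q) * C (rk p q)⁻¹ : Pol) = 1 := by
      rw [← C_mul, mul_inv_cancel₀ hk, C_1]
    rw [hom_lf, scal_mem _ hw, scal_notMem _ hx, lf, C_mul]
    linear_combination C c * X x * e
  have h3 : ∀ (l : List ι) (c d : ℂ), (∀ w ∈ l, w ∉ l1) →
      scal l1 (rk p q) (l.map fun w => lf x w c * lf x w d).prod =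
        (l.map fun w => lf x w c * lf x w d).prod := by
    intro l c d hl
    rw [map_list_prod, List.map_map]
    congr 1
    apply List.map_congr_left
    intro w hw
    rw [Function.comp_apply, map_mul, h1 w (hl w hw), h1 w (hl w hw)]
  have h4 : ∀ l : List ι, (∀ w ∈ l, w ∈ l1) →
      scal l1 (rk p q) (l.map fun w => lf x w ((q ^ 2)⁻¹) * lf x w ((p ^ 2)⁻¹)).prod =
        C ((rk p q ^ 2) ^ l.length) * (l.map fun w => lf x w (q ^ 4) * lf x w (q ^ 2 * p ^ 2)).prod := by
    intro l
    induction l with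
    | nil => simp
    | cons w l ih =>
      intro hl
      have e1 : (q ^ 2)⁻¹ * (rk p q)⁻¹ = q ^ 2 * p ^ 2 := by rw [rk]; field_simp
      have e2 : (p ^ 2)⁻¹ * (rk p q)⁻¹ = q ^ 4 := by rw [rk]; field_simp
      rw [List.map_cons, List.prod_cons, map_mul, ih fun w hw => hl w (by simp [hw]), map_mul,
        h2 w (hl w (by simp)), h2 w (hl w (by simp)), e1, e2, List.length_cons, pow_succ (rk p q ^ 2), C_mul,
        List.map_cons, List.prod_cons, C_pow (rk p q) 2]
      ring
  simp only [redPi, List.map_append, List.prod_append, map_mul]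
  rw [h4 l1 (fun w hw => hw), h3 l1' _ _ (fun w hw => hout w (by simp [hw])),
    h3 l2 _ _ (fun w hw => hout w (by simp [hw])), h3 l3 _ _ (fun w hw => hout w (by simp [hw]))]
  ring

lemma scal_sb {S : List ι} {k : ℂ} {x y : ι} (hx : x ∉ S) (hy : y ∉ S) (c : ℂ)
    (ψ : Pol) : scal S k (sb x y c ψ) = sb x y c (scal S k ψ) :=
  hom_ext_apply (σ := (scal S k).comp (sb x y c)) (τ := (sb x y c).comp (scal S k)) (fun i => by
    simp only [AlgHom.comp_apply]
    by_cases h : i = y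
    · subst h
      rw [sb_X_right, map_mul, hom_C, scal_notMem _ hx, scal_notMem _ hy, sb_X_right]
    · rw [sb_X_of_ne _ h]
      by_cases hi : i ∈ S
      · rw [scal_mem _ hi, map_mul, hom_C, sb_X_of_ne _ h]
      · rw [scal_notMem _ hi, sb_X_of_ne _ h]) ψ

lemma IsRed.rotate {p q : ℂ} (hp : p ≠ 0) (hq : q ≠ 0) {x y : ι} {l1 l1' l2 l3 : List ι}
    (hx : x ∉ l1) (hy : y ∉ l1) (hn : ((l1 ++ l1') ++ (l2 ++ l3)).Nodup) {ψ φ : Pol} :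
    IsRed p q x y (l1 ++ l1') l2 l3 ψ φ ↔ IsRed p q x y l1' l2 (l3 ++ l1) (scal l1 (rk p q) ψ)
      (C ((rk p q ^ 2) ^ l1.length) * scal l1 (rk p q) φ) := by
  have hk := rk_ne_zero hp hq
  have hinj : Function.Injective (scal l1 (rk p q) : Pol →ₐ[ℂ] _) :=
    Function.LeftInverse.injective (g := scal l1 (rk p q)⁻¹) (scal_inv l1 hk)
  rw [IsRed, IsRed, ← scal_sb hx hy, ← hinj.eq_iff, map_mul, scal_redPi hp hq hx hn]
  constructor <;> intro h <;> rw [h] <;> ring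

/-- Symmetric lifts at a pair exist. -/
def HasLift (p q : ℂ) (l1 : List ι) (a b : ι) (l2 : List ι) : Prop :=
  ∀ χ ∈ ML p q (l1 ++ l2), ∃ ζ ∈ ML p q (l1 ++ a :: b :: l2), sw a b ζ = ζ ∧
    IsRed p q a b l1 [] l2 ζ χ

lemma HasLift.rotate {p q : ℂ} (hp : p ≠ 0) (hq : q ≠ 0) {l1 l2 : List ι} {a b : ι}
    (hn : (l1 ++ a :: b :: l2).Nodup) (h : HasLift p q [] a b (l2 ++ l1)) : HasLift p q l1 a b l2 := by
  intro χ hχ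
  have hk := rk_ne_zero hp hq
  obtain ⟨hab, hnr, ha, hb⟩ := red_names (l2 := []) hn
  rw [List.nil_append] at hnr ha hb
  have ha1 : a ∉ l1 := fun h => ha (List.mem_append_left _ h)
  have hb1 : b ∉ l1 := fun h => hb (List.mem_append_left _ h)
  have hc : (rk p q ^ 2) ^ l1.length ≠ 0 := pow_ne_zero _ (pow_ne_zero _ hk)
  have h1 := Submodule.smul_mem _ ((rk p q ^ 2) ^ l1.length) (ML_rotate hp hq hnr hχ)
  obtain ⟨ζ, h2, h3, h4⟩ := h _ h1
  refine ⟨scal l1 (rk p q)⁻¹ ζ, ML_rotate_inv hp hq hn (by simpa using h2), ?_, ?_⟩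
  · rw [← scal_sw (iff_of_false ha1 hb1), h3]
  · have hn2 : ((l1 ++ []) ++ ([] ++ l2)).Nodup := by simpa using hnr
    have := (IsRed.rotate hp hq (l1' := []) (l2 := []) (l3 := l2) ha1 hb1 hn2
      (ψ := scal l1 (rk p q)⁻¹ ζ) (φ := χ)).2 (by
        rw [scal_inv' _ hk]
        rwa [smul_eq_C_mul] at h4)
    simpa using this

/-- The space is generated by the explicit polynomial. -/
def Generated (p q : ℂ) (L : List (ι × ι)) : Prop :=
  ∀ χ ∈ ML p q (ord L), Reach p q (ord L) (fun ψ => ψ = Psi p q L) χ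

lemma seed_front {p q : ℂ} (g : Gen p q) {L : List (ι × ι)} {a b : ι}
    (hn : (a :: b :: ord L).Nodup) : ∃ ζ ∈ ML p q (a :: b :: ord L), sw a b ζ = ζ ∧
      IsRed p q a b [] [] (ord L) ζ (Psi p q L) := by
  have hp := g.p0
  have hq := g.q0
  have hk := rk_ne_zero hp hq
  set E := L.map Prod.snd with hE
  set B := L.map Prod.fst with hB
  have hperm : (E ++ a :: b :: B).Perm (a :: b :: ord L) := by
    rw [ord, ← hE, ← hB]
    exact List.perm_append_comm.trans (by simp)
  have hn' := hperm.nodup_iff.2 hn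
  obtain ⟨F, h1, h2, c, hc, h3⟩ := exists_seed g hn' (by simp [hE, hB])
  obtain ⟨hab, hnr, ha, hb⟩ := red_names (l2 := []) hn'
  rw [List.nil_append] at hnr ha hb
  have ha1 : a ∉ E := fun h => ha (List.mem_append_left _ h)
  have hb1 : b ∉ E := fun h => hb (List.mem_append_left _ h)
  have hz : E.zip B = L.map Prod.swap := by
    symm
    apply List.zip_of_prod <;> rw [List.map_map] <;> rfl
  have hL : (ord L).Nodup := (List.nodup_cons.1 (List.nodup_cons.1 hn).2).2
  have hL' : (ord (L.map Prod.swap)).Nodup := by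
    have : ord (L.map Prod.swap) = E ++ B := by
      rw [ord, List.map_map, List.map_map]; rfl
    rw [this]; exact hnr
  obtain ⟨d, hd, h4⟩ := scal_Psi hp hq hL' (S := E)
    (by
      intro P hP
      obtain ⟨R, hR, rfl⟩ := List.mem_map.1 hP
      exact List.mem_map_of_mem hR)
    (by
      intro P hP
      obtain ⟨R, hR, rfl⟩ := List.mem_map.1 hP
      intro h
      exact (List.nodup_append.1 hL).2.2 _ (List.mem_map_of_mem hR) _ h rfl)
  have hLL : (L.map Prod.swap).map Prod.swap = L := by
    rw [List.map_map]; simp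
  rw [hLL] at h4
  have hn2 : ((E ++ []) ++ ([] ++ B)).Nodup := by simpa using hnr
  have h5 := (IsRed.rotate hp hq (l1' := []) (l2 := []) (l3 := B) ha1 hb1 hn2).1
    (by rw [List.append_nil]; exact h3)
  rw [hz, map_mul, hom_C, h4, ← mul_assoc, ← mul_assoc, ← C_mul, ← C_mul] at h5
  set e := (rk p q ^ 2) ^ E.length * c * d with he
  have he0 : e ≠ 0 := mul_ne_zero (mul_ne_zero (pow_ne_zero _ (pow_ne_zero _ hk)) hc) hd
  refine ⟨e⁻¹ • scal E (rk p q) F, ?_, ?_, ?_⟩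
  · apply Submodule.smul_mem
    have := ML_rotate hp hq hn' h1
    simpa [ord] using this
  · rw [map_smul, ← scal_sw (iff_of_false ha1 hb1), h2]
  · have := h5.smul e⁻¹
    rw [← smul_eq_C_mul, smul_smul, inv_mul_cancel₀ he0, one_smul] at this
    exact this

/-- Divisibilities pass from a polynomial to its symmetric lift. -/
lemma lift_blk {p q : ℂ} (g : Gen p q) {l1 W l3 : List ι} {a b : ι}
    (hn : (l1 ++ (W ++ l3)).Nodup) (he : Even (l1 ++ (W ++ l3)).length)
    (hab : [a, b] <:+: l1 ∨ [a, b] <:+: l3) {ζ χ P : Pol}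
    (hζ : ζ ∈ ML p q (l1 ++ (W ++ l3))) (hs : sw a b ζ = ζ) (hr : sb a b (q ^ 2) ζ = P * χ)
    (hχ : Blk q W χ) : Blk q W ζ := by
  have key : ∀ (N : ℕ) (w1 s2 w3 : List ι) (c e : ι), s2.length ≤ N →
      W = w1 ++ c :: (s2 ++ e :: w3) → lf c e (q ^ 2) ∣ ζ := by
    intro N
    induction N with
    | zero => ?_
    | succ N ih => ?_
    all_goals
      intro w1 s2 w3 c e hN hW
      have e1 : l1 ++ (W ++ l3) = (l1 ++ w1) ++ c :: (s2 ++ e :: (w3 ++ l3)) := by simp [hW]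
      have hb : Btw q c e s2 ζ := by
        intro w hw
        obtain ⟨t1, t2, rfl⟩ := List.append_of_mem hw
        first
          | (exfalso; simp at hN; done)
          | (simp at hN
             exact ⟨ih w1 t1 (t2 ++ e :: w3) c w (by omega) (by simp [hW]),
               ih (w1 ++ c :: t1) t2 w3 w e (by omega) (by simp [hW])⟩)
      have hmem : ∀ i ∈ [a, b], (i ∈ l1 ∨ i ∈ l3) := fun i hi =>
        hab.imp (fun h => h.subset hi) (fun h => h.subset hi)
      have hseg : (a ∈ l1 ++ w1 ↔ b ∈ l1 ++ w1) ∧ (a ∈ s2 ↔ b ∈ s2) ∧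
          (a ∈ w3 ++ l3 ↔ b ∈ w3 ++ l3) := by
        have hnW : ∀ i ∈ [a, b], i ∉ W := by
          intro i hi hiW
          have h2 := (List.nodup_append.1 hn)
          rcases hmem i hi with h | h
          · exact h2.2.2 i h i (List.mem_append_left _ hiW) rfl
          · exact (List.nodup_append.1 h2.2.1).2.2 i hiW i h rfl
        have hx : ∀ i ∈ [a, b], i ∉ w1 ∧ i ∉ s2 ∧ i ∉ w3 := by
          intro i hi
          have := hnW i hi
          rw [hW] at this
          simp only [List.mem_append, List.mem_cons, not_or] at this
          tauto
        obtain ⟨a1, a2, a3⟩ := hx a (by simp)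
        obtain ⟨b1, b2, b3⟩ := hx b (by simp)
        have hl13 : ∀ i, i ∈ l1 → i ∉ l3 := fun i h h' =>
          (List.nodup_append.1 hn).2.2 i h i (List.mem_append_right _ h') rfl
        simp only [List.mem_append, a1, a2, a3, b1, b2, b3, or_false, false_or, iff_self, true_and]
        rcases hab with h | h
        · have ha : a ∈ l1 := h.subset (by simp)
          have hb : b ∈ l1 := h.subset (by simp)
          simp [ha, hb, hl13 a ha, hl13 b hb]
        · have ha : a ∈ l3 := h.subset (by simp)
          have hb : b ∈ l3 := h.subset (by simp)
          have ha' : a ∉ l1 := fun h => hl13 a h ha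
          have hb' : b ∉ l1 := fun h => hl13 b h hb
          simp [ha, hb, ha', hb']
      have ht : ∃ t1 t2, (l1 ++ w1) ++ (s2 ++ (w3 ++ l3)) = t1 ++ a :: b :: t2 := by
        rcases hab with ⟨s, t, h⟩ | ⟨s, t, h⟩
        · exact ⟨s, t ++ (w1 ++ (s2 ++ (w3 ++ l3))), by rw [← h]; simp⟩
        · exact ⟨l1 ++ (w1 ++ (s2 ++ (w3 ++ s))), t, by rw [← h]; simp⟩
      obtain ⟨t1, t2, ht⟩ := ht
      rw [e1] at hn he hζ
      exact natL_dvd g hn he ht hseg hζ hs hr hb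
        (hχ c e (sublist_pair_iff.2 ⟨w1, s2, w3, hW⟩))
  intro c e hce
  obtain ⟨w1, s2, w3, hW⟩ := sublist_pair_iff.1 hce
  exact key s2.length w1 s2 w3 c e le_rfl hW

lemma red_Psi_head {p q : ℂ} (hq : q ≠ 0) {v u : ι} {L : List (ι × ι)}
    (hL : (ord ((v, u) :: L)).Nodup) : ∃ c : ℂ, c ≠ 0 ∧
    IsRed p q v u [] (L.map Prod.fst) (L.map Prod.snd) (Psi p q ((v, u) :: L)) (C c * Psi p q L) := by
  have hn : ∀ P ∈ L, P.1 ≠ v ∧ P.1 ≠ u ∧ P.2 ≠ v ∧ P.2 ≠ u := by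
    intro P hP
    obtain ⟨h1, h2, h3, h4⟩ := ord_cons_ne hL hP
    exact ⟨h1.symm, h3.symm, h2.symm, h4.symm⟩
  have hvu : v ≠ u := ord_self_ne hL (P := (v, u)) (by simp)
  have key : ∀ P, P ∈ L → sb v u (q ^ 2) (Qf p q (v, u) P) =
      C (-(q ^ 2)) * ((lf v P.1 (q ^ 2) * lf v P.1 1) * (lf v P.2 (q ^ 4) * lf v P.2 (q ^ 2 * p ^ 2))) := by
    intro P hP
    obtain ⟨h1, h2, h3, h4⟩ := hn P hP
    rw [Qf, map_mul, map_mul, map_mul, hom_lf, hom_lf, hom_lf, hom_lf, sb_X_right,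
      sb_X_of_ne _ hvu, sb_X_of_ne _ h2, sb_X_of_ne _ h4]
    have e3 : (C (q ^ 4) : Pol) = C (q ^ 2) * C (q ^ 2) := by
      rw [← C_mul]; congr 1; ring
    rw [C_neg]
    simp only [lf, C_1, C_mul, e3]
    ring
  have hd : -(q ^ 2) ≠ 0 := neg_ne_zero.2 (pow_ne_zero _ hq)
  generalize -(q ^ 2) = d at key hd
  refine ⟨d ^ L.length, pow_ne_zero _ hd, ?_⟩
  have hsL : sb v u (q ^ 2) (Psi p q L) = Psi p q L := by
    have : ∀ M : List (ι × ι), (∀ P ∈ M, P ∈ L) → sb v u (q ^ 2) (Psi p q M) = Psi p q M := by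
      intro M hM
      induction M with
      | nil => simp [Psi]
      | cons P M ih =>
        rw [Psi, map_mul, ih (fun R hR => hM R (by simp [hR])), map_list_prod, List.map_map]
        congr 2
        apply List.map_congr_left
        intro R hR
        obtain ⟨-, h1, -, h2⟩ := hn P (hM P (by simp))
        obtain ⟨-, h3, -, h4⟩ := hn R (hM R (by simp [hR]))
        refine (hom_Qf (f := id) fun i hi => ?_)
        simp at hi
        rcases hi with rfl | rfl | rfl | rfl <;> exact sb_X_of_ne _ (by assumption)
    exact this L fun P hP => hP
  rw [IsRed, Psi, map_mul, hsL, map_list_prod, List.map_map]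
  have : (L.map (⇑(sb v u (q ^ 2)) ∘ Qf p q (v, u))).prod =
      C (d ^ L.length) * redPi p q v [] (L.map Prod.fst) (L.map Prod.snd) := by
    clear hsL hL hn
    induction L with
    | nil => simp [redPi]
    | cons P L ih =>
      rw [List.map_cons, List.prod_cons, ih (fun R hR => key R (by simp [hR])), Function.comp_apply,
        key P (by simp), List.length_cons, pow_succ d, C_mul, redPi, redPi]
      simp only [List.map_cons, List.prod_cons, List.map_nil, List.prod_nil]
      ring
  rw [this]; ring

lemma mem_ne_of_not_mem {α : Type} {l : List α} {a b : α} (h : a ∉ l) (hb : b ∈ l) : a ≠ b :=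
  fun e => h (e ▸ hb)

/-- Lifts in the case of a segment of half length. -/
lemma lift_top {p q : ℂ} (g : Gen p q) {v u : ι} {I J : List ι} (hn : (v :: I ++ u :: J).Nodup)
    (hlen : I.length = J.length)
    (hG : ∀ ρ, MB p q I J ρ → Reach p q I (fun ψ => ψ = Psi p q (I.zip J)) ρ)
    {ρ : Pol} (hρ : MB p q I J ρ) :
    ∃ η, Reach p q (v :: I) (fun ψ => ψ = Psi p q ((v, u) :: I.zip J)) η ∧
      MB p q (v :: I) (u :: J) η ∧ Blk q (I ++ [u]) η ∧ IsRed p q v u [] I J η ρ := by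
  set L := I.zip J with hLd
  have hf : L.map Prod.fst = I := List.map_fst_zip hlen.le
  have hs : L.map Prod.snd = J := List.map_snd_zip hlen.ge
  have hord : ord ((v, u) :: L) = v :: I ++ u :: J := by
    rw [ord, List.map_cons, List.map_cons, hf, hs]
  have hL : (ord ((v, u) :: L)).Nodup := hord ▸ hn
  obtain ⟨hvu, hnr, hv, hu⟩ := red_names (l1 := []) hn
  rw [List.nil_append] at hnr hv hu
  have hnI : (I ++ [u]).Nodup := by
    refine hn.sublist ?_
    exact ((List.Sublist.refl I).append (by simp)).trans (List.sublist_cons_self v _)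
  have hnv : (v :: I).Nodup := (List.nodup_append.1 hn).1
  obtain ⟨c, hc, hr⟩ := red_Psi_head (p := p) g.q0 hL
  rw [hf, hs] at hr
  have hbase : MB p q (v :: I) (u :: J) (Psi p q ((v, u) :: L)) := by
    refine ⟨hord ▸ Psi_mem hL, ?_⟩
    have := Psi_blk (p := p) (q := q) (L1 := []) (L2 := (v, u) :: L)
    simpa [hf] using this
  have hbase2 : Blk q (I ++ [u]) (Psi p q ((v, u) :: L)) := by
    have := Psi_blk (p := p) (q := q) (L1 := [(v, u)]) (L2 := L)
    simpa [hf] using this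
  have hR := hG ρ hρ
  clear hρ
  induction hR with
  | base h =>
    refine ⟨c⁻¹ • Psi p q ((v, u) :: L), .smul _ (.base rfl), hbase.smul _, blk_smul hbase2 _, ?_⟩
    have := hr.smul c⁻¹
    rw [← smul_eq_C_mul, smul_smul, inv_mul_cancel₀ hc, one_smul] at this
    rwa [h]
  | zero => exact ⟨0, .zero, .zero, fun _ _ _ => dvd_zero _, by rw [IsRed]; simp⟩
  | add _ _ h1 h2 =>
    obtain ⟨η1, a1, a2, a3, a4⟩ := h1
    obtain ⟨η2, b1, b2, b3, b4⟩ := h2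
    exact ⟨η1 + η2, a1.add b1, a2.add b2, blk_add a3 b3, a4.add b4⟩
  | smul c _ h1 =>
    obtain ⟨η1, a1, a2, a3, a4⟩ := h1
    exact ⟨c • η1, a1.smul c, a2.smul c, blk_smul a3 c, a4.smul c⟩
  | move x y hxy _ hd h1 =>
    obtain ⟨η1, a1, a2, a3, a4⟩ := h1
    have hxy1 : [x, y] <:+: v :: I := hxy.trans (List.suffix_cons _ _).isInfix
    have hxy2 : [x, y] <:+: I ++ [u] := hxy.trans (List.prefix_append _ _).isInfix
    have hdη := blk_dvd a2.2 hxy1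
    have hx : x ∈ I := hxy.subset (by simp)
    have hy : y ∈ I := hxy.subset (by simp)
    have hxJ : x ∉ J := fun h => (List.nodup_append.1 hnr).2.2 x hx x h rfl
    have hyJ : y ∉ J := fun h => (List.nodup_append.1 hnr).2.2 y hy y h rfl
    refine ⟨T p q x y η1, .move x y hxy1 a1 hdη, a2.T_left g hn hxy1,
      T_blk_infix g.q0 hnI hxy2 a3, ?_⟩
    exact natL_T g.q0 (r1 := []) (by simpa using hnr)
      ⟨mem_ne_of_not_mem hv (by simp [hx]), mem_ne_of_not_mem hv (by simp [hy]),
        mem_ne_of_not_mem hu (by simp [hx]), mem_ne_of_not_mem hu (by simp [hy])⟩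
      (infix_ne hnv hxy1) ⟨by simp, by simp [hx, hy], by simp [hxJ, hyJ]⟩ a4 hdη hd

/-- Lifts in the case of a shorter segment. -/
lemma lift_low {p q : ℂ} (g : Gen p q) {v u w : ι} {I J : List ι}
    (hn : (v :: I ++ u :: w :: J).Nodup) (he : Even (v :: I ++ u :: w :: J).length)
    (hE : ∀ ρ, MB p q (I ++ [u]) J ρ → ∃ η, MB p q (v :: (I ++ [u])) (w :: J) η ∧
      Blk q ((I ++ [u]) ++ [w]) η ∧ IsRed p q v w [] (I ++ [u]) J η ρ)
    (hP : ∀ ρ, MB p q I (w :: J) ρ → Reach p q (w :: J) (MB p q (I ++ [w]) J) ρ)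
    (hl : ∀ a b J1 J2, w :: J = J1 ++ a :: b :: J2 → HasLift p q (v :: I ++ u :: J1) a b J2)
    {ρ : Pol} (hρ : MB p q I (w :: J) ρ) :
    ∃ η, Reach p q (u :: w :: J) (MB p q (v :: (I ++ [u])) (w :: J)) η ∧
      Blk q (I ++ [u]) η ∧ IsRed p q v u [] I (w :: J) η ρ := by
  have hp := g.p0
  have hq := g.q0
  obtain ⟨hvu, hnr, hv, hu⟩ := red_names (l1 := []) hn
  rw [List.nil_append] at hnr hv hu
  have hnIJ := List.nodup_append.1 hnr
  have hw : w ∉ I := fun h => hnIJ.2.2 w h w (by simp) rfl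
  have hwJ : w ∉ J := (List.nodup_cons.1 hnIJ.2.1).1
  have huI : u ∉ I := fun h => hu (List.mem_append_left _ h)
  have huw : u ≠ w := mem_ne_of_not_mem hu (by simp)
  have huJ : u ∉ J := fun h => hu (by simp [h])
  have hmb : ∀ {η}, Reach p q (u :: w :: J) (MB p q (v :: (I ++ [u])) (w :: J)) η →
      MB p q (v :: I) (u :: w :: J) η := by
    intro η h
    refine h.mb g hn fun ψ hψ => ⟨by simpa using hψ.1, hψ.2.sublist ?_⟩
    exact (List.sublist_append_left _ _).cons_cons v
  have hnIuw : (I ++ [u, w]).Nodup := by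
    refine hn.sublist ?_
    exact ((List.Sublist.refl I).append (by simp)).trans (List.sublist_cons_self v _)
  have hR := hP ρ hρ
  clear hρ
  induction hR with
  | @base ρ h =>
    have h2 : MB p q (I ++ [u]) J ((aPar p q)⁻¹ • sw u w ρ) := by
      have n1 : ((I ++ [w]) ++ J).Nodup := by simpa using hnr
      have e1 : (I ++ [w]).map (Equiv.swap u w) = I ++ [u] := by
        rw [List.map_append, map_swap_of_notMem huI hw]; simp
      refine MB.smul ⟨?_, ?_⟩ _
      · have := ML_sw n1 h.1 u w
        rwa [List.map_append, e1, map_swap_of_notMem huJ hwJ] at this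
      · have := h.2.sw u w
        rwa [e1] at this
    obtain ⟨η, a1, a2, a3⟩ := hE _ h2
    have a2' : Blk q (I ++ [u, w]) η := by simpa using a2
    have huw' : lf u w (q ^ 2) ∣ η := a2' u w (by simp)
    refine ⟨T p q u w η, .move u w ⟨[], J, rfl⟩ (.base a1) huw', ?_, ?_⟩
    · exact (T_blk_infix hq hnIuw ⟨I, [], by simp⟩ a2').sublist ((List.Sublist.refl _).append (by simp))
    · have hm := moveR_right hp hq (l1 := []) (l2 := I) (l3 := J) hn huw'
        (a1.2 v u (by simp)) a3
      rw [map_smul, sw_sw, ← smul_eq_C_mul, smul_smul, mul_inv_cancel₀ (aPar_ne_zero hp hq),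
        one_smul] at hm
      exact hm
  | zero => exact ⟨0, .zero, fun _ _ _ => dvd_zero _, by rw [IsRed]; simp⟩
  | add _ _ h1 h2 =>
    obtain ⟨η1, a1, a3, a4⟩ := h1
    obtain ⟨η2, b1, b3, b4⟩ := h2
    exact ⟨η1 + η2, a1.add b1, blk_add a3 b3, a4.add b4⟩
  | smul c _ h1 =>
    obtain ⟨η1, a1, a3, a4⟩ := h1
    exact ⟨c • η1, a1.smul c, blk_smul a3 c, a4.smul c⟩
  | @move ρ a b hab _ hd h1 =>
    obtain ⟨η, a1, a3, a4⟩ := h1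
    have a2 := hmb a1
    obtain ⟨J1, J2, hJ⟩ := infix_pair hab
    have haJ : a ∈ w :: J := hab.subset (by simp)
    have hbJ : b ∈ w :: J := hab.subset (by simp)
    have hne : a ≠ b := infix_ne hnIJ.2.1 hab
    have hj : Dj v u a b := ⟨mem_ne_of_not_mem hv (List.mem_append_right _ haJ),
      mem_ne_of_not_mem hv (List.mem_append_right _ hbJ),
      mem_ne_of_not_mem hu (List.mem_append_right _ haJ),
      mem_ne_of_not_mem hu (List.mem_append_right _ hbJ)⟩
    have eL : v :: I ++ u :: w :: J = (v :: I ++ u :: J1) ++ a :: b :: J2 := by rw [hJ]; simp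
    have hn2 : ((v :: I ++ u :: J1) ++ a :: b :: J2).Nodup := eL ▸ hn
    have he2 : Even ((v :: I ++ u :: J1) ++ a :: b :: J2).length := eL ▸ he
    obtain ⟨-, hnr2, ha2, hb2⟩ := red_names (l2 := []) hn2
    have hm2 : η ∈ ML p q ((v :: I ++ u :: J1) ++ a :: b :: J2) := eL ▸ a2.1
    obtain ⟨χ, hχ, hrχ⟩ := ML_red g (l2 := []) hn2 he2 hm2 (by simp [Btw])
    obtain ⟨ζ, hζ, hζs, hζr⟩ := hl a b J1 J2 hJ χ (by simpa using hχ)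
    have hmemL : ∀ i ∈ v :: (I ++ [u]), i ∈ (v :: I ++ u :: J1) ++ ([] ++ J2) := by
      intro i hi
      simp at hi ⊢; tauto
    have hjc : ∀ c e, [c, e].Sublist (v :: (I ++ [u])) → c ≠ e ∧ Dj a b c e := by
      intro c e hce
      have h1 := hmemL c (hce.subset (by simp))
      have h2 := hmemL e (hce.subset (by simp))
      refine ⟨nodup2 (hn.sublist ?_) hce, mem_ne_of_not_mem ha2 h1, mem_ne_of_not_mem ha2 h2,
        mem_ne_of_not_mem hb2 h1, mem_ne_of_not_mem hb2 h2⟩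
      exact ((List.Sublist.refl I).append (by simp)).cons_cons v
    have hχd : Blk q (v :: (I ++ [u])) χ := by
      have hη : ∀ c e, [c, e].Sublist (v :: (I ++ [u])) → lf c e (q ^ 2) ∣ η →
          lf c e (q ^ 2) ∣ χ := fun c e hce h => hrχ.dvd hq ha2 (hjc c e hce).1 (hjc c e hce).2 h
      rw [blk_cons]
      refine ⟨fun i hi => ?_, fun c e hce => hη c e (hce.cons v) (a3 c e hce)⟩
      have hvi : [v, i].Sublist (v :: (I ++ [u])) := (List.singleton_sublist.2 hi).cons_cons v
      rw [List.mem_append, List.mem_singleton] at hi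
      rcases hi with hi | rfl
      · exact hη v i hvi (a2.2 v i ((List.singleton_sublist.2 hi).cons_cons v))
      · exact a4.dvd_other hq hrχ ha2 hvu hne hj hd
    have eW : (v :: I ++ u :: J1) ++ a :: b :: J2 = [] ++ ((v :: (I ++ [u])) ++ (J1 ++ a :: b :: J2)) := by
      simp
    have hζd : Blk q (v :: (I ++ [u])) ζ :=
      lift_blk g (l1 := []) (l3 := J1 ++ a :: b :: J2) (eW ▸ hn2) (eW ▸ he2)
        (Or.inr ⟨J1, J2, by simp⟩) (eW ▸ hζ) hζs hζr hχd
    have hζm : MB p q (v :: (I ++ [u])) (w :: J) ζ := by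
      refine ⟨?_, hζd⟩
      rw [hJ]
      simpa using hζ
    have hdiff : lf a b (q ^ 2) ∣ η - ζ := by
      apply IsRed.dvd_of_zero hne (p := p)
      have := hrχ.sub hζr
      rwa [sub_self] at this
    have hRd : Reach p q (u :: w :: J) (MB p q (v :: (I ++ [u])) (w :: J)) (η - ζ) :=
      a1.sub (.base hζm)
    have hab' : [a, b] <:+: u :: w :: J := hab.trans (List.suffix_cons _ _).isInfix
    have hnIu : ((I ++ [u]) ++ w :: J).Nodup := by
      have := (List.nodup_cons.1 hn).2
      simpa using this
    refine ⟨T p q a b (η - ζ), .move a b hab' hRd hdiff, ?_, ?_⟩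
    · exact T_blk_dj hq hnIu hab hdiff (blk_sub a3 (hζd.sublist (List.sublist_cons_self _ _)))
    · have hr0 : IsRed p q v u [] I (w :: J) (η - ζ) ρ := by
        have := a4.sub (isRed_zero_of_dvd (p := p) (l1 := []) (l2 := I) (l3 := w :: J) hvu
          (hζd v u ((List.singleton_sublist.2 (by simp)).cons_cons v)))
        rwa [sub_zero] at this
      have haI : a ∉ I := fun h => hnIJ.2.2 a h a haJ rfl
      have hbI : b ∉ I := fun h => hnIJ.2.2 b h b hbJ rfl
      exact natL_T hq (r1 := []) (by simpa using hnr) hj hne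
        ⟨by simp, by simp [haI, hbI], iff_of_true haJ hbJ⟩ hr0 hdiff hd

/-- Lifts at the first pair spread to lifts at all pairs. -/
lemma lift_spread {p q : ℂ} (g : Gen p q) {I J : List ι} {u : ι} (hn : (I ++ u :: J).Nodup)
    {N : Pol → Prop}
    (hT : ∀ ψ, N ψ → MB p q I (u :: J) ψ → ∀ x y, [x, y] <:+: I → N (T p q x y ψ))
    (hf : ∀ v I2, I = v :: I2 → ∀ ρ, MB p q I2 J ρ → ∃ η, N η ∧ MB p q I (u :: J) η ∧
      (∀ w ∈ I2, lf w u (q ^ 2) ∣ η) ∧ IsRed p q v u [] I2 J η ρ) (I1 : List ι) :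
    ∀ v I2, I = I1 ++ v :: I2 → ∀ ρ, MB p q (I1 ++ I2) J ρ →
      ∃ η, N η ∧ MB p q I (u :: J) η ∧ (∀ w ∈ I2, lf w u (q ^ 2) ∣ η) ∧
        IsRed p q v u I1 I2 J η ρ := by
  have hp := g.p0
  have hq := g.q0
  induction I1 using List.reverseRecOn with
  | nil => exact hf
  | append_singleton I1 x ih =>
    intro v I2 hI ρ hρ
    have hI' : I = I1 ++ x :: (v :: I2) := by rw [hI]; simp
    have hn2 : (I1 ++ x :: v :: (I2 ++ u :: J)).Nodup := by rw [hI'] at hn; simpa using hn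
    have hnx : (I1 ++ x :: (I2 ++ J)).Nodup :=
      hn2.sublist ((List.Sublist.refl _).append
        ((((List.Sublist.refl I2).append (List.sublist_cons_self u J)).cons v).cons_cons x))
    obtain ⟨hxv, -, hx, hv⟩ := red_names (l2 := []) hn2
    rw [List.nil_append] at hx hv
    simp only [List.mem_append, List.mem_cons, not_or] at hx hv
    have hc : p * q ^ 2 ≠ 0 := mul_ne_zero hp (pow_ne_zero _ hq)
    have h2 : MB p q (I1 ++ (v :: I2)) J ((p * q ^ 2)⁻¹ • sw x v ρ) := by
      have n1 : ((I1 ++ [x]) ++ I2 ++ J).Nodup := by simpa using hnx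
      have e1 : ((I1 ++ [x]) ++ I2).map (Equiv.swap x v) = I1 ++ v :: I2 := by
        rw [List.map_append, List.map_append, map_swap_of_notMem hx.1 hv.1,
          map_swap_of_notMem hx.2.1 hv.2.1]
        simp
      refine MB.smul ⟨?_, ?_⟩ _
      · have := ML_sw n1 hρ.1 x v
        rwa [List.map_append, e1, map_swap_of_notMem hx.2.2.2 hv.2.2.2] at this
      · have := hρ.2.sw x v
        rwa [e1] at this
    obtain ⟨η, a1, a2, a3, a4⟩ := ih x (v :: I2) hI' _ h2
    have hxvI : [x, v] <:+: I := ⟨I1, I2, by rw [hI]; simp⟩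
    have hd := blk_dvd a2.2 hxvI
    have hm := moveR_left hp hq hn2 hd (a3 v (by simp)) a4
    rw [map_smul, sw_sw, ← smul_eq_C_mul, smul_smul, mul_inv_cancel₀ hc, one_smul] at hm
    refine ⟨T p q x v η, hT η a1 a2 x v hxvI, a2.T_left g hn hxvI, fun w hw => ?_, hm⟩
    have hwu : w ≠ u := by
      rintro rfl
      have := (List.nodup_append.1 hn).2.2 w (by rw [hI]; simp [hw]) w (by simp)
      exact this rfl
    exact T_dvd_dj hq ⟨(mem_ne_of_not_mem hx.2.1 hw).symm, (mem_ne_of_not_mem hv.2.1 hw).symm,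
      fun h => hx.2.2.1 h.symm, fun h => hv.2.2.1 h.symm⟩ hxv hwu hd (a3 w (by simp [hw]))

/-- Generation of the polynomials divisible on a segment of half length. -/
def GenTop (p q : ℂ) (m : ℕ) (ι : Type) [DecidableEq ι] : Prop :=
  ∀ I J : List ι, (I ++ J).Nodup → I.length = m → J.length = m → ∀ ψ, MB p q I J ψ →
    Reach p q I (fun ψ => ψ = Psi p q (I.zip J)) ψ

/-- Generation of the polynomials divisible on a shorter segment. -/
def GenLow (p q : ℂ) (m : ℕ) (ι : Type) [DecidableEq ι] : Prop :=
  ∀ (I : List ι) (w : ι) (J : List ι), (I ++ w :: J).Nodup → (I ++ w :: J).length = 2 * m →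
    I.length < m → ∀ ψ, MB p q I (w :: J) ψ → Reach p q (w :: J) (MB p q (I ++ [w]) J) ψ

/-- Lifts at all neighbouring pairs. -/
def Lifts (p q : ℂ) (m : ℕ) (ι : Type) [DecidableEq ι] : Prop :=
  ∀ (l1 : List ι) (a b : ι) (l2 : List ι), (l1 ++ a :: b :: l2).Nodup →
    (l1 ++ a :: b :: l2).length = 2 * m → HasLift p q l1 a b l2

lemma genTop_zero (p q : ℂ) : GenTop p q 0 ι := by
  intro I J hn hI hJ ψ hψ
  have eI := List.length_eq_zero_iff.1 hI
  have eJ := List.length_eq_zero_iff.1 hJ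
  subst eI eJ
  have h1 : ψ.totalDegree = 0 := by
    have := hψ.1.2
    simpa [dg] using this
  have : ψ = (ψ.coeff 0) • Psi p q ([] : List (ι × ι)) := by
    rw [Psi, smul_eq_C_mul, mul_one]
    exact totalDegree_eq_zero_iff_eq_C.1 h1
  rw [this]
  exact .smul _ (.base rfl)

lemma genTop_succ {p q : ℂ} (g : Gen p q) {m : ℕ} (h : GenTop p q m ι) : GenTop p q (m + 1) ι := by
  intro I J hn hI hJ ψ hψ
  obtain ⟨u, J, rfl⟩ := List.exists_cons_of_length_eq_add_one hJ
  have hJ' : J.length = m := by simpa using hJ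
  have he : Even (I ++ u :: J).length := ⟨m + 1, by simp [hI, hJ']⟩
  obtain ⟨η, h1, h2⟩ := eliminate g hn he
    (N := Reach p q I (fun ψ => ψ = Psi p q (I.zip (u :: J)))) .zero (fun _ _ => .add)
    (fun I1 v I2 hI2 => lift_spread g hn
      (fun ψ hψ hm x y hxy => .move x y hxy hψ (blk_dvd hm.2 hxy))
      (by
        rintro v I2 rfl ρ hρ
        have hI2 : I2.length = m := by simpa using hI
        have hn2 : (I2 ++ J).Nodup := (red_names (l1 := []) hn).2.1
        obtain ⟨η, a1, a2, a3, a4⟩ := lift_top g hn (hI2.trans hJ'.symm)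
          (fun ρ hρ => h I2 J hn2 hI2 hJ' ρ hρ) hρ
        exact ⟨η, a1, a2, (blk_concat.1 a3).2, a4⟩) I1 v I2 hI2) hψ
  have hz := MB.eq_zero g (m + 1) (J := J) (I := I ++ [u]) (by simpa using hn)
    (by simp [hI, hJ']; omega) (by simp [hI]) h2
  rw [sub_eq_zero] at hz
  rw [hz]
  exact h1

lemma reach_of_gen {p q : ℂ} {m : ℕ} (h1 : GenTop p q m ι) (h2 : GenLow p q m ι) (J : List ι) :
    ∀ I : List ι, (I ++ J).Nodup → (I ++ J).length = 2 * m → I.length ≤ m → ∀ ψ, MB p q I J ψ →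
      Reach p q (I ++ J) (fun ψ => ψ = Psi p q (((I ++ J).take m).zip ((I ++ J).drop m))) ψ := by
  induction J with
  | nil =>
    intro I hn hl hI ψ hψ
    rw [List.append_nil] at hl
    have : m = 0 := by omega
    subst this
    have hI0 := List.length_eq_zero_iff.1 (by omega : I.length = 0)
    subst hI0
    exact h1 [] [] hn rfl rfl ψ hψ
  | cons w J ih =>
    intro I hn hl hI ψ hψ
    rcases hI.eq_or_lt with hI | hI
    · have := h1 I (w :: J) hn hI (by simp at hl ⊢; omega) ψ hψ
      refine this.trans (List.prefix_append _ _).isInfix fun φ hφ => .base ?_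
      rw [hφ, List.take_left' hI, List.drop_left' hI]
    · refine (h2 I w J hn hl hI ψ hψ).trans (List.suffix_append _ _).isInfix fun φ hφ => ?_
      have := ih (I ++ [w]) (by simpa using hn) (by simpa using hl) (by simp; omega) φ hφ
      simpa using this

lemma generated {p q : ℂ} {m : ℕ} (h1 : GenTop p q m ι) (h2 : GenLow p q m ι) {l : List ι}
    (hn : l.Nodup) (hl : l.length = 2 * m) : ∃ L, ord L = l ∧ Generated p q L := by
  have e : ord ((l.take m).zip (l.drop m)) = l := by
    rw [ord, List.map_fst_zip (by simp; omega), List.map_snd_zip (by simp; omega),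
      List.take_append_drop]
  refine ⟨_, e, ?_⟩
  intro χ hχ
  rw [e] at hχ ⊢
  exact reach_of_gen h1 h2 l [] hn hl (by simp) χ ⟨hχ, fun a b h => by simp at h⟩

lemma lifts_succ {p q : ℂ} (g : Gen p q) {m : ℕ} (h1 : GenTop p q m ι) (h2 : GenLow p q m ι) :
    Lifts p q (m + 1) ι := by
  intro l1 a b l2 hn hl
  apply HasLift.rotate g.p0 g.q0 hn
  have hperm : (l1 ++ a :: b :: l2).Perm (a :: b :: (l2 ++ l1)) :=
    List.perm_append_comm.trans (by simp)
  have hn' := hperm.nodup_iff.1 hn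
  have hl' : (l2 ++ l1).length = 2 * m := by simp at hl ⊢; omega
  generalize l2 ++ l1 = l at *
  have hnl : l.Nodup := (List.nodup_cons.1 (List.nodup_cons.1 hn').2).2
  obtain ⟨L, rfl, hL⟩ := generated h1 h2 hnl hl'
  have hn'' : ([] ++ a :: ([] ++ b :: ord L)).Nodup := hn'
  obtain ⟨hab, -, ha, hb⟩ := red_names hn''
  simp only [List.nil_append] at ha hb
  have he : Even (a :: b :: ord L).length := ⟨m + 1, by simp [hl']; omega⟩
  intro χ hχ
  have hR := hL χ hχ
  clear hχ
  induction hR with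
  | base h =>
    obtain ⟨ζ, k1, k2, k3⟩ := seed_front g hn'
    exact ⟨ζ, k1, k2, h ▸ k3⟩
  | zero => exact ⟨0, Submodule.zero_mem _, map_zero _, by rw [IsRed]; simp⟩
  | add _ _ h1 h2 =>
    obtain ⟨η1, a1, a2, a3⟩ := h1
    obtain ⟨η2, b1, b2, b3⟩ := h2
    exact ⟨η1 + η2, Submodule.add_mem _ a1 b1, by rw [map_add, a2, b2], a3.add b3⟩
  | smul c _ h1 =>
    obtain ⟨η1, a1, a2, a3⟩ := h1
    exact ⟨c • η1, Submodule.smul_mem _ _ a1, by rw [map_smul, a2], a3.smul c⟩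
  | move x y hxy _ hd h1 =>
    obtain ⟨ζ, a1, a2, a3⟩ := h1
    obtain ⟨s, t, hst⟩ := infix_pair hxy
    have hx : x ∈ ord L := hxy.subset (by simp)
    have hy : y ∈ ord L := hxy.subset (by simp)
    have hne := infix_ne hnl hxy
    have e : a :: b :: ord L = (a :: b :: s) ++ ([x, y] ++ t) := by rw [hst]; simp
    have hj : Dj a b x y := ⟨mem_ne_of_not_mem ha hx, mem_ne_of_not_mem ha hy,
      mem_ne_of_not_mem hb hx, mem_ne_of_not_mem hb hy⟩
    have hbl := lift_blk g (a := a) (b := b) (e ▸ hn') (e ▸ he) (Or.inl ⟨[], s, by simp⟩)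
      (by rw [← e]; exact a1) a2 a3 (W := [x, y]) (by
        intro c d hcd
        have := hcd.eq_of_length (by simp)
        simp at this
        obtain ⟨rfl, rfl⟩ := this
        exact hd)
    have hdζ : lf x y (q ^ 2) ∣ ζ := hbl x y (List.Sublist.refl _)
    have hxy' : [x, y] <:+: a :: b :: ord L :=
      hxy.trans ((List.suffix_cons _ _).trans (List.suffix_cons _ _)).isInfix
    refine ⟨T p q x y ζ, T_mem_infix g hn' hxy' a1 hdζ, ?_, ?_⟩
    · rw [sw_T_of_dj g.q0 hj hne hdζ, a2]
    · exact natL_T g.q0 (r1 := []) (r2 := []) hnl hj hne ⟨by simp, by simp, iff_of_true hx hy⟩ a3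
        hdζ hd

lemma lift_exists {p q : ℂ} (g : Gen p q) {m : ℕ} (h1 : GenTop p q m ι) (h2 : GenLow p q m ι)
    (h3 : Lifts p q (m + 1) ι) (J : List ι) : ∀ (I : List ι) (v u : ι),
    (v :: I ++ u :: J).Nodup → (v :: I ++ u :: J).length = 2 * (m + 1) → I.length ≤ m →
    ∀ ρ, MB p q I J ρ → ∃ η, MB p q (v :: I) (u :: J) η ∧ Blk q (I ++ [u]) η ∧
      IsRed p q v u [] I J η ρ ∧ (I.length < m →
        Reach p q (u :: J) (MB p q (v :: (I ++ [u])) J) η) := by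
  induction J with
  | nil =>
    intro I v u hn hl hI ρ hρ
    have hI0 : I.length = m := by simp at hl; omega
    have hm0 : m = 0 := by simp at hl; omega
    subst hm0
    have hn2 : (I ++ []).Nodup := (red_names (l1 := []) hn).2.1
    obtain ⟨η, a1, a2, a3, a4⟩ := lift_top g hn (by simp [hI0])
      (fun ρ hρ => h1 I [] hn2 hI0 rfl ρ hρ) hρ
    exact ⟨η, a2, a3, a4, fun h => absurd h (by omega)⟩
  | cons w J ih =>
    intro I v u hn hl hI ρ hρ
    have hn2 : (I ++ w :: J).Nodup := (red_names (l1 := []) hn).2.1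
    rcases hI.eq_or_lt with hI | hI
    · have hJ : (w :: J).length = m := by simp at hl ⊢; omega
      obtain ⟨η, a1, a2, a3, a4⟩ := lift_top g hn (by rw [hI, hJ])
        (fun ρ hρ => h1 I (w :: J) hn2 hI hJ ρ hρ) hρ
      exact ⟨η, a2, a3, a4, fun h => absurd h (by omega)⟩
    · obtain ⟨η, a1, a2, a3⟩ := lift_low g hn ⟨m + 1, by rw [hl]; omega⟩
        (fun ρ hρ => by
          obtain ⟨η, b1, b2, b3, -⟩ := ih (I ++ [u]) v w (by simpa using hn) (by simpa using hl)
            (by simp; omega) ρ hρ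
          exact ⟨η, b1, b2, b3⟩)
        (h2 I w J hn2 (by simp at hl ⊢; omega) hI)
        (fun a b J1 J2 hJ => h3 _ a b J2 (by rw [hJ] at hn; simpa using hn)
          (by rw [hJ] at hl; simpa using hl)) hρ
      refine ⟨η, ?_, a2, a3, fun _ => a1⟩
      refine a1.mb g hn fun ψ hψ => ⟨by simpa using hψ.1, hψ.2.sublist ?_⟩
      exact (List.sublist_append_left _ _).cons_cons v

lemma genLow_succ {p q : ℂ} (g : Gen p q) {m : ℕ} (h1 : GenTop p q m ι) (h2 : GenLow p q m ι) :
    GenLow p q (m + 1) ι := by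
  have h3 := lifts_succ g h1 h2
  intro I u J hn hl hI ψ hψ
  have hS : ∀ ψ, MB p q (I ++ [u]) J ψ → MB p q I (u :: J) ψ := fun ψ hψ =>
    ⟨by simpa using hψ.1, hψ.2.sublist (List.sublist_append_left _ _)⟩
  have he : Even (I ++ u :: J).length := ⟨m + 1, by rw [hl]; omega⟩
  obtain ⟨η, k1, k2⟩ := eliminate g hn he
    (N := Reach p q (u :: J) (MB p q (I ++ [u]) J)) .zero (fun _ _ => .add)
    (fun I1 v I2 hI2 => lift_spread g hn
      (fun ψ hψ hm x y hxy => hψ.move_left g hn hS hxy fun φ hφ =>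
        .base (hφ.T_left g (by simpa using hn) (hxy.trans (List.prefix_append _ _).isInfix)))
      (by
        rintro v I2 rfl ρ hρ
        have hI2 : I2.length < m := by simpa using hI
        obtain ⟨η, a1, a2, a3, a4⟩ := lift_exists g h1 h2 h3 J I2 v u hn hl hI2.le ρ hρ
        exact ⟨η, a4 hI2, a1, (blk_concat.1 a2).2, a3⟩) I1 v I2 hI2) hψ
  have : ψ = (ψ - η) + η := by ring
  rw [this]
  exact (Reach.base k2).add k1

/-- The minimal space is generated by the explicit polynomial. -/
theorem gen_all {p q : ℂ} (g : Gen p q) (m : ℕ) : GenTop p q m ι ∧ GenLow p q m ι := by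
  induction m with
  | zero => exact ⟨genTop_zero p q, fun _ _ _ _ _ h => absurd h (by omega)⟩
  | succ m ih => exact ⟨genTop_succ g ih.1, genLow_succ g ih.1 ih.2⟩

/-- Symmetric lifts exist at all neighbouring pairs. -/
theorem hasLift {p q : ℂ} (g : Gen p q) {l1 l2 : List ι} {a b : ι}
    (hn : (l1 ++ a :: b :: l2).Nodup) (he : Even (l1 ++ a :: b :: l2).length) :
    HasLift p q l1 a b l2 := by
  obtain ⟨m, hm⟩ := he
  obtain ⟨k, rfl⟩ : ∃ k, m = k + 1 := ⟨m - 1, by simp at hm; omega⟩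
  exact lifts_succ g (gen_all g k).1 (gen_all g k).2 l1 a b l2 hn (by omega)

/-! ### Rotated seeds -/

/-- The shifted Hecke operator. -/
def tc (p q c : ℂ) (x y : ι) (f : Pol) : Pol := T p q x y f - c • f

lemma io_tc {p q : ℂ} (hq : q ≠ 0) {x y : ι} (h : x ≠ y) {ψ : Pol}
    (hd : lf x y (q ^ 2) ∣ ψ) (c : ℂ) : io (tc p q c x y ψ) = TFc p q c x y (io ψ) :=
  io_T_shift hq h hd c

lemma tc_dvd {p q : ℂ} (hq : q ≠ 0) (c : ℂ) {x y : ι} {ψ : Pol}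
    (hd : lf x y (q ^ 2) ∣ ψ) : lf x y (q ^ 2) ∣ tc p q c x y ψ :=
  dvd_sub (T_dvd hq x y ψ) (dvd_smul_of_dvd c hd)

lemma tc_smul {p q : ℂ} (hq : q ≠ 0) (c k : ℂ) {x y : ι} (h : x ≠ y) {ψ : Pol}
    (hd : lf x y (q ^ 2) ∣ ψ) : tc p q c x y (k • ψ) = k • tc p q c x y ψ := by
  rw [tc, tc, T_smul hq h hd, smul_sub, smul_comm c k]

lemma scal_tc {p q : ℂ} (hq : q ≠ 0) (c : ℂ) {S : List ι} {k : ℂ} (hk : k ≠ 0) {x y : ι}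
    (hS : x ∈ S ↔ y ∈ S) (h : x ≠ y) {ψ : Pol} (hd : lf x y (q ^ 2) ∣ ψ) :
    scal S k (tc p q c x y ψ) = tc p q c x y (scal S k ψ) := by
  rw [tc, tc, map_sub, map_smul, scal_T hq hS hk h hd]

lemma pR_smul {p q : ℂ} (hq : q ≠ 0) (c k : ℂ) {W : List ι} (hW : W.Nodup) {ψ : Pol}
    (hψ : Blk q W ψ) : ∀ {B : List ι}, B <:+: W → pR p q c B (k • ψ) = k • pR p q c B ψ
  | [], _ => rfl
  | [_], _ => rfl
  | a :: b :: l, h => by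
    have hb := pR_blk (p := p) hq c hW hψ (infix_tail h)
    change tc p q c a b (pR p q c (b :: l) (k • ψ)) = k • tc p q c a b (pR p q c (b :: l) ψ)
    rw [pR_smul hq c k hW hψ (infix_tail h),
      tc_smul hq c k (infix_ne hW (infix_head h)) (blk_dvd hb (infix_head h))]

lemma scal_pR {p q : ℂ} (hq : q ≠ 0) (c : ℂ) {S : List ι} {k : ℂ} (hk : k ≠ 0) {W : List ι}
    (hW : W.Nodup) (hS : ∀ i ∈ W, i ∉ S) {ψ : Pol} (hψ : Blk q W ψ) :
    ∀ {B : List ι}, B <:+: W → scal S k (pR p q c B ψ) = pR p q c B (scal S k ψ)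
  | [], _ => rfl
  | [_], _ => rfl
  | a :: b :: l, h => by
    have hb := pR_blk (p := p) hq c hW hψ (infix_tail h)
    have hm := (infix_head h).subset
    change scal S k (tc p q c a b (pR p q c (b :: l) ψ)) =
      tc p q c a b (pR p q c (b :: l) (scal S k ψ))
    rw [scal_tc hq c hk (iff_of_false (hS a (hm (by simp))) (hS b (hm (by simp))))
      (infix_ne hW (infix_head h)) (blk_dvd hb (infix_head h)),
      scal_pR hq c hk hW hS hψ (infix_tail h)]

lemma pL_smul {p q : ℂ} (hq : q ≠ 0) (c k : ℂ) {W : List ι} (hW : W.Nodup) :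
    ∀ {B : List ι} {ψ : Pol}, Blk q W ψ → B <:+: W →
      pL p q c B (k • ψ) = k • pL p q c B ψ
  | [], _, _, _ => rfl
  | [_], _, _, _ => rfl
  | a :: b :: l, ψ, hψ, h => by
    change pL p q c (b :: l) (tc p q c a b (k • ψ)) = k • pL p q c (b :: l) (tc p q c a b ψ)
    rw [tc_smul hq c k (infix_ne hW (infix_head h)) (blk_dvd hψ (infix_head h))]
    exact pL_smul hq c k hW (blk_sub (T_blk_infix hq hW (infix_head h) hψ) (blk_smul hψ c))
      (infix_tail h)

lemma scal_blk {q : ℂ} {S : List ι} {k : ℂ} (hk : k ≠ 0) {W : List ι} (hS : ∀ i ∈ W, i ∉ S)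
    {ψ : Pol} (hψ : Blk q W ψ) : Blk q W (scal S k ψ) := fun a b h =>
  (scal_lf_dvd (iff_of_false (hS a (h.subset (by simp))) (hS b (h.subset (by simp)))) hk).2
    (hψ a b h)

lemma scal_pL {p q : ℂ} (hq : q ≠ 0) (c : ℂ) {S : List ι} {k : ℂ} (hk : k ≠ 0) {W : List ι}
    (hW : W.Nodup) (hS : ∀ i ∈ W, i ∉ S) : ∀ {B : List ι} {ψ : Pol}, Blk q W ψ →
      B <:+: W → scal S k (pL p q c B ψ) = pL p q c B (scal S k ψ)
  | [], _, _, _ => rfl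
  | [_], _, _, _ => rfl
  | a :: b :: l, ψ, hψ, h => by
    have hm := (infix_head h).subset
    change scal S k (pL p q c (b :: l) (tc p q c a b ψ)) =
      pL p q c (b :: l) (tc p q c a b (scal S k ψ))
    rw [← scal_tc hq c hk (iff_of_false (hS a (hm (by simp))) (hS b (hm (by simp))))
      (infix_ne hW (infix_head h)) (blk_dvd hψ (infix_head h))]
    exact scal_pL hq c hk hW hS
      (blk_sub (T_blk_infix hq hW (infix_head h) hψ) (blk_smul hψ c)) (infix_tail h)

lemma scal_injective (S : List ι) {k : ℂ} (hk : k ≠ 0) : Function.Injective (scal S k) :=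
  Function.LeftInverse.injective (scal_inv S hk)

lemma Seed.rotate_iff {p q : ℂ} (g : Gen p q) {H l1 l2 : List ι} {x y : ι}
    (hn : (H ++ l1 ++ x :: y :: l2).Nodup) {A A' G F χ : Pol} :
    Seed p q (H ++ l1) x y l2 A A' G F χ ↔ Seed p q l1 x y (l2 ++ H) (scal H (rk p q) A)
      (scal H (rk p q) A') (scal H (rk p q) G) (scal H (rk p q) F)
      (C ((rk p q ^ 2) ^ H.length) * scal H (rk p q) χ) := by
  have hp := g.p0
  have hq := g.q0
  have hk := rk_ne_zero hp hq
  have hi := scal_injective H hk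
  obtain ⟨hxy, hnd, hx, hy⟩ := red_names (l2 := []) hn
  rw [List.nil_append] at hnd hx hy
  have hx' : x ∉ H := fun h => hx (by simp [h])
  have hy' : y ∉ H := fun h => hy (by simp [h])
  have hS : x ∈ H ↔ y ∈ H := iff_of_false hx' hy'
  have hr := IsRed.rotate hp hq (x := x) (y := y) (l1 := H) (l1' := l1) (l2 := []) (l3 := l2) hx' hy'
    (by simpa using hnd) (ψ := F) (φ := χ)
  have hm : F ∈ ML p q (H ++ l1 ++ x :: y :: l2) ↔
      scal H (rk p q) F ∈ ML p q (l1 ++ x :: y :: (l2 ++ H)) := by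
    have := ML_rotate_iff hp hq (l1 := H) (l2 := l1 ++ x :: y :: l2) (by simpa using hn) (ψ := F)
    simp only [List.append_assoc, List.cons_append] at this ⊢
    exact this.symm
  constructor
  · intro h
    refine ⟨hm.1 h.mem, by rw [← scal_sw hS, h.sym], hr.1 h.red, (scal_lf_dvd hS hk).2 h.dvd, ?_, ?_⟩
    · rw [← map_smul, h.diff, map_sub]
    · rw [← scal_T hq hS hk hxy h.dvd, ← map_smul, ← map_smul, ← map_add, ← map_add, ← h.eq]
  · intro h
    have hd := (scal_lf_dvd hS hk).1 h.dvd
    refine ⟨hm.2 h.mem, hi (by rw [scal_sw hS, h.sym]), hr.2 h.red, hd, hi ?_, hi ?_⟩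
    · rw [map_smul, h.diff, map_sub]
    · rw [h.eq, map_add, map_add, map_smul, map_smul, scal_T hq hS hk hxy hd]

lemma Seed.smul {p q : ℂ} (hq : q ≠ 0) {l1 l2 : List ι} {x y : ι} (hxy : x ≠ y)
    {A A' G F χ : Pol} (h : Seed p q l1 x y l2 A A' G F χ) (k : ℂ) :
    Seed p q l1 x y l2 (k • A) (k • A') (k • G) (k • F) (k • χ) := by
  refine ⟨Submodule.smul_mem _ _ h.mem, by rw [map_smul, h.sym], h.red.smul k,
    dvd_smul_of_dvd k h.dvd, ?_, ?_⟩
  · rw [smul_comm, h.diff, smul_sub]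
  · rw [T_smul hq hxy h.dvd, h.eq]; module

lemma scal_Psi_cons {p q : ℂ} (hp : p ≠ 0) (hq : q ≠ 0) {h b : ι} {L : List (ι × ι)}
    (hn : (ord ((h, b) :: L)).Nodup) : ∃ c : ℂ, c ≠ 0 ∧
      scal [h] (rk p q) (Psi p q ((h, b) :: L)) = C c * Psi p q (L ++ [(b, h)]) := by
  have key : ∃ d : ℂ, d ≠ 0 ∧ ∀ R ∈ L, scal [h] (rk p q) (Qf p q (h, b) R) =
      C d * Qf p q R (b, h) := by
    have hk := rk_ne_zero hp hq
    refine ⟨(rk p q * q ^ 2) * (rk p q * (p ^ 2 * q ^ 2)), by simp [hp, hq, hk], fun R hR => ?_⟩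
    obtain ⟨n1, n2, n3, n4⟩ := ord_cons_ne hn hR
    have n5 := ord_self_ne hn (P := (h, b)) (by simp)
    have a1 : scal [h] (rk p q) (X h) = C (rk p q) * X h := scal_mem _ (by simp)
    have a2 : scal [h] (rk p q) (X b) = X b := scal_notMem _ (by simpa using n5.symm)
    have b1 : scal [h] (rk p q) (X R.1) = X R.1 := scal_notMem _ (by simpa using n1.symm)
    have b2 : scal [h] (rk p q) (X R.2) = X R.2 := scal_notMem _ (by simpa using n2.symm)
    rw [Qf, Qf, map_mul, map_mul, map_mul, hom_lf, hom_lf, hom_lf, hom_lf, a1, a2, b1, b2]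
    simp only [lf]
    have r1 : (C (rk p q * q ^ 2) * C (p ^ 2 * q ^ 2) : Pol) = 1 := by
      rw [← C_mul, ← C_1]; congr 1; rw [rk]; field_simp
    simp only [C_mul, C_pow] at r1 ⊢
    generalize (C (rk p q) : Pol) = K at *
    have e1 : (X R.1 - C q ^ 2 * (K * X h) : Pol) =
        -(K * C q ^ 2) * (X h - C p ^ 2 * C q ^ 2 * X R.1) := by linear_combination -X R.1 * r1
    have e2 : (X R.2 - C p ^ 2 * C q ^ 2 * (K * X h) : Pol) =
        -(K * (C p ^ 2 * C q ^ 2)) * (X h - C q ^ 2 * X R.2) := by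
      linear_combination -X R.2 * r1
    rw [e1, e2]
    ring
  obtain ⟨d, hd, hQ⟩ := key
  have hs : scal [h] (rk p q) (Psi p q L) = Psi p q L := by
    have hh : h ∉ ord L := by
      have := (ord_cons_perm (h, b) L).nodup_iff.1 hn
      exact fun hm => (List.nodup_cons.1 this).1 (List.mem_cons_of_mem _ hm)
    have : ∀ L' : List (ι × ι), h ∉ ord L' → scal [h] (rk p q) (Psi p q L') = Psi p q L' := by
      intro L'
      induction L' with
      | nil => intro _; simp [Psi]
      | cons P L' ih =>
        intro hm
        have hP : ∀ R ∈ P :: L', h ≠ R.1 ∧ h ≠ R.2 := fun R hR =>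
          ⟨fun e => hm (List.mem_append_left _ (e ▸ List.mem_map_of_mem hR)),
            fun e => hm (List.mem_append_right _ (e ▸ List.mem_map_of_mem hR))⟩
        have hX : ∀ i, h ≠ i → scal [h] (rk p q) (X i) = X i := fun i hi =>
          scal_notMem _ (by simpa using hi.symm)
        have h1 := hP P (by simp)
        rw [Psi, map_mul, map_list_prod, List.map_map, ih]
        · congr 2
          refine List.map_congr_left fun R hR => ?_
          have h2 := hP R (by simp [hR])
          rw [Function.comp_apply, Qf, map_mul, map_mul, map_mul, hom_lf, hom_lf, hom_lf, hom_lf,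
            hX _ h1.1, hX _ h1.2, hX _ h2.1, hX _ h2.2]
          rfl
        · intro hm'
          have := (ord_cons_perm P L').mem_iff (a := h)
          exact hm (this.2 (by simp [hm']))
    exact this L hh
  refine ⟨d ^ L.length, pow_ne_zero _ hd, ?_⟩
  have e : (L.map fun P => ([(b, h)].map (Qf p q P)).prod) = L.map fun P => Qf p q P (b, h) :=
    List.map_congr_left fun P _ => by simp
  rw [Psi, map_mul, hs, Psi_append, e, map_list_prod, List.map_map]
  have : (L.map (scal [h] (rk p q) ∘ Qf p q (h, b))).prod =
      C (d ^ L.length) * (L.map fun P => Qf p q P (b, h)).prod := by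
    clear e hs hn
    induction L with
    | nil => simp
    | cons R L ih =>
      simp only [List.map_cons, List.prod_cons, List.length_cons]
      rw [ih (fun R' hR' => hQ R' (by simp [hR'])), Function.comp_apply, hQ R (by simp), pow_succ,
        C_mul]
      ring
  rw [this]
  simp only [Psi, List.map_nil, List.prod_nil, mul_one]
  ring

lemma cR_comm {p q : ℂ} (c : ℂ) {x y : ι} : ∀ {A : List ι}, x ∉ A → y ∉ A → ∀ f : Fr ι,
    cR p q c A (TFc p q c x y f) = TFc p q c x y (cR p q c A f)
  | [], _, _, _ => rfl
  | [_], _, _, _ => rfl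
  | a :: b :: s, hx, hy, f => by
    simp only [List.mem_cons, not_or] at hx hy
    have hj : Dj a b x y := ⟨fun h => hx.1 h.symm, fun h => hy.1 h.symm, fun h => hx.2.1 h.symm,
      fun h => hy.2.1 h.symm⟩
    have ih := cR_comm (p := p) (q := q) c (x := x) (y := y) (A := b :: s) (by simp [hx])
      (by simp [hy]) f
    rw [cR, Module.End.mul_apply, Module.End.mul_apply, ih, TFc_comm c hj]

lemma cR_concat {p q c : ℂ} {w h : ι} : ∀ (D : List ι) (f : Fr ι),
    cR p q c (D ++ [w, h]) f = cR p q c (D ++ [w]) (TFc p q c w h f)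
  | [], _ => rfl
  | [_], _ => rfl
  | a :: b :: D, f => by
    have := cR_concat (p := p) (q := q) (c := c) (w := w) (h := h) (b :: D) f
    change TFc p q c a b (cR p q c (b :: D ++ [w, h]) f) = _
    rw [this]
    rfl

lemma pR_dvd_dj {p q : ℂ} (hq : q ≠ 0) (c : ℂ) {x y : ι} (hxy : x ≠ y) {W : List ι} (hW : W.Nodup)
    (hx : x ∉ W) (hy : y ∉ W) {ψ : Pol} (hψ : Blk q W ψ) (hd : lf x y (q ^ 2) ∣ ψ) :
    ∀ {B : List ι}, B <:+: W → lf x y (q ^ 2) ∣ pR p q c B ψ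
  | [], _ => hd
  | [_], _ => hd
  | a :: b :: l, h => by
    have ih := pR_dvd_dj (p := p) hq c hxy hW hx hy hψ hd (infix_tail h)
    have hb := blk_dvd (pR_blk (p := p) hq c hW hψ (infix_tail h)) (infix_head h)
    have hm := (infix_head h).subset
    have n : ∀ i j, i ∈ [a, b] → j ∉ W → j ≠ i := fun i j hi hj e => hj (e ▸ hm hi)
    exact dvd_sub (T_dvd_dj hq ⟨n a x (by simp) hx, n b x (by simp) hx, n a y (by simp) hy,
      n b y (by simp) hy⟩ (infix_ne hW (infix_head h)) hxy hb ih) (dvd_smul_of_dvd c ih)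

lemma pL_dvd_dj {p q : ℂ} (hq : q ≠ 0) (c : ℂ) {x y : ι} (hxy : x ≠ y) {W : List ι} (hW : W.Nodup)
    (hx : x ∉ W) (hy : y ∉ W) : ∀ {B : List ι} {ψ : Pol}, Blk q W ψ →
    lf x y (q ^ 2) ∣ ψ → B <:+: W → lf x y (q ^ 2) ∣ pL p q c B ψ
  | [], _, _, hd, _ => hd
  | [_], _, _, hd, _ => hd
  | a :: b :: l, ψ, hψ, hd, h => by
    have hb := blk_dvd hψ (infix_head h)
    have hm := (infix_head h).subset
    have n : ∀ i j, i ∈ [a, b] → j ∉ W → j ≠ i := fun i j hi hj e => hj (e ▸ hm hi)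
    exact pL_dvd_dj (p := p) hq c hxy hW hx hy (B := b :: l)
      (blk_sub (T_blk_infix hq hW (infix_head h) hψ) (blk_smul hψ c))
      (dvd_sub (T_dvd_dj hq ⟨n a x (by simp) hx, n b x (by simp) hx, n a y (by simp) hy,
        n b y (by simp) hy⟩ (infix_ne hW (infix_head h)) hxy hb hd) (dvd_smul_of_dvd c hd))
      (infix_tail h)

lemma ord_zip {A B : List ι} (h : A.length = B.length) : ord (A.zip B) = A ++ B := by
  rw [ord, List.map_fst_zip h.le, List.map_snd_zip h.ge]

lemma zip_snoc {A B : List ι} (h : A.length = B.length) (x y : ι) :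
    (A ++ [x]).zip (B ++ [y]) = A.zip B ++ [(x, y)] := by rw [List.zip_append h]; rfl

/-- Divisibility of `Psi` on the two halves. -/
lemma Psi_blk_halves {p q : ℂ} {A B : List ι} (h : A.length = B.length) :
    Blk q A (Psi p q (A.zip B)) ∧ Blk q B (Psi p q (A.zip B)) := by
  have h1 := Psi_blk (p := p) (q := q) (L1 := []) (L2 := A.zip B)
  have h2 := Psi_blk (p := p) (q := q) (L1 := A.zip B) (L2 := [])
  rw [List.nil_append, List.map_nil, List.append_nil, List.map_fst_zip h.le] at h1
  rw [List.append_nil, List.map_nil, List.nil_append, List.map_snd_zip h.ge] at h2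
  exact ⟨h1, h2⟩

theorem seed_right {p q : ℂ} (g : Gen p q) {h x y z : ι} {Y W : List ι}
    (hl : (h :: Y ++ x :: y :: z :: W).Nodup) (hlen : Y.length = W.length) :
    ∃ G F, ∃ c : ℂ, c ≠ 0 ∧ Seed p q (h :: Y ++ [x]) y z W
      (tc p q 0 x y (pR p q 0 (z :: W) (Psi p q ((h :: Y ++ [x]).zip (y :: z :: W)))))
      (tc p q (epsPar p) x y
        (pR p q (epsPar p) (z :: W) (Psi p q ((h :: Y ++ [x]).zip (y :: z :: W))))) G F
      (C c * Psi p q ((h :: Y).zip (x :: W))) := by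
  have hp := g.p0
  have hq := g.q0
  have hk := rk_ne_zero hp hq
  have hperm : (h :: Y ++ x :: y :: z :: W).Perm ((Y ++ [x]) ++ y :: z :: (W ++ [h])) := by
    have := (List.perm_append_comm (l₁ := [h]) (l₂ := Y ++ x :: y :: z :: W))
    simpa using this
  have hl' := hperm.nodup_iff.1 hl
  have hpermW : (h :: Y ++ x :: y :: z :: W).Perm (x :: y :: (z :: W) ++ (h :: Y)) :=
    List.perm_append_comm
  have hlW := hpermW.nodup_iff.1 hl
  have hnW : (x :: y :: z :: W).Nodup := hlW.sublist (List.sublist_append_left _ _)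
  have hyW : y ∉ z :: W := (List.nodup_cons.1 (List.nodup_cons.1 hnW).2).1
  have hxW : x ∉ z :: W := fun hm => (List.nodup_cons.1 hnW).1 (List.mem_cons_of_mem _ hm)
  have hxy : x ≠ y := fun e => (List.nodup_cons.1 hnW).1 (by simp [e])
  have hyz : y ≠ z := fun e => hyW (by simp [e])
  have hW : (z :: W).Nodup := (List.nodup_cons.1 (List.nodup_cons.1 hnW).2).2
  have hhW : ∀ i ∈ x :: y :: z :: W, i ∉ [h] := by
    intro i hi hm
    rw [List.mem_singleton] at hm
    exact (List.nodup_cons.1 hl).1 (hm ▸ List.mem_append_right _ hi)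
  set L2 := (Y ++ [x]).zip (z :: W) with hL2
  have hL2l : (Y ++ [x]).length = (z :: W).length := by simp [hlen]
  have e1 : (h :: Y ++ [x]).zip (y :: z :: W) = (h, y) :: L2 := rfl
  have e2 : (Y ++ [x] ++ [y]).zip (z :: (W ++ [h])) = L2 ++ [(y, h)] := by
    rw [← List.cons_append]; exact zip_snoc hL2l y h
  have o1 : (ord ((h, y) :: L2)).Nodup := by
    rw [← e1, ord_zip (by simp [hlen])]; simpa using hl
  have hL : (ord (L2 ++ [(y, h)])).Nodup := by
    rw [← e2, ord_zip (by simp [hlen])]; simpa using hl'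
  obtain ⟨c1, hc1, s1⟩ := scal_Psi_cons hp hq o1
  rw [e1]
  set Ψ := Psi p q ((h, y) :: L2) with hΨ
  set Ψr := Psi p q (L2 ++ [(y, h)]) with hΨr
  obtain ⟨D, w, hD⟩ : ∃ D w, z :: W = D ++ [w] :=
    ⟨(z :: W).dropLast, (z :: W).getLast (by simp), (List.dropLast_append_getLast _).symm⟩
  have hDl : Y.length = D.length := by
    have := congrArg List.length hD
    simp at this; omega
  have bΨr := (e2 ▸ Psi_blk_halves (p := p) (q := q) (A := Y ++ [x] ++ [y])
    (B := z :: (W ++ [h])) (by simp [hlen]) : Blk q _ Ψr ∧ Blk q _ Ψr)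
  have bΨ := (Psi_blk_halves (p := p) (q := q) (A := h :: Y ++ [x]) (B := y :: z :: W)
    (by simp [hlen])).2
  rw [e1] at bΨ
  have inW : z :: W <:+: z :: (W ++ [h]) := ⟨[], [h], by simp⟩
  have bW : Blk q (z :: W) Ψr := bΨr.2.sublist inW.sublist
  have dxy : lf x y (q ^ 2) ∣ Ψr := bΨr.1 x y (by simp)
  have hWh : (z :: (W ++ [h])).Nodup := (List.nodup_cons.1 (List.nodup_append.1 hl').2.1).2
  have dR : ∀ c, lf x y (q ^ 2) ∣ pR p q c (z :: W) Ψr := fun c =>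
    pR_dvd_dj hq c hxy hW hxW hyW bW dxy (List.infix_refl _)
  have chain : ∀ c, pR p q c (z :: (W ++ [h])) Ψr = tc p q c x y (pR p q c (z :: W) Ψr) := by
    intro c
    apply io_injective
    rw [io_pR hq c hWh bΨr.2 (List.infix_refl _), io_tc hq hxy (dR c),
      io_pR hq c hW bW (List.infix_refl _), ← cR_comm c hxW hyW, ← List.cons_append, hD,
      List.append_assoc]
    change cR p q c (D ++ [w, h]) _ = _
    have hx2 : L2 ++ [(y, h)] = Y.zip D ++ [(x, w), (y, h)] := by
      rw [hL2, hD, zip_snoc hDl, List.append_assoc]; rfl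
    rw [cR_concat, TFc_Psi hp hq c hL (x, w) (y, h)
      (hx2 ▸ ⟨Y.zip D, [], by simp⟩)]
  have hsc : ∀ c, scal [h] (rk p q) (tc p q c x y (pR p q c (z :: W) Ψ)) =
      c1 • pR p q c (z :: (W ++ [h])) Ψr := by
    intro c
    have b1 : Blk q (z :: W) Ψ := bΨ.sublist (List.sublist_cons_self _ _)
    have d1 : lf x y (q ^ 2) ∣ pR p q c (z :: W) Ψ := by
      rw [← scal_lf_dvd (iff_of_false (hhW x (by simp)) (hhW y (by simp))) hk,
        scal_pR hq c hk hW (fun i hi => hhW i (by simp at hi ⊢; tauto)) b1 (List.infix_refl _), s1,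
        ← smul_eq_C_mul, pR_smul hq c c1 hW bW (List.infix_refl _)]
      exact dvd_smul_of_dvd _ (dR c)
    rw [scal_tc hq c hk (iff_of_false (hhW x (by simp)) (hhW y (by simp))) hxy d1,
      scal_pR hq c hk hW (fun i hi => hhW i (by simp at hi ⊢; tauto)) b1 (List.infix_refl _), s1,
      ← smul_eq_C_mul, pR_smul hq c c1 hW bW (List.infix_refl _), tc_smul hq c c1 hxy (dR c), chain]
  obtain ⟨G, F, c2, hc2, hS⟩ := seed_center g hl' (by simp [hlen])
  rw [e2] at hS
  have hS := hS.smul hq hyz c1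
  rw [← hsc 0, ← hsc (epsPar p)] at hS
  have o2 : (ord ((h, x) :: Y.zip W)).Nodup := by
    have : ord ((h, x) :: Y.zip W) = h :: Y ++ x :: W := by
      change ord ((h :: Y).zip (x :: W)) = _
      rw [ord_zip (by simp [hlen])]
    rw [this]
    exact hl.sublist ((List.Sublist.refl _).append (((List.sublist_cons_self z W).trans
      (List.sublist_cons_self y _)).cons_cons x))
  obtain ⟨c3, hc3, s3⟩ := scal_Psi_cons hp hq o2
  have hk2 : (rk p q ^ 2) ^ [h].length ≠ 0 := pow_ne_zero _ (pow_ne_zero _ hk)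
  refine ⟨scal [h] (rk p q)⁻¹ (c1 • G), scal [h] (rk p q)⁻¹ (c1 • F),
    ((rk p q ^ 2) ^ [h].length)⁻¹ * c3⁻¹ * c1 * c2,
    mul_ne_zero (mul_ne_zero (mul_ne_zero (inv_ne_zero hk2) (inv_ne_zero hc3)) hc1) hc2, ?_⟩
  have hrot := Seed.rotate_iff g (H := [h]) (l1 := Y ++ [x]) (x := y) (y := z) (l2 := W)
    (by simpa using hl) (A := tc p q 0 x y (pR p q 0 (z :: W) Ψ))
    (A' := tc p q (epsPar p) x y (pR p q (epsPar p) (z :: W) Ψ))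
    (G := scal [h] (rk p q)⁻¹ (c1 • G)) (F := scal [h] (rk p q)⁻¹ (c1 • F))
    (χ := C (((rk p q ^ 2) ^ [h].length)⁻¹ * c3⁻¹ * c1 * c2) * Psi p q ((h, x) :: Y.zip W))
  rw [scal_inv' _ hk, scal_inv' _ hk] at hrot
  refine hrot.2 ?_
  have e4 : C ((rk p q ^ 2) ^ [h].length) * scal [h] (rk p q)
      (C (((rk p q ^ 2) ^ [h].length)⁻¹ * c3⁻¹ * c1 * c2) * Psi p q ((h, x) :: Y.zip W)) =
      c1 • (C c2 * Psi p q ((Y ++ [x]).zip (W ++ [h]))) := by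
    rw [map_mul, hom_C, s3, zip_snoc hlen, smul_eq_C_mul, ← mul_assoc, ← mul_assoc, ← mul_assoc,
      ← C_mul, ← C_mul, ← C_mul]
    congr 2
    field_simp
  rw [e4]
  exact hS

theorem seed_left {p q : ℂ} (g : Gen p q) {w x y z : ι} {Y W : List ι}
    (hl : (Y ++ x :: y :: z :: (W ++ [w])).Nodup) (hlen : Y.length = W.length) :
    ∃ G F, ∃ c : ℂ, c ≠ 0 ∧ Seed p q Y x y (z :: (W ++ [w]))
      (tc p q 0 y z (pL p q 0 (Y ++ [x]) (Psi p q ((Y ++ [x] ++ [y]).zip (z :: (W ++ [w]))))))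
      (tc p q (epsPar p) y z
        (pL p q (epsPar p) (Y ++ [x]) (Psi p q ((Y ++ [x] ++ [y]).zip (z :: (W ++ [w])))))) G F
      (C c * Psi p q ((Y ++ [z]).zip (W ++ [w]))) := by
  have hp := g.p0
  have hq := g.q0
  have hk := rk_ne_zero hp hq
  have hperm : (Y ++ x :: y :: z :: (W ++ [w])).Perm (w :: Y ++ x :: y :: z :: W) := by
    have := (List.perm_append_comm (l₁ := [w]) (l₂ := Y ++ x :: y :: z :: W)).symm
    simpa using this
  have hl' := hperm.nodup_iff.1 hl
  have hw := (List.nodup_cons.1 hl').1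
  have hnY : (Y ++ x :: y :: z :: W).Nodup := (List.nodup_cons.1 hl').2
  have hnYx : ((Y ++ [x]) ++ (y :: z :: W)).Nodup := by simpa using hnY
  have hY : (Y ++ [x]).Nodup := (List.nodup_append.1 hnYx).1
  have hyY : y ∉ Y ++ [x] := fun hm => (List.nodup_append.1 hnYx).2.2 _ hm _ (by simp) rfl
  have hzY : z ∉ Y ++ [x] := fun hm => (List.nodup_append.1 hnYx).2.2 _ hm _ (by simp) rfl
  have hnyz : (y :: z :: W).Nodup := (List.nodup_append.1 hnYx).2.1
  have hyz : y ≠ z := fun e => (List.nodup_cons.1 hnyz).1 (by simp [e])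
  have hxy : x ≠ y := fun e => hyY (by simp [e])
  have hS : ∀ i ∈ Y ++ x :: y :: z :: W, i ∉ [w] := by
    intro i hi hm
    rw [List.mem_singleton] at hm
    exact hw (hm ▸ hi)
  have hSY : ∀ i ∈ Y ++ [x], i ∉ [w] := fun i hi => hS i (by simp at hi ⊢; tauto)
  set L2 := (Y ++ [x]).zip (z :: W) with hL2
  have hL2l : (Y ++ [x]).length = (z :: W).length := by simp [hlen]
  have e1 : (w :: Y ++ [x]).zip (y :: z :: W) = (w, y) :: L2 := rfl
  have e2 : (Y ++ [x] ++ [y]).zip (z :: (W ++ [w])) = L2 ++ [(y, w)] := by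
    rw [← List.cons_append]; exact zip_snoc hL2l y w
  have o1 : (ord ((w, y) :: L2)).Nodup := by
    rw [← e1, ord_zip (by simp [hlen])]; simpa using hl'
  have oL2 : (ord L2).Nodup := ord_tail o1
  obtain ⟨c1, hc1, s1⟩ := scal_Psi_cons hp hq o1
  rw [e2]
  obtain ⟨G, F, c2, hc2, h⟩ := seed_center g hl' (by simp [hlen])
  rw [e1] at h
  set Ψ := Psi p q ((w, y) :: L2) with hΨ
  have bΨ := Psi_blk_halves (p := p) (q := q) (A := w :: Y ++ [x]) (B := y :: z :: W)
    (by simp [hlen])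
  rw [e1] at bΨ
  have bz : Blk q (z :: W) Ψ := bΨ.2.sublist (List.sublist_cons_self _ _)
  have bY : Blk q (Y ++ [x]) Ψ := bΨ.1.sublist (List.sublist_cons_self _ _)
  have hW : (z :: W).Nodup := (List.nodup_cons.1 hnyz).2
  have chain : ∀ c, pR p q c (z :: W) Ψ = pL p q c (Y ++ [x]) Ψ := by
    intro c
    apply io_injective
    rw [io_pR hq c hW bz (List.infix_refl _), io_pL hq c hY bY (List.infix_refl _)]
    have := cR_eq_cL (p := p) (q := q) c (io Ψ) oL2 fun P R hPR =>
      TFc_Psi hp hq c o1 P R (hPR.trans (List.suffix_cons _ _).isInfix)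
    rwa [hL2, List.map_fst_zip hL2l.le, List.map_snd_zip hL2l.ge] at this
  have bY' := scal_blk (q := q) hk hSY bY
  have b2 : Blk q (Y ++ [x]) (Psi p q (L2 ++ [(y, w)])) := by
    rw [s1] at bY'
    exact fun a b hab => (dvd_C_mul hc1).1 (bY' a b hab)
  have hdc : ∀ c, lf y z (q ^ 2) ∣ pL p q c (Y ++ [x]) Ψ := fun c =>
    pL_dvd_dj hq c hyz hY hyY hzY bY (bΨ.2 y z (by simp)) (List.infix_refl _)
  have hsc : ∀ c, scal [w] (rk p q) (pR p q c (y :: z :: W) Ψ) =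
      c1 • tc p q c y z (pL p q c (Y ++ [x]) (Psi p q (L2 ++ [(y, w)]))) := by
    intro c
    change scal [w] (rk p q) (tc p q c y z (pR p q c (z :: W) Ψ)) = _
    have hd := hdc c
    have hd' := (scal_lf_dvd (iff_of_false (hS y (by simp)) (hS z (by simp))) hk).2 hd
    rw [chain, scal_tc hq c hk (iff_of_false (hS y (by simp)) (hS z (by simp))) hyz hd]
    rw [scal_pL hq c hk hY hSY bY (List.infix_refl _), s1, ← smul_eq_C_mul,
      pL_smul hq c c1 hY b2 (List.infix_refl _)] at hd' ⊢
    rw [tc_smul hq c c1 hyz]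
    rwa [smul_eq_C_mul, dvd_C_mul hc1] at hd'
  have h2 := ((Seed.rotate_iff g (H := [w]) (l1 := Y) (by simpa using hl')).1 h).smul hq hxy c1⁻¹
  rw [hsc 0, hsc (epsPar p), smul_smul, smul_smul, inv_mul_cancel₀ hc1, one_smul, one_smul] at h2
  have o2 : (ord ((w, z) :: Y.zip W)).Nodup := by
    have : ord ((w, z) :: Y.zip W) = w :: Y ++ z :: W := by
      change ord ((w :: Y).zip (z :: W)) = _
      rw [ord_zip (by simp [hlen])]
    rw [this]
    exact hl'.sublist ((List.Sublist.refl _).append ((List.sublist_cons_self y _).trans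
      (List.sublist_cons_self x _)))
  obtain ⟨c3, hc3, s3⟩ := scal_Psi_cons hp hq o2
  have hk2 : (rk p q ^ 2) ^ [w].length ≠ 0 := pow_ne_zero _ (pow_ne_zero _ hk)
  refine ⟨c1⁻¹ • scal [w] (rk p q) G, c1⁻¹ • scal [w] (rk p q) F, c1⁻¹ * ((rk p q ^ 2) ^ [w].length * (c2 * c3)),
    mul_ne_zero (inv_ne_zero hc1) (mul_ne_zero hk2 (mul_ne_zero hc2 hc3)), ?_⟩
  have e4 : c1⁻¹ • (C ((rk p q ^ 2) ^ [w].length) * scal [w] (rk p q)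
      (C c2 * Psi p q ((w :: Y).zip (z :: W)))) =
      C (c1⁻¹ * ((rk p q ^ 2) ^ [w].length * (c2 * c3))) *
        Psi p q ((Y ++ [z]).zip (W ++ [w])) := by
    change c1⁻¹ • (C ((rk p q ^ 2) ^ [w].length) * scal [w] (rk p q)
      (C c2 * Psi p q ((w, z) :: Y.zip W))) = _
    rw [map_mul, hom_C, s3, zip_snoc hlen, smul_eq_C_mul]
    simp only [C_mul]
    ring
  rw [e4] at h2
  exact h2

/-! ### Symmetric polynomials at two overlapping places -/

lemma tri_words {V : Type} [AddCommGroup V] [Module ℂ V] {b c : V →ₗ[ℂ] V} {a e t : ℂ}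
    (ha : a ≠ 0) (he : e ≠ 0) (ht : t ≠ 0) (h : e * t = e - a + a⁻¹)
    (hb : ∀ v, b (b v) = v + e • b v) (hc : ∀ v, c (c v) = v + e • c v)
    (hbc : ∀ v, c (b (c v)) = b (c (b v))) {u u' G G' F F' : V}
    (hG : e • G = c u - (c u' - e • u')) (hG' : e • G' = b u - (b u' - e • u'))
    (hF : F = t • c u + b G + (a - e) • G) (hF' : F' = t • b u + c G' + (a - e) • G') :
    (a * t⁻¹) • F' + c (F - t⁻¹ • F') =
      (a⁻¹ * t⁻¹) • F + b (F' - t⁻¹ • F) - e • (F' - t⁻¹ • F) := by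
  have hG2 : G = e⁻¹ • (c u - (c u' - e • u')) := by
    rw [← hG, smul_smul, inv_mul_cancel₀ he, one_smul]
  have hG3 : G' = e⁻¹ • (b u - (b u' - e • u')) := by
    rw [← hG', smul_smul, inv_mul_cancel₀ he, one_smul]
  subst hG2 hG3 hF hF'
  have ht2 : t = (e - a + a⁻¹) / e := by rw [← h]; field_simp
  simp only [map_add, map_sub, map_smul, hb, hc, hbc, smul_add, smul_sub, smul_smul]
  have h2 : e * t * a = e * a - a ^ 2 + 1 := by rw [h]; field_simp
  have ht' : t ≠ 0 := ht
  match_scalars <;> field_simp <;> grind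

/-! ### The operators on `ML` -/

/-- `x`, `y` are neighbours in the list `l`, for generic parameters. -/
structure Loc (p q : ℂ) (l : List ι) (x y : ι) : Prop where
  g : Gen p q
  nd : l.Nodup
  ev : Even l.length
  inf : [x, y] <:+: l

namespace Loc
variable {p q : ℂ} {l : List ι} {x y : ι}

lemma ne (h : Loc p q l x y) : x ≠ y := infix_ne h.nd h.inf

lemma exists_proj (h : Loc p q l x y) (ψ : ML p q l) :
    ∃ s : ML p q l, sw x y (s : Pol) = s ∧
      lf x y (q ^ 2) ∣ (ψ : Pol) - s := by
  obtain ⟨l1, l2, rfl⟩ := infix_pair h.inf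
  obtain ⟨φ, hφ, hr⟩ := ML_red (l2 := []) h.g h.nd h.ev ψ.2 (by intro w hw; simp at hw)
  obtain ⟨ζ, hζ, hs, hr'⟩ := hasLift h.g h.nd h.ev φ hφ
  refine ⟨⟨ζ, hζ⟩, hs, ?_⟩
  have := hr.sub hr'
  rw [sub_self] at this
  exact this.dvd_of_zero h.ne

lemma eq_zero (h : Loc p q l x y) {ψ : ML p q l} (hs : sw x y (ψ : Pol) = ψ)
    (hd : lf x y (q ^ 2) ∣ (ψ : Pol)) : ψ = 0 := by
  obtain ⟨l1, l2, rfl⟩ := infix_pair h.inf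
  exact Subtype.ext (eq_zero_of_sym_dvd h.g h.nd h.ev ψ.2 hs hd)

lemma proj_unique (h : Loc p q l x y) {ψ s s' : ML p q l}
    (hs : sw x y (s : Pol) = s)
    (hd : lf x y (q ^ 2) ∣ (ψ : Pol) - s) (hs' : sw x y (s' : Pol) = s')
    (hd' : lf x y (q ^ 2) ∣ (ψ : Pol) - s') : s = s' := by
  rw [← sub_eq_zero]
  apply h.eq_zero
  · rw [Submodule.coe_sub, map_sub, hs, hs']
  · have := dvd_sub hd' hd
    rwa [sub_sub_sub_cancel_left] at this

/-- The projection on the symmetric polynomials along the multiples of `b`. -/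
def P (h : Loc p q l x y) : Module.End ℂ (ML p q l) where
  toFun ψ := (h.exists_proj ψ).choose
  map_add' ψ φ := by
    have h1 := (h.exists_proj ψ).choose_spec
    have h2 := (h.exists_proj φ).choose_spec
    have h3 := (h.exists_proj (ψ + φ)).choose_spec
    refine h.proj_unique h3.1 h3.2 ?_ ?_
    · rw [Submodule.coe_add, map_add, h1.1, h2.1]
    · rw [Submodule.coe_add, Submodule.coe_add, add_sub_add_comm]
      exact dvd_add h1.2 h2.2
  map_smul' c ψ := by
    have h1 := (h.exists_proj ψ).choose_spec
    have h3 := (h.exists_proj (c • ψ)).choose_spec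
    refine h.proj_unique h3.1 h3.2 ?_ ?_
    · rw [RingHom.id_apply, Submodule.coe_smul, map_smul, h1.1]
    · rw [RingHom.id_apply, Submodule.coe_smul, Submodule.coe_smul, ← smul_sub]
      exact dvd_smul_of_dvd c h1.2

lemma P_sym (h : Loc p q l x y) (ψ : ML p q l) :
    sw x y (h.P ψ : Pol) = h.P ψ := (h.exists_proj ψ).choose_spec.1

lemma P_dvd (h : Loc p q l x y) (ψ : ML p q l) :
    lf x y (q ^ 2) ∣ (ψ : Pol) - h.P ψ := (h.exists_proj ψ).choose_spec.2

lemma P_eq (h : Loc p q l x y) {ψ s : ML p q l} (hs : sw x y (s : Pol) = s)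
    (hd : lf x y (q ^ 2) ∣ (ψ : Pol) - s) : h.P ψ = s :=
  h.proj_unique (h.P_sym ψ) (h.P_dvd ψ) hs hd

lemma P_eq_self (h : Loc p q l x y) {ψ : ML p q l} :
    h.P ψ = ψ ↔ sw x y (ψ : Pol) = ψ :=
  ⟨fun e => by rw [← e]; exact h.P_sym ψ, fun e => h.P_eq e (by rw [sub_self]; exact dvd_zero _)⟩

lemma P_eq_zero (h : Loc p q l x y) {ψ : ML p q l} :
    h.P ψ = 0 ↔ lf x y (q ^ 2) ∣ (ψ : Pol) := by
  refine ⟨fun e => ?_, fun e => h.P_eq (by simp) (by simpa using e)⟩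
  have := h.P_dvd ψ
  rwa [e, Submodule.coe_zero, sub_zero] at this

lemma P_P (h : Loc p q l x y) (ψ : ML p q l) : h.P (h.P ψ) = h.P ψ := h.P_eq_self.2 (h.P_sym ψ)

lemma T_mem_ML (h : Loc p q l x y) {ψ : Pol} (hψ : ψ ∈ ML p q l)
    (hd : lf x y (q ^ 2) ∣ ψ) : T p q x y ψ ∈ ML p q l := by
  obtain ⟨l1, l2, rfl⟩ := infix_pair h.inf
  exact T_mem h.g h.nd hψ hd

/-- The braid operator. -/
def t (h : Loc p q l x y) : Module.End ℂ (ML p q l) where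
  toFun ψ := aPar p q • h.P ψ + ⟨T p q x y ((ψ : Pol) - h.P ψ),
    h.T_mem_ML (Submodule.sub_mem _ ψ.2 (h.P ψ).2) (h.P_dvd ψ)⟩
  map_add' ψ φ := by
    apply Subtype.ext
    have e : ((ψ + φ : ML p q l) : Pol) - h.P (ψ + φ) =
        ((ψ : Pol) - h.P ψ) + ((φ : Pol) - h.P φ) := by
      rw [map_add]; push_cast; ring
    simp only [Submodule.coe_add, Submodule.coe_smul] at e ⊢
    rw [e, T_add h.g.q0 h.ne (h.P_dvd ψ) (h.P_dvd φ), map_add, Submodule.coe_add]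
    module
  map_smul' c ψ := by
    apply Subtype.ext
    have e : ((c • ψ : ML p q l) : Pol) - h.P (c • ψ) =
        c • ((ψ : Pol) - h.P ψ) := by
      rw [map_smul, Submodule.coe_smul, Submodule.coe_smul, ← smul_sub]
    simp only [Submodule.coe_add, Submodule.coe_smul, RingHom.id_apply] at e ⊢
    rw [e, T_smul h.g.q0 h.ne (h.P_dvd ψ), map_smul, Submodule.coe_smul]
    module

lemma coe_t (h : Loc p q l x y) (ψ : ML p q l) : (h.t ψ : Pol) =
    aPar p q • (h.P ψ : Pol) + T p q x y ((ψ : Pol) - h.P ψ) := rfl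

lemma t_of_ker (h : Loc p q l x y) {ψ : ML p q l} (hψ : h.P ψ = 0) :
    (h.t ψ : Pol) = T p q x y ψ := by
  rw [coe_t, hψ, Submodule.coe_zero, smul_zero, zero_add, sub_zero]

lemma t_of_sym (h : Loc p q l x y) {ψ : ML p q l} (hψ : h.P ψ = ψ) : h.t ψ = aPar p q • ψ := by
  apply Subtype.ext
  rw [coe_t, hψ, sub_self, T_zero h.g.q0 h.ne, add_zero, Submodule.coe_smul]

lemma t_P (h : Loc p q l x y) (ψ : ML p q l) : h.t (h.P ψ) = aPar p q • h.P ψ :=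
  h.t_of_sym (h.P_P ψ)

lemma P_t_of_ker (h : Loc p q l x y) {ψ : ML p q l} (hψ : h.P ψ = 0) : h.P (h.t ψ) = 0 := by
  rw [h.P_eq_zero, h.t_of_ker hψ]
  exact T_dvd h.g.q0 x y _

lemma P_sub (h : Loc p q l x y) (ψ : ML p q l) : h.P (ψ - h.P ψ) = 0 := by
  rw [map_sub, h.P_P, sub_self]

lemma P_t (h : Loc p q l x y) (ψ : ML p q l) : h.P (h.t ψ) = aPar p q • h.P ψ := by
  have := h.P_t_of_ker (h.P_sub ψ)
  rwa [map_sub, map_sub, h.t_P, map_smul, h.P_P, sub_eq_zero] at this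

lemma t_t_of_ker (h : Loc p q l x y) {ψ : ML p q l} (hψ : h.P ψ = 0) :
    h.t (h.t ψ) = ψ + epsPar p • h.t ψ := by
  apply Subtype.ext
  rw [h.t_of_ker (h.P_t_of_ker hψ), h.t_of_ker hψ, T_T h.g.p0 h.g.q0 h.ne (h.P_eq_zero.1 hψ),
    Submodule.coe_add, Submodule.coe_smul, h.t_of_ker hψ]

lemma t_t (h : Loc p q l x y) (ψ : ML p q l) : h.t (h.t ψ) =
    ψ + epsPar p • h.t ψ - (epsPar p * aPar p q * tauPar p q) • h.P ψ := by
  have h1 := h.t_t_of_ker (h.P_sub ψ)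
  have e := eps_mul_tau (q := q) h.g.eps
  have ha := aPar_ne_zero h.g.p0 h.g.q0
  have e2 : epsPar p * aPar p q * tauPar p q = epsPar p * aPar p q - aPar p q ^ 2 + 1 := by
    rw [mul_right_comm, e]; field_simp
  simp only [map_sub, h.t_P, map_smul] at h1
  rw [e2, ← sub_eq_zero]
  rw [← sub_eq_zero] at h1
  rw [← h1]
  module

end Loc

lemma infix_split {x y c d : ι} {s t : List ι} (hj : Dj x y c d)
    (h : [x, y] <:+: s ++ c :: d :: t) : [x, y] <:+: s ∨ [x, y] <:+: t := by
  obtain ⟨u, v, e⟩ := h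
  obtain ⟨h1, h2, h3, h4⟩ := hj
  rw [List.append_assoc, List.cons_append, List.cons_append, List.nil_append,
    List.append_eq_append_iff] at e
  rcases e with ⟨a, e1, e2⟩ | ⟨b, e1, e2⟩
  · match a with
    | [] => simp at e2; exact absurd e2.1 h1
    | [_] => simp at e2; exact absurd e2.2.1 h3
    | a1 :: a2 :: a =>
      simp at e2
      exact .inl ⟨u, a, by rw [e1, ← e2.1, ← e2.2.1]; simp⟩
  · match b with
    | [] => simp at e2; exact absurd e2.1.symm h1
    | [_] => simp at e2; exact absurd e2.2.1.symm h2
    | b1 :: b2 :: b =>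
      simp at e2
      exact .inr ⟨b, v, by rw [e2.2.2]; simp⟩

namespace Loc
variable {p q : ℂ} {l : List ι} {x y c d : ι}

lemma P_ker_far (h : Loc p q l x y) (h' : Loc p q l c d) (hj : Dj x y c d) {ψ : ML p q l}
    (hψ : h'.P ψ = 0) : h'.P (h.P ψ) = 0 := by
  rw [h'.P_eq_zero] at hψ ⊢
  obtain ⟨s, t, e⟩ := infix_pair h'.inf
  have hn : (s ++ ([c, d] ++ t)).Nodup := by have := h.nd; rw [e] at this; exact this
  have he : Even (s ++ ([c, d] ++ t)).length := by have := h.ev; rw [e] at this; exact this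
  have hi : [x, y] <:+: s ++ c :: d :: t := e ▸ h.inf
  have hb : Blk q [c, d] (h.P ψ : Pol) := by
    refine lift_blk h.g (χ := sb x y (q ^ 2) ψ) (P := 1) hn he (infix_split hj hi) ?_ (h.P_sym ψ)
      ?_ ?_
    · have h2 : ∀ φ ∈ ML p q l, φ ∈ ML p q (s ++ ([c, d] ++ t)) := fun φ hφ => by
        rw [e] at hφ; exact hφ
      exact h2 _ (h.P ψ).2
    · have := (lf_dvd_iff h.ne).1 (h.P_dvd ψ)
      rw [map_sub, sub_eq_zero] at this
      rw [one_mul, this]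
    · intro a b hab
      have := hab.eq_of_length_le (by simp)
      simp only [List.cons.injEq, and_true] at this
      obtain ⟨rfl, rfl⟩ := this
      rw [lf_dvd_iff h'.ne] at hψ ⊢
      rw [sb_sb_comm hj.symm, hψ, map_zero]
  exact hb c d (List.Sublist.refl _)

lemma P_t_far (h : Loc p q l x y) (h' : Loc p q l c d) (hj : Dj x y c d) {ψ : ML p q l}
    (hψ : h'.P ψ = 0) : h.P (h'.t ψ) = h'.t (h.P ψ) := by
  have h1 := h.P_ker_far h' hj hψ
  have d1 := h'.P_eq_zero.1 hψ
  have d2 := h'.P_eq_zero.1 h1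
  apply h.P_eq
  · rw [h'.t_of_ker h1, sw_T_of_dj h.g.q0 hj h'.ne d2, h.P_sym]
  · have h3 : h'.P (ψ - h.P ψ) = 0 := by rw [map_sub, hψ, h1, sub_zero]
    have := T_dvd_dj (p := p) h.g.q0 hj h'.ne h.ne (h'.P_eq_zero.1 h3) (h.P_dvd ψ)
    rw [← h'.t_of_ker h3, map_sub] at this
    exact this

lemma t_ker_far (h : Loc p q l x y) (h' : Loc p q l c d) (hj : Dj x y c d) {ψ : ML p q l}
    (hψ : h'.P ψ = 0) : h'.P (h.t ψ) = 0 := by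
  have h1 := h.P_ker_far h' hj hψ
  have h3 : h'.P (ψ - h.P ψ) = 0 := by rw [map_sub, hψ, h1, sub_zero]
  have h4 : h'.P (h.t (ψ - h.P ψ)) = 0 := by
    rw [h'.P_eq_zero, h.t_of_ker (h.P_sub ψ)]
    exact T_dvd_dj h.g.q0 hj.symm h.ne h'.ne (h.P_dvd ψ) (h'.P_eq_zero.1 h3)
  rwa [map_sub, map_sub, h.t_P, map_smul, h1, smul_zero, sub_zero] at h4

lemma t_t_far (h : Loc p q l x y) (h' : Loc p q l c d) (hj : Dj x y c d) {ψ : ML p q l}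
    (hψ : h'.P ψ = 0) : h.t (h'.t ψ) = h'.t (h.t ψ) := by
  have h1 := h.P_ker_far h' hj hψ
  have h3 : h'.P (ψ - h.P ψ) = 0 := by rw [map_sub, hψ, h1, sub_zero]
  have h0 := h.P_sub ψ
  have hk : h.t (h'.t (ψ - h.P ψ)) = h'.t (h.t (ψ - h.P ψ)) := by
    have e1 : h.P (h'.t (ψ - h.P ψ)) = 0 := by rw [h.P_t_far h' hj h3, h0, map_zero]
    apply Subtype.ext
    rw [h.t_of_ker e1, h'.t_of_ker h3, h'.t_of_ker (h.t_ker_far h' hj h3), h.t_of_ker h0]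
    exact T_T_comm h.g.q0 hj h.ne h'.ne (h.P_eq_zero.1 h0) (h'.P_eq_zero.1 h3)
  have hs : h.t (h'.t (h.P ψ)) = h'.t (h.t (h.P ψ)) := by
    have := h.P_t_far h' hj h1
    rw [h.P_P] at this
    rw [h.t_of_sym this, h.t_P, map_smul]
  have := congrArg₂ (· + ·) hk hs
  simpa only [← map_add, sub_add_cancel] using this

end Loc

/-! ### Rotation of the operators -/

/-- The rotation of the list. -/
def rot {p q : ℂ} (g : Gen p q) {H K : List ι} (hn : (H ++ K).Nodup) :
    ML p q (H ++ K) →ₗ[ℂ] ML p q (K ++ H) :=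
  (scal H (rk p q)).toLinearMap.restrict fun _ hψ => ML_rotate g.p0 g.q0 hn hψ

lemma coe_rot {p q : ℂ} (g : Gen p q) {H K : List ι} (hn : (H ++ K).Nodup) (ψ : ML p q (H ++ K)) :
    (rot g hn ψ : Pol) = scal H (rk p q) ψ := rfl

lemma rot_injective {p q : ℂ} (g : Gen p q) {H K : List ι} (hn : (H ++ K).Nodup) :
    Function.Injective (rot g hn) := fun _ _ e =>
  Subtype.ext (scal_injective H (rk_ne_zero g.p0 g.q0) (congrArg Subtype.val e))

namespace Loc
variable {p q : ℂ} {H K : List ι} {x y : ι}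

lemma P_rot (h : Loc p q (H ++ K) x y) (h' : Loc p q (K ++ H) x y) (hS : x ∈ H ↔ y ∈ H)
    (ψ : ML p q (H ++ K)) : h'.P (rot h.g h.nd ψ) = rot h.g h.nd (h.P ψ) := by
  apply h'.P_eq
  · rw [coe_rot, ← scal_sw hS, h.P_sym]
  · rw [coe_rot, coe_rot, ← map_sub, scal_lf_dvd hS (rk_ne_zero h.g.p0 h.g.q0)]
    exact h.P_dvd ψ

lemma t_rot (h : Loc p q (H ++ K) x y) (h' : Loc p q (K ++ H) x y) (hS : x ∈ H ↔ y ∈ H)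
    (ψ : ML p q (H ++ K)) : h'.t (rot h.g h.nd ψ) = rot h.g h.nd (h.t ψ) := by
  apply Subtype.ext
  rw [coe_t, h.P_rot h' hS, coe_rot, coe_rot, coe_rot, coe_t, map_add, map_smul,
    scal_T h.g.q0 hS (rk_ne_zero h.g.p0 h.g.q0) h.ne (h.P_dvd ψ), map_sub]

end Loc

/-! ### The seeds at two overlapping places -/

/-- The relations of two symmetric polynomials at overlapping places. -/
structure Tri {p q : ℂ} {l : List ι} {x y z : ι} (h1 : Loc p q l x y) (h2 : Loc p q l y z)
    (F F' : ML p q l) : Prop where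
  sym : h1.P F = F
  sym' : h2.P F' = F'
  proj : h2.P F = (tauPar p q)⁻¹ • F'
  proj' : h1.P F' = (tauPar p q)⁻¹ • F
  tt : h1.t (h2.t F) = F'

lemma blk3 {q : ℂ} {x y z : ι} {f : Pol} : Blk q [x, y, z] f ↔
    lf x y (q ^ 2) ∣ f ∧ lf x z (q ^ 2) ∣ f ∧ lf y z (q ^ 2) ∣ f := by
  rw [blk_cons]
  constructor
  · rintro ⟨h1, h2⟩
    exact ⟨h1 y (by simp), h1 z (by simp), h2 y z (List.Sublist.refl _)⟩
  · rintro ⟨h1, h2, h3⟩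
    refine ⟨by simp [h1, h2], fun a b hab => ?_⟩
    have := hab.eq_of_length_le (by simp)
    simp only [List.cons.injEq, and_true] at this
    obtain ⟨rfl, rfl⟩ := this
    exact h3

theorem tri_of_seeds {p q : ℂ} {l l1 l2 : List ι} {x y z : ι} (h1 : Loc p q l x y)
    (h2 : Loc p q l y z) (hl : l = l1 ++ x :: y :: z :: l2) (hxz : x ≠ z)
    {u u' G G' F F' χ χ' : Pol}
    (b1 : lf x y (q ^ 2) ∣ u) (b2 : lf y z (q ^ 2) ∣ u) (b1' : lf x y (q ^ 2) ∣ u')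
    (b2' : lf y z (q ^ 2) ∣ u') (b3 : lf x z (q ^ 2) ∣ u - u')
    (hS : Seed p q l1 x y (z :: l2) (tc p q 0 y z u) (tc p q (epsPar p) y z u') G F χ)
    (hS' : Seed p q (l1 ++ [x]) y z l2 (tc p q 0 x y u) (tc p q (epsPar p) x y u') G' F' χ') :
    ∃ f f' : ML p q l, f.1 = F ∧ f'.1 = F' ∧ Tri h1 h2 f f' := by
  have hq := h1.g.q0
  have hε := h1.g.eps
  have hτ := h1.g.tau
  have ha := aPar_ne_zero h1.g.p0 hq
  have hxy := h1.ne
  have hyz := h2.ne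
  have hn3 : [x, y, z].Nodup := by simp [hxy, hyz, hxz]
  have mF : F ∈ ML p q l := hl ▸ hS.mem
  have mF' : F' ∈ ML p q l := by rw [hl]; simpa using hS'.mem
  have bd : Blk q [x, y, z] (u - u') := blk3.2 ⟨dvd_sub b1 b1', b3, dvd_sub b2 b2'⟩
  have hdiv : ∀ {G : Pol} {a b : ι}, [a, b] <:+: [x, y, z] →
      lf a b (q ^ 2) ∣ u → lf a b (q ^ 2) ∣ u' →
      epsPar p • G = tc p q 0 a b u - tc p q (epsPar p) a b u' → Blk q [x, y, z] (G - u) := by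
    intro G a b hab d1 d2 e
    have hne := infix_ne hn3 hab
    have e2 : epsPar p • (G - u) = T p q a b (u - u') - epsPar p • (u - u') := by
      have := T_add (p := p) hq hne (dvd_sub d1 d2) d2
      rw [sub_add_cancel] at this
      rw [smul_sub, e, tc, tc, zero_smul, this]
      module
    have e3 := blk_sub (T_blk_infix (p := p) hq hn3 hab bd) (blk_smul bd (epsPar p))
    rw [← e2] at e3
    intro i j hij
    have := e3 i j hij
    rwa [smul_eq_C_mul, dvd_C_mul hε] at this
  have i12 : [x, y] <:+: [x, y, z] := ⟨[], [z], rfl⟩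
  have i23 : [y, z] <:+: [x, y, z] := ⟨[x], [], rfl⟩
  have g1 := hdiv i23 b2 b2' hS.diff
  have g2 := hdiv i12 b1 b1' hS'.diff
  have t1 : ∀ {G : Pol} {a b : ι}, [a, b] <:+: [x, y, z] → Blk q [x, y, z] (G - u) →
      lf a b (q ^ 2) ∣ u → Blk q [x, y, z] (T p q a b G - T p q a b u) := by
    intro G a b hab hG d1
    have := T_add (p := p) hq (infix_ne hn3 hab) (blk_dvd hG hab) d1
    rw [sub_add_cancel] at this
    rw [this, add_sub_cancel_right]
    exact T_blk_infix hq hn3 hab hG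
  have t11 := blk3.1 (t1 i12 g1 b1)
  have t12 := blk3.1 (t1 i23 g2 b2)
  have g1 := blk3.1 g1
  have g2 := blk3.1 g2
  have gd1 : lf y z (q ^ 2) ∣ G := by have := dvd_add g1.2.2 b2; rwa [sub_add_cancel] at this
  have gd2 : lf x y (q ^ 2) ∣ G' := by have := dvd_add g2.1 b1; rwa [sub_add_cancel] at this
  have tm : ∀ f : Pol, (tauPar p q)⁻¹ • tauPar p q • f = f := fun f => by
    rw [smul_smul, inv_mul_cancel₀ hτ, one_smul]
  have k2 : lf y z (q ^ 2) ∣ F - (tauPar p q)⁻¹ • F' := by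
    rw [hS.eq, hS'.eq, smul_add, smul_add, tm]
    have e : tauPar p q • tc p q 0 y z u + T p q x y G + (aPar p q - epsPar p) • G -
        (tc p q 0 x y u + (tauPar p q)⁻¹ • T p q y z G' +
          (tauPar p q)⁻¹ • (aPar p q - epsPar p) • G') =
        tauPar p q • tc p q 0 y z u + (T p q x y G - T p q x y u) + (aPar p q - epsPar p) • G -
        ((tauPar p q)⁻¹ • T p q y z G' + (tauPar p q)⁻¹ • (aPar p q - epsPar p) • G') := by
      rw [tc, tc]; module
    rw [e]
    exact dvd_sub (dvd_add (dvd_add (dvd_smul_of_dvd _ (tc_dvd hq 0 b2)) t11.2.2)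
      (dvd_smul_of_dvd _ gd1)) (dvd_add (dvd_smul_of_dvd _ (T_dvd hq y z _))
      (dvd_smul_of_dvd _ (dvd_smul_of_dvd _ hS'.dvd)))
  have k1 : lf x y (q ^ 2) ∣ F' - (tauPar p q)⁻¹ • F := by
    rw [hS.eq, hS'.eq, smul_add, smul_add, tm]
    have e : tauPar p q • tc p q 0 x y u + T p q y z G' + (aPar p q - epsPar p) • G' -
        (tc p q 0 y z u + (tauPar p q)⁻¹ • T p q x y G +
          (tauPar p q)⁻¹ • (aPar p q - epsPar p) • G) =
        tauPar p q • tc p q 0 x y u + (T p q y z G' - T p q y z u) + (aPar p q - epsPar p) • G' -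
        ((tauPar p q)⁻¹ • T p q x y G + (tauPar p q)⁻¹ • (aPar p q - epsPar p) • G) := by
      rw [tc, tc]; module
    rw [e]
    exact dvd_sub (dvd_add (dvd_add (dvd_smul_of_dvd _ (tc_dvd hq 0 b1)) t12.1)
      (dvd_smul_of_dvd _ gd2)) (dvd_add (dvd_smul_of_dvd _ (T_dvd hq x y _))
      (dvd_smul_of_dvd _ (dvd_smul_of_dvd _ hS.dvd)))
  set f : ML p q l := ⟨F, mF⟩ with hf
  set f' : ML p q l := ⟨F', mF'⟩ with hf'
  have s1 : h1.P f = f := h1.P_eq_self.2 hS.sym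
  have s2 : h2.P f' = f' := h2.P_eq_self.2 hS'.sym
  have p1 : h1.P f' = (tauPar p q)⁻¹ • f := h1.P_eq
    (by rw [Submodule.coe_smul, map_smul]; exact congrArg _ hS.sym) k1
  have p2 : h2.P f = (tauPar p q)⁻¹ • f' := h2.P_eq
    (by rw [Submodule.coe_smul, map_smul]; exact congrArg _ hS'.sym) k2
  have key : h2.t f = h1.t f' - epsPar p • f' + (epsPar p * tauPar p q) • h1.P f' := by
    apply Subtype.ext
    apply io_injective
    have w := tri_words (b := TF p q x y) (c := TF p q y z) (u := io u) (u' := io u') (G := io G)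
      (G' := io G') (F := io F) (F' := io F') ha hε hτ (eps_mul_tau hε)
      (TF_sq h1.g.p0 hq hxy) (TF_sq h1.g.p0 hq hyz)
      (fun v => (TF_braid h1.g.p0 hq hxy hyz hxz v).symm)
      (by have := congrArg io hS.diff
          rw [map_smul, map_sub, io_tc hq hyz b2, io_tc hq hyz b2', TFc_apply, TFc_apply,
            zero_smul, sub_zero] at this
          exact this)
      (by have := congrArg io hS'.diff
          rw [map_smul, map_sub, io_tc hq hxy b1, io_tc hq hxy b1', TFc_apply, TFc_apply,
            zero_smul, sub_zero] at this
          exact this)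
      (by have := congrArg io hS.eq
          rwa [map_add, map_add, map_smul, map_smul, io_tc hq hyz b2, io_T hq hxy hS.dvd,
            TFc_apply, zero_smul, sub_zero] at this)
      (by have := congrArg io hS'.eq
          rwa [map_add, map_add, map_smul, map_smul, io_tc hq hxy b1, io_T hq hyz hS'.dvd,
            TFc_apply, zero_smul, sub_zero] at this)
    rw [Loc.coe_t, p2, Submodule.coe_add, Submodule.coe_sub, Loc.coe_t, p1]
    simp only [Submodule.coe_smul, map_add, map_sub, map_smul]
    rw [show (f : Pol) = F from rfl, show (f' : Pol) = F' from rfl]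
    rw [io_T hq hyz k2, io_T hq hxy k1]
    simp only [map_sub, map_smul] at w ⊢
    have e := eps_mul_tau (q := q) hε
    have e1 : (epsPar p * tauPar p q) * (tauPar p q)⁻¹ = epsPar p := by field_simp
    have e2 : aPar p q * (tauPar p q)⁻¹ + epsPar p =
        (aPar p q)⁻¹ * (tauPar p q)⁻¹ + epsPar p * (tauPar p q)⁻¹ := by
      rw [← sub_eq_zero, ← mul_eq_zero_iff_right hτ]
      linear_combination e + (aPar p q - (aPar p q)⁻¹ - epsPar p) * inv_mul_cancel₀ hτ
    rw [smul_smul, w, smul_smul, smul_smul, e1]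
    have e3 := congrArg (fun k : ℂ => k • io F) e2
    simp only [add_smul] at e3
    rw [← sub_eq_zero] at e3 ⊢
    rw [← neg_eq_zero, ← e3]
    module
  refine ⟨f, f', rfl, rfl, s1, s2, p2, p1, ?_⟩
  rw [key, map_add, map_sub, map_smul, map_smul, h1.t_t, h1.t_P]
  module

/-! ### Generation by moves away from one name -/

lemma Psi_zip_move {p q : ℂ} (hp : p ≠ 0) (hq : q ≠ 0) {I J : List ι} (hn : (I ++ J).Nodup)
    (hlen : I.length = J.length) {x y : ι} (hxy : [x, y] <:+: I) : ∃ c d, [c, d] <:+: J ∧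
    T p q x y (Psi p q (I.zip J)) = T p q c d (Psi p q (I.zip J)) := by
  obtain ⟨s, t, rfl⟩ := infix_pair hxy
  obtain ⟨s', J', rfl, hs⟩ : ∃ s' J', J = s' ++ J' ∧ s.length = s'.length :=
    ⟨J.take s.length, J.drop s.length, (List.take_append_drop _ _).symm, by
      rw [List.length_take, ← hlen]; simp⟩
  match J', hn, hlen with
  | c :: d :: t', hn, hlen =>
    refine ⟨c, d, ⟨s', t', by simp⟩, ?_⟩
    have e : (s ++ x :: y :: t).zip (s' ++ c :: d :: t') =
        s.zip s' ++ (x, c) :: (y, d) :: t.zip t' := by rw [List.zip_append hs]; rfl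
    rw [← ord_zip hlen, e] at hn
    rw [e]
    exact T_Psi (P := (x, c)) (R := (y, d)) hp hq hn
  | [_], _, hlen => simp at hlen; omega
  | [], _, hlen => simp at hlen; omega

lemma reach_rest {p q : ℂ} (g : Gen p q) {m : ℕ} (J : List ι) :
    ∀ I : List ι, (I ++ J).Nodup → (I ++ J).length = 2 * m → I.length ≤ m → ∀ ψ, MB p q I J ψ →
      Reach p q J (fun ψ => ψ = Psi p q (((I ++ J).take m).zip ((I ++ J).drop m))) ψ := by
  have top : ∀ I J : List ι, (I ++ J).Nodup → (I ++ J).length = 2 * m → I.length = m →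
      ∀ ψ, MB p q I J ψ →
      Reach p q J (fun ψ => ψ = Psi p q (((I ++ J).take m).zip ((I ++ J).drop m))) ψ := by
    intro I J hn hl hI ψ hψ
    have hJ : J.length = m := by rw [List.length_append] at hl; omega
    rw [List.take_left' hI, List.drop_left' hI]
    have hlen := hI.trans hJ.symm
    have hS : ∀ φ, φ = Psi p q (I.zip J) → MB p q I J φ := by
      rintro φ rfl
      refine ⟨?_, (Psi_blk_halves hlen).1⟩
      rw [← ord_zip hlen] at hn ⊢
      exact Psi_mem hn
    have hr := (gen_all g m).1 I J hn hI hJ ψ hψ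
    clear hψ
    induction hr with
    | base h => exact .base h
    | zero => exact .zero
    | add _ _ ih1 ih2 => exact ih1.add ih2
    | smul c _ ih1 => exact ih1.smul c
    | move x y hxy _ _ ih1 =>
      refine Reach.move_left g hn hS hxy ?_ ih1
      rintro φ rfl
      obtain ⟨c, d, hcd, e⟩ := Psi_zip_move g.p0 g.q0 hn hlen hxy
      rw [e]
      exact .move c d hcd (.base rfl) (blk_dvd (Psi_blk_halves hlen).2 hcd)
  induction J with
  | nil =>
    intro I hn hl hI ψ hψ
    refine top I [] hn hl (le_antisymm hI ?_) ψ hψ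
    simp at hl; omega
  | cons w J ih =>
    intro I hn hl hI ψ hψ
    rcases hI.eq_or_lt with hI | hI
    · exact top I (w :: J) hn hl hI ψ hψ
    · refine ((gen_all g m).2 I w J hn hl hI ψ hψ).trans (List.infix_refl _) fun φ hφ => ?_
      have := ih (I ++ [w]) (by simpa using hn) (by simpa using hl) (by simp; omega) φ hφ
      have e : I ++ [w] ++ J = I ++ w :: J := by simp
      rw [e] at this
      exact this.trans (List.suffix_cons _ _).isInfix fun φ hφ => .base hφ

/-! ### Seeds of the relations at overlapping places -/

theorem exists_tri {p q : ℂ} {h x y z : ι} {Y W : List ι}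
    (hlen : Y.length = W.length) (h1 : Loc p q (h :: Y ++ x :: y :: z :: W) x y)
    (h2 : Loc p q (h :: Y ++ x :: y :: z :: W) y z) : ∃ f f', ∃ c c' : ℂ, c ≠ 0 ∧ c' ≠ 0 ∧
      Tri h1 h2 f f' ∧
      IsRed p q x y (h :: Y) [] (z :: W) f.1 (C c * Psi p q ((h :: Y).zip (z :: W))) ∧
      IsRed p q y z (h :: Y ++ [x]) [] W f'.1 (C c' * Psi p q ((h :: Y).zip (x :: W))) := by
  have g := h1.g
  have hq := g.q0
  have hl := h1.nd
  obtain ⟨G, F, c, hc, hS⟩ := seed_center g (A0 := h :: Y) (B0 := z :: W) hl (by simp [hlen])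
  obtain ⟨G', F', c', hc', hS'⟩ := seed_right g hl hlen
  have hnW : (x :: y :: z :: W).Nodup := hl.sublist (List.sublist_append_right _ _)
  have hyzW := (List.nodup_cons.1 hnW).2
  have hzW := (List.nodup_cons.1 hyzW).2
  have hyW : y ∉ z :: W := (List.nodup_cons.1 hyzW).1
  have hxW : x ∉ z :: W := fun hm => (List.nodup_cons.1 hnW).1 (List.mem_cons_of_mem _ hm)
  have hxz : x ≠ z := fun e => hxW (by simp [e])
  obtain ⟨D, w, hD⟩ : ∃ D w, z :: W = D ++ [w] :=
    ⟨(z :: W).dropLast, (z :: W).getLast (by simp), (List.dropLast_append_getLast _).symm⟩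
  have hDl : (h :: Y).length = (y :: D).length := by
    have := congrArg List.length hD
    simp at this ⊢; omega
  have ez : (h :: Y ++ [x]).zip (y :: z :: W) = (h :: Y).zip (y :: D) ++ [(x, w)] := by
    rw [hD, ← List.cons_append, zip_snoc hDl]
  set Ψ := Psi p q ((h :: Y ++ [x]).zip (y :: z :: W)) with hΨ
  have bxD : Blk q (x :: y :: D) Ψ := by
    have := Psi_blk (p := p) (q := q) (L1 := (h :: Y).zip (y :: D)) (L2 := [(x, w)])
    rwa [List.map_snd_zip hDl.ge, ← ez] at this
  have byW : Blk q (y :: z :: W) Ψ := (Psi_blk_halves (by simp [hlen])).2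
  have bW : Blk q (z :: W) Ψ := byW.sublist (List.sublist_cons_self _ _)
  have inW : z :: W <:+: y :: z :: W := (List.suffix_cons _ _).isInfix
  have b1 : ∀ c, lf x y (q ^ 2) ∣ pR p q c (z :: W) Ψ := fun c =>
    pR_dvd_dj hq c h1.ne hzW hxW hyW bW (bxD x y (by simp)) (List.infix_refl _)
  have b2 : ∀ c, lf y z (q ^ 2) ∣ pR p q c (z :: W) Ψ := fun c =>
    pR_blk hq c hyzW byW inW y z (by simp)
  have b3 : lf x z (q ^ 2) ∣ pR p q 0 (z :: W) Ψ - pR p q (epsPar p) (z :: W) Ψ := by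
    have bx : Blk q (x :: z :: W) (lf x w (q ^ 2) * Ψ) := by
      rw [blk_cons]
      refine ⟨fun v hv => ?_, fun a b h => (bW a b h).mul_left _⟩
      rw [hD, List.mem_append, List.mem_singleton] at hv
      rcases hv with hv | rfl
      · exact ((blk_cons.1 bxD).1 v (List.mem_cons_of_mem _ hv)).mul_left _
      · exact Dvd.intro _ rfl
    have hnx : (x :: z :: W).Nodup := List.nodup_cons.2 ⟨hxW, hzW⟩
    have inx : z :: W <:+: x :: z :: W := (List.suffix_cons _ _).isInfix
    have iX : ∀ i, io (X i : Pol) = xF i := fun i => rfl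
    have r1 : X z * pR p q (epsPar p) (z :: W) Ψ - C (q ^ 2) * X x * pR p q 0 (z :: W) Ψ =
        pR p q 0 (z :: W) (lf x w (q ^ 2) * Ψ) := by
      apply io_injective
      have e1 : io (lf x w (q ^ 2) * Ψ) = xF w * io Ψ - (q ^ 2) • (xF x * io Ψ) := by
        rw [lf, ← smul_eq_C_mul, map_mul, map_sub, map_smul, iX, iX, sub_mul, smul_mul_assoc]
      rw [io_pR hq 0 hnx bx inx, e1, map_sub (cR p q 0 (z :: W)), map_smul (cR p q 0 (z :: W)),
        cR_bernstein _ hzW (by rw [hD]; simp), cR_mul _ hxW, map_sub, mul_assoc, ← smul_eq_C_mul,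
        map_smul io (q ^ 2), map_mul, map_mul, iX, iX, io_pR hq _ hzW bW (List.infix_refl _),
        io_pR hq _ hzW bW (List.infix_refl _)]
    have d := pR_blk (p := p) hq 0 hnx bx inx x z (by simp)
    rw [← r1] at d
    rw [lf_dvd_iff hxz] at d ⊢
    simp only [map_sub, map_mul, hom_C, sb_X_of_ne _ hxz] at d ⊢
    rw [show sb x z (q ^ 2) (X z) = C (q ^ 2) * X x by simp [sb_X], ← mul_sub] at d
    rcases mul_eq_zero.1 d with d | d
    · exact absurd d (mul_ne_zero (C_ne_zero' (pow_ne_zero _ hq)) (X_ne_zero _))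
    · rw [← neg_sub, d, neg_zero]
  obtain ⟨f, f', e, e', ht⟩ := tri_of_seeds h1 h2 rfl hxz (b1 0) (b2 0) (b1 _) (b2 _) b3 hS hS'
  exact ⟨f, f', c, c', hc, hc', ht, e ▸ hS.red, e' ▸ hS'.red⟩

lemma Tri.rot {p q : ℂ} {H K : List ι} {x y z : ι} {h1 : Loc p q (H ++ K) x y}
    {h2 : Loc p q (H ++ K) y z} (h1' : Loc p q (K ++ H) x y) (h2' : Loc p q (K ++ H) y z)
    (hx : x ∉ H) (hy : y ∉ H) (hz : z ∉ H) {f f' : ML p q (H ++ K)} (h : Tri h1 h2 f f') :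
    Tri h1' h2' (rot h1.g h1.nd f) (rot h1.g h1.nd f') := by
  have i1 := iff_of_false hx hy
  have i2 := iff_of_false hy hz
  constructor
  · rw [h1.P_rot h1' i1, h.sym]
  · rw [h2.P_rot h2' i2, h.sym']
  · rw [h2.P_rot h2' i2, h.proj, map_smul]
  · rw [h1.P_rot h1' i1, h.proj', map_smul]
  · rw [h2.t_rot h2' i2, h1.t_rot h1' i1, h.tt]


/-! ### From seeds to all symmetric polynomials -/

theorem sym_mem_of_reach {p q : ℂ} {l1 l2 K : List ι} {a b : ι}
    (h : Loc p q (l1 ++ a :: b :: l2) a b) (hK : K <:+: l2) {Ψ : Pol}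
    (hgen : ∀ χ ∈ ML p q (l1 ++ l2), Reach p q K (fun ψ => ψ = Ψ) χ)
    (N : Submodule ℂ (ML p q (l1 ++ a :: b :: l2)))
    (hseed : ∃ f ∈ N, h.P f = f ∧ ∃ c : ℂ, c ≠ 0 ∧ IsRed p q a b l1 [] l2 f.1 (C c * Ψ))
    (hmove : ∀ c d (h' : Loc p q (l1 ++ a :: b :: l2) c d), [c, d] <:+: K → ∀ ψ ∈ N,
      h'.P ψ = 0 → h'.t ψ ∈ N) {ψ : ML p q (l1 ++ a :: b :: l2)} (hψ : h.P ψ = ψ) : ψ ∈ N := by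
  have hq := h.g.q0
  have hn : (l1 ++ [a, b] ++ l2).Nodup := by simpa using h.nd
  have hn2 : (l1 ++ l2).Nodup := h.nd.sublist ((List.Sublist.refl _).append (by simp))
  have key : ∀ χ, Reach p q K (fun ψ => ψ = Ψ) χ →
      ∃ f ∈ N, h.P f = f ∧ IsRed p q a b l1 [] l2 f.1 χ := by
    intro χ hr
    induction hr with
    | base e =>
      obtain ⟨f, hf, hs, c, hc, hr⟩ := hseed
      refine ⟨c⁻¹ • f, N.smul_mem _ hf, by rw [map_smul, hs], ?_⟩
      have := hr.smul c⁻¹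
      rwa [← smul_eq_C_mul, smul_smul, inv_mul_cancel₀ hc, one_smul, ← e] at this
    | zero => exact ⟨0, N.zero_mem, map_zero _, by simp [IsRed]⟩
    | add _ _ i1 i2 =>
      obtain ⟨f, hf, hs, hr⟩ := i1
      obtain ⟨f', hf', hs', hr'⟩ := i2
      exact ⟨f + f', N.add_mem hf hf', by rw [map_add, hs, hs'], hr.add hr'⟩
    | smul c _ i1 =>
      obtain ⟨f, hf, hs, hr⟩ := i1
      exact ⟨c • f, N.smul_mem _ hf, by rw [map_smul, hs], hr.smul c⟩
    | @move χ c d hcd _ hd i1 =>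
      obtain ⟨f, hf, hs, hr⟩ := i1
      have hcd2 := hcd.trans hK
      have h' : Loc p q (l1 ++ a :: b :: l2) c d := ⟨h.g, h.nd, h.ev,
        hcd2.trans ⟨l1 ++ [a, b], [], by simp⟩⟩
      have hc2 : c ∈ l2 := hcd2.subset (by simp)
      have hd2 : d ∈ l2 := hcd2.subset (by simp)
      have hj : Dj a b c d := dj_of_append hn (by simp) (by simp) hc2 hd2
      have hdf : lf c d (q ^ 2) ∣ f.1 := by
        obtain ⟨u, v, rfl⟩ := infix_pair hcd2
        have e : l1 ++ a :: b :: (u ++ c :: d :: v) = (l1 ++ a :: b :: u) ++ ([c, d] ++ v) := by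
          simp
        refine lift_blk h.g (e ▸ h.nd) (e ▸ h.ev) (.inl ⟨l1, u, by simp⟩) (e ▸ f.2)
          (h.P_eq_self.1 hs) hr ?_ c d (List.Sublist.refl _)
        intro i j hij
        have := hij.eq_of_length_le (by simp)
        simp only [List.cons.injEq, and_true] at this
        obtain ⟨rfl, rfl⟩ := this
        exact hd
      have h0 := h'.P_eq_zero.2 hdf
      refine ⟨h'.t f, hmove c d h' hcd f hf h0, by rw [h.P_t_far h' hj h0, hs], ?_⟩
      rw [h'.t_of_ker h0]
      refine natL_T hq hn2 hj h'.ne ⟨iff_of_false ?_ ?_, by simp, iff_of_true hc2 hd2⟩ hr hdf hd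
      · exact fun hm => (List.nodup_append.1 hn2).2.2 _ hm _ hc2 rfl
      · exact fun hm => (List.nodup_append.1 hn2).2.2 _ hm _ hd2 rfl
  obtain ⟨χ, hχ, hr⟩ := ML_red h.g (l2 := []) h.nd h.ev ψ.2 (fun _ hw => by simp at hw)
  obtain ⟨f, hf, hs, hr'⟩ := key χ (hgen χ hχ)
  have e : ψ - f = 0 := by
    have h1 : h.P (ψ - f) = 0 := by
      rw [h.P_eq_zero]
      have := hr.sub hr'
      rw [sub_self] at this
      exact this.dvd_of_zero h.ne
    rw [map_sub, hψ, hs] at h1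
    exact h1
  rw [sub_eq_zero.1 e]
  exact hf

/-- The relations of the symmetric polynomials at overlapping places. -/
structure TriRel {p q : ℂ} {l : List ι} {x y z : ι} (h1 : Loc p q l x y) (h2 : Loc p q l y z) :
    Prop where
  pp : ∀ ψ, h1.P ψ = ψ → h1.P (h2.P ψ) = ((tauPar p q)⁻¹ * (tauPar p q)⁻¹) • ψ
  pp' : ∀ ψ, h2.P ψ = ψ → h2.P (h1.P ψ) = ((tauPar p q)⁻¹ * (tauPar p q)⁻¹) • ψ
  tt : ∀ ψ, h1.P ψ = ψ → h1.t (h2.t ψ) = tauPar p q • h2.P ψ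

lemma triRel_front {p q : ℂ} {x y z : ι} {R : List ι} (h1 : Loc p q (x :: y :: z :: R) x y)
    (h2 : Loc p q (x :: y :: z :: R) y z) : TriRel h1 h2 := by
  have g := h1.g
  have hτ := g.tau
  obtain ⟨m, hm⟩ := h1.ev
  obtain ⟨W, h, Y, rfl, hlen⟩ : ∃ W h Y, R = W ++ h :: Y ∧ Y.length = W.length := by
    simp at hm
    obtain ⟨h, Y, e⟩ : ∃ h Y, R.drop (m - 2) = h :: Y := by
      cases hR : R.drop (m - 2) with
      | nil => have := congrArg List.length hR; simp at this; omega
      | cons h Y => exact ⟨h, Y, rfl⟩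
    refine ⟨R.take (m - 2), h, Y, by rw [← e, List.take_append_drop], ?_⟩
    have := congrArg List.length e
    simp at this
    rw [List.length_take]
    omega
  simp at hm
  have hm' : W.length + 2 = m := by omega
  have hn := h1.nd
  have hnz : (z :: (W ++ h :: Y)).Nodup := (List.nodup_cons.1 (List.nodup_cons.1 hn).2).2
  have hnx : (x :: (W ++ h :: Y)).Nodup := hn.sublist (by simp)
  have hgen : ∀ v : ι, (v :: (W ++ h :: Y)).Nodup → ∀ χ ∈ ML p q (v :: (W ++ h :: Y)),
      Reach p q (W ++ h :: Y) (fun ψ => ψ = Psi p q ((v :: W).zip (h :: Y))) χ := by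
    intro v hv χ hχ
    have := reach_rest g (m := m - 1) (W ++ h :: Y) [v] hv (by simp; omega) (by simp; omega) χ
      ⟨hχ, fun a b hab => by simp at hab⟩
    have e : [v] ++ (W ++ h :: Y) = (v :: W) ++ h :: Y := by simp
    rwa [e, List.take_left' (by simp; omega), List.drop_left' (by simp; omega)] at this
  have hperm : (x :: y :: z :: (W ++ h :: Y)).Perm (h :: Y ++ x :: y :: z :: W) := by
    have := List.perm_append_comm (l₁ := x :: y :: z :: W) (l₂ := h :: Y)
    simpa using this
  have hn' := hperm.nodup_iff.1 hn
  have he' : Even (h :: Y ++ x :: y :: z :: W).length := hperm.length_eq ▸ h1.ev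
  have h1' : Loc p q (h :: Y ++ x :: y :: z :: W) x y := ⟨g, hn', he', h :: Y, z :: W, by simp⟩
  have h2' : Loc p q (h :: Y ++ x :: y :: z :: W) y z := ⟨g, hn', he', h :: Y ++ [x], W, by simp⟩
  obtain ⟨f, f', c, c', hc, hc', ht, hr, hr'⟩ := exists_tri hlen h1' h2'
  have hnH : ∀ i ∈ x :: y :: z :: W, i ∉ h :: Y := fun i hi hm =>
    (List.nodup_append.1 hn').2.2 _ hm _ hi rfl
  have hT := ht.rot (K := x :: y :: z :: W) h1 h2 (hnH x (by simp)) (hnH y (by simp))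
    (hnH z (by simp))
  have hk : (rk p q ^ 2) ^ (h :: Y).length ≠ 0 :=
    pow_ne_zero _ (pow_ne_zero _ (rk_ne_zero g.p0 g.q0))
  have hsc : ∀ v, v ∈ x :: y :: z :: W → (v :: (W ++ h :: Y)).Nodup → ∃ c : ℂ, c ≠ 0 ∧
      scal (h :: Y) (rk p q) (Psi p q ((h :: Y).zip (v :: W))) =
        C c * Psi p q ((v :: W).zip (h :: Y)) := by
    intro v hv hvn
    have hpm : (h :: Y ++ v :: W).Perm (v :: (W ++ h :: Y)) := List.perm_append_comm
    have hz : List.map Prod.swap ((h :: Y).zip (v :: W)) = (v :: W).zip (h :: Y) := List.zip_swap _ _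
    rw [← hz]
    refine scal_Psi g.p0 g.q0 (L := (h :: Y).zip (v :: W)) (S := h :: Y) ?_
      (fun P hP => (List.of_mem_zip hP).1) (fun P hP => hnH _ ?_)
    · rw [ord_zip (by simp [hlen])]
      exact hpm.nodup_iff.2 hvn
    · rcases List.mem_cons.1 (List.of_mem_zip hP).2 with e | e
      · exact e ▸ hv
      · simp [e]
  have hdj : ∀ c d, [c, d] <:+: W ++ h :: Y → Dj x y c d ∧ Dj y z c d := by
    intro c d hcd
    have hcm : c ∈ W ++ h :: Y := hcd.subset List.mem_cons_self
    have hdm : d ∈ W ++ h :: Y := hcd.subset (List.mem_cons_of_mem _ List.mem_cons_self)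
    have hn3 : ([x, y, z] ++ (W ++ h :: Y)).Nodup := hn
    exact ⟨dj_of_append hn3 (by simp) (by simp) hcm hdm,
      dj_of_append hn3 (by simp) (by simp) hcm hdm⟩
  obtain ⟨d, hd, e⟩ := hsc z (by simp) hnz
  obtain ⟨d', hd', e'⟩ := hsc x (by simp) hnx
  have hnz' : (h :: Y ++ z :: W).Nodup := hn'.sublist
    (List.Sublist.append (List.Sublist.refl (h :: Y)) (by simp : (z :: W).Sublist (x :: y :: z :: W)))
  have hnx' : (h :: Y ++ x :: W).Nodup := hn'.sublist
    (List.Sublist.append (List.Sublist.refl (h :: Y)) (by simp : (x :: W).Sublist (x :: y :: z :: W)))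
  have rot1 := IsRed.rotate g.p0 g.q0 (l1 := h :: Y) (l1' := []) (l2 := []) (l3 := z :: W)
    (hnH x (by simp)) (hnH y (by simp)) (by rw [List.append_nil]; exact hnz') (ψ := f.1)
    (φ := C c * Psi p q ((h :: Y).zip (z :: W)))
  rw [List.append_nil] at rot1
  have red1 := rot1.1 hr
  have red2 := (IsRed.rotate g.p0 g.q0 (l1 := h :: Y) (l1' := [x]) (l2 := []) (l3 := W)
    (hnH y (by simp)) (hnH z (by simp)) (by simpa using hnx') (ψ := f'.1)
    (φ := C c' * Psi p q ((h :: Y).zip (x :: W)))).1 hr'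
  rw [map_mul, hom_C, e, ← mul_assoc, ← mul_assoc, ← C_mul, ← C_mul] at red1
  rw [map_mul, hom_C, e', ← mul_assoc, ← mul_assoc, ← C_mul, ← C_mul] at red2
  set τ := tauPar p q with hτd
  have hN1 : ∀ ψ, h1.P ψ = ψ → ψ ∈ LinearMap.ker (h1.t * h2.t - τ • h2.P) ⊓
      LinearMap.ker (h1.P * h2.P - (τ⁻¹ * τ⁻¹) • 1) := by
    intro ψ hψ
    refine sym_mem_of_reach (l1 := []) h1 (List.suffix_cons z _).isInfix (hgen z hnz) _
      ⟨_, ?_, hT.sym, _, mul_ne_zero (mul_ne_zero hk hc) hd, red1⟩ ?_ hψ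
    · simp only [Submodule.mem_inf, LinearMap.mem_ker, LinearMap.sub_apply, Module.End.mul_apply,
        LinearMap.smul_apply, Module.End.one_apply]
      refine ⟨?_, ?_⟩
      · rw [hT.tt, hT.proj, smul_smul, mul_inv_cancel₀ hτ, one_smul, sub_self]
      · rw [hT.proj, map_smul, hT.proj', smul_smul, sub_self]
    · intro c d h' hcd ψ hψ h0
      obtain ⟨j1, j2⟩ := hdj c d hcd
      simp only [Submodule.mem_inf, LinearMap.mem_ker, LinearMap.sub_apply, Module.End.mul_apply,
        LinearMap.smul_apply, Module.End.one_apply, sub_eq_zero] at hψ ⊢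
      rw [h2.t_t_far h' j2 h0, h2.P_t_far h' j2 h0, h1.t_t_far h' j1 (h2.t_ker_far h' j2 h0),
        h1.P_t_far h' j1 (h2.P_ker_far h' j2 h0), hψ.1, hψ.2, map_smul, map_smul]
      exact ⟨rfl, rfl⟩
  have hN2 : ∀ ψ, h2.P ψ = ψ → ψ ∈ LinearMap.ker (h2.P * h1.P - (τ⁻¹ * τ⁻¹) • 1) := by
    intro ψ hψ
    refine sym_mem_of_reach (l1 := [x]) h2 (List.infix_refl _) (hgen x hnx) _
      ⟨_, ?_, hT.sym', _, mul_ne_zero (mul_ne_zero hk hc') hd', red2⟩ ?_ hψ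
    · simp only [LinearMap.mem_ker, LinearMap.sub_apply, Module.End.mul_apply,
        LinearMap.smul_apply, Module.End.one_apply]
      rw [hT.proj', map_smul, hT.proj, smul_smul, sub_self]
    · intro c d h' hcd ψ hψ h0
      obtain ⟨j1, j2⟩ := hdj c d hcd
      simp only [LinearMap.mem_ker, LinearMap.sub_apply, Module.End.mul_apply,
        LinearMap.smul_apply, Module.End.one_apply, sub_eq_zero] at hψ ⊢
      rw [h1.P_t_far h' j1 h0, h2.P_t_far h' j2 (h1.P_ker_far h' j1 h0), hψ, map_smul]
  simp only [Submodule.mem_inf, LinearMap.mem_ker, LinearMap.sub_apply, Module.End.mul_apply,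
    LinearMap.smul_apply, Module.End.one_apply, sub_eq_zero] at hN1 hN2
  exact ⟨fun ψ hψ => (hN1 ψ hψ).2, hN2, fun ψ hψ => (hN1 ψ hψ).1⟩

theorem triRel {p q : ℂ} {l H R : List ι} {x y z : ι} (hl : l = H ++ x :: y :: z :: R)
    (h1 : Loc p q l x y) (h2 : Loc p q l y z) : TriRel h1 h2 := by
  subst hl
  have g := h1.g
  have hperm : (H ++ x :: y :: z :: R).Perm (x :: y :: z :: R ++ H) := List.perm_append_comm
  have hn' := hperm.nodup_iff.1 h1.nd
  have he' : Even (x :: y :: z :: R ++ H).length := hperm.length_eq ▸ h1.ev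
  have h1' : Loc p q (x :: y :: z :: R ++ H) x y := ⟨g, hn', he', [], z :: (R ++ H), by simp⟩
  have h2' : Loc p q (x :: y :: z :: R ++ H) y z := ⟨g, hn', he', [x], R ++ H, by simp⟩
  have ht := triRel_front h1' h2'
  have hnH : ∀ i ∈ x :: y :: z :: R, i ∉ H := fun i hi hm =>
    (List.nodup_append.1 h1.nd).2.2 _ hm _ hi rfl
  have i1 := iff_of_false (hnH x (by simp)) (hnH y (by simp))
  have i2 := iff_of_false (hnH y (by simp)) (hnH z (by simp))
  constructor
  · intro ψ hψ
    apply rot_injective g h1.nd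
    rw [← h1.P_rot h1' i1, ← h2.P_rot h2' i2, ht.pp _ (by rw [h1.P_rot h1' i1, hψ]), map_smul]
  · intro ψ hψ
    apply rot_injective g h1.nd
    rw [← h2.P_rot h2' i2, ← h1.P_rot h1' i1, ht.pp' _ (by rw [h2.P_rot h2' i2, hψ]), map_smul]
  · intro ψ hψ
    apply rot_injective g h1.nd
    rw [← h1.t_rot h1' i1, ← h2.t_rot h2' i2, ht.tt _ (by rw [h1.P_rot h1' i1, hψ]), map_smul,
      h2.P_rot h2' i2]

/-! ### Two overlapping pairs of operators -/

/-- Relations of two neighbouring pairs of operators that follow from the symmetric vectors. -/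
structure Nbr {V : Type} [AddCommGroup V] [Module ℂ V] (a e τ : ℂ) (b P c Q : Module.End ℂ V) :
    Prop where
  a0 : a ≠ 0
  τ0 : τ ≠ 0
  skein : e * τ = e - a + a⁻¹
  bb : ∀ v, b (b v) = v + e • b v - (e * a * τ) • P v
  cc : ∀ v, c (c v) = v + e • c v - (e * a * τ) • Q v
  bP : ∀ v, b (P v) = a • P v
  Pb : ∀ v, P (b v) = a • P v
  cQ : ∀ v, c (Q v) = a • Q v
  Qc : ∀ v, Q (c v) = a • Q v
  PP : ∀ v, P (P v) = P v
  QQ : ∀ v, Q (Q v) = Q v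
  PQP : ∀ v, P (Q (P v)) = (τ⁻¹ * τ⁻¹) • P v
  QPQ : ∀ v, Q (P (Q v)) = (τ⁻¹ * τ⁻¹) • Q v
  bcP : ∀ v, b (c (P v)) = τ • Q (P v)

namespace Nbr
variable {V : Type} [AddCommGroup V] [Module ℂ V] {a e τ : ℂ} {b P c Q : Module.End ℂ V}

lemma PcP (h : Nbr a e τ b P c Q) (v : V) : P (c (P v)) = (a⁻¹ * τ⁻¹) • P v := by
  have h3 := congrArg P (h.bcP v)
  rw [h.Pb, map_smul, h.PQP] at h3
  have := congrArg (fun w => a⁻¹ • w) h3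
  simp only [smul_smul] at this
  rw [inv_mul_cancel₀ h.a0, one_smul, ← mul_assoc τ, mul_inv_cancel₀ h.τ0, one_mul] at this
  exact this

lemma cP (h : Nbr a e τ b P c Q) (v : V) :
    c (P v) = τ • b (Q (P v)) - (e * τ) • Q (P v) + e • P v := by
  have h1 := h.bb (c (P v))
  have h2 := h.bcP v
  have h4 := h.PcP v
  rw [h2, h4, map_smul] at h1
  have e1 : e * a * τ * (a⁻¹ * τ⁻¹) = e := by
    have := h.a0
    have := h.τ0
    field_simp
  rw [smul_smul, smul_smul, e1] at h1
  rw [h1]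
  module

lemma cbQ (h : Nbr a e τ b P c Q) (v : V) : c (b (Q v)) = τ • P (Q v) := by
  have h0 := h.a0
  have h1 := h.τ0
  have e1 : b (Q v) = τ • c (P (Q v)) + e • Q v - (e * τ) • P (Q v) := by
    have := congrArg (fun w => τ • w) (h.cP (Q v))
    simp only [h.QPQ, map_smul, smul_add, smul_sub, smul_smul] at this
    rw [this]
    match_scalars <;> field_simp <;> ring
  rw [e1]
  simp only [map_add, map_sub, map_smul, h.cc, h.cQ, h.QPQ]
  match_scalars <;> field_simp <;> ring

lemma symm (h : Nbr a e τ b P c Q) : Nbr a e τ c Q b P :=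
  ⟨h.a0, h.τ0, h.skein, h.cc, h.bb, h.cQ, h.Qc, h.bP, h.Pb, h.QQ, h.PP, h.QPQ, h.PQP, h.cbQ⟩

/-- The vectors on which the remaining relations hold. -/
def good (τ : ℂ) (b P c Q : Module.End ℂ V) : Submodule ℂ V :=
  LinearMap.ker (P * c * b - τ • (P * Q)) ⊓ LinearMap.ker (Q * b * c - τ • (Q * P)) ⊓
    LinearMap.ker (b * c * b - c * b * c)

lemma mem_good {v : V} : v ∈ good τ b P c Q ↔ (P (c (b v)) = τ • P (Q v) ∧
    Q (b (c v)) = τ • Q (P v)) ∧ b (c (b v)) = c (b (c v)) := by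
  simp only [good, Submodule.mem_inf, LinearMap.mem_ker, LinearMap.sub_apply,
    Module.End.mul_apply, LinearMap.smul_apply, sub_eq_zero]

lemma good_P (h : Nbr a e τ b P c Q) (v : V) : P v ∈ good τ b P c Q := by
  have h0 := h.a0
  have h1 := h.τ0
  rw [mem_good]
  simp only [h.bP, h.bcP, map_smul, h.PcP, h.PQP, h.QQ, h.PP, h.cQ, smul_smul]
  refine ⟨⟨?_, trivial⟩, ?_⟩
  · congr 1; field_simp
  · congr 1; ring

lemma good_Q (h : Nbr a e τ b P c Q) (v : V) : Q v ∈ good τ b P c Q := by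
  have := h.symm.good_P v
  rw [mem_good] at this ⊢
  exact ⟨⟨this.1.2, this.1.1⟩, this.2.symm⟩

lemma good_cP (h : Nbr a e τ b P c Q) (v : V) : c (P v) ∈ good τ b P c Q := by
  have h0 := h.a0
  have h1 := h.τ0
  have hs := h.skein
  have hs' : e * τ * a = e * a - a * a + 1 := by rw [hs]; field_simp
  rw [mem_good]
  simp only [h.bcP, map_smul, map_add, map_sub, h.cQ, h.PQP, h.Qc, h.cc, h.bP, h.symm.PcP,
    h.PcP, smul_smul, h.cbQ, h.QQ]
  refine ⟨⟨?_, ?_⟩, ?_⟩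
  · module
  · match_scalars
    field_simp
    linear_combination hs'
  · rw [h.cP]
    rw [show e * a * τ * (τ * (τ⁻¹ * τ⁻¹)) = e * a by field_simp]
    module

end Nbr


/-- The parameters avoid a second list of special values. -/
structure Gen2 (p q : ℂ) : Prop extends Gen p q where
  tau2 : tauPar p q ^ 2 - 1 ≠ 0
  cross : (tauPar p q ^ 2 - 1) * (tauPar p q + epsPar p * ((aPar p q)⁻¹ - aPar p q)) -
    tauPar p q * (aPar p q ^ 2 + (aPar p q)⁻¹ ^ 2) + 2 ≠ 0

lemma Loc.nbr {p q : ℂ} {l : List ι} {x y z : ι} {h1 : Loc p q l x y} {h2 : Loc p q l y z}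
    (h : TriRel h1 h2) : Nbr (aPar p q) (epsPar p) (tauPar p q) h1.t h1.P h2.t h2.P where
  a0 := aPar_ne_zero h1.g.p0 h1.g.q0
  τ0 := h1.g.tau
  skein := eps_mul_tau h1.g.eps
  bb := h1.t_t
  cc := h2.t_t
  bP := h1.t_P
  Pb := h1.P_t
  cQ := h2.t_P
  Qc := h2.P_t
  PP := h1.P_P
  QQ := h2.P_P
  PQP v := h.pp _ (h1.P_P v)
  QPQ v := h.pp' _ (h2.P_P v)
  bcP v := h.tt _ (h1.P_P v)

lemma good_of_blk {p q : ℂ} {l : List ι} {x y z : ι} (h1 : Loc p q l x y) (h2 : Loc p q l y z)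
    (hn : [x, y, z].Nodup) {ψ : ML p q l} (hψ : Blk q [x, y, z] (ψ : Pol)) :
    ψ ∈ Nbr.good (tauPar p q) h1.t h1.P h2.t h2.P := by
  have hq := h1.g.q0
  have i1 : [x, y] <:+: [x, y, z] := ⟨[], [z], rfl⟩
  have i2 : [y, z] <:+: [x, y, z] := ⟨[x], [], rfl⟩
  have k1 : ∀ {φ : ML p q l}, Blk q [x, y, z] (φ : Pol) → h1.P φ = 0 ∧
      (h1.t φ : Pol) = T p q x y φ ∧ Blk q [x, y, z] (h1.t φ : Pol) := by
    intro φ hφ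
    have h0 := h1.P_eq_zero.2 (blk_dvd hφ i1)
    refine ⟨h0, h1.t_of_ker h0, ?_⟩
    rw [h1.t_of_ker h0]
    exact T_blk_infix hq hn i1 hφ
  have k2 : ∀ {φ : ML p q l}, Blk q [x, y, z] (φ : Pol) → h2.P φ = 0 ∧
      (h2.t φ : Pol) = T p q y z φ ∧ Blk q [x, y, z] (h2.t φ : Pol) := by
    intro φ hφ
    have h0 := h2.P_eq_zero.2 (blk_dvd hφ i2)
    refine ⟨h0, h2.t_of_ker h0, ?_⟩
    rw [h2.t_of_ker h0]
    exact T_blk_infix hq hn i2 hφ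
  have b1 := k1 hψ
  have b2 := k2 hψ
  have b12 := k2 b1.2.2
  have b21 := k1 b2.2.2
  have b121 := k1 b12.2.2
  have b212 := k2 b21.2.2
  rw [Nbr.mem_good]
  refine ⟨⟨?_, ?_⟩, ?_⟩
  · rw [b121.1, b2.1, map_zero, smul_zero]
  · rw [b212.1, b1.1, map_zero, smul_zero]
  · apply Subtype.ext
    rw [b121.2.1, b12.2.1, b1.2.1, b212.2.1, b21.2.1, b2.2.1]
    apply io_injective
    have d := fun {φ : ML p q l} (h : Blk q [x, y, z] (φ : Pol)) => blk_dvd h i1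
    have d' := fun {φ : ML p q l} (h : Blk q [x, y, z] (φ : Pol)) => blk_dvd h i2
    have d1 := d b12.2.2
    have d2 := d' b21.2.2
    rw [b12.2.1, b1.2.1] at d1
    rw [b21.2.1, b2.2.1] at d2
    have d3 := d' b1.2.2
    have d4 := d b2.2.2
    rw [b1.2.1] at d3
    rw [b2.2.1] at d4
    simp only [List.nodup_cons, List.mem_cons, List.not_mem_nil, or_false, not_or] at hn
    rw [io_T hq h1.ne d1, io_T hq h2.ne d3, io_T hq h1.ne (d hψ), io_T hq h2.ne d2,
      io_T hq h1.ne d4, io_T hq h2.ne (d' hψ), TF_braid h1.g.p0 hq h1.ne h2.ne hn.1.2]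

lemma exists_cross {p q : ℂ} (g : Gen2 p q) {H R : List ι} {x y z : ι}
    (h1 : Loc p q (H ++ x :: y :: z :: R) x y) (h2 : Loc p q (H ++ x :: y :: z :: R) y z)
    {ψ : ML p q (H ++ x :: y :: z :: R)} (k1 : h1.P ψ = 0) (k2 : h2.P ψ = 0) :
    ∃ ζ u v : ML p q (H ++ x :: y :: z :: R),
      Blk q [x, y, z] (ψ - (h2.t (h1.P ζ) + h1.P u + h2.P v) : ML p q (H ++ x :: y :: z :: R)).1 := by
  have hp := g.p0
  have hq := g.q0
  have hn := h1.nd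
  have hN := Loc.nbr (triRel rfl h1 h2)
  have hn3 : [x, y, z].Nodup := by
    refine hn.sublist ?_
    exact (by simp : [x, y, z].Sublist (x :: y :: z :: R)).trans (List.sublist_append_right _ _)
  have hxz : x ≠ z := by simp at hn3; tauto
  have d1 := h1.P_eq_zero.1 k1
  have d2 := h2.P_eq_zero.1 k2
  obtain ⟨ρ, hρ, hr⟩ := ML_red g.toGen (x := x) (y := z) (l1 := H) (l2 := [y]) (l3 := R) hn h1.ev ψ.2
    (fun w hw => by rw [List.mem_singleton.1 hw]; exact ⟨d1, d2⟩)
  set τ := tauPar p q with hτd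
  set a := aPar p q with had
  set e := epsPar p with hed
  have a0 := hN.a0
  have τ0 := hN.τ0
  have t2 := g.tau2
  rw [← hτd] at t2
  set ν := τ ^ 2 / (τ ^ 2 - 1) with hν
  set r := 1 + e * a⁻¹ * τ⁻¹ - e * a * τ⁻¹ -
    ν * (a⁻¹ ^ 2 * τ⁻¹ ^ 2 + a ^ 2 * τ⁻¹ ^ 2 - 2 * τ⁻¹ ^ 3) with hr'
  have r0 : r ≠ 0 := by
    intro h
    apply g.cross
    rw [← hτd, ← had, ← hed]
    have : (τ ^ 2 - 1) * (τ + e * (a⁻¹ - a)) - τ * (a ^ 2 + a⁻¹ ^ 2) + 2 = r * (τ ^ 2 - 1) * τ := by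
      rw [hr', hν]; field_simp; ring
    rw [this, h]; ring
  -- the lift
  have hsw : (H ++ ([y] ++ R)).map (Equiv.swap y z) = H ++ z :: R := by
    have hd : (H ++ [x] ++ y :: z :: R).Nodup := by simpa using hn
    have := map_swap_adj hd
    have hm := List.nodup_append.1 hd
    have hz : z ∉ R := (List.nodup_cons.1 (List.nodup_cons.1 hm.2.1).2).1
    have hy : y ∉ R := fun h => (List.nodup_cons.1 hm.2.1).1 (List.mem_cons_of_mem _ h)
    have hzH : z ∉ H := fun h => hm.2.2 z (by simp [h]) z (by simp) rfl
    have hyH : y ∉ H := fun h => hm.2.2 y (by simp [h]) y (by simp) rfl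
    rw [List.map_append, List.map_append, map_swap_of_notMem hyH hzH, map_swap_of_notMem hy hz]
    simp
  have hnr : (H ++ ([y] ++ R)).Nodup := hn.sublist ((List.Sublist.refl _).append (by simp))
  have hχ : (a * r⁻¹) • sw y z ρ ∈ ML p q (H ++ z :: R) :=
    Submodule.smul_mem _ _ (hsw ▸ ML_sw hnr hρ y z)
  obtain ⟨F, hF, hFs, hFr⟩ := hasLift g.toGen h1.nd h1.ev _ hχ
  set ζ : ML p q (H ++ x :: y :: z :: R) := ⟨F, hF⟩ with hζ
  have zs : h1.P ζ = ζ := h1.P_eq_self.2 hFs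
  have Pt := hN.PcP ζ
  have PQ := hN.PQP ζ
  rw [zs] at Pt PQ
  set η := h2.t ζ - (ν * (a⁻¹ * τ⁻¹ - a * τ⁻¹ ^ 2)) • ζ - (ν * (a - a⁻¹ * τ⁻¹)) • h2.P ζ with hη
  have e1 : h1.P η = 0 := by
    rw [hη, map_sub, map_sub, map_smul, map_smul, Pt, PQ, zs, hν]
    match_scalars; field_simp; ring
  have e2 : h2.P η = 0 := by
    rw [hη, map_sub, map_sub, map_smul, map_smul, h2.P_t, h2.P_P, hν]
    match_scalars; field_simp; ring
  have e3 : h1.P (h2.t η) = r • ζ := by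
    rw [hη]
    simp only [map_sub, map_add, map_smul, h2.t_t, h2.t_P, Pt, PQ, zs]
    rw [hr']
    match_scalars; field_simp; ring
  have b1 := h1.P_eq_zero.1 e1
  have b2 := h2.P_eq_zero.1 e2
  obtain ⟨ρ', hρ', hrη⟩ := ML_red g.toGen (x := x) (y := z) (l1 := H) (l2 := [y]) (l3 := R) hn h1.ev
    η.2 (fun w hw => by rw [List.mem_singleton.1 hw]; exact ⟨b1, b2⟩)
  have hm := moveR_right hp hq (v := x) (u := y) (w := z) (l1 := H) (l2 := []) (l3 := R) hn b2 b1 hrη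
  rw [← h2.t_of_ker e2] at hm
  have hm2 : IsRed p q x y H [] (z :: R) (h2.t η).1 (r • (a * r⁻¹) • sw y z ρ) := by
    have k := h1.P_sub (h2.t η)
    rw [e3, h1.P_eq_zero] at k
    have := (hFr.smul r).add (isRed_zero_of_dvd (p := p) (l1 := H) (l2 := []) (l3 := z :: R) h1.ne k)
    rw [add_zero] at this
    convert this using 1
    change _ = r • F + ((h2.t η).1 - r • F)
    abel
  have hxr : x ∉ H ++ ([] ++ z :: R) := (red_names (l2 := []) (by
    have : (H ++ x :: y :: z :: R).Nodup := hn
    exact this)).2.2.1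
  have hu := hm.unique hxr hm2
  have hρe : ρ' = ρ := by
    apply sw_injective y z
    apply mul_left_cancel₀ (C_ne_zero' a0)
    rw [hu, smul_smul, mul_left_comm, mul_inv_cancel₀ r0, mul_one, smul_eq_C_mul]
  rw [hρe] at hrη
  have hs := hr.sub hrη
  rw [sub_self] at hs
  refine ⟨ζ, -(ν * (a⁻¹ * τ⁻¹ - a * τ⁻¹ ^ 2)) • ζ, -(ν * (a - a⁻¹ * τ⁻¹)) • ζ, ?_⟩
  have : h2.t (h1.P ζ) + h1.P (-(ν * (a⁻¹ * τ⁻¹ - a * τ⁻¹ ^ 2)) • ζ) +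
      h2.P (-(ν * (a - a⁻¹ * τ⁻¹)) • ζ) = η := by
    rw [map_smul, map_smul, zs, hη]; module
  rw [this]
  exact blk3.2 ⟨dvd_sub d1 b1, hs.dvd_of_zero hxz, dvd_sub d2 b2⟩

theorem mem_good_all {p q : ℂ} (g : Gen2 p q) {l H R : List ι} {x y z : ι}
    (hl : l = H ++ x :: y :: z :: R) (h1 : Loc p q l x y) (h2 : Loc p q l y z) (ψ : ML p q l) :
    ψ ∈ Nbr.good (tauPar p q) h1.t h1.P h2.t h2.P := by
  subst hl
  have hN := Loc.nbr (triRel rfl h1 h2)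
  have τ0 := hN.τ0
  have t2 := g.tau2
  set τ := tauPar p q with hτ
  set ν := τ ^ 2 / (τ ^ 2 - 1) with hν
  have hn3 : [x, y, z].Nodup := h1.nd.sublist
    ((by simp : [x, y, z].Sublist (x :: y :: z :: R)).trans (List.sublist_append_right _ _))
  set φ := ψ - h1.P (ν • (ψ - h2.P ψ)) - h2.P (ν • (ψ - h1.P ψ)) with hφ
  have k1 : h1.P φ = 0 := by
    rw [hφ]
    simp only [map_sub, map_smul, h1.P_P, h2.P_P, hN.PQP]
    rw [hν]
    match_scalars <;> field_simp <;> ring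
  have k2 : h2.P φ = 0 := by
    rw [hφ]
    simp only [map_sub, map_smul, h1.P_P, h2.P_P, hN.QPQ]
    rw [hν]
    match_scalars <;> field_simp <;> ring
  obtain ⟨ζ, u, v, hb⟩ := exists_cross g h1 h2 k1 k2
  have h3 := good_of_blk h1 h2 hn3 hb
  have h4 := add_mem h3 (add_mem (add_mem (hN.good_cP ζ) (hN.good_P u)) (hN.good_Q v))
  rw [sub_add_cancel] at h4
  have h5 := add_mem (add_mem h4 (hN.good_Q (ν • (ψ - h1.P ψ)))) (hN.good_P (ν • (ψ - h2.P ψ)))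
  rwa [hφ, sub_add_cancel, sub_add_cancel] at h5

/-! ### Commuting chains -/

lemma commute_cL {p q : ℂ} (c : ℂ) {X : Module.End ℂ (Fr ι)} : ∀ {A : List ι},
    (∀ a b, [a, b] <:+: A → ∀ f, X (TF p q a b f) = TF p q a b (X f)) →
    ∀ f, X (cL p q c A f) = cL p q c A (X f)
  | [], _, _ => rfl
  | [_], _, _ => rfl
  | a :: b :: s, h, f => by
    have ih := commute_cL c (A := b :: s) (fun u v huv => h u v (huv.trans (List.suffix_cons _ _).isInfix))
    rw [cL, Module.End.mul_apply, Module.End.mul_apply, ih, TFc_apply, TFc_apply, map_sub, map_smul,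
      h a b ⟨[], s, rfl⟩]

lemma commute_cR {p q : ℂ} (c : ℂ) {X : Module.End ℂ (Fr ι)} : ∀ {A : List ι},
    (∀ a b, [a, b] <:+: A → ∀ f, X (TF p q a b f) = TF p q a b (X f)) →
    ∀ f, X (cR p q c A f) = cR p q c A (X f)
  | [], _, _ => rfl
  | [_], _, _ => rfl
  | a :: b :: s, h, f => by
    have ih := commute_cR c (A := b :: s) (fun u v huv => h u v (huv.trans (List.suffix_cons _ _).isInfix))
    rw [cR, Module.End.mul_apply, Module.End.mul_apply, TFc_apply, TFc_apply, map_sub, map_smul,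
      h a b ⟨[], s, rfl⟩, ih]

lemma TF_commute {p q : ℂ} {A : List ι} {x y : ι} (hx : x ∉ A) (hy : y ∉ A) (a b : ι)
    (h : [a, b] <:+: A) (f : Fr ι) : TF p q x y (TF p q a b f) = TF p q a b (TF p q x y f) := by
  have ha : a ∈ A := h.subset (by simp)
  have hb : b ∈ A := h.subset (by simp)
  exact TF_comm (ne_of_mem_of_not_mem ha hx).symm (ne_of_mem_of_not_mem hb hx).symm
    (ne_of_mem_of_not_mem ha hy).symm (ne_of_mem_of_not_mem hb hy).symm f

lemma sF_commute {p q : ℂ} {A : List ι} {x y : ι} (hx : x ∉ A) (hy : y ∉ A) (a b : ι)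
    (h : [a, b] <:+: A) (f : Fr ι) : sF x y (TF p q a b f) = TF p q a b (sF x y f) := by
  have ha : a ∈ A := h.subset (by simp)
  have hb : b ∈ A := h.subset (by simp)
  rw [TF_sF, sw_ne (ne_of_mem_of_not_mem ha hx) (ne_of_mem_of_not_mem ha hy),
    sw_ne (ne_of_mem_of_not_mem hb hx) (ne_of_mem_of_not_mem hb hy)]

lemma cL_concat {p q c : ℂ} {w h : ι} : ∀ (D : List ι) (f : Fr ι),
    cL p q c (D ++ [w, h]) f = TFc p q c w h (cL p q c (D ++ [w]) f)
  | [], _ => rfl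
  | [_], _ => rfl
  | a :: b :: D, f => cL_concat (b :: D) (TFc p q c a b f)

/-- The shift of a chain by a full chain. -/
lemma cL_shift {p q : ℂ} (hp : p ≠ 0) (hq : q ≠ 0) (c : ℂ) : ∀ {b : ι} {l : List ι} {a : ι},
    (a :: b :: l).Nodup → ∀ f, cL p q c ((a :: b :: l).dropLast) (cL p q 0 (a :: b :: l) f) =
      cL p q 0 (a :: b :: l) (cL p q c (b :: l) f)
  | b, [], a, _, f => rfl
  | b, d :: l, a, hn, f => by
    have hn' := (List.nodup_cons.1 hn).2
    have hab : a ≠ b := fun e => (List.nodup_cons.1 hn).1 (by simp [e])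
    have had : a ≠ d := fun e => (List.nodup_cons.1 hn).1 (by simp [e])
    have hbd : b ≠ d := fun e => (List.nodup_cons.1 hn').1 (by simp [e])
    have ha : a ∉ d :: l := fun h => (List.nodup_cons.1 hn).1 (List.mem_cons_of_mem _ h)
    have hb := (List.nodup_cons.1 hn').1
    have ih := cL_shift hp hq c hn' (TF p q a b (TFc p q c b d f))
    have com := fun (k : ℂ) => commute_cL (p := p) (q := q) k (TF_commute (p := p) (q := q) ha hb)
    have e0 : ∀ {x y : ι} (g : Fr ι), TFc p q 0 x y g = TF p q x y g := fun g => by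
      rw [TFc_apply, zero_smul, sub_zero]
    have ec : ∀ {x y : ι} {s : List ι} (k : ℂ) (g : Fr ι), cL p q k (x :: y :: s) g =
      cL p q k (y :: s) (TFc p q k x y g) := fun k g => rfl
    have ed : cL p q c (List.dropLast (a :: b :: d :: l)) (cL p q 0 (a :: b :: d :: l) f) =
        cL p q c (List.dropLast (b :: d :: l)) (TFc p q c a b (cL p q 0 (a :: b :: d :: l) f)) := rfl
    have eb : TFc p q c a b (cL p q 0 (a :: b :: d :: l) f) =
        cL p q 0 (b :: d :: l) (TF p q a b (TFc p q c b d f)) := by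
      rw [ec 0, ec 0, e0, e0, ec 0, e0, TFc_apply, com, TFc_apply, map_sub, map_sub, map_sub, map_smul,
        map_smul, map_smul, TF_braid hp hq hab hbd had]
    rw [ed, eb, ih, ← com]
    change _ = cL p q 0 (b :: d :: l) (TFc p q 0 a b (cL p q c (b :: d :: l) f))
    rw [e0]
    rfl


/-- The two orders of the construction of a polynomial with two symmetries agree. -/
lemma comm_words {V : Type} [AddCommGroup V] [Module ℂ V] {T1 T2 T3 L L' P P' : V →ₗ[ℂ] V}
    {a e τ : ℂ} (ha : a ≠ 0) (he : e ≠ 0) (hs : e * τ = e - a + a⁻¹)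
    (q1 : ∀ v, T1 (T1 v) = v + e • T1 v) (q3 : ∀ v, T3 (T3 v) = v + e • T3 v)
    (c13 : ∀ v, T3 (T1 v) = T1 (T3 v)) (p1 : ∀ v, P (T1 v) = T1 (P v))
    (p1' : ∀ v, P' (T1 v) = T1 (P' v)) (p2 : ∀ v, P (T2 v) = T2 (P v))
    (p2' : ∀ v, P' (T2 v) = T2 (P' v)) (l3 : ∀ v, L (T3 v) = T3 (L v))
    (l3' : ∀ v, L' (T3 v) = T3 (L' v)) (l2 : ∀ v, L (T2 v) = T2 (L v))
    (l2' : ∀ v, L' (T2 v) = T2 (L' v)) (pl : ∀ v, P (L v) = L (P v))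
    (pl' : ∀ v, P (L' v) = L' (P v)) (pl2 : ∀ v, P' (L v) = L (P' v))
    (pl3 : ∀ v, P' (L' v) = L' (P' v)) {ψ G G' F F' S D : V}
    (key : T3 (L' (P ψ)) = T1 (L (P' ψ)))
    (hG : e • G = T2 (L ψ) - (T2 (L' ψ) - e • L' ψ))
    (hF : F = τ • T2 (L ψ) + T1 G + (a - e) • G)
    (hG' : e • G' = T2 (P ψ) - (T2 (P' ψ) - e • P' ψ))
    (hF' : F' = τ • T2 (P ψ) + T3 G' + (a - e) • G')
    (hD : e • D = P F - P' F) (hS : S = τ • P F + T3 D + (a - e) • D) :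
    e • S = (e * τ) • L F' + T1 (L F' - L' F') + (a - e) • (L F' - L' F') := by
  have k0 : e • F = (e * τ) • T2 (L ψ) + T1 (T2 (L ψ) - (T2 (L' ψ) - e • L' ψ)) +
      (a - e) • (T2 (L ψ) - (T2 (L' ψ) - e • L' ψ)) := by
    rw [← hG, hF, map_smul]; module
  have k0' : e • F' = (e * τ) • T2 (P ψ) + T3 (T2 (P ψ) - (T2 (P' ψ) - e • P' ψ)) +
      (a - e) • (T2 (P ψ) - (T2 (P' ψ) - e • P' ψ)) := by
    rw [← hG', hF', map_smul]; module
  have k1 : e • S = (e * τ) • P F + T3 (P F - P' F) + (a - e) • (P F - P' F) := by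
    rw [← hD, hS, map_smul]; module
  rw [hs] at k0 k0' k1 ⊢
  have hi : a * a⁻¹ = 1 := mul_inv_cancel₀ ha
  generalize a⁻¹ = i at *
  have f1 := congrArg P k0
  have f2 := congrArg P' k0
  have f3 := congrArg L k0'
  have f4 := congrArg L' k0'
  have f5 := congrArg T3 f1
  have f6 := congrArg T3 f2
  have f7 := congrArg T1 f3
  have f8 := congrArg T1 f4
  have key1 := congrArg T1 key
  have key3 := congrArg T3 key
  have key13 := congrArg T3 key1
  simp only [map_add, map_sub, map_smul, p1, p1', p2, p2', l3, l3', l2, l2', pl, pl', pl2, pl3, c13,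
    q1, q3] at f1 f2 f3 f4 f5 f6 f7 f8 key key1 key3 key13
  have h0 : e • (e • S - ((e - a + i) • L F' + T1 (L F' - L' F') + (a - e) • (L F' - L' F'))) = 0 := by
    rw [k1]
    simp only [map_sub]
    linear_combination (norm := module) i • f1 - (a - e) • f2 + f5 - f6 - i • f3 + (a - e) • f4 - f7 + f8 +
      e • ((1 - i * e) • key1 + (1 - i * e) • key3 + (a - e - e + i * e * e) • key + i • key13) +
      e • hi • (L' (P ψ) - L (P' ψ))
  have := (smul_eq_zero.1 h0).resolve_left he
  rwa [sub_eq_zero] at this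

lemma red_pR {p q : ℂ} (hq : q ≠ 0) (c : ℂ) {l1 l2 W : List ι} {x y : ι}
    (hn : (l1 ++ x :: y :: l2).Nodup) (hW : W <:+: l2) {f χ : Pol} (bf : Blk q W f)
    (bχ : Blk q W χ) (hs : sw x y f = f) (hr : IsRed p q x y l1 [] l2 f χ) : ∀ {B : List ι},
    B <:+: W → sw x y (pR p q c B f) = pR p q c B f ∧
      IsRed p q x y l1 [] l2 (pR p q c B f) (pR p q c B χ)
  | [], _ => ⟨hs, hr⟩
  | [_], _ => ⟨hs, hr⟩
  | a :: b :: B, hB => by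
    obtain ⟨h1, h2⟩ := red_pR hq c hn hW bf bχ hs hr (B := b :: B) (infix_tail hB)
    have hab := (infix_head hB).trans hW
    have hnW : W.Nodup := (hn.sublist (List.sublist_append_right _ _)).sublist
      (hW.sublist.trans (by simp))
    have hn3 : (l1 ++ [x, y] ++ l2).Nodup := by simpa using hn
    have ha : a ∈ l2 := hab.subset (by simp)
    have hb : b ∈ l2 := hab.subset (by simp)
    have hj : Dj x y a b := dj_of_append hn3 (by simp) (by simp) ha hb
    have hne := infix_ne hnW (infix_head hB)
    have d1 := blk_dvd (pR_blk (p := p) hq c hnW bf (infix_tail hB)) (infix_head hB)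
    have d2 := blk_dvd (pR_blk (p := p) hq c hnW bχ (infix_tail hB)) (infix_head hB)
    have hn2 : (l1 ++ ([] ++ l2)).Nodup := hn.sublist ((List.Sublist.refl _).append (by simp))
    refine ⟨?_, ?_⟩
    · rw [pR, map_sub, map_smul, sw_T_of_dj hq hj hne d1, h1]
    · refine (natL_T hq hn2 hj hne ⟨iff_of_false ?_ ?_, by simp, iff_of_true ha hb⟩ h2 d1 d2).sub
        (h2.smul c)
      · exact fun hm => (List.nodup_append.1 hn2).2.2 _ hm _ ha rfl
      · exact fun hm => (List.nodup_append.1 hn2).2.2 _ hm _ hb rfl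

theorem exists_double_seed {p q : ℂ} (g : Gen p q) {x y u v : ι} {Y W : List ι}
    (hn : (Y ++ x :: y :: u :: v :: W).Nodup) (hlen : Y.length = W.length) :
    ∃ S ∈ ML p q (Y ++ x :: y :: u :: v :: W), ∃ F ∈ ML p q (Y ++ u :: v :: W), ∃ c : ℂ, c ≠ 0 ∧
      sw x y S = S ∧ sw u v S = S ∧ sw u v F = F ∧ IsRed p q x y Y [] (u :: v :: W) S F ∧
      IsRed p q u v Y [] W F (C c * Psi p q (Y.zip W)) := by
  have hp := g.p0
  have hq := g.q0
  have hε := g.eps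
  have he : Even (Y ++ x :: y :: u :: v :: W).length :=
    ⟨W.length + 2, by simp [hlen]; omega⟩
  have hnx : (x :: y :: u :: v :: W).Nodup := hn.sublist (List.sublist_append_right _ _)
  have hny := (List.nodup_cons.1 hnx).2
  have hnu := (List.nodup_cons.1 hny).2
  have hnv := (List.nodup_cons.1 hnu).2
  have hxy : x ≠ y := fun e => (List.nodup_cons.1 hnx).1 (by simp [e])
  have hyu : y ≠ u := fun e => (List.nodup_cons.1 hny).1 (by simp [e])
  have huv : u ≠ v := fun e => (List.nodup_cons.1 hnu).1 (by simp [e])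
  have hxv : x ∉ v :: W := fun h => (List.nodup_cons.1 hnx).1 (by simp at h ⊢; tauto)
  have hyv : y ∉ v :: W := fun h => (List.nodup_cons.1 hny).1 (by simp at h ⊢; tauto)
  have huv' := (List.nodup_cons.1 hnu).1
  have hnY2 : ((Y ++ [x]) ++ (y :: u :: v :: W)).Nodup := by simpa using hn
  have hnY3 : ((Y ++ [x] ++ [y]) ++ (u :: v :: W)).Nodup := by simpa using hn
  have hYd := (List.nodup_append.1 hnY2).2.2
  have hYx : (Y ++ [x]).Nodup := (List.nodup_append.1 hnY2).1
  have hYxy : (Y ++ [x] ++ [y]).Nodup := (List.nodup_append.1 hnY3).1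
  have hyY : y ∉ Y ++ [x] := fun h => hYd _ h y (by simp) rfl
  have huY : u ∉ Y ++ [x] := fun h => hYd _ h u (by simp) rfl
  have hvY : v ∉ Y ++ [x] := fun h => hYd _ h v (by simp) rfl
  have hu3 : Dj x y u v := dj_of_append hnY3 (by simp) (by simp) (by simp) (by simp)
  have hnYu : (Y ++ u :: v :: W).Nodup := hn.sublist ((List.Sublist.refl _).append (by simp))
  -- the two seeds and the small one
  obtain ⟨D, w, hD⟩ : ∃ D w, v :: W = D ++ [w] :=
    ⟨(v :: W).dropLast, (v :: W).getLast (by simp), (List.dropLast_append_getLast _).symm⟩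
  have hDl : Y.length = D.length := by
    have := congrArg List.length hD
    simp at this; omega
  obtain ⟨G, Fx, c, hc, hS⟩ := seed_left g (Y := Y) (x := x) (y := y) (z := u) (W := D) (w := w)
    (by rw [← hD]; exact hn) hDl
  rw [← hD] at hS
  obtain ⟨h, Y', hY'⟩ : ∃ h Y', Y ++ [x] = h :: Y' := List.exists_cons_of_ne_nil (by simp)
  have hY'l : Y'.length = W.length := by
    have := congrArg List.length hY'
    simp at this; omega
  obtain ⟨G', Fu, c', hc', hS'⟩ := seed_right g (h := h) (Y := Y') (x := y) (y := u) (z := v) (W := W)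
    (by rw [← hY']; exact hnY2) hY'l
  rw [← hY'] at hS'
  obtain ⟨G0, F0, c0, hc0, hS0⟩ := seed_center g hnYu hlen
  set Ψ := Psi p q ((Y ++ [x] ++ [y]).zip (u :: v :: W)) with hΨ
  set Ψ0 := Psi p q ((Y ++ [u]).zip (v :: W)) with hΨ0
  have hS0 := hS0.smul hq huv c
  have hL : (Y ++ [x] ++ [y]).length = (u :: v :: W).length := by simp [hlen]
  obtain ⟨bL, bR⟩ := Psi_blk_halves (p := p) (q := q) hL
  rw [← hΨ] at bL bR
  have bLx : Blk q (Y ++ [x]) Ψ := bL.sublist (List.sublist_append_left _ _)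
  have bRv : Blk q (v :: W) Ψ := bR.sublist (List.sublist_cons_self _ _)
  have bΨ0 : Blk q (v :: W) Ψ0 := (Psi_blk_halves (by simp [hlen])).2
  have dyu : lf y u (q ^ 2) ∣ Ψ := by
    have := Psi_blk (p := p) (q := q) (L1 := (Y ++ [x]).zip (u :: D)) (L2 := [(y, w)])
    rw [List.map_snd_zip (by simp [hDl]), ← zip_snoc (by simp [hDl]), List.cons_append, ← hD] at this
    exact this y u (by simp)
  have dL : ∀ k, lf y u (q ^ 2) ∣ pL p q k (Y ++ [x]) Ψ := fun k =>
    pL_dvd_dj hq k hyu hYx hyY huY bLx dyu (List.infix_refl _)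
  have dR : ∀ k, lf y u (q ^ 2) ∣ pR p q k (v :: W) Ψ := fun k =>
    pR_dvd_dj hq k hyu hnv hyv huv' bRv dyu (List.infix_refl _)
  -- the polynomial
  have bF : Blk q (v :: W) Fx := by
    have e : Y ++ x :: y :: u :: v :: W = (Y ++ x :: y :: [u]) ++ ((v :: W) ++ []) := by simp
    exact lift_blk g (e ▸ hn) (e ▸ he) (.inl ⟨Y, [u], by simp⟩) (e ▸ hS.mem) hS.sym hS.red
      (fun a b hab => (bΨ0 a b hab).mul_left _)
  have bχ : Blk q (v :: W) (c • Ψ0) := blk_smul bΨ0 c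
  have hred : IsRed p q x y Y [] (u :: v :: W) Fx (c • Ψ0) := by
    rw [smul_eq_C_mul]; exact hS.red
  have rA := fun k => red_pR (p := p) hq k hn (List.suffix_cons u (v :: W)).isInfix bF bχ hS.sym hred
    (List.infix_refl _)
  have eA : ∀ k, pR p q k (v :: W) (c • Ψ0) = c • pR p q k (v :: W) Ψ0 := fun k =>
    pR_smul hq k c hnv bΨ0 (List.infix_refl _)
  set A := pR p q 0 (v :: W) Fx with hA
  set A' := pR p q (epsPar p) (v :: W) Fx with hA'
  have inl : v :: W <:+: Y ++ x :: y :: u :: v :: W := ⟨Y ++ [x, y, u], [], by simp⟩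
  have mA : A ∈ ML p q (Y ++ x :: y :: u :: v :: W) :=
    pR_mem g 0 hnv hn inl bF hS.mem (List.infix_refl _)
  have mA' : A' ∈ ML p q (Y ++ x :: y :: u :: v :: W) :=
    pR_mem g _ hnv hn inl bF hS.mem (List.infix_refl _)
  have rAA := (rA 0).2.sub (rA (epsPar p)).2
  rw [eA, eA, ← hS0.diff] at rAA
  have sAA : sw x y (A - A') = A - A' := by rw [map_sub, (rA 0).1, (rA (epsPar p)).1]
  have buv : Blk q [u, v] (A - A') := by
    have e : Y ++ x :: y :: u :: v :: W = (Y ++ x :: [y]) ++ ([u, v] ++ W) := by simp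
    refine lift_blk g (e ▸ hn) (e ▸ he) (.inl ⟨Y, [], by simp⟩) (e ▸ Submodule.sub_mem _ mA mA') sAA
      rAA fun a b hab => ?_
    have := hab.eq_of_length_le (by simp)
    simp only [List.cons.injEq, and_true] at this
    obtain ⟨rfl, rfl⟩ := this
    exact dvd_smul_of_dvd _ hS0.dvd
  have duv := buv u v (List.Sublist.refl _)
  set Z := (epsPar p)⁻¹ • (A - A') with hZ
  have eZ : epsPar p • Z = A - A' := by rw [hZ, smul_smul, mul_inv_cancel₀ hε, one_smul]
  have dZ : lf u v (q ^ 2) ∣ Z := dvd_smul_of_dvd _ duv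
  have rZ : IsRed p q x y Y [] (u :: v :: W) Z (c • G0) := by
    have := rAA.smul (epsPar p)⁻¹
    rwa [smul_smul, inv_mul_cancel₀ hε, one_smul] at this
  have mZ : Z ∈ ML p q (Y ++ x :: y :: u :: v :: W) :=
    Submodule.smul_mem _ _ (Submodule.sub_mem _ mA mA')
  have sZ : sw x y Z = Z := by rw [hZ, map_smul, sAA]
  have inuv : [u, v] <:+: Y ++ x :: y :: u :: v :: W := ⟨Y ++ [x, y], W, by simp⟩
  refine ⟨tauPar p q • A + T p q u v Z + (aPar p q - epsPar p) • Z,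
    Submodule.add_mem _ (Submodule.add_mem _ (Submodule.smul_mem _ _ mA)
      (T_mem_infix g hn inuv mZ dZ)) (Submodule.smul_mem _ _ mZ), c • F0, hS0.mem, c * c0,
    mul_ne_zero hc hc0, ?_, ?_, hS0.sym, ?_, ?_⟩
  · rw [map_add, map_add, map_smul, map_smul, sw_T_of_dj hq hu3 huv dZ, sZ, (rA 0).1]
  · apply io_injective
    rw [← sF_io]
    -- the other construction
    have iA : ∀ k, io (pR p q k (v :: W) Fx) = cR p q k (v :: W) (io Fx) := fun k =>
      io_pR hq k hnv bF (List.infix_refl _)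
    have iL : ∀ k, io (pL p q k (Y ++ [x]) Ψ) = cL p q k (Y ++ [x]) (io Ψ) := fun k =>
      io_pL hq k hYx bLx (List.infix_refl _)
    have iR : ∀ k, io (pR p q k (v :: W) Ψ) = cR p q k (v :: W) (io Ψ) := fun k =>
      io_pR hq k hnv bRv (List.infix_refl _)
    have iV : ∀ (k : ℂ) {X : Module.End ℂ (Fr ι)},
        (∀ a b, [a, b] <:+: v :: W → ∀ f, X (TF p q a b f) = TF p q a b (X f)) →
        ∀ f, X (cR p q k (v :: W) f) = cR p q k (v :: W) (X f) := fun k X hX => commute_cR k hX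
    have lr : ∀ (k k' : ℂ) f, cR p q k (v :: W) (cL p q k' (Y ++ [x]) f) =
        cL p q k' (Y ++ [x]) (cR p q k (v :: W) f) := fun k k' f =>
      commute_cL k' (X := cR p q k (v :: W)) (fun a b hab f => (commute_cR k (X := TF p q a b)
        (TF_commute (fun h => hYd a (hab.subset (by simp)) a (by simp at h ⊢; tauto) rfl)
          (fun h => hYd b (hab.subset (by simp)) b (by simp at h ⊢; tauto) rfl)) f).symm) f
    have e0 : ∀ {a b : ι} (f : Fr ι), TFc p q 0 a b f = TF p q a b f := fun f => by
      rw [TFc_apply, zero_smul, sub_zero]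
    have oΨ : (ord ((Y ++ [x] ++ [y]).zip (u :: v :: W))).Nodup := by rw [ord_zip hL]; exact hnY3
    have key : TF p q u v (cL p q (epsPar p) (Y ++ [x]) (cR p q 0 (v :: W) (io Ψ))) =
        TF p q x y (cL p q 0 (Y ++ [x]) (cR p q (epsPar p) (v :: W) (io Ψ))) := by
      have full : cR p q 0 (u :: v :: W) (io Ψ) = cL p q 0 (Y ++ [x] ++ [y]) (io Ψ) := by
        have := cR_eq_cL (p := p) (q := q) 0 (io Ψ) oΨ fun P R hPR => TFc_Psi hp hq 0 oΨ P R hPR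
        rwa [List.map_fst_zip hL.le, List.map_snd_zip hL.ge] at this
      have tail : cR p q (epsPar p) (v :: W) (io Ψ) =
          cL p q (epsPar p) (Y' ++ [y]) (io Ψ) := by
        have hl' : (Y' ++ [y]).length = (v :: W).length := by simp [hY'l]
        have ez : (Y ++ [x] ++ [y]).zip (u :: v :: W) = (h, u) :: (Y' ++ [y]).zip (v :: W) := by
          rw [hY']; rfl
        have := cR_eq_cL (p := p) (q := q) (epsPar p) (io Ψ) (L := (Y' ++ [y]).zip (v :: W))
          (ord_tail (ez ▸ oΨ)) fun P R hPR => TFc_Psi hp hq _ oΨ P R (by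
            rw [ez]; exact hPR.trans (List.suffix_cons _ _).isInfix)
        rwa [List.map_fst_zip hl'.le, List.map_snd_zip hl'.ge] at this
      have step : TF p q u v (cR p q 0 (v :: W) (io Ψ)) = cR p q 0 (u :: v :: W) (io Ψ) := by
        rw [cR, Module.End.mul_apply, e0]
      rw [commute_cL _ (TF_commute huY hvY), step, full, tail]
      obtain ⟨b, s, hb⟩ : ∃ b s, Y' ++ [y] = b :: s := List.exists_cons_of_ne_nil (by simp)
      have hYl : Y ++ [x] ++ [y] = h :: b :: s := by rw [hY', ← hb]; rfl
      have sh := cL_shift hp hq (epsPar p) (hYl ▸ hYxy) (io Ψ)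
      rw [← hYl, ← hb, List.dropLast_concat] at sh
      rw [sh, ← e0]
      simp only [List.append_assoc, List.singleton_append]
      exact cL_concat Y _
    have cw := comm_words (T1 := TF p q x y) (T2 := TF p q y u) (T3 := TF p q u v)
      (L := cL p q 0 (Y ++ [x])) (L' := cL p q (epsPar p) (Y ++ [x])) (P := cR p q 0 (v :: W))
      (P' := cR p q (epsPar p) (v :: W)) (a := aPar p q) (e := epsPar p) (τ := tauPar p q)
      (ψ := io Ψ) (G := io G) (G' := io G') (F := io Fx) (F' := io Fu) (D := io Z)
      (S := io (tauPar p q • A + T p q u v Z + (aPar p q - epsPar p) • Z))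
      (aPar_ne_zero hp hq) hε (eps_mul_tau hε) (TF_sq hp hq hxy) (TF_sq hp hq huv)
      (fun f => TF_comm hu3.1.symm hu3.2.2.1.symm hu3.2.1.symm hu3.2.2.2.symm f)
      (fun f => (iV 0 (TF_commute hxv hyv) f).symm) (fun f => (iV _ (TF_commute hxv hyv) f).symm)
      (fun f => (iV 0 (TF_commute hyv huv') f).symm) (fun f => (iV _ (TF_commute hyv huv') f).symm)
      (fun f => (commute_cL 0 (TF_commute huY hvY) f).symm)
      (fun f => (commute_cL _ (TF_commute huY hvY) f).symm)
      (fun f => (commute_cL 0 (TF_commute hyY huY) f).symm)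
      (fun f => (commute_cL _ (TF_commute hyY huY) f).symm)
      (lr 0 0) (lr 0 _) (lr _ 0) (lr _ _) key
      (by
        have := congrArg io hS.diff
        rwa [map_smul, map_sub, io_tc hq hyu (dL 0), io_tc hq hyu (dL _), iL, iL, e0,
          TFc_apply] at this)
      (by
        have := congrArg io hS.eq
        rwa [map_add, map_add, map_smul, map_smul, io_tc hq hyu (dL 0), iL, e0,
          io_T hq hxy hS.dvd] at this)
      (by
        have := congrArg io hS'.diff
        rwa [map_smul, map_sub, io_tc hq hyu (dR 0), io_tc hq hyu (dR _), iR, iR, e0,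
          TFc_apply] at this)
      (by
        have := congrArg io hS'.eq
        rwa [map_add, map_add, map_smul, map_smul, io_tc hq hyu (dR 0), iR, e0,
          io_T hq huv hS'.dvd] at this)
      (by rw [← map_smul, eZ, map_sub, iA, iA])
      (by rw [map_add, map_add, map_smul, map_smul, io_T hq huv dZ, iA])
    have sL : ∀ k f, sF u v (cL p q k (Y ++ [x]) f) = cL p q k (Y ++ [x]) (sF u v f) := fun k f =>
      commute_cL k (X := (sF u v).toLinearMap) (fun a b hab f => sF_commute huY hvY a b hab f) f
    have sT : ∀ f, sF u v (TF p q x y f) = TF p q x y (sF u v f) := fun f => by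
      rw [TF_sF, sw_ne hu3.1 hu3.2.1, sw_ne hu3.2.2.1 hu3.2.2.2]
    have sU : sF u v (io Fu) = io Fu := by rw [sF_io, hS'.sym]
    have sm : ∀ (k : ℂ) f, sF u v (k • f) = k • sF u v f := fun k f =>
      (sF u v).toLinearMap.map_smul k f
    have fin := congrArg (sF u v) cw
    rw [sm, map_add (sF u v), map_add (sF u v), sm, sm, sT, map_sub (sF u v), sL, sL, sU, ← cw] at fin
    have := congrArg (fun f => (epsPar p)⁻¹ • f) fin
    simpa only [smul_smul, inv_mul_cancel₀ hε, one_smul] using this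
  · have hn2 : (Y ++ ([] ++ u :: v :: W)).Nodup := hnYu
    rw [hS0.eq]
    refine (IsRed.add ((eA 0 ▸ (rA 0).2).smul _) (natL_T hq hn2 hu3 huv ⟨iff_of_false ?_ ?_, by simp,
      iff_of_true (by simp) (by simp)⟩ rZ dZ hS0.dvd)).add (rZ.smul _)
    · exact fun hm => huY (List.mem_append_left _ hm)
    · exact fun hm => hvY (List.mem_append_left _ hm)
  · rw [C_mul, mul_assoc, ← smul_eq_C_mul]
    exact hS0.red

/-! ### Commuting projections at distance two -/

/-- The polynomials with a lift that is symmetric at two places. -/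
def dblLift {p q : ℂ} {x y u v : ι} {R : List ι} (h : Loc p q (x :: y :: u :: v :: R) x y)
    (k : Loc p q (x :: y :: u :: v :: R) u v) : Submodule ℂ (ML p q (u :: v :: R)) where
  carrier := {χ | ∃ f, h.P f = f ∧ k.P f = f ∧
    IsRed p q x y [] [] (u :: v :: R) (f : Pol) χ}
  zero_mem' := ⟨0, map_zero _, map_zero _, by simp [IsRed]⟩
  add_mem' := by
    rintro χ χ' ⟨f, h1, h2, h3⟩ ⟨f', h1', h2', h3'⟩
    exact ⟨f + f', by rw [map_add, h1, h1'], by rw [map_add, h2, h2'], h3.add h3'⟩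
  smul_mem' := by
    rintro c χ ⟨f, h1, h2, h3⟩
    exact ⟨c • f, by rw [map_smul, h1], by rw [map_smul, h2], h3.smul c⟩

lemma mem_dblLift {p q : ℂ} {x y u v : ι} {R : List ι} (h : Loc p q (x :: y :: u :: v :: R) x y)
    (k : Loc p q (x :: y :: u :: v :: R) u v) (k0 : Loc p q (u :: v :: R) u v)
    {χ : ML p q (u :: v :: R)} (hχ : k0.P χ = χ) : χ ∈ dblLift h k := by
  have g := h.g
  have hn := h.nd
  have hn4 : ([x, y, u, v] ++ R).Nodup := hn
  obtain ⟨m, hm⟩ := h.ev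
  obtain ⟨W, Y, rfl, hlen⟩ : ∃ W Y, R = W ++ Y ∧ Y.length = W.length := by
    refine ⟨R.take (m - 2), R.drop (m - 2), (List.take_append_drop _ _).symm, ?_⟩
    simp at hm
    rw [List.length_take, List.length_drop]; omega
  have hperm : (Y ++ x :: y :: u :: v :: W).Perm (x :: y :: u :: v :: (W ++ Y)) :=
    List.perm_append_comm
  have hnb := hperm.nodup_iff.2 hn
  have heb : Even (Y ++ x :: y :: u :: v :: W).length := hperm.length_eq ▸ h.ev
  have hperm0 : (Y ++ u :: v :: W).Perm (u :: v :: (W ++ Y)) := List.perm_append_comm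
  have hns := hperm0.nodup_iff.2 k0.nd
  have hes : Even (Y ++ u :: v :: W).length := hperm0.length_eq ▸ k0.ev
  obtain ⟨S, mS, F, mF, c, hc, s1, s2, s3, r1, r2⟩ := exists_double_seed g hnb hlen
  have hb : Loc p q (Y ++ x :: y :: u :: v :: W) x y := ⟨g, hnb, heb, Y, u :: v :: W, by simp⟩
  have kb : Loc p q (Y ++ x :: y :: u :: v :: W) u v := ⟨g, hnb, heb, Y ++ [x, y], W, by simp⟩
  have ks : Loc p q (Y ++ u :: v :: W) u v := ⟨g, hns, hes, Y, W, by simp⟩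
  have hY : ∀ i ∈ x :: y :: u :: v :: W, i ∉ Y := fun i hi hm =>
    (List.nodup_append.1 hnb).2.2 _ hm _ hi rfl
  have i1 := iff_of_false (hY x (by simp)) (hY y (by simp))
  have i2 := iff_of_false (hY u (by simp)) (hY v (by simp))
  have hk : (rk p q ^ 2) ^ Y.length ≠ 0 := pow_ne_zero _ (pow_ne_zero _ (rk_ne_zero g.p0 g.q0))
  set κ := (rk p q ^ 2) ^ Y.length with hκ
  have f1 : h.P (rot g hnb ⟨S, mS⟩) = rot g hnb ⟨S, mS⟩ :=
    (hb.P_rot (K := x :: y :: u :: v :: W) h i1 _).trans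
      (congrArg _ (hb.P_eq_self.2 s1))
  have f2 : k.P (rot g hnb ⟨S, mS⟩) = rot g hnb ⟨S, mS⟩ :=
    (kb.P_rot (K := x :: y :: u :: v :: W) k i2 _).trans
      (congrArg _ (kb.P_eq_self.2 s2))
  have f3 : k0.P (rot g hns ⟨F, mF⟩) = rot g hns ⟨F, mF⟩ :=
    (ks.P_rot (K := u :: v :: W) k0 i2 _).trans
      (congrArg _ (ks.P_eq_self.2 s3))
  have rot1 := IsRed.rotate g.p0 g.q0 (l1 := Y) (l1' := []) (l2 := []) (l3 := u :: v :: W)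
    (hY x (by simp)) (hY y (by simp)) (by rw [List.append_nil]; exact hns) (ψ := S) (φ := F)
  have rot2 := IsRed.rotate g.p0 g.q0 (l1 := Y) (l1' := []) (l2 := []) (l3 := W)
    (hY u (by simp)) (hY v (by simp)) (by
      rw [List.append_nil]; exact hns.sublist ((List.Sublist.refl _).append (by simp))) (ψ := F)
    (φ := C c * Psi p q (Y.zip W))
  rw [List.append_nil] at rot1 rot2
  have red1 := rot1.1 r1
  have red2 := rot2.1 r2
  have hnR : (W ++ Y).Nodup := hn4.sublist (List.sublist_append_right _ _)
  obtain ⟨d, hd, hz⟩ := scal_Psi g.p0 g.q0 (L := Y.zip W) (S := Y)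
    (by rw [ord_zip hlen]; exact (List.perm_append_comm.nodup_iff).2 hnR)
    (fun P hP => (List.of_mem_zip hP).1)
    (fun P hP => hY _ (by have := (List.of_mem_zip hP).2; simp [this]))
  rw [List.zip_swap] at hz
  rw [map_mul, hom_C, hz, ← mul_assoc, ← mul_assoc, ← C_mul, ← C_mul] at red2
  have hgen : ∀ ω ∈ ML p q ([] ++ (W ++ Y)), Reach p q (W ++ Y)
      (fun ψ => ψ = Psi p q (W.zip Y)) ω := by
    intro ω hω
    have := reach_rest g (m := W.length) (W ++ Y) [] hnR (by simp [hlen]; omega) (by simp) ω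
      ⟨hω, fun a b hab => by simp at hab⟩
    rwa [List.nil_append, List.take_left' rfl, List.drop_left' rfl] at this
  refine sym_mem_of_reach (l1 := []) k0 (List.infix_refl (W ++ Y)) hgen (dblLift h k)
    ⟨rot g hns ⟨F, mF⟩, ?_, f3, _, mul_ne_zero (mul_ne_zero hk hc) hd, red2⟩ ?_ hχ
  · refine ⟨κ⁻¹ • rot g hnb ⟨S, mS⟩, by rw [map_smul, f1], by rw [map_smul, f2], ?_⟩
    have := red1.smul κ⁻¹
    rwa [← smul_eq_C_mul, smul_smul, inv_mul_cancel₀ hk, one_smul] at this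
  · rintro a b k' hab χ ⟨f, e1, e2, e3⟩ h0
    have hab' : [a, b] <:+: x :: y :: u :: v :: (W ++ Y) := hab.trans ⟨[x, y, u, v], [], by simp⟩
    have kl : Loc p q (x :: y :: u :: v :: (W ++ Y)) a b := ⟨g, hn, h.ev, hab'⟩
    have ha : a ∈ W ++ Y := hab.subset List.mem_cons_self
    have hb : b ∈ W ++ Y := hab.subset (List.mem_cons_of_mem _ List.mem_cons_self)
    have j1 : Dj x y a b := dj_of_append hn4 (by simp) (by simp) ha hb
    have j2 : Dj u v a b := dj_of_append hn4 (by simp) (by simp) ha hb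
    have dχ := k'.P_eq_zero.1 h0
    have df : lf a b (q ^ 2) ∣ (f : Pol) := by
      obtain ⟨s, t, e⟩ := infix_pair hab
      have e' : x :: y :: u :: v :: (W ++ Y) = (x :: y :: u :: v :: s) ++ ([a, b] ++ t) := by
        rw [e]; simp
      refine lift_blk g (e' ▸ hn) (e' ▸ h.ev) (.inl ⟨[], u :: v :: s, by simp⟩) (ζ := f) ?_
        (h.P_eq_self.1 e1) e3 ?_ a b (List.Sublist.refl _)
      · have : ∀ l, x :: y :: u :: v :: (W ++ Y) = l → f.1 ∈ ML p q l := by rintro l rfl; exact f.2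
        exact this _ e'
      · intro i j hij
        have := hij.eq_of_length_le (by simp)
        simp only [List.cons.injEq, and_true] at this
        obtain ⟨rfl, rfl⟩ := this
        exact dχ
    have hf0 := kl.P_eq_zero.2 df
    refine ⟨kl.t f, by rw [h.P_t_far kl j1 hf0, e1], by rw [k.P_t_far kl j2 hf0, e2], ?_⟩
    rw [kl.t_of_ker hf0, k'.t_of_ker h0]
    refine natL_T g.q0 (r1 := []) (r2 := []) k0.nd j1 kl.ne ⟨by simp, by simp, iff_of_true ?_ ?_⟩ e3
      df dχ
    · simp only [List.mem_cons]; exact .inr (.inr ha)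
    · simp only [List.mem_cons]; exact .inr (.inr hb)

lemma P_comm_front {p q : ℂ} {x y u v : ι} {R : List ι} (h : Loc p q (x :: y :: u :: v :: R) x y)
    (k : Loc p q (x :: y :: u :: v :: R) u v) (ψ : ML p q (x :: y :: u :: v :: R)) :
    h.P (k.P ψ) = k.P (h.P ψ) := by
  have hn4 : ([x, y] ++ (u :: v :: R)).Nodup := h.nd
  have hj : Dj x y u v := dj_of_append hn4 (by simp) (by simp) (by simp) (by simp)
  have hns : (u :: v :: R).Nodup := (List.nodup_append.1 hn4).2.1
  have hes : Even (u :: v :: R).length := even_rest (l1 := []) (l2 := []) h.ev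
  have k0 : Loc p q (u :: v :: R) u v := ⟨h.g, hns, hes, [], R, by simp⟩
  obtain ⟨χ, hχ, hr⟩ := ML_red h.g (l1 := []) (l2 := []) (l3 := u :: v :: R) h.nd h.ev (h.P ψ).2
    (fun _ hw => by simp at hw)
  obtain ⟨f, f1, f2, f3⟩ := mem_dblLift h k k0 (k0.P_P ⟨χ, hχ⟩)
  have h0 : k.P (h.P ψ - f) = 0 := by
    rw [k.P_eq_zero]
    have e : x :: y :: u :: v :: R = [x, y] ++ ([u, v] ++ R) := rfl
    refine lift_blk h.g (l1 := [x, y]) (W := [u, v]) (l3 := R) h.nd h.ev (.inl (List.infix_refl _))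
      (h.P ψ - f).2 (h.P_eq_self.1 (by rw [map_sub, h.P_P, f1])) (hr.sub f3) ?_ u v
      (List.Sublist.refl _)
    intro i j hij
    have := hij.eq_of_length_le (by simp)
    simp only [List.cons.injEq, and_true] at this
    obtain ⟨rfl, rfl⟩ := this
    exact k0.P_dvd ⟨χ, hχ⟩
  rw [map_sub, f2, sub_eq_zero] at h0
  have h1 := k.P_ker_far h hj.symm (h.P_sub ψ)
  rw [map_sub, map_sub, h0, f1, sub_eq_zero] at h1
  rw [h1, h0]

lemma P_comm_near {p q : ℂ} {l H R : List ι} {x y u v : ι} (hl : l = H ++ x :: y :: u :: v :: R)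
    (h : Loc p q l x y) (k : Loc p q l u v) (ψ : ML p q l) : h.P (k.P ψ) = k.P (h.P ψ) := by
  subst hl
  have g := h.g
  have hperm : (H ++ x :: y :: u :: v :: R).Perm (x :: y :: u :: v :: R ++ H) :=
    List.perm_append_comm
  have hn' := hperm.nodup_iff.1 h.nd
  have he' : Even (x :: y :: u :: v :: R ++ H).length := hperm.length_eq ▸ h.ev
  have h' : Loc p q (x :: y :: u :: v :: R ++ H) x y := ⟨g, hn', he', [], u :: v :: (R ++ H), by simp⟩
  have k' : Loc p q (x :: y :: u :: v :: R ++ H) u v := ⟨g, hn', he', [x, y], R ++ H, by simp⟩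
  have hnH : ∀ i ∈ x :: y :: u :: v :: R, i ∉ H := fun i hi hm =>
    (List.nodup_append.1 h.nd).2.2 _ hm _ hi rfl
  have i1 := iff_of_false (hnH x (by simp)) (hnH y (by simp))
  have i2 := iff_of_false (hnH u (by simp)) (hnH v (by simp))
  apply rot_injective g h.nd
  rw [← h.P_rot h' i1, ← k.P_rot k' i2, P_comm_front h' k', h.P_rot h' i1, k.P_rot k' i2]

/-! ### Commuting projections at any distance -/

namespace Loc
variable {p q : ℂ} {l : List ι} {x y c d : ι}

lemma P_t_comm (h : Loc p q l x y) (h' : Loc p q l c d) (hj : Dj x y c d)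
    (hc : ∀ ψ, h.P (h'.P ψ) = h'.P (h.P ψ)) (ψ : ML p q l) : h.P (h'.t ψ) = h'.t (h.P ψ) := by
  have h1 := h.P_t_far h' hj (h'.P_sub ψ)
  have h2 : h.P (h'.t (h'.P ψ)) = h'.t (h.P (h'.P ψ)) := by
    rw [h'.t_P, map_smul, hc, h'.t_P]
  have := congrArg₂ (· + ·) h1 h2
  simpa only [← map_add, sub_add_cancel] using this

lemma t_t_comm (h : Loc p q l x y) (h' : Loc p q l c d) (hj : Dj x y c d)
    (hc : ∀ ψ, h.P (h'.P ψ) = h'.P (h.P ψ)) (ψ : ML p q l) : h.t (h'.t ψ) = h'.t (h.t ψ) := by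
  have h1 := h.t_t_far h' hj (h'.P_sub ψ)
  have h2 : h.t (h'.t (h'.P ψ)) = h'.t (h.t (h'.P ψ)) := by
    rw [h'.t_P, map_smul, h'.t_of_sym]
    rw [h'.P_t_comm h hj.symm fun φ => (hc φ).symm, h'.P_P]
  have := congrArg₂ (· + ·) h1 h2
  simpa only [← map_add, sub_add_cancel] using this

end Loc

/-- A projection commuting with one pair of operators commutes with the next projection. -/
lemma Nbr.commute_next {V : Type} [AddCommGroup V] [Module ℂ V] {a e τ : ℂ}
    {b P c Q X : Module.End ℂ V} (h : Nbr a e τ b P c Q) (hbr : ∀ v, b (c (b v)) = c (b (c v)))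
    (hs : (a - a⁻¹ * τ) ^ 2 - e * (a - a⁻¹ * τ) * (1 - τ ^ 2) - (1 - τ ^ 2) ^ 2 ≠ 0)
    (hb : ∀ v, X (b v) = b (X v)) (hP : ∀ v, X (P v) = P (X v))
    (hk : ∀ v, Q v = 0 → Q (X v) = 0) (hc : ∀ v, Q v = 0 → X (c v) = c (X v)) (v : V) :
    X (Q v) = Q (X v) := by
  have a0 := h.a0
  have τ0 := h.τ0
  set Δ := fun v => X (Q v) - Q (X v) with hΔ
  -- the commutators
  have d0 : ∀ v, Q v = 0 → Δ v = 0 := fun v hv => by simp only [hΔ, hv, hk v hv, map_zero, sub_self]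
  have dQ : ∀ v, Δ (Q v) = Δ v := fun v => by
    have h1 := hk (v - Q v) (by rw [map_sub, h.QQ, sub_self])
    rw [map_sub, map_sub, sub_eq_zero] at h1
    simp only [hΔ, h.QQ, h1]
  have dK : ∀ v, Q (Δ v) = 0 := fun v => by
    rw [← dQ]; simp only [hΔ, h.QQ, map_sub, sub_self]
  have dc : ∀ v, X (c v) - c (X v) = a • Δ v - c (Δ v) := fun v => by
    have h1 := hc (v - Q v) (by rw [map_sub, h.QQ, sub_self])
    have h2 := h.cQ (X v)
    simp only [map_sub, h.cQ, map_smul] at h1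
    simp only [hΔ, map_sub, h2, smul_sub]
    rw [sub_eq_sub_iff_add_eq_add] at h1 ⊢
    linear_combination (norm := module) h1
  have main : ∀ v, Δ (P v) = 0 := by
    intro v
    set y := Δ (P v) with hy
    have e1 : b y = (a⁻¹ * τ⁻¹ + e * τ⁻¹) • y - τ⁻¹ • c y := by
      have k1 := congrArg X (h.cP v)
      have k2 := h.cP (X v)
      have k3 := dc (P v)
      rw [← hy] at k3
      have k4 : y = X (Q (P v)) - Q (X (P v)) := rfl
      have k5 := congrArg b k4
      simp only [map_add, map_sub, map_smul, hb, hP] at k1 k3 k4 k5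
      have k6 : τ • b y = a • y - c y + (e * τ) • y := by
        linear_combination (norm := module) k3 - k1 + k2 + τ • k5 - (e * τ) • k4
      have k7 := congrArg (fun w => τ⁻¹ • w) k6
      simp only [smul_smul, inv_mul_cancel₀ τ0, one_smul, smul_add, smul_sub] at k7
      rw [k7]
      have hsk : τ⁻¹ * a + τ⁻¹ * (e * τ) = a⁻¹ * τ⁻¹ + e * τ⁻¹ := by rw [h.skein]; ring
      linear_combination (norm := module) hsk • y
    have cc : c (c y) = y + e • c y := by rw [h.cc, dK, smul_zero, sub_zero]
    have bP0 : P y = 0 := by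
      have k1 := congrArg X (h.PQP v)
      have k2 := h.PQP (X v)
      simp only [hP, map_smul] at k1
      have : P y = P (X (Q (P v))) - P (Q (P (X v))) := by
        rw [← map_sub, ← hP]
      rw [this, k1, k2, sub_self]
    have bb : b (b y) = y + e • b y := by rw [h.bb, bP0, smul_zero, sub_zero]
    have i1 : a * a⁻¹ = 1 := mul_inv_cancel₀ a0
    have i2 : τ * τ⁻¹ = 1 := mul_inv_cancel₀ τ0
    have hsk := h.skein
    generalize a⁻¹ = α at *
    generalize τ⁻¹ = σ at *
    generalize hcy : c y = w at *
    clear_value y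
    have e1c := congrArg c e1
    have e1b := congrArg b e1
    simp only [map_sub, map_smul, hcy] at e1c e1b
    have hw : b w = (a * σ * (α + e) - τ) • y - (a * σ) • w := by
      have k1 : σ • b w = (α * σ + e * σ) • b y - (y + e • b y) := by rw [← bb, e1b]; module
      rw [show b w = τ • σ • b w by rw [smul_smul, i2, one_smul], k1, e1]
      match_scalars
      · linear_combination (α + e) * (α * σ + e * σ) * i2 - (α * σ + e * σ) * hsk
      · linear_combination -(σ * (α + e)) * i2 + σ * hsk
    have hcw := congrArg c hw
    have hbb := congrArg b e1c
    simp only [map_sub, map_smul, hcy] at hcw hbb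
    have hn : (1 - τ ^ 2) • w = (a - α * τ) • y := by
      rw [cc, map_add, map_smul, hw, e1, ← e1, hbr, hcy, hcw, cc, e1] at hbb
      have k1 := congrArg (fun v => τ • v) hbb
      linear_combination (norm := skip) k1
      match_scalars
      · linear_combination -(τ * σ + τ * σ ^ 2) * i1 - i2
      · linear_combination (a - α * τ) * i2 + τ * σ * (α * σ + e * σ) * i1
    have hz : ((a - α * τ) ^ 2 - e * (a - α * τ) * (1 - τ ^ 2) - (1 - τ ^ 2) ^ 2) • y = 0 := by
      have k1 := congrArg c hn
      simp only [map_smul, cc, hcy] at k1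
      linear_combination (norm := module) (-(1 - τ ^ 2)) • k1 - ((a - α * τ) - e * (1 - τ ^ 2)) • hn
    exact (smul_eq_zero.1 hz).resolve_left hs
  have : Q v = (τ ^ 2) • Q (P (Q v)) := by
    rw [h.QPQ, smul_smul]
    rw [show τ ^ 2 * (τ⁻¹ * τ⁻¹) = 1 by field_simp, one_smul]
  have h1 : Δ v = (τ ^ 2) • Δ (P (Q v)) := by
    have k1 : Δ (Q v) = Δ ((τ ^ 2) • Q (P (Q v))) := congrArg Δ this
    rw [← dQ v, k1, ← dQ (P (Q v))]
    simp only [hΔ, map_smul, smul_sub]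
  rw [main, smul_zero] at h1
  exact sub_eq_zero.1 h1

/-- The parameters avoid a third list of special values. -/
structure Gen3 (p q : ℂ) : Prop extends Gen2 p q where
  third : (aPar p q - (aPar p q)⁻¹ * tauPar p q) ^ 2 -
    epsPar p * (aPar p q - (aPar p q)⁻¹ * tauPar p q) * (1 - tauPar p q ^ 2) -
    (1 - tauPar p q ^ 2) ^ 2 ≠ 0

lemma P_comm {p q : ℂ} (g : Gen3 p q) {l H M : List ι} {x y : ι} (h : Loc p q l x y) :
    ∀ {R : List ι} {u v : ι}, l = H ++ x :: y :: (M ++ u :: v :: R) → ∀ (k : Loc p q l u v)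
      (ψ : ML p q l), h.P (k.P ψ) = k.P (h.P ψ) := by
  induction M using List.reverseRecOn with
  | nil => exact fun hl k ψ => P_comm_near hl h k ψ
  | append_singleton M m ih =>
    intro R u v hl k ψ
    have hl' : l = H ++ x :: y :: (M ++ m :: u :: (v :: R)) := by simp [hl]
    have j : Loc p q l m u := ⟨h.g, h.nd, h.ev, H ++ x :: y :: M, v :: R, by simp [hl]⟩
    have hl2 : l = (H ++ x :: y :: M) ++ m :: u :: v :: R := by simp [hl]
    have hn := h.nd
    rw [hl] at hn
    simp only [List.nodup_append, List.nodup_cons, List.mem_append, List.mem_cons, not_or] at hn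
    have d1 : Dj x y m u := by unfold Dj; aesop
    have d2 : Dj x y u v := by unfold Dj; aesop
    have c1 := ih hl' j
    exact Nbr.commute_next (Loc.nbr (triRel hl2 j k))
      (fun w => (Nbr.mem_good.1 (mem_good_all g.toGen2 hl2 j k w)).2) g.third
      (fun v => h.P_t_comm j d1 c1 v) c1 (fun v hv => h.P_ker_far k d2 hv)
      (fun v hv => h.P_t_far k d2 hv) ψ

/-! ### The space of the statement -/

lemma sublist_finRange {n : ℕ} {i j k : Fin n} :
    [i, j, k].Sublist (List.finRange n) ↔ i < j ∧ j < k := by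
  constructor
  · intro h
    have := (List.pairwise_lt_finRange n).sublist h
    simp only [List.pairwise_cons, List.mem_cons] at this
    exact ⟨this.1 j (by simp), this.2.1 k (by simp)⟩
  · rintro ⟨h1, h2⟩
    have hp : [i, j, k].Pairwise (· < ·) := by simp [h1, h2, h1.trans h2]
    exact List.sublist_of_subperm_of_pairwise
      (List.subperm_of_subset (hp.imp fun h => h.ne) fun t _ => List.mem_finRange t) hp
      (List.pairwise_lt_finRange n)

lemma PP_finRange {n : ℕ} {p q : ℂ} {ψ : MvPolynomial (Fin n) ℂ} :
    PP p q (List.finRange n) ψ ↔ PropP p q ψ := by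
  constructor
  · intro h i j k hij hjk z hz
    have key : ∀ c₁ c₂, Val p q c₁ c₂ → z j = c₁ * z i → z k = c₂ * z i → eval z ψ = 0 := by
      intro c₁ c₂ hv h1 h2
      have := h.hom (sublist_finRange.2 ⟨hij, hjk⟩) hv
        (σ := (Algebra.ofId ℂ (MvPolynomial (Fin n) ℂ)).comp (aeval z))
        (by simp [h1, Algebra.ofId_apply, MvPolynomial.algebraMap_eq])
        (by simp [h2, Algebra.ofId_apply, MvPolynomial.algebraMap_eq])
      simpa [Algebra.ofId_apply, MvPolynomial.algebraMap_eq, aeval_eq_eval] using this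
    rcases hz with ⟨h1, h2⟩ | ⟨h1, h2⟩ | ⟨h1, h2⟩
    · exact key _ _ (Or.inl ⟨rfl, rfl⟩) h1 h2
    · exact key _ _ (Or.inr (Or.inl ⟨rfl, rfl⟩)) h1 h2
    · exact key _ _ (Or.inr (Or.inr ⟨rfl, rfl⟩)) h1 h2
  · intro h i j k hs c₁ c₂ hv
    obtain ⟨hij, hjk⟩ := sublist_finRange.1 hs
    have hik := (hij.trans hjk).ne
    refine MvPolynomial.funext fun z => ?_
    have e : (aeval z).comp (tr i j k c₁ c₂) = aeval fun t => aeval z (tr i j k c₁ c₂ (X t)) := by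
      ext t; simp
    have e1 := DFunLike.congr_fun e ψ
    rw [map_zero]
    refine Eq.trans (b := aeval (fun t => aeval z (tr i j k c₁ c₂ (X t))) ψ) e1 ?_
    rw [aeval_eq_eval]
    refine h i j k hij hjk _ ?_
    simp only [tr_X _ _ hik, hij.ne, hik, hjk.ne', if_true, if_false, map_mul, aeval_X, aeval_C,
      Algebra.algebraMap_self, RingHom.id_apply]
    rcases hv with ⟨rfl, rfl⟩ | ⟨rfl, rfl⟩ | ⟨rfl, rfl⟩ <;> simp

lemma homogeneousComponent_sb (x y : ι) (c : ℂ) (d : ℕ) (ψ : Pol) :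
    homogeneousComponent d (sb x y c ψ) = sb x y c (homogeneousComponent d ψ) := by
  have h1 : ∀ i, (sb x y c (homogeneousComponent i ψ)).IsHomogeneous i := by
    intro i
    have := (homogeneousComponent_isHomogeneous i ψ).aeval
      (fun i => if i = y then C c * X x else X i) (n := 1) (fun i => by
        split_ifs
        · simpa using (isHomogeneous_C ι c).mul (isHomogeneous_X ℂ x)
        · exact isHomogeneous_X ℂ i)
    rwa [one_mul] at this
  conv_lhs => rw [← sum_homogeneousComponent ψ]
  rw [map_sum, map_sum, Finset.sum_congr rfl fun i _ => homogeneousComponent_of_mem (h1 i)]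
  rw [Finset.sum_ite_eq]
  split_ifs with h
  · rfl
  · rw [homogeneousComponent_eq_zero _ _ (by simpa using h), map_zero]

lemma ML_homogeneous {p q : ℂ} (g : Gen p q) {l : List ι} (hl : l.Nodup) (he : Even l.length)
    {ψ : Pol} (h : ψ ∈ ML p q l) : ψ.IsHomogeneous (dg l.length) := by
  have h0 : ∀ d ∈ Finset.range (ψ.totalDegree + 1), d ≠ dg l.length →
      homogeneousComponent d ψ = 0 := by
    intro d hd hne
    have hd' : d < dg l.length := by
      have := h.2
      rw [Finset.mem_range] at hd
      omega
    refine eq_zero_of_low g hl he (fun i j k hs c₁ c₂ hv => ?_)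
      ((homogeneousComponent_isHomogeneous d ψ).totalDegree_le.trans_lt hd')
    rw [← homogeneousComponent_sb, ← homogeneousComponent_sb, h.1 i j k hs c₁ c₂ hv, map_zero]
  have h1 := sum_homogeneousComponent ψ
  by_cases hm : dg l.length ∈ Finset.range (ψ.totalDegree + 1)
  · rw [Finset.sum_eq_single_of_mem _ hm h0] at h1
    rw [← h1]
    exact homogeneousComponent_isHomogeneous _ _
  · rw [Finset.sum_eq_zero fun d hd => h0 d hd fun hc => hm (hc ▸ hd)] at h1
    rw [← h1]
    exact isHomogeneous_zero _ _ _

lemma minDeg_eq {n : ℕ} (hn : Even n) {p q : ℂ} (g : Gen p q) : minDeg n p q = dg n := by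
  have hlen := List.length_finRange (n := n)
  have hnd := List.nodup_finRange n
  obtain ⟨m, hm⟩ := hn
  have hS : ∃ ψ ∈ ML p q (List.finRange n), ψ ≠ 0 := by
    have e : ord (((List.finRange n).take m).zip ((List.finRange n).drop m)) = List.finRange n := by
      rw [ord, List.map_fst_zip (by simp; omega), List.map_snd_zip (by simp; omega),
        List.take_append_drop]
    have h1 := Psi_mem (p := p) (q := q) (e.symm ▸ hnd)
    have h2 := Psi_ne_zero (p := p) (q := q) (e.symm ▸ hnd)
    rw [e] at h1
    exact ⟨_, h1, h2.1⟩
  obtain ⟨ψ, h1, h2⟩ := hS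
  have h3 := ML_homogeneous g hnd (by rw [hlen]; exact ⟨m, hm⟩) h1
  rw [hlen] at h3
  have hne : {d | ∃ ψ : MvPolynomial (Fin n) ℂ, ψ ≠ 0 ∧ ψ.IsHomogeneous d ∧ PropP p q ψ}.Nonempty :=
    ⟨dg n, ψ, h2, h3, PP_finRange.1 h1.1⟩
  refine le_antisymm (Nat.sInf_le ⟨ψ, h2, h3, PP_finRange.1 h1.1⟩) (not_lt.1 fun hlt => ?_)
  obtain ⟨φ, f1, f2, f3⟩ := Nat.sInf_mem hne
  refine f1 (eq_zero_of_low g hnd (by rw [hlen]; exact ⟨m, hm⟩) (PP_finRange.2 f3) ?_)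
  rw [hlen]
  exact f2.totalDegree_le.trans_lt hlt

lemma M_eq {n : ℕ} (hn : Even n) {p q : ℂ} (g : Gen p q) : M n p q = ML p q (List.finRange n) := by
  ext ψ
  change (ψ.IsHomogeneous (minDeg n p q) ∧ PropP p q ψ) ↔ PP p q (List.finRange n) ψ ∧ _
  rw [minDeg_eq hn g, PP_finRange]
  constructor
  · exact fun h => ⟨h.2, by rw [List.length_finRange]; exact h.1.totalDegree_le⟩
  · intro h
    have := ML_homogeneous g (List.nodup_finRange n) (by rwa [List.length_finRange])
      (ψ := ψ) ⟨PP_finRange.2 h.1, h.2⟩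
    rw [List.length_finRange] at this
    exact ⟨this, h.1⟩

/-! ### Generic parameters -/

/-- `τ` is the quotient of these two. -/
lemma tauPar_eq {p q : ℂ} (hp : p ≠ 0) (hq : q ≠ 0) (h : p ^ 2 - 1 ≠ 0) :
    tauPar p q = (p ^ 2 * q ^ 2 - 1) * (q ^ 2 + 1) / (q ^ 2 * (p ^ 2 - 1)) := by
  have he : p - p⁻¹ = (p ^ 2 - 1) / p := by field_simp
  rw [tauPar, aPar, epsPar, he]
  field_simp
  ring

/-- The factors whose nonvanishing makes the parameters generic. -/
lemma exists_generic : ∃ F : MvPolynomial (Fin 2) ℤ, F ≠ 0 ∧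
    ∀ p q : ℂ, p ≠ 0 → q ≠ 0 → p ^ 2 ≠ 1 → aeval ![p, q] F ≠ 0 → Gen3 p q := by
  let S : Finset (ℕ × ℕ) := (Finset.range 25 ×ˢ Finset.range 25).erase (12, 12)
  let x : MvPolynomial (Fin 2) ℤ := X 0
  let y : MvPolynomial (Fin 2) ℤ := X 1
  let N := (x ^ 2 * y ^ 2 - 1) * (y ^ 2 + 1)
  let D := y ^ 2 * (x ^ 2 - 1)
  let A := D - x ^ 2 * y ^ 4 * N
  let F1 := ∏ s ∈ S, (x ^ s.1 * y ^ s.2 - x ^ 12 * y ^ 12)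
  let F2 := N ^ 2 - D ^ 2
  let F3 := (N ^ 2 - D ^ 2) * (N * x ^ 2 * y ^ 4 + (x ^ 2 - 1) ^ 2 * y ^ 4 * (N - D)) -
    N * D ^ 2 * (1 + x ^ 4 * y ^ 8) + 2 * D ^ 3 * x ^ 2 * y ^ 4
  let F4 := A ^ 2 * D ^ 2 - (x ^ 2 - 1) * y ^ 2 * A * D * (D ^ 2 - N ^ 2) -
    x ^ 2 * y ^ 4 * (D ^ 2 - N ^ 2) ^ 2
  have h1 : F1 ≠ 0 := by
    refine Finset.prod_ne_zero_iff.2 fun s hs h => ?_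
    have := congrArg (eval ![2, 2 ^ 25]) h
    simp only [x, y, map_sub, map_mul, map_pow, eval_X, map_zero, Matrix.cons_val_zero,
      Matrix.cons_val_one, ← pow_mul, ← pow_add, sub_eq_zero] at this
    have := Int.pow_right_injective (a := 2) (by norm_num) this
    simp only [S, Finset.mem_erase, Finset.mem_product, Finset.mem_range, ne_eq, Prod.ext_iff] at hs
    omega
  have hne : ∀ {f : MvPolynomial (Fin 2) ℤ}, eval ![2, 1] f ≠ 0 → f ≠ 0 := by
    rintro _ h rfl; exact h (map_zero _)
  have h2 : F2 ≠ 0 := hne (by simp [F2, N, D, x, y])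
  have h3 : F3 ≠ 0 := hne (by simp [F3, N, D, x, y])
  have h4 : F4 ≠ 0 := hne (by simp [F4, A, N, D, x, y])
  refine ⟨F1 * F2 * F3 * F4, by simp [h1, h2, h3, h4], fun p q hp hq hp2 h => ?_⟩
  simp only [map_mul, ne_eq, mul_eq_zero, not_or] at h
  obtain ⟨⟨⟨g1, g2⟩, g3⟩, g4⟩ := h
  have hd : p ^ 2 - 1 ≠ 0 := sub_ne_zero.2 hp2
  have hD : q ^ 2 * (p ^ 2 - 1) ≠ 0 := mul_ne_zero (pow_ne_zero 2 hq) hd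
  have he : p - p⁻¹ = (p ^ 2 - 1) / p := by field_simp
  simp only [F2, F3, F4, A, N, D, x, y, map_sub, map_add, map_mul, map_pow, aeval_X, map_one,
    map_ofNat, Matrix.cons_val_zero, Matrix.cons_val_one] at g2 g3 g4
  refine ⟨⟨⟨hp, hq, fun i j hij hi hj hc => g1 ?_⟩, fun hc => g2 ?_, fun hc => g3 ?_⟩,
    fun hc => g4 ?_⟩
  · rw [map_prod]
    rw [abs_le] at hi hj
    refine Finset.prod_eq_zero (i := ((i + 12).toNat, (j + 12).toNat)) ?_ ?_
    · simp only [S, Finset.mem_erase, Finset.mem_product, Finset.mem_range, ne_eq, Prod.ext_iff]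
      omega
    · simp only [x, y, map_sub, map_mul, map_pow, aeval_X, Matrix.cons_val_zero,
        Matrix.cons_val_one]
      rw [← zpow_natCast, ← zpow_natCast, Int.toNat_of_nonneg (by omega),
        Int.toNat_of_nonneg (by omega), zpow_add₀ hp, zpow_add₀ hq,
        zpow_ofNat, zpow_ofNat]
      linear_combination (p ^ 12 * q ^ 12) * hc
  · rw [tauPar_eq hp hq hd] at hc
    field_simp at hc
    linear_combination hc
  · rw [tauPar_eq hp hq hd, aPar, epsPar, he] at hc
    field_simp at hc
    linear_combination q ^ 4 * hc
  · rw [tauPar_eq hp hq hd, aPar, epsPar, he] at hc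
    field_simp at hc
    linear_combination q ^ 4 * hc

/-! ### The representation -/

lemma drop_finRange {n i : ℕ} (h : i < n) :
    (List.finRange n).drop i = ⟨i, h⟩ :: (List.finRange n).drop (i + 1) := by
  rw [List.drop_eq_getElem_cons (by simpa using h), List.getElem_finRange]
  rfl

lemma finRange_split {n : ℕ} (i : Fin (n - 1)) : List.finRange n =
    (List.finRange n).take i ++ lft i :: rgt i :: (List.finRange n).drop (i + 2) := by
  conv_lhs => rw [← List.take_append_drop i (List.finRange n), drop_finRange (by omega : (i : ℕ) < n),
    drop_finRange (by omega : (i : ℕ) + 1 < n)]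
  rfl

lemma loc_finRange {n : ℕ} (hn : Even n) {p q : ℂ} (g : Gen p q) (i : Fin (n - 1)) :
    Loc p q (List.finRange n) (lft i) (rgt i) :=
  ⟨g, List.nodup_finRange n, by rwa [List.length_finRange], (List.finRange n).take i,
    (List.finRange n).drop (i + 2), by
      conv_rhs => rw [finRange_split i]
      simp⟩

section
variable {n : ℕ} {p q : ℂ} (h : ∀ i : Fin (n - 1), Loc p q (List.finRange n) (lft i) (rgt i))

lemma nbr_finRange {i j : Fin (n - 1)} (g : Gen2 p q) (hij : (i : ℕ) + 1 = j) :
    Nbr (aPar p q) (epsPar p) (tauPar p q) (h i).t (h i).P (h j).t (h j).P ∧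
    ∀ v, v ∈ Nbr.good (tauPar p q) (h i).t (h i).P (h j).t (h j).P := by
  have e : rgt i = lft j := Fin.ext hij
  have hl : List.finRange n = (List.finRange n).take i ++
      lft i :: lft j :: rgt j :: (List.finRange n).drop (i + 3) := by
    have := finRange_split i
    rw [drop_finRange (by omega : (i : ℕ) + 2 < n)] at this
    rw [e] at this
    refine this.trans ?_
    congr 4
    exact Fin.ext (by simp only [rgt]; omega)
  have h1 := h i
  generalize h i = hi
  generalize rgt i = x at *
  subst e
  exact ⟨Loc.nbr (triRel hl hi (h j)), mem_good_all g hl hi (h j)⟩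

/-- All relations between neighbouring generators. -/
lemma rel_adjacent {i j : Fin (n - 1)} (g : Gen2 p q) (hij : Adjacent i j) :
    Nbr (aPar p q) (epsPar p) (tauPar p q) (h i).t (h i).P (h j).t (h j).P ∧
    ∀ v, ((h i).P ((h j).t ((h i).t v)) = tauPar p q • (h i).P ((h j).P v) ∧
      (h j).P ((h i).t ((h j).t v)) = tauPar p q • (h j).P ((h i).P v)) ∧
      (h i).t ((h j).t ((h i).t v)) = (h j).t ((h i).t ((h j).t v)) := by
  rcases hij with hij | hij
  · obtain ⟨h1, h2⟩ := nbr_finRange h g hij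
    exact ⟨h1, fun v => Nbr.mem_good.1 (h2 v)⟩
  · obtain ⟨h1, h2⟩ := nbr_finRange h g hij
    refine ⟨h1.symm, fun v => ?_⟩
    have := Nbr.mem_good.1 (h2 v)
    exact ⟨this.1.symm, this.2.symm⟩

lemma P_comm_finRange {i j : Fin (n - 1)} (g : Gen3 p q) (hij : (i : ℕ) + 2 ≤ j)
    (ψ : ML p q (List.finRange n)) : (h i).P ((h j).P ψ) = (h j).P ((h i).P ψ) := by
  refine P_comm g (H := (List.finRange n).take i) (M := ((List.finRange n).drop (i + 2)).take
    (j - (i + 2))) (h i) (R := (List.finRange n).drop (j + 2)) ?_ (h j) ψ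
  conv_lhs => rw [finRange_split i, ← List.take_append_drop (j - (i + 2))
    ((List.finRange n).drop (i + 2)), List.drop_drop, show (i : ℕ) + 2 + (j - (i + 2)) = j by omega,
    drop_finRange (by omega : (j : ℕ) < n), drop_finRange (by omega : (j : ℕ) + 1 < n)]
  rfl

lemma rel_distant {i j : Fin (n - 1)} (g : Gen3 p q) (hij : Distant i j)
    (ψ : ML p q (List.finRange n)) : (h i).P ((h j).P ψ) = (h j).P ((h i).P ψ) ∧
    (h i).t ((h j).t ψ) = (h j).t ((h i).t ψ) := by
  have hc : ∀ ψ, (h i).P ((h j).P ψ) = (h j).P ((h i).P ψ) := by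
    rcases hij with hij | hij
    · exact P_comm_finRange h g hij
    · exact fun ψ => (P_comm_finRange h g hij ψ).symm
  refine ⟨hc ψ, (h i).t_t_comm (h j) ?_ hc ψ⟩
  simp only [Dj, lft, rgt, ne_eq, Fin.mk.injEq]
  unfold Distant at hij
  omega

/-- The operators of the generators. -/
def genOp : BMWGen n → (Module.End ℂ (ML p q (List.finRange n)))ᵐᵒᵖ
  | .t i => .op (h i).t
  | .tInv i => .op ((h i).t - epsPar p • (1 - tauPar p q • (h i).P))
  | .e i => .op (tauPar p q • (h i).P)

lemma genOp_rel (g : Gen3 p q) {x y : FreeAlgebra ℂ (BMWGen n)} (hxy : BMWRel n p q x y) :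
    FreeAlgebra.lift ℂ (genOp h) x = FreeAlgebra.lift ℂ (genOp h) y := by
  have τ0 : tauPar p q ≠ 0 := g.toGen.tau
  have hsk := eps_mul_tau (p := p) (q := q) g.toGen.eps
  have a0 := aPar_ne_zero g.p0 g.q0
  apply MulOpposite.unop_injective
  refine LinearMap.ext fun v => ?_
  have hS := fun i v => (h i).t_t v
  have h1 := fun i v => (h i).t_P v
  have h2 := fun i v => (h i).P_t v
  have h3 := fun i v => (h i).P_P v
  cases hxy with
  | t_comm i j hij =>
    simp only [freeT, map_mul, FreeAlgebra.lift_ι_apply, genOp, MulOpposite.unop_mul,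
      MulOpposite.unop_op, Module.End.mul_apply]
    exact (rel_distant h g hij v).2.symm
  | e_comm i j hij =>
    simp only [freeE, map_mul, FreeAlgebra.lift_ι_apply, genOp, MulOpposite.unop_mul,
      MulOpposite.unop_op, Module.End.mul_apply, LinearMap.smul_apply, map_smul]
    rw [(rel_distant h g hij v).1]
  | braid i j hij | eee i j hij | ete i j hij | tte i j hij | ett i j hij =>
    obtain ⟨k1, k2⟩ := rel_adjacent h g.toGen2 hij
    simp only [freeT, freeE, map_mul, map_smul, FreeAlgebra.lift_ι_apply, genOp,
      MulOpposite.unop_mul, MulOpposite.unop_smul, MulOpposite.unop_op, Module.End.mul_apply,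
      LinearMap.smul_apply]
    first
    | exact (k2 v).2
    | rw [k1.PQP]; match_scalars; field_simp
    | rw [k1.PcP]; match_scalars; field_simp
    | rw [(k2 v).1.2]
    | rw [k1.bcP]
  | t_tInv i | tInv_t i | skein i | et i | te i | ee i =>
    simp only [freeT, freeTInv, freeE, map_mul, map_smul, map_sub, map_one,
      FreeAlgebra.lift_ι_apply, genOp, MulOpposite.unop_mul, MulOpposite.unop_smul,
      MulOpposite.unop_sub, MulOpposite.unop_one, MulOpposite.unop_op, Module.End.mul_apply,
      LinearMap.smul_apply, LinearMap.sub_apply, Module.End.one_apply, hS, h1, h2, h3]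
    try module

end

/-- A minimal polynomial that is symmetric and divisible is zero, and the algebra acts through the
decomposition into a symmetric and a divisible part. -/
theorem exists_representation {n : ℕ} (hn : Even n) {p q : ℂ} (g : Gen3 p q)
    {W : Submodule ℂ (MvPolynomial (Fin n) ℂ)} (hW : W = ML p q (List.finRange n)) :
    (∀ i, ∀ ψ ∈ W, SymAt i ψ → b q i ∣ ψ → ψ = 0) ∧
    ∃ ρ : BMW n p q →ₐ[ℂ] (Module.End ℂ W)ᵐᵒᵖ, ∀ i (ψ : W), ∃ s r : W,
      SymAt i (s : MvPolynomial (Fin n) ℂ) ∧ b q i ∣ (r : MvPolynomial (Fin n) ℂ) ∧ ψ = s + r ∧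
      (ρ (BMW.e p q i)).unop ψ = tauPar p q • s ∧
      (((ρ (BMW.t p q i)).unop ψ : W) : MvPolynomial (Fin n) ℂ) =
        aPar p q • (s : MvPolynomial (Fin n) ℂ) + T p q (lft i) (rgt i) r := by
  subst hW
  have h := loc_finRange hn g.toGen
  refine ⟨fun i ψ hψ hs hd => ?_, RingQuot.liftAlgHom ℂ ⟨FreeAlgebra.lift ℂ (genOp h),
    fun _ _ => genOp_rel h g⟩, fun i ψ => ⟨(h i).P ψ, ψ - (h i).P ψ, (h i).P_sym ψ, ?_, ?_, ?_, ?_⟩⟩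
  · exact congrArg Subtype.val ((h i).eq_zero (ψ := ⟨ψ, hψ⟩) hs ((lnf_dvd g.q0).1 hd))
  · exact (lnf_dvd g.q0).2 ((h i).P_dvd ψ)
  · exact (add_sub_cancel _ _).symm
  · rw [BMW.e, RingQuot.liftAlgHom_mkAlgHom_apply, freeE, FreeAlgebra.lift_ι_apply]
    rfl
  · rw [BMW.t, RingQuot.liftAlgHom_mkAlgHom_apply, freeT, FreeAlgebra.lift_ι_apply]
    rfl

/-! ### The two pieces of a divisible polynomial -/

lemma dd_add_lnf {p : ℂ} {x y : ι} (hxy : x ≠ y) {S₁ S₂ : Pol} (h1 : sw x y S₁ = S₁)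
    (h2 : sw x y S₂ = S₂) : dd x y (S₁ + lnf p x y * S₂) = C (p + p⁻¹) * S₂ := by
  apply dd_unique hxy
  rw [map_add (sw x y), map_mul (sw x y), h1, h2, sw_lnf, lnf, lnf, C_add]
  ring

lemma dl_split {p : ℂ} {x y : ι} (hxy : x ≠ y) {S₁ S₂ : Pol} (h1 : sw x y S₁ = S₁)
    (h2 : sw x y S₂ = S₂) :
    dl p x y (S₁ + lnf p x y * S₂) = C p * (lnf p x y * S₂) - C p⁻¹ * S₁ := by
  rw [dl, dd_add_lnf hxy h1 h2, C_add]
  ring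

lemma exists_split {p : ℂ} (hp : p + p⁻¹ ≠ 0) {x y : ι} (hxy : x ≠ y) (φ : Pol) :
    ∃ S₁ S₂, sw x y S₁ = S₁ ∧ sw x y S₂ = S₂ ∧ φ = S₁ + lnf p x y * S₂ := by
  have hC : (C (p + p⁻¹) : Pol) * C (p + p⁻¹)⁻¹ = 1 := by
    rw [← C_mul, mul_inv_cancel₀ hp, C_1]
  have h1 : sw x y (C (p + p⁻¹)⁻¹ * dd x y φ) = C (p + p⁻¹)⁻¹ * dd x y φ := by
    rw [map_mul, sw_dd hxy, hom_C]
  refine ⟨φ - lnf p x y * (C (p + p⁻¹)⁻¹ * dd x y φ), _, ?_, h1, (sub_add_cancel _ _).symm⟩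
  rw [map_sub, map_mul, h1, sw_lnf]
  have h2 := mul_dd x y φ
  have h3 : lnf p x y - lnf p y x = C (p + p⁻¹) * (X x - X y) := by rw [lnf, lnf, C_add]; ring
  linear_combination (C (p + p⁻¹)⁻¹ * dd x y φ) * h3 + ((X x - X y) * dd x y φ) * hC + h2

lemma dl_eq_dd {p : ℂ} {x y : ι} (hxy : x ≠ y) (φ : Pol) :
    dl p x y φ - C p * φ = dd x y (lnf p y x * φ) := by
  refine (dd_unique hxy ?_).symm
  rw [mul_sub, mul_dl, map_mul (sw x y),
    show sw x y (lnf p y x) = lnf p x y by simp [lnf], lnf, lnf, epsPar, C_sub]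
  ring

end BMWPoly
end

theorem mainTheorem2 (n : ℕ) (hn : Even n) :
    ∃ F : MvPolynomial (Fin 2) ℤ, F ≠ 0 ∧
      ∀ p q : ℂ, p ≠ 0 → q ≠ 0 → p ^ 2 ≠ 1 → MvPolynomial.aeval ![p, q] F ≠ 0 →
        -- existence and uniqueness of the splitting
        (∀ (i : Fin (n - 1)), ∀ ψ ∈ BMWPoly.M n p q,
          ∃! S : MvPolynomial (Fin n) ℂ × MvPolynomial (Fin n) ℂ × MvPolynomial (Fin n) ℂ,
            BMWPoly.IsSplitting p q i ψ S.1 S.2.1 S.2.2) ∧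
        -- the action of the Birman-Wenzl-Murakami algebra and the three pieces
        BMWPoly.tauPar p q ≠ 0 ∧
        ∃ ρ : BMWPoly.BMW n p q →ₐ[ℂ] (Module.End ℂ (BMWPoly.M n p q))ᵐᵒᵖ,
          ∀ (i : Fin (n - 1)) (ψ : BMWPoly.M n p q),
            (∀ S₀ S₁ S₂ : MvPolynomial (Fin n) ℂ, BMWPoly.IsSplitting p q i ψ S₀ S₁ S₂ →
              BMWPoly.act ρ ψ (BMWPoly.BMW.e p q i) = BMWPoly.tauPar p q • S₀ ∧
              BMWPoly.act ρ ψ (BMWPoly.BMW.t p q i) =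
                BMWPoly.aPar p q • S₀ - p⁻¹ • (BMWPoly.b q i * S₁)
                  + p • (BMWPoly.b q i * (BMWPoly.lin p i * S₂))) ∧
            (BMWPoly.act ρ ψ (BMWPoly.BMW.e p q i) =
                BMWPoly.tauPar p q • (ψ : MvPolynomial (Fin n) ℂ) ↔
              BMWPoly.SymAt i (ψ : MvPolynomial (Fin n) ℂ)) ∧
            (BMWPoly.act ρ ψ (BMWPoly.BMW.e p q i) = 0 ↔
              BMWPoly.b q i ∣ (ψ : MvPolynomial (Fin n) ℂ)) ∧
            -- the divided-difference formulas, on polynomials divisible by `b_{i,i+1}`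
            (∀ φ : MvPolynomial (Fin n) ℂ,
              (ψ : MvPolynomial (Fin n) ℂ) = BMWPoly.b q i * φ →
              ∃ D₁ D₂ : MvPolynomial (Fin n) ℂ,
                (MvPolynomial.X (BMWPoly.rgt i) - MvPolynomial.X (BMWPoly.lft i)) * D₁ =
                  BMWPoly.swapVars i (BMWPoly.lin p i) * φ
                    - BMWPoly.swapVars i (BMWPoly.swapVars i (BMWPoly.lin p i) * φ) ∧
                (MvPolynomial.X (BMWPoly.lft i) - MvPolynomial.X (BMWPoly.rgt i)) * D₂ =
                  φ - BMWPoly.swapVars i φ ∧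
                BMWPoly.act ρ ψ (BMWPoly.BMW.t p q i) - p • (ψ : MvPolynomial (Fin n) ℂ) =
                  -(BMWPoly.b q i * D₁) ∧
                BMWPoly.act ρ ψ (BMWPoly.BMW.t p q i) + p⁻¹ • (ψ : MvPolynomial (Fin n) ℂ) =
                  BMWPoly.b q i * (BMWPoly.lin p i * D₂))
    := by
  open BMWPoly MvPolynomial in
  obtain ⟨F, hF, hgen⟩ := exists_generic
  refine ⟨F, hF, fun p q hp hq hp2 hpq => ?_⟩
  have g := hgen p q hp hq hp2 hpq
  have τ0 : tauPar p q ≠ 0 := g.toGen.tau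
  obtain ⟨hz, ρ, hρ⟩ := exists_representation hn g (M_eq hn g.toGen)
  have hne : ∀ i : Fin (n - 1), lft i ≠ rgt i := fun i h => by simp [lft, rgt] at h
  have hpp : p + p⁻¹ ≠ 0 := fun h => g.mono 4 0 (by norm_num) (by norm_num) (by norm_num) (by
    have h1 : p ^ 2 = -1 := by field_simp at h; linear_combination h
    rw [zpow_ofNat, zpow_zero, mul_one]
    linear_combination (p ^ 2 - 1) * h1)
  -- the decomposition into a symmetric and a divisible part is unique
  have huniq : ∀ (i : Fin (n - 1)) (s r s' r' : MvPolynomial (Fin n) ℂ), s ∈ M n p q →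
      s' ∈ M n p q → SymAt i s → SymAt i s' → b q i ∣ r → b q i ∣ r' → s + r = s' + r' →
      s = s' ∧ r = r' := by
    intro i s r s' r' hs hs' h1 h1' h2 h2' he
    have e : s - s' = r' - r := by linear_combination he
    have h0 : s - s' = 0 := hz i _ (Submodule.sub_mem _ hs hs')
      ((map_sub (rename (Equiv.swap (lft i) (rgt i))) s s').trans (congrArg₂ _ h1 h1'))
      (e ▸ dvd_sub h2' h2)
    exact ⟨sub_eq_zero.1 h0, (sub_eq_zero.1 (e ▸ h0)).symm⟩
  have hTb : ∀ (i : Fin (n - 1)) φ, T p q (lft i) (rgt i) (b q i * φ) =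
      b q i * dl p (lft i) (rgt i) φ := fun i φ => T_mul hq (hne i) φ
  have hb : ∀ i : Fin (n - 1), b q i ≠ 0 := fun i => lnf_ne_zero hq (hne i)
  refine ⟨fun i ψ hψ => ?_, τ0, ρ, fun i ψ => ?_⟩
  · obtain ⟨⟨s, hs⟩, ⟨r, hr⟩, h1, ⟨φ, h2⟩, h3, -, h5⟩ := hρ i ⟨ψ, hψ⟩
    obtain ⟨S₁, S₂, k1, k2, rfl⟩ := exists_split hpp (hne i) φ
    replace h3 : ψ = s + r := congrArg Subtype.val h3
    dsimp only at h1 h2 h5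
    subst h2
    rw [hTb, dl_split (hne i) k1 k2] at h5
    have hT : b q i * (C p * (lnf p (lft i) (rgt i) * S₂) - C p⁻¹ * S₁) ∈ M n p q := by
      have := Submodule.sub_mem _ ((ρ (BMW.t p q i)).unop ⟨ψ, hψ⟩).2
        (Submodule.smul_mem _ (aPar p q) hs)
      rwa [h5, add_sub_cancel_left] at this
    have m2 : b q i * (lin p i * S₂) ∈ M n p q := by
      have := Submodule.smul_mem _ (p + p⁻¹)⁻¹
        (Submodule.add_mem _ hT (Submodule.smul_mem _ p⁻¹ hr))
      convert this using 1
      rw [smul_eq_C_mul, smul_eq_C_mul]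
      have hC : (C (p + p⁻¹)⁻¹ : MvPolynomial (Fin n) ℂ) * (C p + C p⁻¹) = 1 := by
        rw [← C_add, ← C_mul, inv_mul_cancel₀ hpp, C_1]
      change b q i * (lnf p (lft i) (rgt i) * S₂) = _
      linear_combination -(b q i * (lnf p (lft i) (rgt i) * S₂)) * hC
    have m1 : b q i * S₁ ∈ M n p q := by
      have := Submodule.sub_mem _ hr m2
      rwa [← mul_sub, show lin p i = lnf p (lft i) (rgt i) from rfl, add_sub_cancel_right] at this
    refine ⟨(s, S₁, S₂), ⟨h1, k1, k2, hs, m1, m2, h3⟩, ?_⟩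
    rintro ⟨S₀', S₁', S₂'⟩ ⟨f0, f1, f2, f3, f4, f5, f6⟩
    obtain ⟨e1, e2⟩ := huniq i _ _ _ _ f3 hs f0 h1 ⟨_, rfl⟩ ⟨_, rfl⟩ (f6.symm.trans h3)
    have e3 := mul_left_cancel₀ (hb i) e2
    have e4 := congrArg (dd (lft i) (rgt i)) e3
    have e5 := (dd_add_lnf (hne i) f1 f2).symm.trans (e4.trans (dd_add_lnf (hne i) k1 k2))
    have e6 : S₂' = S₂ := mul_left_cancel₀ (fun h => hpp (C_injective _ _ (h.trans C_0.symm))) e5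
    dsimp only at e1 e3
    subst e6
    exact Prod.ext e1 (Prod.ext (add_right_cancel e3) rfl)
  · obtain ⟨s, r, h1, h2, h3, h4, h5⟩ := hρ i ψ
    have hv : (ψ : MvPolynomial (Fin n) ℂ) = s + r := congrArg Subtype.val h3
    have h4' : act ρ ψ (BMW.e p q i) = tauPar p q • (s : MvPolynomial (Fin n) ℂ) :=
      congrArg Subtype.val h4
    change act ρ ψ (BMW.t p q i) = _ at h5
    have hdvd : ∀ φ, (ψ : MvPolynomial (Fin n) ℂ) = b q i * φ →
        (s : MvPolynomial (Fin n) ℂ) = 0 ∧ (r : MvPolynomial (Fin n) ℂ) = b q i * φ := fun φ h =>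
      huniq i _ _ 0 _ s.2 (Submodule.zero_mem _) h1 (map_zero _) h2 ⟨φ, rfl⟩
        (hv.symm.trans (h.trans (zero_add _).symm))
    refine ⟨fun S₀ S₁ S₂ hS => ?_, ?_, ?_, fun φ h => ?_⟩
    · obtain ⟨e1, e2⟩ := huniq i _ _ _ _ s.2 hS.mem₀ h1 hS.sym₀ h2 ⟨_, rfl⟩ (hv.symm.trans hS.eq)
      rw [h4', h5, e1, e2, hTb]
      refine ⟨rfl, ?_⟩
      have := dl_split (p := p) (hne i) hS.sym₁ hS.sym₂
      change dl p (lft i) (rgt i) (S₁ + lin p i * S₂) = C p * (lin p i * S₂) - C p⁻¹ * S₁ at this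
      rw [this]
      simp only [smul_eq_C_mul]
      ring
    · rw [h4', (smul_right_injective _ τ0).eq_iff]
      refine ⟨fun h => h ▸ h1, fun h => ?_⟩
      exact (huniq i _ _ _ 0 s.2 ψ.2 h1 h h2 (dvd_zero _) (by rw [add_zero, hv])).1
    · rw [h4', smul_eq_zero, or_iff_right τ0]
      refine ⟨fun h => ?_, fun ⟨φ, h⟩ => (hdvd φ h).1⟩
      rw [hv, h, zero_add]
      exact h2
    · obtain ⟨e1, e2⟩ := hdvd φ h
      rw [e1, e2, smul_zero, zero_add, hTb] at h5
      rw [h5, h]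
      refine ⟨-dd (lft i) (rgt i) (lnf p (rgt i) (lft i) * φ), dd (lft i) (rgt i) φ, ?_,
        mul_dd _ _ _, ?_, ?_⟩
      · have := mul_dd (lft i) (rgt i) (lnf p (rgt i) (lft i) * φ)
        rw [show swapVars i (lin p i) = lnf p (rgt i) (lft i) from sw_lnf p _ _]
        change _ = _ - sw _ _ _
        linear_combination this
      · rw [← dl_eq_dd (hne i), smul_eq_C_mul]
        ring
      · rw [smul_eq_C_mul, dl]
        change b q i * (lin p i * _ - _) + _ = _
        ring
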